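/- Let $K$ be a field with $\operatorname{char} K\neq 2$. All superspaces are $\mathbb Z/2$-graded $K$-vector spaces, $|x|$ denotes the degree of a homogeneous element, morphisms of superalgebras, supermodules and supercomodules are even (degree preserving), and $A\otimes B$ (over $K$) of superalgebras carries the product $(a\otimes b)(a'\otimes b')=(-1)^{|b||a'|}aa'\otimes bb'$. Let $SAlg_K$ be the category of supercommutative $K$-superalgebras. A $K$-functor is a functor from $SAlg_K$ to sets; for $B\in SAlg_K$ let $SSp\,B=\operatorname{Hom}_{SAlg_K}(B,?)$ (an affine superscheme). Dur sheaves. A supermodule $Y$ over $A\in SAlg_K$ is faithfully flat if a sequence $X'\to X\to X''$ of right $A$-supermodules is exact if and only if $X'\otimes_AY\to X\otimes_AY\to X''\otimes_AY$ is exact. A $K$-functor $X$ is a dur $K$-sheaf if, for every finite family $A\to S_1,\dots,A\to S_n$ in $SAlg_K$ such that $S_1\times\cdots\times S_n$ is a faithfully flat $A$-supermodule, $X(A)\to\prod_iX(S_i)\rightrightarrows\prod_{i,j}X(S_i\otimes_AS_j)$ is an equalizer. The dur $K$-sheaf associated with a $K$-functor $X$ is the universal dur $K$-sheaf with a morphism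 from $X$. Supergroups. Let $G$ be an affine supergroup over $K$, i.e. $G=SSp\,K[G]$ for a supercommutative Hopf superalgebra $K[G]$ with comultiplication $\delta$, and let $H$ be a closed supersubgroup of $G$, given by a surjective morphism of Hopf superalgebras $p:K[G]\to K[H]$. The quotient $G/H$ is the dur $K$-sheaf associated with $S\mapsto G(S)/H(S)$ (cosets $gH(S)$); it is affine if it is isomorphic to $SSp\,B$ for some $B\in SAlg_K$. Let $\mathrm{mod}\text{-}H$ be the category of right $H$-supermodules, identified with the category of left $K[H]$-supercomodules (and even morphisms). Regard $K[G]$ as a right $K[H]$-supercomodule through $(\mathrm{id}\otimes p)\delta$, and as an object of $\mathrm{mod}\text{-}H$ through $(p\otimes\mathrm{id})\delta$. For $N\in\mathrm{mod}\text{-}H$ with coaction $\tau_N$ let $$\operatorname{ind}^G_HN=K[G]\,\square_{K[H]}N=\{x\in K[G]\otimes N\mid ((\mathrm{id}\otimes p)\delta\otimes\mathrm{id})(x)=(\mathrm{id}\otimes\tau_N)(x)\}.$$ Let $R=K[G]^H=\{a\in K[G]\mid(\mathrm{id}\otimes p)\delta(a)=a\otimes1\}$; it is a supersubalgebra with $\delta(R)\subseteq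 K[G]\otimes R$. An $(R,K[G])$-Hopf supermodule is a left $R$-supermodule $M$ that is also a left $K[G]$-supercomodule, with coaction $\tau:M\to K[G]\otimes M$, such that for homogeneous terms $$\tau(rm)=\sum(-1)^{|r_2||a_1|}\,r_1a_1\otimes r_2m_2,\qquad \delta(r)=\sum r_1\otimes r_2,\quad\tau(m)=\sum a_1\otimes m_2;$$ morphisms are the even $R$-linear and $K[G]$-colinear maps. On $\operatorname{ind}^G_HN$ the ring $R$ acts by $r\sum a\otimes n=\sum ra\otimes n$, and the $K[G]$-coaction is the restriction of $\delta\otimes\mathrm{id}$. Theorem 5.2. The following are equivalent: (i) the quotient dur $K$-sheaf $G/H$ is affine; (ii) $H$ is faithfully exact in $G$, i.e. $K[G]$ is a faithfully coflat right $K[H]$-supercomodule: a sequence $W'\to W\to W''$ of left $K[H]$-supercomodules is exact if and only if $K[G]\square_{K[H]}W'\to K[G]\square_{K[H]}W\to K[G]\square_{K[H]}W''$ is exact; (iii) $N\mapsto\operatorname{ind}^G_HN$ is an equivalence from $\mathrm{mod}\text{-}H$ to the category of $(R,K[G])$-Hopf supermodules; (iv) $K[G]$ is an injective cogenerator of $\mathrm{mod}\text{-}H$,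 where, as usual for supercomodules, the morphisms to $K[G]$ in the definition of a cogenerator may be even or odd: $K[G]$ is an injective object of $\mathrm{mod}\text{-}H$, and for any two distinct parallel morphisms $f,g:V\to W$ in $\mathrm{mod}\text{-}H$ there is a morphism $h$ from $W$ to $K[G]$, or to $K[G]$ with its even and odd parts exchanged, such that $hf\neq hg$. -/

import Mathlib

open CategoryTheory TensorProduct

universe u w

namespace Super

noncomputable section

/-! ## Superspaces -/

section Superspaces

variable {K V W V' W' : Type*} [Field K] [AddCommGroup V] [Module K V]
  [AddCommGroup W] [Module K W] [AddCommGroup V'] [Module K V'] [AddCommGroup W'] [Module K W']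

/-- The `ZMod 2`-grading of a tensor product of superspaces: `V_j ⊗ W_k` has degree `j + k`. -/
def tensorGr (𝒱 : ZMod 2 → Submodule K V) (𝒲 : ZMod 2 → Submodule K W) (i : ZMod 2) :
    Submodule K (V ⊗[K] W) :=
  Submodule.span K {t | ∃ j k : ZMod 2, j + k = i ∧ ∃ v ∈ 𝒱 j, ∃ w ∈ 𝒲 k, t = v ⊗ₜ[K] w}

/-- A linear map of superspaces is even if it preserves the degree. -/
def IsEven (𝒱 : ZMod 2 → Submodule K V) (𝒲 : ZMod 2 → Submodule K W) (f : V →ₗ[K] W) : Prop :=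
  ∀ i, ∀ v ∈ 𝒱 i, f v ∈ 𝒲 i

theorem zmod2_cases (i : ZMod 2) : i = 0 ∨ i = 1 := by
  revert i; decide

theorem internal_iff (𝒱 : ZMod 2 → Submodule K V) :
    DirectSum.IsInternal 𝒱 ↔ IsCompl (𝒱 0) (𝒱 1) :=
  DirectSum.isInternal_submodule_iff_isCompl 𝒱 (by decide)
    (by ext i; simpa using zmod2_cases i)

theorem internal_decomp {𝒱 : ZMod 2 → Submodule K V} (h : DirectSum.IsInternal 𝒱) (v : V) :
    ∃ x ∈ 𝒱 0, ∃ y ∈ 𝒱 1, x + y = v :=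
  Submodule.mem_sup.1 (((internal_iff 𝒱).1 h).sup_eq_top ▸ Submodule.mem_top)

theorem internal_disj {𝒱 : ZMod 2 → Submodule K V} (h : DirectSum.IsInternal 𝒱) {i j : ZMod 2}
    (hij : i ≠ j) {v : V} (hi : v ∈ 𝒱 i) (hj : v ∈ 𝒱 j) : v = 0 := by
  have hd := ((internal_iff 𝒱).1 h).disjoint
  rw [Submodule.disjoint_def] at hd
  rcases zmod2_cases i with rfl | rfl <;> rcases zmod2_cases j with rfl | rfl
  · exact absurd rfl hij
  · exact hd v hi hj
  · exact hd v hj hi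
  · exact absurd rfl hij

theorem tmul_mem_tensorGr {𝒱 : ZMod 2 → Submodule K V} {𝒲 : ZMod 2 → Submodule K W}
    {i j k : ZMod 2} {v : V} {w : W} (hv : v ∈ 𝒱 j) (hw : w ∈ 𝒲 k) (h : j + k = i) :
    v ⊗ₜ[K] w ∈ tensorGr 𝒱 𝒲 i :=
  Submodule.subset_span ⟨j, k, h, v, hv, w, hw, rfl⟩

theorem map_mem_tensorGr {𝒱 : ZMod 2 → Submodule K V} {𝒲 : ZMod 2 → Submodule K W}
    {𝒱' : ZMod 2 → Submodule K V'} {𝒲' : ZMod 2 → Submodule K W'}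
    {f : V →ₗ[K] V'} {g : W →ₗ[K] W'} (hf : IsEven 𝒱 𝒱' f) (hg : IsEven 𝒲 𝒲' g) :
    IsEven (tensorGr 𝒱 𝒲) (tensorGr 𝒱' 𝒲') (TensorProduct.map f g) := by
  intro i t ht
  induction ht using Submodule.span_induction with
  | mem x hx =>
    obtain ⟨j, k, h, v, hv, w, hw, rfl⟩ := hx
    rw [TensorProduct.map_tmul]
    exact tmul_mem_tensorGr (hf j v hv) (hg k w hw) h
  | zero => rw [map_zero]; exact zero_mem _
  | add x y _ _ hx hy => rw [map_add]; exact add_mem hx hy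
  | smul a x _ hx => rw [map_smul]; exact Submodule.smul_mem _ a hx

theorem assoc_mem_tensorGr (𝒱 : ZMod 2 → Submodule K V) (𝒲 : ZMod 2 → Submodule K W)
    (𝒱' : ZMod 2 → Submodule K V') :
    IsEven (tensorGr (tensorGr 𝒱 𝒲) 𝒱') (tensorGr 𝒱 (tensorGr 𝒲 𝒱'))
      (TensorProduct.assoc K V W V').toLinearMap := by
  intro i t ht
  induction ht using Submodule.span_induction with
  | mem x hx =>
    obtain ⟨j, k, h, v, hv, w, hw, rfl⟩ := hx
    induction hv using Submodule.span_induction with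
    | mem y hy =>
      obtain ⟨j', k', h', v', hv', w', hw', rfl⟩ := hy
      refine tmul_mem_tensorGr (k := k' + k) hv' (tmul_mem_tensorGr hw' hw rfl) ?_
      rw [← add_assoc, h', h]
    | zero => simp
    | add x y _ _ hx hy => rw [TensorProduct.add_tmul, map_add]; exact add_mem hx hy
    | smul a x _ hx =>
      rw [← TensorProduct.smul_tmul', map_smul]; exact Submodule.smul_mem _ a hx
  | zero => rw [map_zero]; exact zero_mem _
  | add x y _ _ hx hy => rw [map_add]; exact add_mem hx hy
  | smul a x _ hx => rw [map_smul]; exact Submodule.smul_mem _ a hx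

theorem exists_proj {𝒱 : ZMod 2 → Submodule K V} (hV : DirectSum.IsInternal 𝒱) :
    ∃ p0 p1 : V →ₗ[K] V, (∀ v ∈ 𝒱 0, p0 v = v) ∧ (∀ v ∈ 𝒱 1, p0 v = 0) ∧
      (∀ v ∈ 𝒱 0, p1 v = 0) ∧ (∀ v ∈ 𝒱 1, p1 v = v) := by
  have c := (internal_iff 𝒱).1 hV
  refine ⟨Submodule.projection _ _ c, Submodule.projection _ _ c.symm,
    fun v hv => Submodule.projection_apply_left c ⟨v, hv⟩,
    fun v hv => Submodule.projection_apply_of_mem_right c hv,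
    fun v hv => Submodule.projection_apply_of_mem_right c.symm hv,
    fun v hv => Submodule.projection_apply_left c.symm ⟨v, hv⟩⟩

theorem tensorGr_internal {𝒱 : ZMod 2 → Submodule K V} {𝒲 : ZMod 2 → Submodule K W}
    (hV : DirectSum.IsInternal 𝒱) (hW : DirectSum.IsInternal 𝒲) :
    DirectSum.IsInternal (tensorGr 𝒱 𝒲) := by
  rw [internal_iff]
  have cV := (internal_iff 𝒱).1 hV
  have cW := (internal_iff 𝒲).1 hW
  constructor
  · obtain ⟨p0, p1, a00, a01, a10, a11⟩ := exists_proj hV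
    obtain ⟨q0, q1, b00, b01, b10, b11⟩ := exists_proj hW
    let P : V ⊗[K] W →ₗ[K] V ⊗[K] W := TensorProduct.map p0 q0 + TensorProduct.map p1 q1
    have h0 : ∀ t ∈ tensorGr 𝒱 𝒲 0, P t = t := fun t ht => by
      induction ht using Submodule.span_induction with
      | mem x hx =>
        obtain ⟨j, k, h, v, hv, w, hw, rfl⟩ := hx
        rcases zmod2_cases j with rfl | rfl <;> rcases zmod2_cases k with rfl | rfl
        · simp [P, a00 v hv, a10 v hv, b00 w hw]
        · exact absurd h (by decide)
        · exact absurd h (by decide)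
        · simp [P, a01 v hv, a11 v hv, b11 w hw]
      | zero => rw [map_zero]
      | add x y _ _ hx hy => rw [map_add, hx, hy]
      | smul a x _ hx => rw [map_smul, hx]
    have h1 : ∀ t ∈ tensorGr 𝒱 𝒲 1, P t = 0 := fun t ht => by
      induction ht using Submodule.span_induction with
      | mem x hx =>
        obtain ⟨j, k, h, v, hv, w, hw, rfl⟩ := hx
        rcases zmod2_cases j with rfl | rfl <;> rcases zmod2_cases k with rfl | rfl
        · exact absurd h (by decide)
        · simp [P, b01 w hw, a10 v hv]
        · simp [P, a01 v hv, b10 w hw]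
        · exact absurd h (by decide)
      | zero => rw [map_zero]
      | add x y _ _ hx hy => rw [map_add, hx, hy, add_zero]
      | smul a x _ hx => rw [map_smul, hx, smul_zero]
    rw [Submodule.disjoint_def]
    intro t ht0 ht1
    rw [← h0 t ht0, h1 t ht1]
  · rw [codisjoint_iff, eq_top_iff]
    intro t _
    induction t with
    | zero => exact zero_mem _
    | add x y hx hy => exact add_mem (hx trivial) (hy trivial)
    | tmul v w =>
      obtain ⟨v0, hv0, v1, hv1, rfl⟩ := internal_decomp hV v
      obtain ⟨w0, hw0, w1, hw1, rfl⟩ := internal_decomp hW w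
      have e : (v0 + v1) ⊗ₜ[K] (w0 + w1) =
          (v0 ⊗ₜ[K] w0 + v1 ⊗ₜ[K] w1) + (v0 ⊗ₜ[K] w1 + v1 ⊗ₜ[K] w0) := by
        simp only [TensorProduct.add_tmul, TensorProduct.tmul_add]; abel
      rw [e]
      refine Submodule.add_mem_sup (add_mem ?_ ?_) (add_mem ?_ ?_)
      · exact tmul_mem_tensorGr hv0 hw0 (by decide)
      · exact tmul_mem_tensorGr hv1 hw1 (by decide)
      · exact tmul_mem_tensorGr hv0 hw1 (by decide)
      · exact tmul_mem_tensorGr hv1 hw0 (by decide)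
end Superspaces

/-! ## Commutative superalgebras, flatness -/

/-- A (super)commutative superalgebra over `K`. -/
structure CommSuperalg (K : Type u) [Field K] where
  carrier : Type u
  [ring : Ring carrier]
  [algebra : Algebra K carrier]
  gr : ZMod 2 → Submodule K carrier
  [graded : GradedAlgebra gr]
  supercomm : ∀ i j : ZMod 2, ∀ a ∈ gr i, ∀ b ∈ gr j, a * b = (-1 : ℤˣ) ^ (i * j) • (b * a)

attribute [instance] CommSuperalg.ring CommSuperalg.algebra CommSuperalg.graded

instance (K : Type u) [Field K] : CoeSort (CommSuperalg K) (Type u) := ⟨CommSuperalg.carrier⟩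

/-- The category `SAlg_K` of commutative superalgebras and even algebra morphisms. -/
instance (K : Type u) [Field K] : Category.{u} (CommSuperalg K) where
  Hom R S := GradedAlgHom K R.gr S.gr
  id R := GradedAlgHom.id K R.gr
  comp f g := { g.toAlgHom.comp f.toAlgHom with map_mem := fun h => g.map_mem (f.map_mem h) }

section

variable {K : Type u} [Field K]

/-- The even algebra morphism underlying an arrow of `SAlg_K`. -/
def CommSuperalg.alg {R S : CommSuperalg K} (f : R ⟶ S) : GradedAlgHom K R.gr S.gr := f

/-- A right supermodule over the superalgebra `R`. -/
structure RightSupermod (R : CommSuperalg K) where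
  carrier : Type u
  [addCommGroup : AddCommGroup carrier]
  [module : Module K carrier]
  [rightModule : Module Rᵐᵒᵖ carrier]
  [tower : IsScalarTower K Rᵐᵒᵖ carrier]
  gr : ZMod 2 → Submodule K carrier
  isInternal : DirectSum.IsInternal gr
  smul_mem : ∀ i j : ZMod 2, ∀ x ∈ gr i, ∀ r ∈ R.gr j, MulOpposite.op r • x ∈ gr (i + j)

attribute [instance] RightSupermod.addCommGroup RightSupermod.module RightSupermod.rightModule
  RightSupermod.tower

/-- An even morphism of right supermodules. -/
structure RightSupermod.Hom {R : CommSuperalg K} (X Y : RightSupermod R) where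
  toLin : X.carrier →ₗ[K] Y.carrier
  even : IsEven X.gr Y.gr toLin
  map_smul : ∀ (r : R) (x : X.carrier),
    toLin (MulOpposite.op r • x) = MulOpposite.op r • toLin x

section Tensor

variable (R : CommSuperalg K) (Y : Type u) [AddCommGroup Y] [Module K Y] [Module R Y]

/-- The relations `xr ⊗ y = x ⊗ ry` in `X ⊗_K Y`. -/
def tensorRel (X : RightSupermod R) : Submodule K (X.carrier ⊗[K] Y) :=
  Submodule.span K {t | ∃ (x : X.carrier) (r : R) (y : Y),
    t = (MulOpposite.op r • x) ⊗ₜ[K] y - x ⊗ₜ[K] (r • y)}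

/-- The tensor product `X ⊗_R Y` of a right and a left module over the superalgebra `R`. -/
abbrev TensorOver (X : RightSupermod R) : Type u := (X.carrier ⊗[K] Y) ⧸ tensorRel R Y X

/-- The map `f ⊗ id : X ⊗_R Y → X' ⊗_R Y`. -/
def TensorOver.map {X X' : RightSupermod R} (f : X.Hom X') :
    TensorOver R Y X →ₗ[K] TensorOver R Y X' :=
  Submodule.mapQ _ _ (f.toLin.rTensor Y) <| by
    rw [tensorRel, Submodule.span_le]
    rintro _ ⟨x, r, y, rfl⟩
    refine Submodule.subset_span ⟨f.toLin x, r, y, ?_⟩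
    simp [f.map_smul]

/-- `Y` is faithfully flat over the superalgebra `R`: a sequence `X' → X → X''` of right
`R`-supermodules is exact if and only if `X' ⊗_R Y → X ⊗_R Y → X'' ⊗_R Y` is exact.
(The grading of `Y` plays no role in this condition.) -/
def IsFaithfullyFlat : Prop :=
  ∀ (X' X X'' : RightSupermod R) (f : X'.Hom X) (g : X.Hom X''),
    Function.Exact f.toLin g.toLin ↔
      Function.Exact (TensorOver.map R Y f) (TensorOver.map R Y g)

end Tensor

/-- A finite family of `R`-superalgebras `R → S_1, …, R → S_n` is a faithfully flat covering if
the `R`-supermodule `S_1 × ⋯ × S_n` is faithfully flat. -/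
def IsFFCovering (R : CommSuperalg K) {n : ℕ} (S : Fin n → CommSuperalg K) (f : ∀ i, R ⟶ S i) :
    Prop :=
  letI : Module R (∀ i, S i) :=
    Module.compHom _ (RingHom.pi fun i => ((CommSuperalg.alg (f i)).toAlgHom : R →+* S i))
  IsFaithfullyFlat R (∀ i, S i)

/-! ## K-functors and dur K-sheaves -/

/-- A `K`-functor `X` is a dur `K`-sheaf if for each faithfully flat covering `R → S_i` the set
`X(R)` is the equalizer of `∏ X(S_i) ⇉ ∏ X(S_i ⊗_R S_j)`. Two elements of `X(S_i)` and `X(S_j)`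
agree over `S_i ⊗_R S_j`, the pushout of `S_i` and `S_j` over `R` in `SAlg_K`, if and only if they
agree over each `T` that completes `S_i ← R → S_j` to a commutative square. -/
def IsDurSheaf (X : CommSuperalg K ⥤ Type w) : Prop :=
  ∀ (R : CommSuperalg K) (n : ℕ) (S : Fin n → CommSuperalg K) (f : ∀ i, R ⟶ S i),
    IsFFCovering R S f → ∀ x : ∀ i, X.obj (S i),
      (∀ (i j : Fin n) (T : CommSuperalg K) (g : S i ⟶ T) (h : S j ⟶ T),
        f i ≫ g = f j ≫ h → X.map g (x i) = X.map h (x j)) →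
      ∃! y : X.obj R, ∀ i, X.map (f i) y = x i

/-- The affine superscheme `SSp R`, a `K`-functor (with values in `Type (u + 1)`). -/
def SSp (R : CommSuperalg K) : CommSuperalg K ⥤ Type (u + 1) :=
  coyoneda.obj (Opposite.op R) ⋙ uliftFunctor.{u + 1}

/-- `α : X ⟶ Y` exhibits `Y` as the dur `K`-sheaf associated with the `K`-functor `X`. -/
def IsAssociatedDurSheaf {X Y : CommSuperalg K ⥤ Type (u + 1)} (α : X ⟶ Y) : Prop :=
  IsDurSheaf Y ∧ ∀ Z : CommSuperalg K ⥤ Type (u + 1), IsDurSheaf Z →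
    ∀ β : X ⟶ Z, ∃! γ : Y ⟶ Z, α ≫ γ = β

/-- The dur `K`-sheaf associated with the `K`-functor `X` is an affine superscheme. -/
def HasAffineDurSheaf (X : CommSuperalg K ⥤ Type (u + 1)) : Prop :=
  ∃ (R : CommSuperalg K) (α : X ⟶ SSp R), IsAssociatedDurSheaf α

/-! ## Affine supergroups -/

open GradedTensorProduct in
/-- An affine supergroup `G`, given by its coordinate superalgebra `K[G]`, a commutative Hopf
superalgebra: comultiplication, counit and antipode are even and the first two are morphisms of
superalgebras, where `K[G] ⊗ K[G]` carries the product
`(a ⊗ b)(a' ⊗ b') = (-1)^(|b||a'|) aa' ⊗ bb'`. -/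
structure AffineSupergroup (K : Type u) [Field K] extends CommSuperalg K where
  [coalgebra : Coalgebra K carrier]
  comul_mem : IsEven gr (tensorGr gr gr) (Coalgebra.comul (R := K) (A := carrier))
  comul_one : of K gr gr (Coalgebra.comul (1 : carrier)) = 1
  comul_mul : ∀ a b : carrier, of K gr gr (Coalgebra.comul (a * b)) =
    of K gr gr (Coalgebra.comul a) * of K gr gr (Coalgebra.comul b)
  counit_mem : ∀ a ∈ gr 1, Coalgebra.counit (R := K) a = 0
  counit_one : Coalgebra.counit (R := K) (1 : carrier) = 1
  counit_mul : ∀ a b : carrier, Coalgebra.counit (R := K) (a * b) =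
    Coalgebra.counit (R := K) a * Coalgebra.counit (R := K) b
  antipode : carrier →ₗ[K] carrier
  antipode_mem : IsEven gr gr antipode
  mul_antipode_left : LinearMap.mul' K carrier ∘ₗ antipode.rTensor carrier ∘ₗ
    Coalgebra.comul = Algebra.linearMap K carrier ∘ₗ Coalgebra.counit
  mul_antipode_right : LinearMap.mul' K carrier ∘ₗ antipode.lTensor carrier ∘ₗ
    Coalgebra.comul = Algebra.linearMap K carrier ∘ₗ Coalgebra.counit

attribute [instance] AffineSupergroup.coalgebra

instance : CoeSort (AffineSupergroup K) (Type u) := ⟨fun G => G.carrier⟩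

namespace AffineSupergroup

open Coalgebra

/-- The comultiplication as a morphism of superalgebras. -/
def comulAlg (G : AffineSupergroup K) :
    G.carrier →ₐ[K] GradedTensorProduct K G.gr G.gr :=
  AlgHom.ofLinearMap ((GradedTensorProduct.of K G.gr G.gr).toLinearMap ∘ₗ comul)
    G.comul_one G.comul_mul

/-- The elements of `G(S)`. -/
abbrev Points (G : AffineSupergroup K) (S : CommSuperalg K) : Type u := G.toCommSuperalg ⟶ S

/-- The product of `g, h ∈ G(S)`: `(gh)(a) = ∑ g(a_1) h(a_2)`. -/
def mulPoints (G : AffineSupergroup K) {S : CommSuperalg K} (g h : G.Points S) : G.Points S :=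
  { (GradedTensorProduct.lift G.gr G.gr (CommSuperalg.alg g).toAlgHom
      (CommSuperalg.alg h).toAlgHom (fun i j a b => by
        rw [mul_comm j i]
        exact S.supercomm i j _ ((CommSuperalg.alg g).map_mem a.2) _
          ((CommSuperalg.alg h).map_mem b.2))).comp G.comulAlg with
    map_mem := by
      intro i a ha
      have key : ∀ t ∈ tensorGr G.gr G.gr i, LinearMap.mul' K S (TensorProduct.map
          (CommSuperalg.alg g).toAlgHom.toLinearMap
          (CommSuperalg.alg h).toAlgHom.toLinearMap t) ∈ S.gr i := by
        intro t ht
        induction ht using Submodule.span_induction with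
        | mem x hx =>
          obtain ⟨j, k, rfl, v, hv, w, hw, rfl⟩ := hx
          exact SetLike.mul_mem_graded ((CommSuperalg.alg g).map_mem hv)
            ((CommSuperalg.alg h).map_mem hw)
        | zero => rw [map_zero, map_zero]; exact zero_mem _
        | add x y _ _ hx hy => rw [map_add, map_add]; exact add_mem hx hy
        | smul c x _ hx => rw [map_smul, map_smul]; exact Submodule.smul_mem _ c hx
      exact key _ (G.comul_mem i a ha) }

theorem mulPoints_apply (G : AffineSupergroup K) {S : CommSuperalg K} (g h : G.Points S) (a : G) :
    CommSuperalg.alg (G.mulPoints g h) a = LinearMap.mul' K S (TensorProduct.map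
      (CommSuperalg.alg g).toAlgHom.toLinearMap
      (CommSuperalg.alg h).toAlgHom.toLinearMap (comul (R := K) a)) := rfl

theorem mulPoints_comp (G : AffineSupergroup K) {S T : CommSuperalg K} (g h : G.Points S)
    (f : S ⟶ T) : G.mulPoints g h ≫ f = G.mulPoints (g ≫ f) (h ≫ f) := by
  refine DFunLike.ext (CommSuperalg.alg _) (CommSuperalg.alg _) fun a => ?_
  refine Eq.trans ?_ (G.mulPoints_apply (g ≫ f) (h ≫ f) a).symm
  change CommSuperalg.alg f (CommSuperalg.alg (G.mulPoints g h) a) = _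
  rw [G.mulPoints_apply]
  induction (comul (R := K) a) with
  | zero => simp
  | add x y hx hy => simp only [map_add, hx, hy]
  | tmul x y => exact map_mul (CommSuperalg.alg f) _ _

end AffineSupergroup

/-- A closed supersubgroup `H` of `G`: an affine supergroup with a surjective morphism of Hopf
superalgebras `p : K[G] → K[H]`, so that `K[H] = K[G]/I_H` for the Hopf superideal
`I_H = ker p`. -/
structure ClosedSupersubgroup (G : AffineSupergroup K) extends AffineSupergroup K where
  proj : G.toCommSuperalg ⟶ toCommSuperalg
  surjective : Function.Surjective (CommSuperalg.alg proj)
  comul_proj : ∀ a : G, Coalgebra.comul (R := K) (CommSuperalg.alg proj a) =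
    TensorProduct.map (CommSuperalg.alg proj).toAlgHom.toLinearMap
      (CommSuperalg.alg proj).toAlgHom.toLinearMap (Coalgebra.comul (R := K) a)
  counit_proj : ∀ a : G, Coalgebra.counit (R := K) (CommSuperalg.alg proj a) =
    Coalgebra.counit (R := K) a

namespace ClosedSupersubgroup

open Coalgebra

variable {G : AffineSupergroup K} (H : ClosedSupersubgroup G)

/-- The projection `K[G] → K[H]` as a linear map. -/
def p : G.carrier →ₗ[K] H.carrier := (CommSuperalg.alg H.proj).toAlgHom.toLinearMap

/-- `g, g' ∈ G(S)` lie in the same coset if `g' = gh` for some `h ∈ H(S)`. -/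
def SameCoset {S : CommSuperalg K} (g g' : G.Points S) : Prop :=
  ∃ h : H.toAffineSupergroup.Points S, g' = G.mulPoints g (H.proj ≫ h)

/-- The naive quotient `S ↦ G(S)/H(S)`. -/
def naiveQuotient : CommSuperalg K ⥤ Type u where
  obj S := Quot (H.SameCoset (S := S))
  map {S T} f := TypeCat.ofHom (Quot.map (fun g => g ≫ f) (by
    rintro g _ ⟨h, rfl⟩
    refine ⟨h ≫ f, ?_⟩
    exact G.mulPoints_comp g (H.proj ≫ h) f))
  map_id S := by
    ext x
    induction x using Quot.ind
    rfl
  map_comp f g := by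
    ext x
    induction x using Quot.ind
    rfl

/-- The quotient dur `K`-sheaf `G/H`, that is, the dur `K`-sheaf associated with the naive
quotient, is an affine superscheme. -/
def IsQuotientAffine : Prop :=
  HasAffineDurSheaf (H.naiveQuotient ⋙ uliftFunctor.{u + 1})

end ClosedSupersubgroup

/-! ## Supercomodules and cotensor products -/

open Coalgebra

/-- A left `C`-supercomodule (`C` a commutative Hopf superalgebra). -/
structure LeftSComod (C : AffineSupergroup K) where
  carrier : Type u
  [addCommGroup : AddCommGroup carrier]
  [module : Module K carrier]
  gr : ZMod 2 → Submodule K carrier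
  isInternal : DirectSum.IsInternal gr
  coact : carrier →ₗ[K] C.carrier ⊗[K] carrier
  coact_mem : IsEven gr (tensorGr C.gr gr) coact
  coassoc : ∀ v, TensorProduct.assoc K C.carrier C.carrier carrier
    ((comul (R := K) (A := C.carrier)).rTensor carrier (coact v)) =
      coact.lTensor C.carrier (coact v)
  counit_coact : ∀ v, TensorProduct.lid K carrier
    ((counit (R := K) (A := C.carrier)).rTensor carrier (coact v)) = v

attribute [instance] LeftSComod.addCommGroup LeftSComod.module

namespace LeftSComod

variable {C : AffineSupergroup K}

/-- An even morphism of left supercomodules. -/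
@[ext]
structure Hom (V W : LeftSComod C) where
  toLin : V.carrier →ₗ[K] W.carrier
  even : IsEven V.gr W.gr toLin
  colinear : ∀ v, W.coact (toLin v) = toLin.lTensor C.carrier (V.coact v)

/-- The category `C-scomod` of left `C`-supercomodules and even morphisms. -/
instance : Category.{u} (LeftSComod C) where
  Hom V W := Hom V W
  id V := ⟨LinearMap.id, fun _ _ h => h, by simp⟩
  comp f g := ⟨g.toLin ∘ₗ f.toLin, fun i v h => g.even i _ (f.even i v h), fun v => by
    simp [g.colinear, f.colinear, LinearMap.lTensor_comp]⟩

/-- The linear map underlying an arrow of `C-scomod`. -/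
def lin {V W : LeftSComod C} (f : V ⟶ W) : V.carrier →ₗ[K] W.carrier := Hom.toLin f

/-- The parity shift of a supercomodule: the same comodule with even and odd part exchanged. -/
def parityShift (V : LeftSComod C) : LeftSComod C where
  carrier := V.carrier
  gr i := V.gr (i + 1)
  isInternal := by
    rw [internal_iff]
    exact ((internal_iff _).1 V.isInternal).symm
  coact := V.coact
  coact_mem := by
    have h : ∀ i, ∀ t ∈ tensorGr C.gr V.gr (i + 1), t ∈ tensorGr C.gr (fun i => V.gr (i + 1)) i := by
      intro i t ht
      refine Submodule.span_mono ?_ ht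
      rintro _ ⟨j, k, h, v, hv, w, hw, rfl⟩
      refine ⟨j, k + 1, ?_, v, hv, w, ?_, rfl⟩
      · rw [← add_assoc, h, add_assoc, CharTwo.add_self_eq_zero, add_zero]
      · change w ∈ V.gr (k + 1 + 1)
        rwa [add_assoc, CharTwo.add_self_eq_zero, add_zero]
    exact fun i v hv => h i _ (V.coact_mem _ v hv)
  coassoc := V.coassoc
  counit_coact := V.counit_coact

end LeftSComod

section Cotensor

variable {C : AffineSupergroup K} {V : Type u} [AddCommGroup V] [Module K V]
  (ρ : V →ₗ[K] V ⊗[K] C.carrier)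

/-- The difference of `ρ ⊗ id` and `id ⊗ τ_W`, as a map `V ⊗ W → V ⊗ (C ⊗ W)`. -/
def cotensorDiff (W : LeftSComod C) :
    V ⊗[K] W.carrier →ₗ[K] V ⊗[K] (C.carrier ⊗[K] W.carrier) :=
  (TensorProduct.assoc K V C.carrier W.carrier).toLinearMap ∘ₗ ρ.rTensor W.carrier -
    W.coact.lTensor V

/-- The cotensor product `V □_C W ⊆ V ⊗ W`, for a right coaction `ρ : V → V ⊗ C`. -/
def cotensor (W : LeftSComod C) : Submodule K (V ⊗[K] W.carrier) :=
  LinearMap.ker (cotensorDiff ρ W)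

theorem cotensorDiff_map {W W' : LeftSComod C} (f : W ⟶ W') (x : V ⊗[K] W.carrier) :
    cotensorDiff ρ W' ((LeftSComod.lin f).lTensor V x) =
      ((LeftSComod.lin f).lTensor C.carrier).lTensor V (cotensorDiff ρ W x) := by
  induction x with
  | zero => simp
  | add x y hx hy => simp only [map_add, hx, hy]
  | tmul v w =>
    have h := LeftSComod.Hom.colinear f w
    simp only [cotensorDiff, LinearMap.sub_apply, LinearMap.comp_apply, LinearMap.lTensor_tmul,
      LinearMap.rTensor_tmul, map_sub, LinearEquiv.coe_coe]
    congr 1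
    · induction (ρ v) with
      | zero => simp
      | add x y hx hy => simp only [map_add, TensorProduct.add_tmul, hx, hy]
      | tmul x y => simp
    · exact congrArg _ h

/-- The map `V □_C W → V □_C W'` induced by a morphism `W → W'`. -/
def cotensorMap {W W' : LeftSComod C} (f : W ⟶ W') : cotensor ρ W →ₗ[K] cotensor ρ W' :=
  ((LeftSComod.lin f).lTensor V).restrict (fun x hx => by
    rw [cotensor, LinearMap.mem_ker] at hx ⊢
    rw [cotensorDiff_map, hx, map_zero])

/-- The right `C`-supercomodule `V` with coaction `ρ` is faithfully coflat: a sequence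
`W' → W → W''` in `C-scomod` is exact if and only if `V □_C W' → V □_C W → V □_C W''` is exact. -/
def IsFaithfullyCoflat : Prop :=
  ∀ (W' W W'' : LeftSComod C) (f : W' ⟶ W) (g : W ⟶ W''),
    Function.Exact (LeftSComod.lin f) (LeftSComod.lin g) ↔
      Function.Exact (cotensorMap ρ f) (cotensorMap ρ g)

end Cotensor

/-! ## Corestriction of maps into a tensor product -/

section Restrict

variable {A U V X : Type*} [AddCommGroup A] [Module K A] [AddCommGroup U] [Module K U]
  [AddCommGroup V] [Module K V] [AddCommGroup X] [Module K X]

theorem lTensor_inj {ι : U →ₗ[K] V} (hι : Function.Injective ι) :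
    Function.Injective (ι.lTensor A) :=
  Module.Flat.lTensor_preserves_injective_linearMap ι hι

/-- A map `φ : X → A ⊗ V` with image in `A ⊗ U`, as a map to `A ⊗ U`. -/
def tensorLift (ι : U →ₗ[K] V) (hι : Function.Injective ι) (φ : X →ₗ[K] A ⊗[K] V)
    (h : ∀ x, φ x ∈ LinearMap.range (ι.lTensor A)) : X →ₗ[K] A ⊗[K] U :=
  (LinearEquiv.ofInjective (ι.lTensor A) (lTensor_inj hι)).symm.toLinearMap ∘ₗ
    φ.codRestrict _ h

@[simp]
theorem lTensor_tensorLift (ι : U →ₗ[K] V) (hι : Function.Injective ι) (φ : X →ₗ[K] A ⊗[K] V)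
    (h : ∀ x, φ x ∈ LinearMap.range (ι.lTensor A)) (x : X) :
    ι.lTensor A (tensorLift ι hι φ h x) = φ x := by
  have := LinearEquiv.apply_symm_apply (LinearEquiv.ofInjective (ι.lTensor A) (lTensor_inj hι))
    (φ.codRestrict _ h x)
  exact congrArg Subtype.val this

theorem mem_range_of_ker (D : V →ₗ[K] X) (ι : U →ₗ[K] V) (hι : ∀ v, D v = 0 ↔ ∃ u, ι u = v)
    (t : A ⊗[K] V) (ht : D.lTensor A t = 0) : t ∈ LinearMap.range (ι.lTensor A) :=
  (Module.Flat.lTensor_exact A (f := ι) (g := D) hι t).1 ht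

theorem mem_range_ker_subtype (D : V →ₗ[K] X) (t : A ⊗[K] V) (ht : D.lTensor A t = 0) :
    t ∈ LinearMap.range ((LinearMap.ker D).subtype.lTensor A) :=
  mem_range_of_ker D _ (fun v => ⟨fun h => ⟨⟨v, h⟩, rfl⟩, fun ⟨u, hu⟩ => hu ▸ u.2⟩) t ht

end Restrict

/-- A subspace stable under the coaction and spanned by homogeneous elements is a
supercomodule. -/
def LeftSComod.sub {C : AffineSupergroup K} (V : LeftSComod C) (U : Submodule K V.carrier)
    (hU : ∀ x ∈ V.gr 0, ∀ y ∈ V.gr 1, x + y ∈ U → x ∈ U)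
    (h : ∀ x : U, (V.coact ∘ₗ U.subtype) x ∈ LinearMap.range (U.subtype.lTensor C.carrier)) : LeftSComod C :=
  have hint : DirectSum.IsInternal (fun i => (V.gr i).comap U.subtype) := by
    rw [internal_iff]
    constructor
    · rw [Submodule.disjoint_def]
      intro x h0 h1
      exact Subtype.ext (internal_disj V.isInternal (by decide) h0 h1)
    · rw [codisjoint_iff, eq_top_iff]
      rintro ⟨x, hx⟩ _
      obtain ⟨a, ha, b, hb, rfl⟩ := internal_decomp V.isInternal x
      have ha' := hU a ha b hb hx
      have hb' : b ∈ U := by simpa using U.sub_mem hx ha'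
      exact Submodule.mem_sup.2 ⟨⟨a, ha'⟩, ha, ⟨b, hb'⟩, hb, rfl⟩
  { carrier := U
    gr := fun i => (V.gr i).comap U.subtype
    isInternal := hint
    coact := tensorLift U.subtype U.subtype_injective (V.coact ∘ₗ U.subtype) h
    coact_mem := by
      intro i v hv
      have hι : IsEven (tensorGr C.gr (fun i => (V.gr i).comap U.subtype)) (tensorGr C.gr V.gr)
          (U.subtype.lTensor C.carrier) :=
        map_mem_tensorGr (f := LinearMap.id) (fun _ _ h => h) (fun _ _ h => h)
      have hd := V.coact_mem i _ hv
      set t := tensorLift U.subtype U.subtype_injective (V.coact ∘ₗ U.subtype) h v with ht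
      have ht' : U.subtype.lTensor C.carrier t = V.coact v := lTensor_tensorLift _ _ _ h v
      have hT := tensorGr_internal (DirectSum.Decomposition.isInternal C.gr) hint
      have hT' := tensorGr_internal (DirectSum.Decomposition.isInternal C.gr) V.isInternal
      obtain ⟨a, ha, b, hb, hab⟩ := internal_decomp hT t
      have ha' := hι 0 a ha
      have hb' := hι 1 b hb
      rw [← hab, map_add] at ht'
      have inj := lTensor_inj (A := C.carrier) U.subtype_injective
      rcases zmod2_cases i with rfl | rfl
      · have : b = 0 := inj <| by
          rw [map_zero]
          refine internal_disj hT' (i := 0) (j := 1) (by decide) ?_ hb'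
          rw [eq_sub_of_add_eq' ht']
          exact sub_mem hd ha'
        rw [← hab, this, add_zero]; exact ha
      · have : a = 0 := inj <| by
          rw [map_zero]
          refine internal_disj hT' (i := 0) (j := 1) (by decide) ha' ?_
          rw [eq_sub_of_add_eq ht']
          exact sub_mem hd hb'
        rw [← hab, this, zero_add]; exact hb
    coassoc := by
      intro v
      apply lTensor_inj (A := C.carrier) (lTensor_inj (A := C.carrier) U.subtype_injective)
      set c := tensorLift U.subtype U.subtype_injective (V.coact ∘ₗ U.subtype) h with hc
      have key : ∀ x, U.subtype.lTensor C.carrier (c x) = V.coact x := lTensor_tensorLift _ _ _ h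
      have e1 : ∀ t : C.carrier ⊗[K] U, (U.subtype.lTensor C.carrier).lTensor C.carrier
          (TensorProduct.assoc K C.carrier C.carrier U
            ((comul (R := K) (A := C.carrier)).rTensor U t)) =
          TensorProduct.assoc K C.carrier C.carrier V.carrier
            ((comul (R := K) (A := C.carrier)).rTensor V.carrier
              (U.subtype.lTensor C.carrier t)) := by
        intro t
        induction t with
        | zero => simp
        | add x y hx hy => simp only [map_add, hx, hy]
        | tmul x y =>
          simp only [LinearMap.rTensor_tmul, LinearMap.lTensor_tmul]
          induction (comul (R := K) x) with
          | zero => simp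
          | add x y hx hy => simp only [map_add, TensorProduct.add_tmul, hx, hy]
          | tmul x y => simp
      have e2 : ∀ t : C.carrier ⊗[K] U, (U.subtype.lTensor C.carrier).lTensor C.carrier
          (c.lTensor C.carrier t) = V.coact.lTensor C.carrier (U.subtype.lTensor C.carrier t) := by
        intro t
        induction t with
        | zero => simp
        | add x y hx hy => simp only [map_add, hx, hy]
        | tmul x y => simp [key]
      rw [e1, e2, key, V.coassoc]
    counit_coact := by
      intro v
      apply U.subtype_injective
      set c := tensorLift U.subtype U.subtype_injective (V.coact ∘ₗ U.subtype) h with hc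
      have key : ∀ x, U.subtype.lTensor C.carrier (c x) = V.coact x := lTensor_tensorLift _ _ _ h
      have e1 : ∀ t : C.carrier ⊗[K] U, U.subtype (TensorProduct.lid K U
            ((counit (R := K) (A := C.carrier)).rTensor U t)) =
          TensorProduct.lid K V.carrier ((counit (R := K) (A := C.carrier)).rTensor V.carrier
              (U.subtype.lTensor C.carrier t)) := by
        intro t
        induction t with
        | zero => simp
        | add x y hx hy => simp only [map_add, hx, hy]
        | tmul x y => simp
      rw [e1, key, V.counit_coact]; rfl }

theorem LeftSComod.sub_coact {C : AffineSupergroup K} (V : LeftSComod C)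
    (U : Submodule K V.carrier) (hU : ∀ x ∈ V.gr 0, ∀ y ∈ V.gr 1, x + y ∈ U → x ∈ U)
    (h : ∀ x : U, (V.coact ∘ₗ U.subtype) x ∈ LinearMap.range (U.subtype.lTensor C.carrier))
    (x : U) : U.subtype.lTensor C.carrier ((V.sub U hU h).coact x) = V.coact (x : V.carrier) :=
  lTensor_tensorLift U.subtype U.subtype_injective _ h x

/-- The coaction `G ⊗ N → G ⊗ (G ⊗ N)` through the comultiplication of the first factor. -/
def cofreeCoact (G : AffineSupergroup K) (N : Type u) [AddCommGroup N] [Module K N] :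
    G.carrier ⊗[K] N →ₗ[K] G.carrier ⊗[K] (G.carrier ⊗[K] N) :=
  (TensorProduct.assoc K G.carrier G.carrier N).toLinearMap ∘ₗ
    (comul (R := K) (A := G.carrier)).rTensor N

/-- The left supercomodule `G ⊗ N`, coacted on through the comultiplication of the first factor. -/
def cofree (G : AffineSupergroup K) {N : Type u} [AddCommGroup N] [Module K N]
    {grN : ZMod 2 → Submodule K N} (hN : DirectSum.IsInternal grN) : LeftSComod G where
  carrier := G.carrier ⊗[K] N
  gr := tensorGr G.gr grN
  isInternal := tensorGr_internal (DirectSum.Decomposition.isInternal G.gr) hN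
  coact := cofreeCoact G N
  coact_mem := fun i v hv => assoc_mem_tensorGr G.gr G.gr grN i _
    (map_mem_tensorGr (g := LinearMap.id) G.comul_mem (fun _ _ h => h) i v hv)
  coassoc := by
    intro v
    induction v with
    | zero => simp
    | add x y hx hy => simp only [map_add, hx, hy]
    | tmul a n =>
      have h := Coalgebra.coassoc_apply (R := K) a
      have e1 : ∀ t : G.carrier ⊗[K] G.carrier,
          TensorProduct.assoc K G.carrier G.carrier (G.carrier ⊗[K] N)
          ((comul (R := K) (A := G.carrier)).rTensor _
            (TensorProduct.assoc K G.carrier G.carrier N (t ⊗ₜ n))) =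
          (TensorProduct.assoc K G.carrier G.carrier N).toLinearMap.lTensor G.carrier
            (TensorProduct.assoc K G.carrier (G.carrier ⊗[K] G.carrier) N
              ((TensorProduct.assoc K G.carrier G.carrier G.carrier
                ((comul (R := K) (A := G.carrier)).rTensor _ t)) ⊗ₜ n)) := by
        intro t
        induction t with
        | zero => simp
        | add x y hx hy => simp only [map_add, TensorProduct.add_tmul, hx, hy]
        | tmul x y =>
          simp only [LinearMap.rTensor_tmul, TensorProduct.assoc_tmul]
          induction (comul (R := K) x) with
          | zero => simp
          | add x y hx hy => simp only [map_add, TensorProduct.add_tmul, hx, hy]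
          | tmul x y => simp
      have e2 : ∀ t : G.carrier ⊗[K] G.carrier,
          (cofreeCoact G N).lTensor G.carrier
            (TensorProduct.assoc K G.carrier G.carrier N (t ⊗ₜ n)) =
          (TensorProduct.assoc K G.carrier G.carrier N).toLinearMap.lTensor G.carrier
            (TensorProduct.assoc K G.carrier (G.carrier ⊗[K] G.carrier) N
              (((comul (R := K) (A := G.carrier)).lTensor _ t) ⊗ₜ n)) := by
        intro t
        induction t with
        | zero => simp
        | add x y hx hy => simp only [map_add, TensorProduct.add_tmul, hx, hy]
        | tmul x y => simp [cofreeCoact]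
      simp only [cofreeCoact, LinearMap.comp_apply, LinearMap.rTensor_tmul, LinearEquiv.coe_coe]
      rw [e1]
      exact (congrArg _ (congrArg _ (congrArg (· ⊗ₜ n) h))).trans (e2 _).symm
  counit_coact := by
    intro v
    induction v with
    | zero => simp
    | add x y hx hy => simp only [map_add, hx, hy]
    | tmul a n =>
      have h := Coalgebra.rTensor_counit_comul (R := K) a
      have e1 : ∀ t : G.carrier ⊗[K] G.carrier,
          TensorProduct.lid K (G.carrier ⊗[K] N)
          ((counit (R := K) (A := G.carrier)).rTensor _
            (TensorProduct.assoc K G.carrier G.carrier N (t ⊗ₜ n))) =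
          TensorProduct.lid K G.carrier ((counit (R := K) (A := G.carrier)).rTensor _ t) ⊗ₜ n := by
        intro t
        induction t with
        | zero => simp
        | add x y hx hy => simp only [map_add, TensorProduct.add_tmul, hx, hy]
        | tmul x y => simp [TensorProduct.smul_tmul']
      simp only [cofreeCoact, LinearMap.comp_apply, LinearMap.rTensor_tmul, LinearEquiv.coe_coe]
      rw [e1, h]; simp

/-! ## The coactions of `K[H]` on `K[G]` -/

namespace ClosedSupersubgroup

variable {G : AffineSupergroup K} (H : ClosedSupersubgroup G)

theorem p_even : IsEven G.gr H.gr H.p := fun _ _ h => (CommSuperalg.alg H.proj).map_mem h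

theorem p_comul (a : G) : comul (R := K) (H.p a) = TensorProduct.map H.p H.p (comul (R := K) a) :=
  H.comul_proj a

theorem p_counit (a : G) : counit (R := K) (H.p a) = counit (R := K) a := H.counit_proj a

/-- The right coaction `(id ⊗ p) δ : K[G] → K[G] ⊗ K[H]`, dual to the right multiplication
`G × H → G`. -/
def rightCoact : G.carrier →ₗ[K] G.carrier ⊗[K] H.carrier :=
  H.p.lTensor G.carrier ∘ₗ comul

/-- The left coaction `(p ⊗ id) δ : K[G] → K[H] ⊗ K[G]`, which makes `K[G]` an object of
`mod-H = K[H]-scomod`. -/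
def leftCoact : G.carrier →ₗ[K] H.carrier ⊗[K] G.carrier :=
  H.p.rTensor G.carrier ∘ₗ comul

/-- `K[G]` as a left `K[H]`-supercomodule. -/
def coordLeft : LeftSComod H.toAffineSupergroup where
  carrier := G.carrier
  gr := G.gr
  isInternal := DirectSum.Decomposition.isInternal G.gr
  coact := H.leftCoact
  coact_mem := fun i v hv =>
    map_mem_tensorGr (g := LinearMap.id) H.p_even (fun _ _ h => h) i _ (G.comul_mem i v hv)
  coassoc := by
    intro a
    have e1 : ∀ t : G.carrier ⊗[K] G.carrier,
        TensorProduct.assoc K H.carrier H.carrier G.carrier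
          ((comul (R := K) (A := H.carrier)).rTensor _ (H.p.rTensor G.carrier t)) =
        TensorProduct.map H.p (H.p.rTensor G.carrier)
          (TensorProduct.assoc K G.carrier G.carrier G.carrier
            ((comul (R := K) (A := G.carrier)).rTensor _ t)) := by
      intro t
      induction t with
      | zero => simp
      | add x y hx hy => simp only [map_add, hx, hy]
      | tmul x y =>
        simp only [LinearMap.rTensor_tmul, p_comul]
        induction (comul (R := K) x) with
        | zero => simp
        | add x y hx hy => simp only [map_add, TensorProduct.add_tmul, hx, hy]
        | tmul x y => simp
    have e2 : ∀ t : G.carrier ⊗[K] G.carrier,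
        H.leftCoact.lTensor H.carrier (H.p.rTensor G.carrier t) =
        TensorProduct.map H.p (H.p.rTensor G.carrier)
            ((comul (R := K) (A := G.carrier)).lTensor _ t) := by
      intro t
      induction t with
      | zero => simp
      | add x y hx hy => simp only [map_add, hx, hy]
      | tmul x y => simp [leftCoact]
    change TensorProduct.assoc K H.carrier H.carrier G.carrier
      ((comul (R := K) (A := H.carrier)).rTensor _ (H.p.rTensor G.carrier (comul (R := K) a))) =
        H.leftCoact.lTensor H.carrier (H.p.rTensor G.carrier (comul (R := K) a))
    rw [e1, e2, Coalgebra.coassoc_apply]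
  counit_coact := by
    intro a
    have e1 : ∀ t : G.carrier ⊗[K] G.carrier,
        (counit (R := K) (A := H.carrier)).rTensor _ (H.p.rTensor G.carrier t) =
          (counit (R := K) (A := G.carrier)).rTensor _ t := by
      intro t
      induction t with
      | zero => simp
      | add x y hx hy => simp only [map_add, hx, hy]
      | tmul x y => simp [p_counit]
    change TensorProduct.lid K G.carrier ((counit (R := K) (A := H.carrier)).rTensor _
      (H.p.rTensor G.carrier (comul (R := K) a))) = a
    rw [e1, Coalgebra.rTensor_counit_comul]
    simp

/-- The right coaction as a morphism of superalgebras `K[G] → K[G] ⊗ K[H]`. -/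
def rightCoactAlg : G.carrier →ₐ[K] GradedTensorProduct K G.gr H.gr :=
  (GradedTensorProduct.lift G.gr G.gr (GradedTensorProduct.includeLeft G.gr H.gr)
    ((GradedTensorProduct.includeRight G.gr H.gr).comp (CommSuperalg.alg H.proj).toAlgHom)
    (fun i j a b => by
      have hb : H.p b ∈ H.gr j := H.p_even j _ b.2
      change GradedTensorProduct.of K G.gr H.gr ((a : G.carrier) ⊗ₜ 1) *
        GradedTensorProduct.of K G.gr H.gr (1 ⊗ₜ H.p b) = (-1 : ℤˣ) ^ (j * i) •
        (GradedTensorProduct.of K G.gr H.gr (1 ⊗ₜ H.p b) *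
          GradedTensorProduct.of K G.gr H.gr ((a : G.carrier) ⊗ₜ 1))
      have h1 := GradedTensorProduct.tmul_one_mul_one_tmul (R := K) G.gr H.gr a (H.p b)
      have h2 := GradedTensorProduct.tmul_coe_mul_coe_tmul (R := K) G.gr H.gr 1 ⟨H.p b, hb⟩ a 1
      rw [h1, h2, one_mul, mul_one, smul_smul, Int.units_mul_self, one_smul])).comp G.comulAlg

theorem rightCoactAlg_apply (a : G) :
    H.rightCoactAlg a = GradedTensorProduct.of K G.gr H.gr (H.rightCoact a) := by
  change LinearMap.mul' K _ (TensorProduct.map _ _ (comul (R := K) a)) =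
    GradedTensorProduct.of K G.gr H.gr (H.p.lTensor G.carrier (comul (R := K) a))
  induction (comul (R := K) a) with
  | zero => simp
  | add x y hx hy => simp only [map_add, hx, hy]
  | tmul x y => exact GradedTensorProduct.tmul_one_mul_one_tmul (R := K) G.gr H.gr x (H.p y)

theorem tmul_one_mul (𝒜 : CommSuperalg K) (ℬ : CommSuperalg K) (a : 𝒜) (t : 𝒜.carrier ⊗[K] ℬ.carrier) :
    GradedTensorProduct.of K 𝒜.gr ℬ.gr (a ⊗ₜ 1) * GradedTensorProduct.of K 𝒜.gr ℬ.gr t =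
      GradedTensorProduct.of K 𝒜.gr ℬ.gr ((LinearMap.mulLeft K a).rTensor ℬ.carrier t) := by
  induction t with
  | zero => simp
  | add x y hx hy => simp only [map_add, mul_add, hx, hy]
  | tmul x y =>
    obtain ⟨x0, h0, x1, h1, rfl⟩ := internal_decomp (DirectSum.Decomposition.isInternal 𝒜.gr) x
    have e0 := GradedTensorProduct.tmul_one_mul_coe_tmul (R := K) 𝒜.gr ℬ.gr a ⟨x0, h0⟩ y
    have e1 := GradedTensorProduct.tmul_one_mul_coe_tmul (R := K) 𝒜.gr ℬ.gr a ⟨x1, h1⟩ y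
    simp only [TensorProduct.add_tmul, map_add, mul_add, LinearMap.rTensor_tmul,
      LinearMap.mulLeft_apply]
    exact congrArg₂ _ e0 e1

end ClosedSupersubgroup

/-! ## Coideal superalgebras and Hopf supermodules -/

/-- A left coideal supersubalgebra `B` of `K[G]`: `δ(B) ⊆ K[G] ⊗ B`. -/
structure LeftCoidealSubalg (G : AffineSupergroup K) where
  alg : Subalgebra K G.carrier
  homogeneous : ∀ i, ∀ b ∈ alg, GradedAlgebra.proj G.gr i b ∈ alg
  coideal : ∀ b : alg, (comul (R := K) ∘ₗ alg.val.toLinearMap) b ∈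
    LinearMap.range (alg.val.toLinearMap.lTensor G.carrier)

namespace LeftCoidealSubalg

variable {G : AffineSupergroup K} (B : LeftCoidealSubalg G)

/-- The projection of `B` to its component of degree `i`. -/
def proj (i : ZMod 2) : B.alg →ₗ[K] B.alg :=
  (GradedAlgebra.proj G.gr i).restrict (p := Subalgebra.toSubmodule B.alg)
    (q := Subalgebra.toSubmodule B.alg) (B.homogeneous i)

/-- The coaction `B → K[G] ⊗ B`, the restriction of the comultiplication. -/
def coact : B.alg →ₗ[K] G.carrier ⊗[K] B.alg :=
  tensorLift B.alg.val.toLinearMap Subtype.val_injective (comul ∘ₗ B.alg.val.toLinearMap)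
    B.coideal

theorem lTensor_coact (b : B.alg) : B.alg.val.toLinearMap.lTensor G.carrier (B.coact b) =
    comul (R := K) (b : G.carrier) :=
  lTensor_tensorLift B.alg.val.toLinearMap Subtype.val_injective _ B.coideal b

/-- The action of `K[G] ⊗ B` on `K[G] ⊗ M` for a `B`-module `M`, given on homogeneous elements by
`(c ⊗ b) (a ⊗ m) = (-1)^(|b||a|) ca ⊗ bm`. -/
def superAct (M : Type u) [AddCommGroup M] [Module K M] [Module B.alg M]
    [IsScalarTower K B.alg M] :
    G.carrier ⊗[K] B.alg →ₗ[K] G.carrier ⊗[K] M →ₗ[K] G.carrier ⊗[K] M :=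
  ∑ i : ZMod 2, ∑ j : ZMod 2, (-1 : ℤˣ) ^ (i * j) •
    TensorProduct.map₂ ((LinearMap.mul K G.carrier).compl₂ (GradedAlgebra.proj G.gr j))
      ((Algebra.lsmul K K M).toLinearMap ∘ₗ B.proj i)

theorem decomp (b : B.alg) : ∃ x : B.alg, (x : G.carrier) ∈ G.gr 0 ∧
    ∃ y : B.alg, (y : G.carrier) ∈ G.gr 1 ∧ x + y = b := by
  refine ⟨B.proj 0 b, SetLike.coe_mem _, B.proj 1 b, SetLike.coe_mem _, Subtype.ext ?_⟩
  obtain ⟨x, hx, y, hy, h⟩ :=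
    internal_decomp (DirectSum.Decomposition.isInternal G.gr) (b : G.carrier)
  change GradedAlgebra.proj G.gr 0 (b : G.carrier) + GradedAlgebra.proj G.gr 1 (b : G.carrier) = b
  rw [← h, map_add, map_add, GradedAlgebra.proj_apply, GradedAlgebra.proj_apply,
    GradedAlgebra.proj_apply, GradedAlgebra.proj_apply, DirectSum.decompose_of_mem_same _ hx,
    DirectSum.decompose_of_mem_same _ hy, DirectSum.decompose_of_mem_ne _ hx (by decide),
    DirectSum.decompose_of_mem_ne _ hy (by decide), add_zero, zero_add]

theorem superAct_tmul (M : Type u) [AddCommGroup M] [Module K M] [Module B.alg M]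
    [IsScalarTower K B.alg M] (i j : ZMod 2) (c : G) (b : B.alg) (hb : (b : G.carrier) ∈ G.gr i)
    (a : G) (ha : a ∈ G.gr j) (m : M) :
    B.superAct M (c ⊗ₜ b) (a ⊗ₜ m) = (-1 : ℤˣ) ^ (i * j) • ((c * a) ⊗ₜ[K] (b • m)) := by
  have pa : ∀ k, GradedAlgebra.proj G.gr k a = if k = j then a else 0 := fun k => by
    rw [GradedAlgebra.proj_apply]
    split_ifs with h
    · rw [h, DirectSum.decompose_of_mem_same _ ha]
    · rw [DirectSum.decompose_of_mem_ne _ ha (Ne.symm h)]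
  have pb : ∀ k, B.proj k b = if k = i then b else 0 := fun k => by
    apply Subtype.ext
    change GradedAlgebra.proj G.gr k (b : G.carrier) = _
    rw [GradedAlgebra.proj_apply]
    split_ifs with h
    · rw [h, DirectSum.decompose_of_mem_same _ hb]
    · rw [DirectSum.decompose_of_mem_ne _ hb (Ne.symm h)]; rfl
  rw [superAct, LinearMap.sum_apply, LinearMap.sum_apply, Finset.sum_eq_single i,
    LinearMap.sum_apply, LinearMap.sum_apply, Finset.sum_eq_single j]
  · simp only [LinearMap.smul_apply, TensorProduct.map₂_apply_tmul, TensorProduct.map_tmul,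
      LinearMap.compl₂_apply, LinearMap.comp_apply, pa, pb, if_true]
    rfl
  · intro k _ hk
    simp [TensorProduct.map₂_apply_tmul, pa, hk]
  · simp
  · intro k _ hk
    simp [LinearMap.sum_apply, TensorProduct.map₂_apply_tmul, pb, hk]
  · simp

theorem superAct_map {M M' : Type u} [AddCommGroup M] [Module K M] [Module B.alg M]
    [IsScalarTower K B.alg M] [AddCommGroup M'] [Module K M'] [Module B.alg M']
    [IsScalarTower K B.alg M'] (f : M →ₗ[K] M') (hf : ∀ (b : B.alg) (m : M), f (b • m) = b • f m)
    (t : G.carrier ⊗[K] B.alg) (s : G.carrier ⊗[K] M) :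
    f.lTensor G.carrier (B.superAct M t s) = B.superAct M' t (f.lTensor G.carrier s) := by
  induction t with
  | zero => simp
  | add x y hx hy => simp only [map_add, LinearMap.add_apply, hx, hy]
  | tmul c b =>
    induction s with
    | zero => simp
    | add x y hx hy => simp only [map_add, hx, hy]
    | tmul a m =>
      obtain ⟨a0, ha0, a1, ha1, rfl⟩ :=
        internal_decomp (DirectSum.Decomposition.isInternal G.gr) a
      obtain ⟨b0, hb0, b1, hb1, rfl⟩ := B.decomp b
      have h : ∀ i j, ∀ b : B.alg, (b : G.carrier) ∈ G.gr i → ∀ a ∈ G.gr j,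
          f.lTensor G.carrier (B.superAct M (c ⊗ₜ b) (a ⊗ₜ m)) =
            B.superAct M' (c ⊗ₜ b) (f.lTensor G.carrier (a ⊗ₜ m)) := by
        intro i j b hb a ha
        rw [B.superAct_tmul M i j c b hb a ha, LinearMap.lTensor_tmul,
          B.superAct_tmul M' i j c b hb a ha, LinearMap.map_smul_of_tower, LinearMap.lTensor_tmul,
          hf]
      simp only [TensorProduct.tmul_add, TensorProduct.add_tmul, map_add, LinearMap.add_apply,
        h 0 0 b0 hb0 a0 ha0, h 0 1 b0 hb0 a1 ha1, h 1 0 b1 hb1 a0 ha0, h 1 1 b1 hb1 a1 ha1]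

theorem superAct_assoc {N : Type u} [AddCommGroup N] [Module K N]
    (t : G.carrier ⊗[K] B.alg) (s r : G.carrier ⊗[K] G.carrier) (n : N)
    (h : GradedTensorProduct.of K G.gr G.gr r =
      GradedTensorProduct.of K G.gr G.gr (B.alg.val.toLinearMap.lTensor G.carrier t) *
        GradedTensorProduct.of K G.gr G.gr s) :
    TensorProduct.assoc K G.carrier G.carrier N (r ⊗ₜ n) =
      B.superAct (G.carrier ⊗[K] N) t (TensorProduct.assoc K G.carrier G.carrier N (s ⊗ₜ n)) := by
  obtain rfl : r = (GradedTensorProduct.of K G.gr G.gr).symm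
      (GradedTensorProduct.of K G.gr G.gr (B.alg.val.toLinearMap.lTensor G.carrier t) *
        GradedTensorProduct.of K G.gr G.gr s) := by rw [← h]; rfl
  clear h
  induction t with
  | zero => simp
  | add x y hx hy =>
    simp only [map_add, LinearMap.add_apply, add_mul, TensorProduct.add_tmul, hx, hy]
  | tmul c b =>
    induction s with
    | zero => simp
    | add x y hx hy => simp only [map_add, mul_add, TensorProduct.add_tmul, hx, hy]
    | tmul a m =>
      obtain ⟨a0, ha0, a1, ha1, rfl⟩ :=
        internal_decomp (DirectSum.Decomposition.isInternal G.gr) a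
      obtain ⟨b0, hb0, b1, hb1, rfl⟩ := B.decomp b
      have h : ∀ i j, ∀ b : B.alg, (b : G.carrier) ∈ G.gr i → ∀ a ∈ G.gr j,
          TensorProduct.assoc K G.carrier G.carrier N
            ((GradedTensorProduct.of K G.gr G.gr).symm
              (GradedTensorProduct.of K G.gr G.gr (c ⊗ₜ B.alg.val.toLinearMap b) *
              GradedTensorProduct.of K G.gr G.gr (a ⊗ₜ m)) ⊗ₜ n) =
          B.superAct (G.carrier ⊗[K] N) (c ⊗ₜ b)
            (TensorProduct.assoc K G.carrier G.carrier N ((a ⊗ₜ m) ⊗ₜ n)) := by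
        intro i j b hb a ha
        have e := GradedTensorProduct.tmul_coe_mul_coe_tmul (R := K) G.gr G.gr c ⟨b, hb⟩ ⟨a, ha⟩ m
        have e' := congrArg (GradedTensorProduct.of K G.gr G.gr).symm e
        rw [TensorProduct.assoc_tmul, B.superAct_tmul _ i j c b hb a ha]
        refine (congrArg (fun z => TensorProduct.assoc K G.carrier G.carrier N (z ⊗ₜ n)) e').trans
          ?_
        change TensorProduct.assoc K G.carrier G.carrier N
          (((-1 : ℤˣ) ^ (i * j) • ((c * a) ⊗ₜ[K] ((b : G.carrier) * m))) ⊗ₜ n) = _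
        rw [← TensorProduct.smul_tmul']
        change (TensorProduct.assoc K G.carrier G.carrier N).toLinearMap _ = _
        rw [LinearMap.map_smul_of_tower]
        rfl
      simp only [LinearMap.lTensor_tmul, TensorProduct.tmul_add, TensorProduct.add_tmul,
        map_add, LinearMap.add_apply, add_mul, mul_add,
        h 0 0 b0 hb0 a0 ha0, h 0 1 b0 hb0 a1 ha1, h 1 0 b1 hb1 a0 ha0, h 1 1 b1 hb1 a1 ha1]

end LeftCoidealSubalg

/-- A `(B, K[G])`-Hopf supermodule: a left `B`-supermodule and left `K[G]`-supercomodule `M` with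
`τ(bm) = ∑ (-1)^(|b_2||a_1|) b_1 a_1 ⊗ b_2 m_2` for `δ(b) = ∑ b_1 ⊗ b_2`,
`τ(m) = ∑ a_1 ⊗ m_2`. -/
structure HopfSMod {G : AffineSupergroup K} (B : LeftCoidealSubalg G) extends LeftSComod G where
  [bmodule : Module B.alg carrier]
  [tower : IsScalarTower K B.alg carrier]
  smul_mem : ∀ i j : ZMod 2, ∀ b : B.alg, (b : G.carrier) ∈ G.gr i → ∀ m ∈ gr j, b • m ∈ gr (i + j)
  coact_smul : ∀ (b : B.alg) (m : carrier),
    coact (b • m) = B.superAct carrier (B.coact b) (coact m)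

attribute [instance] HopfSMod.bmodule HopfSMod.tower

namespace HopfSMod

variable {G : AffineSupergroup K} {B : LeftCoidealSubalg G}

/-- A morphism of Hopf supermodules: even, colinear and `B`-linear. -/
@[ext]
structure Hom (M N : HopfSMod B) extends LeftSComod.Hom M.toLeftSComod N.toLeftSComod where
  map_smul : ∀ (b : B.alg) (m : M.carrier), toLin (b • m) = b • toLin m

/-- The category `_B H` of `(B, K[G])`-Hopf supermodules. -/
instance : Category.{u} (HopfSMod B) where
  Hom M N := Hom M N
  id M := ⟨⟨LinearMap.id, fun _ _ h => h, by simp⟩, by simp⟩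
  comp f g := ⟨⟨g.toLin ∘ₗ f.toLin, fun i v h => g.even i _ (f.even i v h), fun v => by
    simp [g.colinear, f.colinear, LinearMap.lTensor_comp]⟩, fun b m => by
    simp [f.map_smul, g.map_smul]⟩

end HopfSMod

/-! ## Induction -/

namespace ClosedSupersubgroup

variable {G : AffineSupergroup K} (H : ClosedSupersubgroup G)

theorem rightCoact_even : IsEven G.gr (tensorGr G.gr H.gr) H.rightCoact := fun i v hv =>
  map_mem_tensorGr (f := LinearMap.id) (fun _ _ h => h) H.p_even i _ (G.comul_mem i v hv)

theorem one_mem_gr : (1 : H.carrier) ∈ H.gr 0 := SetLike.GradedOne.one_mem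

/-- `a ↦ (id ⊗ p) δ(a) - a ⊗ 1`. -/
def invDiff : G.carrier →ₗ[K] G.carrier ⊗[K] H.carrier :=
  H.rightCoact - (TensorProduct.mk K G.carrier H.carrier).flip 1

theorem invDiff_apply (a : G) : H.invDiff a = H.rightCoact a - a ⊗ₜ 1 := rfl

theorem invDiff_even : IsEven G.gr (tensorGr G.gr H.gr) H.invDiff := fun i v hv =>
  sub_mem (H.rightCoact_even i v hv) (tmul_mem_tensorGr hv H.one_mem_gr (add_zero i))

theorem rightCoact_mul (b a : G) (hb : H.rightCoact b = b ⊗ₜ 1) :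
    H.rightCoact (b * a) = (LinearMap.mulLeft K b).rTensor H.carrier (H.rightCoact a) := by
  apply (GradedTensorProduct.of K G.gr H.gr).injective
  rw [← rightCoactAlg_apply, map_mul, rightCoactAlg_apply, rightCoactAlg_apply, hb]
  exact tmul_one_mul G.toCommSuperalg H.toCommSuperalg b _

/-- Even maps kill the homogeneous components of the elements of their kernel. -/
theorem even_ker {V W : Type*} [AddCommGroup V] [Module K V] [AddCommGroup W] [Module K W]
    {𝒱 : ZMod 2 → Submodule K V} {𝒲 : ZMod 2 → Submodule K W} (hW : DirectSum.IsInternal 𝒲)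
    {f : V →ₗ[K] W} (hf : IsEven 𝒱 𝒲 f) {x y : V} (hx : x ∈ 𝒱 0) (hy : y ∈ 𝒱 1)
    (h : f (x + y) = 0) : f x = 0 := by
  refine internal_disj hW (i := 0) (j := 1) (by decide) (hf 0 x hx) ?_
  rw [map_add] at h
  rw [eq_neg_of_add_eq_zero_left h]
  exact neg_mem (hf 1 y hy)

/-- The superalgebra of invariants `R = K[G]^H = {a | (id ⊗ p) δ(a) = a ⊗ 1}`, a left coideal
supersubalgebra of `K[G]`. -/
def invariants : LeftCoidealSubalg G where
  alg :=
    { carrier := {a | H.rightCoact a = a ⊗ₜ 1}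
      mul_mem' := by
        intro a b ha hb
        change H.rightCoact _ = _
        rw [H.rightCoact_mul a b ha, show H.rightCoact b = b ⊗ₜ 1 from hb]
        simp
      add_mem' := by
        intro a b ha hb
        change H.rightCoact _ = _
        rw [map_add, show H.rightCoact a = a ⊗ₜ 1 from ha, show H.rightCoact b = b ⊗ₜ 1 from hb,
          TensorProduct.add_tmul]
      algebraMap_mem' := by
        intro c
        change H.rightCoact _ = _
        apply (GradedTensorProduct.of K G.gr H.gr).injective
        rw [← rightCoactAlg_apply, AlgHom.commutes]
        rfl }
  homogeneous := by
    intro i b hb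
    have hb' : H.invDiff b = 0 := sub_eq_zero.2 hb
    obtain ⟨x, hx, y, hy, rfl⟩ := internal_decomp (DirectSum.Decomposition.isInternal G.gr) b
    have hx0 := even_ker (tensorGr_internal (DirectSum.Decomposition.isInternal G.gr)
      (DirectSum.Decomposition.isInternal H.gr)) H.invDiff_even hx hy hb'
    have hy0 : H.invDiff y = 0 := by rwa [map_add, hx0, zero_add] at hb'
    rw [map_add, GradedAlgebra.proj_apply, GradedAlgebra.proj_apply]
    rcases zmod2_cases i with rfl | rfl
    · rw [DirectSum.decompose_of_mem_same _ hx, DirectSum.decompose_of_mem_ne _ hy (by decide),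
        add_zero]
      exact sub_eq_zero.1 hx0
    · rw [DirectSum.decompose_of_mem_same _ hy, DirectSum.decompose_of_mem_ne _ hx (by decide),
        zero_add]
      exact sub_eq_zero.1 hy0
  coideal := by
    rintro ⟨b, hb⟩
    refine mem_range_of_ker H.invDiff _ (fun v => ⟨fun h => ⟨⟨v, sub_eq_zero.1 h⟩, rfl⟩, ?_⟩) _ ?_
    · rintro ⟨⟨u, hu⟩, rfl⟩
      exact sub_eq_zero.2 hu
    · change H.invDiff.lTensor G.carrier (comul (R := K) b) = 0
      have e1 : ∀ t : G.carrier ⊗[K] G.carrier, H.rightCoact.lTensor G.carrier t =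
          (H.p.lTensor G.carrier).lTensor G.carrier ((comul (R := K)).lTensor G.carrier t) := by
        intro t
        rw [rightCoact, LinearMap.lTensor_comp]; rfl
      have e2 : ∀ t : G.carrier ⊗[K] G.carrier, (H.p.lTensor G.carrier).lTensor G.carrier
          (TensorProduct.assoc K G.carrier G.carrier G.carrier ((comul (R := K)).rTensor _ t)) =
          TensorProduct.assoc K G.carrier G.carrier H.carrier
            ((comul (R := K)).rTensor _ (H.p.lTensor G.carrier t)) := by
        intro t
        induction t with
        | zero => simp
        | add x y hx hy => simp only [map_add, hx, hy]
        | tmul x y =>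
          simp only [LinearMap.rTensor_tmul, LinearMap.lTensor_tmul]
          induction (comul (R := K) x) with
          | zero => simp
          | add x y hx hy => simp only [map_add, TensorProduct.add_tmul, hx, hy]
          | tmul x y => simp
      have e3 : ∀ t : G.carrier ⊗[K] G.carrier,
          ((TensorProduct.mk K G.carrier H.carrier).flip 1).lTensor G.carrier t =
          TensorProduct.assoc K G.carrier G.carrier H.carrier (t ⊗ₜ 1) := by
        intro t
        induction t with
        | zero => simp
        | add x y hx hy => simp only [map_add, TensorProduct.add_tmul, hx, hy]
        | tmul x y => simp
      rw [invDiff, LinearMap.lTensor_sub, LinearMap.sub_apply, e1, e3, ← Coalgebra.coassoc_apply,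
        e2]
      change TensorProduct.assoc K G.carrier G.carrier H.carrier
            ((comul (R := K)).rTensor _ (H.rightCoact b)) - _ = 0
      rw [show H.rightCoact b = b ⊗ₜ 1 from hb, LinearMap.rTensor_tmul, sub_self]

theorem mem_invariants (a : G) : a ∈ H.invariants.alg ↔ H.rightCoact a = a ⊗ₜ 1 := Iff.rfl

variable (N : LeftSComod H.toAffineSupergroup)

theorem cotensorDiff_even : IsEven (tensorGr G.gr N.gr) (tensorGr G.gr (tensorGr H.gr N.gr))
    (cotensorDiff H.rightCoact N) := fun i v hv =>
  sub_mem (assoc_mem_tensorGr G.gr H.gr N.gr i _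
    (map_mem_tensorGr (g := LinearMap.id) H.rightCoact_even (fun _ _ h => h) i v hv))
    (map_mem_tensorGr (f := LinearMap.id) (fun _ _ h => h) N.coact_mem i v hv)

theorem cotensorDiff_cofree (x : G.carrier ⊗[K] N.carrier) :
    (cotensorDiff H.rightCoact N).lTensor G.carrier (cofreeCoact G N.carrier x) =
      TensorProduct.assoc K G.carrier G.carrier (H.carrier ⊗[K] N.carrier)
        ((comul (R := K)).rTensor _ (cotensorDiff H.rightCoact N x)) := by
  induction x with
  | zero => simp
  | add x y hx hy => simp only [map_add, hx, hy]
  | tmul a n =>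
    have e1 : ∀ t : G.carrier ⊗[K] G.carrier,
        ((TensorProduct.assoc K G.carrier H.carrier N.carrier).toLinearMap ∘ₗ
          H.rightCoact.rTensor N.carrier).lTensor G.carrier
            (TensorProduct.assoc K G.carrier G.carrier N.carrier (t ⊗ₜ n)) =
        (TensorProduct.assoc K G.carrier H.carrier N.carrier).toLinearMap.lTensor G.carrier
          (TensorProduct.assoc K G.carrier (G.carrier ⊗[K] H.carrier) N.carrier
            ((H.p.lTensor G.carrier).lTensor G.carrier
              ((comul (R := K)).lTensor G.carrier t) ⊗ₜ n)) := by
      intro t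
      induction t with
      | zero => simp
      | add x y hx hy => simp only [map_add, TensorProduct.add_tmul, hx, hy]
      | tmul x y => simp [rightCoact]
    have e2 : ∀ t : G.carrier ⊗[K] G.carrier,
        (TensorProduct.assoc K G.carrier H.carrier N.carrier).toLinearMap.lTensor G.carrier
          (TensorProduct.assoc K G.carrier (G.carrier ⊗[K] H.carrier) N.carrier
            ((H.p.lTensor G.carrier).lTensor G.carrier
              (TensorProduct.assoc K G.carrier G.carrier G.carrier
                ((comul (R := K)).rTensor G.carrier t)) ⊗ₜ n)) =
        TensorProduct.assoc K G.carrier G.carrier (H.carrier ⊗[K] N.carrier)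
          ((comul (R := K)).rTensor _ (TensorProduct.assoc K G.carrier H.carrier N.carrier
            (H.p.lTensor G.carrier t ⊗ₜ n))) := by
      intro t
      induction t with
      | zero => simp
      | add x y hx hy => simp only [map_add, TensorProduct.add_tmul, hx, hy]
      | tmul x y =>
        simp only [LinearMap.rTensor_tmul, LinearMap.lTensor_tmul, TensorProduct.assoc_tmul]
        induction (comul (R := K) x) with
        | zero => simp
        | add x y hx hy => simp only [map_add, TensorProduct.add_tmul, hx, hy]
        | tmul x y => simp
    have e3 : ∀ t : G.carrier ⊗[K] G.carrier,
        (N.coact.lTensor G.carrier).lTensor G.carrier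
            (TensorProduct.assoc K G.carrier G.carrier N.carrier (t ⊗ₜ n)) =
        TensorProduct.assoc K G.carrier G.carrier (H.carrier ⊗[K] N.carrier)
          (t ⊗ₜ N.coact n) := by
      intro t
      induction t with
      | zero => simp
      | add x y hx hy => simp only [map_add, TensorProduct.add_tmul, hx, hy]
      | tmul x y => simp
    rw [cotensorDiff, LinearMap.lTensor_sub, LinearMap.sub_apply, LinearMap.sub_apply, map_sub,
      map_sub]
    rw [show cofreeCoact G N.carrier (a ⊗ₜ n) = TensorProduct.assoc K G.carrier G.carrier
      N.carrier (comul (R := K) a ⊗ₜ n) from rfl, e1, e3, ← Coalgebra.coassoc_apply, e2]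
    rfl

theorem cotensor_homog (x : G.carrier ⊗[K] N.carrier) (hx : x ∈ tensorGr G.gr N.gr 0)
    (y : G.carrier ⊗[K] N.carrier) (hy : y ∈ tensorGr G.gr N.gr 1)
    (h : x + y ∈ cotensor H.rightCoact N) : x ∈ cotensor H.rightCoact N := by
  have hW := tensorGr_internal (DirectSum.Decomposition.isInternal G.gr)
      (tensorGr_internal (DirectSum.Decomposition.isInternal H.gr) N.isInternal)
  exact even_ker hW (H.cotensorDiff_even N) hx hy h

theorem cotensor_coact (x : cotensor H.rightCoact N) :
    (cofreeCoact G N.carrier ∘ₗ (cotensor H.rightCoact N).subtype) x ∈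
      LinearMap.range ((cotensor H.rightCoact N).subtype.lTensor G.carrier) := by
  have hx : cotensorDiff H.rightCoact N x.1 = 0 := x.2
  have h0 : (cotensorDiff H.rightCoact N).lTensor G.carrier (cofreeCoact G N.carrier x.1) = 0 := by
    rw [H.cotensorDiff_cofree N x.1, hx, map_zero, map_zero]
  exact mem_range_ker_subtype (cotensorDiff H.rightCoact N) _ h0

/-- `K[G] □_{K[H]} N` as a subcomodule of the left `K[G]`-supercomodule `K[G] ⊗ N`. -/
def indComod : LeftSComod G :=
  (cofree G N.isInternal).sub (cotensor H.rightCoact N) (H.cotensor_homog N) (H.cotensor_coact N)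

theorem smul_tmul_eq {X : Type u} [AddCommGroup X] [Module K X] (b : H.invariants.alg)
    (a : G.carrier) (n : X) : b • (a ⊗ₜ[K] n) = ((b : G.carrier) * a) ⊗ₜ[K] n := rfl

theorem cotensorDiff_smul (b : H.invariants.alg) (x : G.carrier ⊗[K] N.carrier) :
    cotensorDiff H.rightCoact N (b • x) = b • cotensorDiff H.rightCoact N x := by
  induction x with
  | zero => simp
  | add x y hx hy => simp only [map_add, smul_add, hx, hy]
  | tmul a n =>
    have hb := H.rightCoact_mul b a b.2
    rw [H.smul_tmul_eq, cotensorDiff, LinearMap.sub_apply, LinearMap.sub_apply, smul_sub]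
    simp only [LinearMap.comp_apply, LinearMap.rTensor_tmul, LinearMap.lTensor_tmul,
      LinearEquiv.coe_coe, hb]
    congr 1
    · induction (H.rightCoact a) with
      | zero => simp
      | add x y hx hy => simp only [map_add, TensorProduct.add_tmul, smul_add, hx, hy]
      | tmul x y =>
        simp only [LinearMap.rTensor_tmul, TensorProduct.assoc_tmul, LinearMap.mulLeft_apply,
          H.smul_tmul_eq]

instance : SMul H.invariants.alg (cotensor H.rightCoact N) :=
  ⟨fun b x => ⟨b • x.1, by
    have hx : cotensorDiff H.rightCoact N x.1 = 0 := x.2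
    change cotensorDiff H.rightCoact N (b • x.1) = 0
    rw [cotensorDiff_smul, hx, smul_zero]⟩⟩

/-- The action of `R` on `K[G] □_{K[H]} N`, `r (∑ a ⊗ n) = ∑ ra ⊗ n`. -/
instance : Module H.invariants.alg (cotensor H.rightCoact N) :=
  Function.Injective.module _ (cotensor H.rightCoact N).subtype.toAddMonoidHom
    (Submodule.subtype_injective _) (fun _ _ => rfl)

instance : IsScalarTower K H.invariants.alg (cotensor H.rightCoact N) :=
  ⟨fun c b x => Subtype.ext (smul_assoc c b x.1)⟩

theorem smul_mem_tensorGr (i j : ZMod 2) (b : H.invariants.alg) (hb : (b : G.carrier) ∈ G.gr i)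
    (x : G.carrier ⊗[K] N.carrier) (hx : x ∈ tensorGr G.gr N.gr j) :
    b • x ∈ tensorGr G.gr N.gr (i + j) := by
  induction hx using Submodule.span_induction with
  | mem x hx =>
    obtain ⟨k, l, rfl, v, hv, w, hw, rfl⟩ := hx
    rw [H.smul_tmul_eq]
    exact tmul_mem_tensorGr (SetLike.mul_mem_graded hb hv) hw (add_assoc i k l)
  | zero => rw [smul_zero]; exact zero_mem _
  | add x y _ _ hx hy => rw [smul_add]; exact add_mem hx hy
  | smul c x _ hx => rw [smul_comm]; exact Submodule.smul_mem _ c hx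

theorem cofreeCoact_smul (b : H.invariants.alg) (x : G.carrier ⊗[K] N.carrier) :
    cofreeCoact G N.carrier (b • x) = H.invariants.superAct (G.carrier ⊗[K] N.carrier)
      (H.invariants.coact b) (cofreeCoact G N.carrier x) := by
  induction x with
  | zero => simp
  | add x y hx hy => simp only [map_add, smul_add, hx, hy]
  | tmul a n =>
    refine H.invariants.superAct_assoc (H.invariants.coact b) (comul (R := K) a)
      (comul (R := K) (b * a : G.carrier)) n ?_
    rw [LeftCoidealSubalg.lTensor_coact]
    exact G.comul_mul b a

theorem indComod_coact (x : cotensor H.rightCoact N) :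
    (cotensor H.rightCoact N).subtype.lTensor G.carrier ((H.indComod N).coact x) =
      cofreeCoact G N.carrier x.1 :=
  LeftSComod.sub_coact (cofree G N.isInternal) (cotensor H.rightCoact N) (H.cotensor_homog N)
    (H.cotensor_coact N) x

instance : Module H.invariants.alg (H.indComod N).carrier :=
  inferInstanceAs (Module H.invariants.alg (cotensor H.rightCoact N))

instance : IsScalarTower K H.invariants.alg (H.indComod N).carrier :=
  inferInstanceAs (IsScalarTower K H.invariants.alg (cotensor H.rightCoact N))

/-- The inclusion of `K[G] □_{K[H]} N` into `K[G] ⊗ N`. -/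
def indIncl : (H.indComod N).carrier →ₗ[K] G.carrier ⊗[K] N.carrier :=
  (cotensor H.rightCoact N).subtype

theorem indComod_coact_smul (b : H.invariants.alg) (x : (H.indComod N).carrier) :
    (H.indComod N).coact (b • x) =
      H.invariants.superAct (H.indComod N).carrier (H.invariants.coact b)
        ((H.indComod N).coact x) := by
  apply lTensor_inj (A := G.carrier) (ι := H.indIncl N)
    (cotensor H.rightCoact N).subtype_injective
  refine (H.indComod_coact N (b • x)).trans ?_
  refine Eq.trans ?_ (H.invariants.superAct_map (H.indIncl N)
    (fun _ _ => rfl) (H.invariants.coact b) ((H.indComod N).coact x)).symm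
  refine (H.cofreeCoact_smul N b x.1).trans ?_
  exact congrArg _ (H.indComod_coact N x).symm

/-- The Hopf supermodule `ind^G_H N = K[G] □_{K[H]} N`. -/
def indObj : HopfSMod H.invariants where
  toLeftSComod := H.indComod N
  bmodule := inferInstanceAs (Module H.invariants.alg (H.indComod N).carrier)
  tower := inferInstanceAs (IsScalarTower K H.invariants.alg (H.indComod N).carrier)
  smul_mem i j b hb m hm := H.smul_mem_tensorGr N i j b hb m.1 hm
  coact_smul b m := H.indComod_coact_smul N b m

theorem cotensorMap_even {N N' : LeftSComod H.toAffineSupergroup} (f : N ⟶ N') :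
    IsEven (H.indComod N).gr (H.indComod N').gr (cotensorMap H.rightCoact f) := fun i x hx =>
  map_mem_tensorGr (f := LinearMap.id) (fun _ _ h => h) (LeftSComod.Hom.even f) i x.1 hx

theorem cotensorMap_colinear {N N' : LeftSComod H.toAffineSupergroup} (f : N ⟶ N')
    (x : cotensor H.rightCoact N) : (H.indComod N').coact (cotensorMap H.rightCoact f x) =
      (cotensorMap H.rightCoact f).lTensor G.carrier ((H.indComod N).coact x) := by
  apply lTensor_inj (A := G.carrier) (cotensor H.rightCoact N').subtype_injective
  refine (H.indComod_coact N' _).trans ?_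
  have e1 : ∀ t : G.carrier ⊗[K] cotensor H.rightCoact N,
      (cotensor H.rightCoact N').subtype.lTensor G.carrier
        ((cotensorMap H.rightCoact f).lTensor G.carrier t) =
      ((LeftSComod.lin f).lTensor G.carrier).lTensor G.carrier
        ((cotensor H.rightCoact N).subtype.lTensor G.carrier t) := by
    intro t
    induction t with
    | zero => simp
    | add x y hx hy => simp only [map_add, hx, hy]
    | tmul x y => rfl
  have e2 : ∀ y : G.carrier ⊗[K] N.carrier,
      cofreeCoact G N'.carrier ((LeftSComod.lin f).lTensor G.carrier y) =
        ((LeftSComod.lin f).lTensor G.carrier).lTensor G.carrier (cofreeCoact G N.carrier y) := by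
    intro y
    induction y with
    | zero => simp
    | add x y hx hy => simp only [map_add, hx, hy]
    | tmul a n =>
      simp only [cofreeCoact, LinearMap.comp_apply, LinearMap.rTensor_tmul, LinearMap.lTensor_tmul,
        LinearEquiv.coe_coe]
      induction (comul (R := K) a) with
      | zero => simp
      | add x y hx hy => simp only [map_add, TensorProduct.add_tmul, hx, hy]
      | tmul x y => simp
  refine (e2 x.1).trans ?_
  refine Eq.trans ?_ (e1 ((H.indComod N).coact x)).symm
  exact congrArg _ (H.indComod_coact N x).symm

theorem cotensorMap_smul {N N' : LeftSComod H.toAffineSupergroup} (f : N ⟶ N')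
    (b : H.invariants.alg) (x : cotensor H.rightCoact N) :
    cotensorMap H.rightCoact f (b • x) = b • cotensorMap H.rightCoact f x := by
  apply Subtype.ext
  change (LeftSComod.lin f).lTensor G.carrier (b • x.1) =
    b • (LeftSComod.lin f).lTensor G.carrier x.1
  induction x.1 with
  | zero => simp
  | add x y hx hy => simp only [map_add, smul_add, hx, hy]
  | tmul a n => rfl

/-- The induction functor `ind^G_H = K[G] □_{K[H]} ?` from `mod-H = K[H]-scomod` to the category
of `(R, K[G])`-Hopf supermodules. -/
def ind : LeftSComod H.toAffineSupergroup ⥤ HopfSMod H.invariants where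
  obj N := H.indObj N
  map {N N'} f := HopfSMod.Hom.mk
    ⟨cotensorMap H.rightCoact f, H.cotensorMap_even f, H.cotensorMap_colinear f⟩
    (H.cotensorMap_smul f)
  map_id N := by
    refine HopfSMod.Hom.ext (LinearMap.ext fun x => Subtype.ext ?_)
    exact congrArg (fun l => l x.1) (LinearMap.lTensor_id G.carrier N.carrier)
  map_comp {N N' N''} f g := by
    refine HopfSMod.Hom.ext (LinearMap.ext fun x => Subtype.ext ?_)
    exact congrArg (fun l => l x.1)
      (LinearMap.lTensor_comp G.carrier (LeftSComod.lin g) (LeftSComod.lin f))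

/-- `K[G]` is an injective cogenerator in `mod-H = K[H]-scomod`. As usual for supercomodules,
the morphisms into `K[G]` that separate the arrows of this category may be even or odd, i.e. they
are even morphisms into `K[G]` or into its parity shift. -/
def IsInjectiveCogenerator : Prop :=
  Injective H.coordLeft ∧
    (ObjectProperty.pair H.coordLeft H.coordLeft.parityShift).IsCoseparating

end ClosedSupersubgroup

end
end
end Super

/-! Write A = K[G], C = K[H], and let R be the superalgebra of invariants. Everything turns on one
piece of data: an even, unital, C-colinear map l : C → A, a total integral in the language of Hopf
modules. Condition (iv) produces such a map and is implied by its existence; each of (i), (ii),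
(iii) produces one, and one such map implies all of them.

From l to the four conditions. Put ℓ = S∘l with S the antipode. Then a ↦ ∑ a_1 ℓ(p(a_2)) is an
R-linear projection of A onto R (`trace_mem`, `trace_mul`), and together with S it yields an
R-linear section of the multiplication R ⊗ A → A (`mul_splitMul`). So A is a direct summand of a
free R-module and contains R as a summand, hence is faithfully flat. The same formula shows that ∑
S(a_1) ⊗ a_2 in A ⊗_R A depends on p(a) only (`galMap_eq`), so two points of G that agree on R lie
in one coset. These facts are collected in `IsFFGalois`. Descent along R → A then makes SSp R the
quotient sheaf. They also give A ⊗_R (A □ N) ≅ A ⊗ N (`IsFFGalois.indFold_bijective`), so exactness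
after cotensoring can be tested on N itself, which is faithful coflatness. The inverse of induction
is M ↦ M/R⁺M: for every Hopf supermodule A ⊗_R M ≅ A ⊗ M/R⁺M, and unit and counit become
isomorphisms after the base change A ⊗_R, respectively after A ⊗. Finally, l makes A a direct
summand of the cofree comodule C ⊗ A, so that A is injective and cogenerates. Conversely,
injectivity of A extends the unit K → A along the unit K → C, and the extension is an l.

From (i), (ii), (iii) to l. Each of them implies that A □ ? preserves surjections. For (ii) this is
immediate, and for (iii) it holds because equivalences preserve epimorphisms. For (i), let SSp B be
the quotient sheaf. Testing its universal property against a sheaf of coset families shows that B →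
A separates cosets. Hence over every point of G with values in T the cotensor product becomes T ⊗ N
(`inflate_fold`), where lifting along a surjection is clear. Liftability is local for faithfully
flat coverings, so it passes to the generic point of SSp B (`property_generic`) and thus to A □ N.

If A □ ? preserves surjections, then, as A □ V* is the space of right colinear maps V → A for finite
dimensional V, colinear maps extend from subcomodules of finite dimensional comodules. Local
finiteness and Zorn's lemma extend 1 ↦ 1 to a colinear map on C. Averaging with the parity
automorphisms makes it even, and conjugation with antipodes changes right colinear to left colinear.

Division by 2 occurs in this averaging and in the comparison of faithful flatness for right
supermodules with faithful flatness for arbitrary left modules (`flipEquiv`). -/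

namespace Super
noncomputable section
open Coalgebra

/-! ## Convolution -/

section Convolution

variable {K C D E F : Type*} [Field K] [AddCommGroup C] [Module K C] [Coalgebra K C]
  [AddCommGroup D] [Module K D] [Coalgebra K D] [Ring E] [Algebra K E] [Ring F] [Algebra K F]

/-- The convolution product of two linear maps from a coalgebra to an algebra. -/
def cv (f g : C →ₗ[K] E) : C →ₗ[K] E :=
  LinearMap.mul' K E ∘ₗ TensorProduct.map f g ∘ₗ comul

variable (K C E) in
/-- The unit of the convolution product. -/
def cvOne : C →ₗ[K] E := Algebra.linearMap K E ∘ₗ counit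

theorem cv_apply (f g : C →ₗ[K] E) (c : C) :
    cv f g c = LinearMap.mul' K E (TensorProduct.map f g (comul c)) := rfl

theorem cv_repr (f g : C →ₗ[K] E) (c : C) {ι : Type*} (r : Coalgebra.Repr K c ι) :
    cv f g c = ∑ i ∈ r.index, f (r.left i) * g (r.right i) := by
  simp [cv_apply, ← r.eq]

theorem cvOne_apply (c : C) : cvOne K C E c = algebraMap K E (counit c) := rfl

/-- `cv` unfolds to the multiplication of `WithConv`, so the monoid laws of convolution are taken
from there. -/
theorem cv_assoc (f g h : C →ₗ[K] E) : cv (cv f g) h = cv f (cv g h) :=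
  congrArg WithConv.ofConv (mul_assoc (WithConv.toConv f) (WithConv.toConv g) (WithConv.toConv h))

@[simp] theorem cvOne_cv (f : C →ₗ[K] E) : cv (cvOne K C E) f = f :=
  congrArg WithConv.ofConv (one_mul (WithConv.toConv f))

@[simp] theorem cv_cvOne (f : C →ₗ[K] E) : cv f (cvOne K C E) = f :=
  congrArg WithConv.ofConv (mul_one (WithConv.toConv f))

/-- Uniqueness of inverses in the convolution monoid. Every formula for S below (for δ∘S, p∘S and
S∘S) is obtained by recognising two inverses of one element. -/
theorem cv_left_inv_eq_right_inv {f g h : C →ₗ[K] E} (h1 : cv f g = cvOne K C E)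
    (h2 : cv g h = cvOne K C E) : f = h := by
  rw [← cv_cvOne f, ← h2, ← cv_assoc, h1, cvOne_cv]

/-- Algebra morphisms act on convolution monoids by postcomposition; `cv_comp` is the dual statement
for coalgebra maps. -/
theorem comp_cv (φ : E →ₐ[K] F) (f g : C →ₗ[K] E) :
    φ.toLinearMap ∘ₗ cv f g = cv (φ.toLinearMap ∘ₗ f) (φ.toLinearMap ∘ₗ g) := by
  ext c
  simp [cv_repr _ _ c (ℛ K c)]

theorem comp_cvOne (φ : E →ₐ[K] F) : φ.toLinearMap ∘ₗ cvOne K C E = cvOne K C F := by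
  ext c
  simp [cvOne_apply]

theorem cv_comp (f g : C →ₗ[K] E) (ψ : D →ₗ[K] C)
    (hψ : comul ∘ₗ ψ = TensorProduct.map ψ ψ ∘ₗ comul) :
    cv f g ∘ₗ ψ = cv (f ∘ₗ ψ) (g ∘ₗ ψ) := by
  rw [cv, LinearMap.comp_assoc, LinearMap.comp_assoc, hψ, cv, TensorProduct.map_comp,
    LinearMap.comp_assoc]

theorem cvOne_comp (ψ : D →ₗ[K] C) (hψ : counit (R := K) ∘ₗ ψ = counit) :
    cvOne K C E ∘ₗ ψ = cvOne K D E := by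
  rw [cvOne, LinearMap.comp_assoc, hψ, cvOne]

/-- If `f * f' = 1`, then `f * (f' * g) = g`. -/
theorem cv_cancel_left {f f' : C →ₗ[K] E} (h : cv f f' = cvOne K C E) (g : C →ₗ[K] E) :
    cv f (cv f' g) = g := by
  rw [← cv_assoc, h, cvOne_cv]

end Convolution

/-! ## The graded tensor product -/

section GradedTensor

variable {K : Type u} [Field K]

namespace CommSuperalg

theorem one_mem (S : CommSuperalg K) : (1 : S) ∈ S.gr 0 := SetLike.GradedOne.one_mem

theorem mul_mem (S : CommSuperalg K) {i j : ZMod 2} {a b : S} (ha : a ∈ S.gr i) (hb : b ∈ S.gr j) :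
    a * b ∈ S.gr (i + j) := SetLike.mul_mem_graded ha hb

theorem isInternal (S : CommSuperalg K) : DirectSum.IsInternal S.gr :=
  DirectSum.Decomposition.isInternal S.gr

theorem decomp (S : CommSuperalg K) (a : S) : ∃ x ∈ S.gr 0, ∃ y ∈ S.gr 1, x + y = a :=
  internal_decomp S.isInternal a

/-- To prove an additive statement it suffices to treat homogeneous elements. -/
theorem homog_induction (S : CommSuperalg K) {P : S → Prop} (hadd : ∀ a b, P a → P b → P (a + b))
    (h : ∀ i, ∀ a ∈ S.gr i, P a) (a : S) : P a := by
  obtain ⟨x, hx, y, hy, rfl⟩ := S.decomp a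
  exact hadd _ _ (h 0 x hx) (h 1 y hy)

/-- The graded tensor product of two commutative superalgebras, as an algebra. -/
abbrev gt (S T : CommSuperalg K) : Type u := GradedTensorProduct K S.gr T.gr

variable (S T : CommSuperalg K)

/-- `s ↦ s ⊗ 1`. -/
def inl : S →ₐ[K] gt S T := GradedTensorProduct.includeLeft S.gr T.gr

/-- `t ↦ 1 ⊗ t`. -/
def inr : T →ₐ[K] gt S T := GradedTensorProduct.includeRight S.gr T.gr

/-- The identification of `S ⊗ T` with the underlying space of the graded tensor product. -/
def gtOf : S.carrier ⊗[K] T.carrier ≃ₗ[K] gt S T := GradedTensorProduct.of K S.gr T.gr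

variable {S T}

theorem inl_apply (s : S) : inl S T s = gtOf S T (s ⊗ₜ 1) := rfl

theorem inr_apply (t : T) : inr S T t = gtOf S T (1 ⊗ₜ t) := rfl

theorem inl_mul_inr (s : S) (t : T) : inl S T s * inr S T t = gtOf S T (s ⊗ₜ t) :=
  GradedTensorProduct.tmul_one_mul_one_tmul (R := K) S.gr T.gr s t

theorem tmul_mul_tmul {j k : ZMod 2} (a : S) {b : T} (hb : b ∈ T.gr j) {c : S} (hc : c ∈ S.gr k)
    (d : T) : gtOf S T (a ⊗ₜ b) * gtOf S T (c ⊗ₜ d) =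
      (-1 : ℤˣ) ^ (j * k) • gtOf S T ((a * c) ⊗ₜ (b * d)) :=
  GradedTensorProduct.tmul_coe_mul_coe_tmul (R := K) S.gr T.gr a ⟨b, hb⟩ ⟨c, hc⟩ d

theorem inr_mul_inl {j k : ZMod 2} {t : T} (ht : t ∈ T.gr j) {s : S} (hs : s ∈ S.gr k) :
    inr S T t * inl S T s = (-1 : ℤˣ) ^ (j * k) • (inl S T s * inr S T t) := by
  rw [inl_mul_inr, inr_apply, inl_apply, tmul_mul_tmul _ ht hs, one_mul, mul_one]

/-- Pure tensors are written as products of the two inclusions, so that the Koszul sign enters only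
through `inr_mul_inl`. -/
theorem gt_induction {P : gt S T → Prop} (hadd : ∀ x y, P x → P y → P (x + y))
    (h : ∀ (i : ZMod 2) (s : S) (_ : s ∈ S.gr i) (j : ZMod 2) (t : T) (_ : t ∈ T.gr j),
      P (inl S T s * inr S T t)) (x : gt S T) : P x := by
  change P (gtOf S T x)
  induction (show S.carrier ⊗[K] T.carrier from x) with
  | zero => simpa using h 0 0 (zero_mem _) 0 0 (zero_mem _)
  | add x y hx hy => rw [map_add]; exact hadd _ _ hx hy
  | tmul s t =>
    rw [← inl_mul_inr]
    refine S.homog_induction (P := fun s => P (inl S T s * inr S T t))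
      (fun a b ha hb => by rw [map_add, add_mul]; exact hadd _ _ ha hb) (fun i s hs => ?_) s
    refine T.homog_induction (P := fun t => P (inl S T s * inr S T t))
      (fun a b ha hb => by rw [map_add, mul_add]; exact hadd _ _ ha hb) (fun j t ht => ?_) t
    exact h i s hs j t ht

/-- The morphism `S ⊗ T → E` with components `f` and `g`, for a commutative superalgebra `E`. -/
def gtLift {E : CommSuperalg K} (f : GradedAlgHom K S.gr E.gr) (g : GradedAlgHom K T.gr E.gr) :
    gt S T →ₐ[K] E :=
  GradedTensorProduct.lift S.gr T.gr f.toAlgHom g.toAlgHom (fun i j a b => by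
    rw [mul_comm j i]
    exact E.supercomm i j _ (f.map_mem a.2) _ (g.map_mem b.2))

theorem gtLift_gtOf {E : CommSuperalg K} (f : GradedAlgHom K S.gr E.gr)
    (g : GradedAlgHom K T.gr E.gr) (x : S.carrier ⊗[K] T.carrier) :
    gtLift f g (gtOf S T x) = LinearMap.mul' K E (TensorProduct.map f.toAlgHom.toLinearMap
      g.toAlgHom.toLinearMap x) := rfl

theorem gtLift_inl {E : CommSuperalg K} (f : GradedAlgHom K S.gr E.gr)
    (g : GradedAlgHom K T.gr E.gr) (s : S) : gtLift f g (inl S T s) = f s := by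
  rw [inl_apply, gtLift_gtOf]
  simp

theorem gtLift_inr {E : CommSuperalg K} (f : GradedAlgHom K S.gr E.gr)
    (g : GradedAlgHom K T.gr E.gr) (t : T) : gtLift f g (inr S T t) = g t := by
  rw [inr_apply, gtLift_gtOf]
  simp

end CommSuperalg

end GradedTensor

/-! ## Antipodes -/

namespace AffineSupergroup

open CommSuperalg

variable {K : Type u} [Field K] (G : AffineSupergroup K)

/-- The graded tensor square of `K[G]`. -/
abbrev sq : Type u := gt G.toCommSuperalg G.toCommSuperalg

theorem comulAlg_apply (a : G) :
    G.comulAlg a = gtOf G.toCommSuperalg G.toCommSuperalg (comul (R := K) a) := rfl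

/-- Since δ(a) = ∑ (a_1 ⊗ 1)(1 ⊗ a_2), the comultiplication is itself a convolution product.
Identities between Hopf maps thereby become computations in a convolution monoid, free of Sweedler
sums and signs. -/
theorem comulAlg_eq : G.comulAlg.toLinearMap =
    cv (inl G.toCommSuperalg G.toCommSuperalg).toLinearMap
      (inr G.toCommSuperalg G.toCommSuperalg).toLinearMap := by
  ext a
  rw [cv_apply, AlgHom.toLinearMap_apply, comulAlg_apply]
  induction comul (R := K) a with
  | zero => simp
  | add x y hx hy => simp only [map_add, hx, hy]
  | tmul x y =>
    simpa using (inl_mul_inr (S := G.toCommSuperalg) (T := G.toCommSuperalg) x y).symm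

theorem cv_antipode_id : cv G.antipode LinearMap.id = cvOne K G.carrier G.carrier :=
  G.mul_antipode_left

theorem cv_id_antipode : cv LinearMap.id G.antipode = cvOne K G.carrier G.carrier :=
  G.mul_antipode_right

/-- An algebra morphism is invertible for convolution, with inverse its composite with S: push
forward the equation id * S = 1. The target need not be commutative. -/
theorem cv_comp_antipode {E : Type*} [Ring E] [Algebra K E] (φ : G.carrier →ₐ[K] E) :
    cv φ.toLinearMap (φ.toLinearMap ∘ₗ G.antipode) = cvOne K G.carrier E := by
  have h := comp_cv φ LinearMap.id G.antipode
  rw [cv_id_antipode, comp_cvOne] at h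
  exact h.symm

theorem cv_antipode_comp {E : Type*} [Ring E] [Algebra K E] (φ : G.carrier →ₐ[K] E) :
    cv (φ.toLinearMap ∘ₗ G.antipode) φ.toLinearMap = cvOne K G.carrier E := by
  have h := comp_cv φ G.antipode LinearMap.id
  rw [cv_antipode_id, comp_cvOne] at h
  exact h.symm

/-- The counit as an algebra morphism. -/
def counitAlg : G.carrier →ₐ[K] K := AlgHom.ofLinearMap counit G.counit_one G.counit_mul

/-- `a ⊗ b ↦ a ε(b)`. -/
def idCounit : G.sq →ₐ[K] G.carrier :=
  GradedTensorProduct.lift G.gr G.gr (AlgHom.id K _) ((Algebra.ofId K G.carrier).comp G.counitAlg)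
    (fun i j a b => by
      -- The counit kills odd elements, so both sides vanish for odd `b`; for even `b` the sign is
      -- trivial.
      rcases zmod2_cases j with rfl | rfl
      · rw [zero_mul, uzpow_zero, one_smul]
        exact (Algebra.commutes _ _).symm
      · have h : G.counitAlg (b : G.carrier) = 0 := G.counit_mem _ b.2
        simp [h])

theorem idCounit_inl (a : G) : G.idCounit (inl _ _ a) = a := by
  rw [inl_apply]
  change LinearMap.mul' K _ (TensorProduct.map _ _ (a ⊗ₜ 1)) = _
  simp

theorem idCounit_inr (a : G) : G.idCounit (inr _ _ a) = algebraMap K _ (counit a) := by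
  rw [inr_apply]
  change LinearMap.mul' K _ (TensorProduct.map _ _ (1 ⊗ₜ a)) = _
  simp; rfl

end AffineSupergroup

end
end Super

namespace Super
noncomputable section
open Coalgebra

/-! ## The tensor product of commutative superalgebras -/

namespace CommSuperalg

variable {K : Type u} [Field K] (S T : CommSuperalg K)

/-- The grading of the graded tensor product. -/
def gtGr (i : ZMod 2) : Submodule K (gt S T) :=
  (tensorGr S.gr T.gr i).map (gtOf S T).toLinearMap

variable {S T}

theorem gtOf_mem {i : ZMod 2} {x : S.carrier ⊗[K] T.carrier} (hx : x ∈ tensorGr S.gr T.gr i) :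
    gtOf S T x ∈ gtGr S T i := ⟨x, hx, rfl⟩

theorem gtGr_induction {i : ZMod 2} {P : gt S T → Prop} (h0 : P 0)
    (hadd : ∀ x y, P x → P y → P (x + y)) (hsmul : ∀ (c : K) x, P x → P (c • x))
    (h : ∀ j k, j + k = i → ∀ s ∈ S.gr j, ∀ t ∈ T.gr k, P (inl S T s * inr S T t))
    (x : gt S T) (hx : x ∈ gtGr S T i) : P x := by
  obtain ⟨x, hx, rfl⟩ := hx
  change P (gtOf S T x)
  induction hx using Submodule.span_induction with
  | mem x hx =>
    obtain ⟨j, k, hjk, v, hv, w, hw, rfl⟩ := hx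
    rw [← inl_mul_inr]
    exact h j k hjk v hv w hw
  | zero => rwa [map_zero]
  | add x y _ _ hx hy => rw [map_add]; exact hadd _ _ hx hy
  | smul a x _ hx => rw [map_smul]; exact hsmul _ _ hx

theorem inl_mem {i : ZMod 2} {s : S} (hs : s ∈ S.gr i) : inl S T s ∈ gtGr S T i :=
  gtOf_mem (tmul_mem_tensorGr hs T.one_mem (add_zero i))

theorem inr_mem {i : ZMod 2} {t : T} (ht : t ∈ T.gr i) : inr S T t ∈ gtGr S T i :=
  gtOf_mem (tmul_mem_tensorGr S.one_mem ht (zero_add i))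

theorem inl_mul_inr_mem {i j k : ZMod 2} (h : j + k = i) {s : S} (hs : s ∈ S.gr j) {t : T}
    (ht : t ∈ T.gr k) : inl S T s * inr S T t ∈ gtGr S T i := by
  rw [inl_mul_inr]
  exact gtOf_mem (tmul_mem_tensorGr hs ht h)

theorem inl_mul_inr_mul {j k : ZMod 2} (s : S) {t : T} (ht : t ∈ T.gr j) {s' : S}
    (hs' : s' ∈ S.gr k) (t' : T) : (inl S T s * inr S T t) * (inl S T s' * inr S T t') =
      (-1 : ℤˣ) ^ (j * k) • (inl S T (s * s') * inr S T (t * t')) := by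
  rw [inl_mul_inr, inl_mul_inr, inl_mul_inr, tmul_mul_tmul _ ht hs']

theorem gtGr_mul_mem {i j : ZMod 2} (x : gt S T) (hx : x ∈ gtGr S T i) (y : gt S T)
    (hy : y ∈ gtGr S T j) : x * y ∈ gtGr S T (i + j) := by
  refine gtGr_induction (P := fun x => x * y ∈ gtGr S T (i + j)) ?_ (fun x x' hx hx' => ?_)
    (fun c x hx => ?_) (fun j1 k1 h1 s hs t ht => ?_) x hx
  · rw [zero_mul]; exact zero_mem _
  · rw [add_mul]; exact add_mem hx hx'
  · rw [smul_mul_assoc]; exact Submodule.smul_mem _ _ hx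
  refine gtGr_induction (P := fun y => inl S T s * inr S T t * y ∈ gtGr S T (i + j)) ?_
    (fun x x' hx hx' => ?_) (fun c x hx => ?_) (fun j2 k2 h2 s' hs' t' ht' => ?_) y hy
  · rw [mul_zero]; exact zero_mem _
  · rw [mul_add]; exact add_mem hx hx'
  · rw [mul_smul_comm]; exact Submodule.smul_mem _ _ hx
  rw [inl_mul_inr_mul s ht hs' t']
  have hm : inl S T (s * s') * inr S T (t * t') ∈ gtGr S T (i + j) :=
    inl_mul_inr_mem (by rw [← h1, ← h2]; ring) (S.mul_mem hs hs') (T.mul_mem ht ht')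
  rcases Int.units_eq_one_or ((-1 : ℤˣ) ^ (k1 * j2)) with h | h <;> rw [h]
  · rwa [one_smul]
  · rw [Units.neg_smul, one_smul]; exact neg_mem hm

theorem gtGr_supercomm {i j : ZMod 2} (x : gt S T) (hx : x ∈ gtGr S T i) (y : gt S T)
    (hy : y ∈ gtGr S T j) : x * y = (-1 : ℤˣ) ^ (i * j) • (y * x) := by
  refine gtGr_induction (P := fun x => x * y = (-1 : ℤˣ) ^ (i * j) • (y * x)) ?_
    (fun x x' hx hx' => ?_) (fun c x hx => ?_) (fun j1 k1 h1 s hs t ht => ?_) x hx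
  · rw [zero_mul, mul_zero, smul_zero]
  · rw [add_mul, mul_add, smul_add, hx, hx']
  · rw [smul_mul_assoc, mul_smul_comm, hx, smul_comm]
  refine gtGr_induction (P := fun y => inl S T s * inr S T t * y =
    (-1 : ℤˣ) ^ (i * j) • (y * (inl S T s * inr S T t))) ?_
    (fun x x' hx hx' => ?_) (fun c x hx => ?_) (fun j2 k2 h2 s' hs' t' ht' => ?_) y hy
  · rw [zero_mul, mul_zero, smul_zero]
  · rw [add_mul, mul_add, smul_add, hx, hx']
  · rw [smul_mul_assoc, mul_smul_comm, hx, smul_comm]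
  rw [inl_mul_inr_mul s ht hs' t', inl_mul_inr_mul s' ht' hs t]
  rw [S.supercomm _ _ s hs s' hs', T.supercomm _ _ t ht t' ht', ← h1, ← h2]
  -- Both sides are now multiples of the same tensor, and the sixteen choices of parities compare
  -- the signs.
  rcases zmod2_cases j1 with rfl | rfl <;> rcases zmod2_cases k1 with rfl | rfl <;>
  rcases zmod2_cases j2 with rfl | rfl <;> rcases zmod2_cases k2 with rfl | rfl <;>
  simp [CharTwo.add_self_eq_zero, Units.neg_smul]

theorem gtGr_internal (S T : CommSuperalg K) : DirectSum.IsInternal (gtGr S T) := by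
  have h := (internal_iff _).1 (tensorGr_internal S.isInternal T.isInternal)
  rw [internal_iff]
  exact h.map (Submodule.orderIsoMapComap (gtOf S T))

/-- A grading by subspaces that is internal, multiplicative and contains `1` in degree zero makes
an algebra graded. -/
abbrev gradedOfInternal {E : Type*} [Ring E] [Algebra K E] {gr : ZMod 2 → Submodule K E}
    (h : DirectSum.IsInternal gr) (h1 : (1 : E) ∈ gr 0)
    (hm : ∀ i j : ZMod 2, ∀ x ∈ gr i, ∀ y ∈ gr j, x * y ∈ gr (i + j)) : GradedAlgebra gr :=
  letI := h.chooseDecomposition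
  { one_mem := h1, mul_mem := fun i j x y hx hy => hm i j x hx y hy }

/-- The tensor product of two commutative superalgebras. -/
abbrev tensor (S T : CommSuperalg K) : CommSuperalg K where
  carrier := gt S T
  gr := gtGr S T
  graded := gradedOfInternal (gtGr_internal S T)
    (by rw [← map_one (inl S T)]; exact inl_mem S.one_mem)
    (fun _ _ x hx y hy => gtGr_mul_mem x hx y hy)
  supercomm _ _ x hx y hy := gtGr_supercomm x hx y hy

/-- An even algebra morphism, as an arrow of `SAlg_K`. -/
def homMk {S T : CommSuperalg K} (f : S.carrier →ₐ[K] T.carrier)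
    (hf : ∀ i, ∀ a ∈ S.gr i, f a ∈ T.gr i) : S ⟶ T :=
  ({ f with map_mem := fun {i a} h => hf i a h } : GradedAlgHom K S.gr T.gr)

/-- The algebra morphism underlying an arrow of `SAlg_K`. -/
def hom {S T : CommSuperalg K} (f : S ⟶ T) : S.carrier →ₐ[K] T.carrier := (alg f).toAlgHom

theorem hom_comp_apply {S T U : CommSuperalg K} (f : S ⟶ T) (g : T ⟶ U) (a : S) :
    hom (f ≫ g) a = hom g (hom f a) := rfl

theorem hom_mem {S T : CommSuperalg K} (f : S ⟶ T) {i : ZMod 2} {a : S} (ha : a ∈ S.gr i) :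
    hom f a ∈ T.gr i := (alg f).map_mem ha

theorem hom_ext {S T : CommSuperalg K} {f g : S ⟶ T} (h : ∀ a, hom f a = hom g a) : f = g :=
  DFunLike.ext (alg f) (alg g) h

/-- The first inclusion of the tensor product. -/
def tensorInl (S T : CommSuperalg K) : S ⟶ tensor S T := homMk (inl S T) fun _ _ h => inl_mem h

/-- The second inclusion of the tensor product. -/
def tensorInr (S T : CommSuperalg K) : T ⟶ tensor S T := homMk (inr S T) fun _ _ h => inr_mem h

/-- The morphism out of a tensor product with given components. -/
def gtDesc {S T E : CommSuperalg K} (f : S ⟶ E) (g : T ⟶ E) : gt S T →ₐ[K] E.carrier :=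
  gtLift (alg f) (alg g)

theorem gtDesc_inl {S T E : CommSuperalg K} (f : S ⟶ E) (g : T ⟶ E) (s : S) :
    gtDesc f g (inl S T s) = hom f s := gtLift_inl _ _ s

theorem gtDesc_inr {S T E : CommSuperalg K} (f : S ⟶ E) (g : T ⟶ E) (t : T) :
    gtDesc f g (inr S T t) = hom g t := gtLift_inr _ _ t

theorem gtDesc_gtOf {S T E : CommSuperalg K} (f : S ⟶ E) (g : T ⟶ E)
    (x : S.carrier ⊗[K] T.carrier) : gtDesc f g (gtOf S T x) =
      LinearMap.mul' K E (TensorProduct.map (hom f).toLinearMap (hom g).toLinearMap x) := rfl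

/-- Odd and even elements of a commutative superalgebra commute up to sign; the sign is trivial
for even elements. -/
theorem even_comm (S : CommSuperalg K) {a : S} (ha : a ∈ S.gr 0) (b : S) : a * b = b * a := by
  refine S.homog_induction (P := fun b => a * b = b * a)
    (fun x y hx hy => by rw [mul_add, add_mul, hx, hy]) (fun i b hb => ?_) b
  rw [S.supercomm 0 i a ha b hb, zero_mul, uzpow_zero, one_smul]

end CommSuperalg

/-! ## The antipode is an involutive morphism of superalgebras -/

namespace AffineSupergroup

open CommSuperalg

variable {K : Type u} [Field K] (G : AffineSupergroup K)

/-- The comultiplication as an arrow of `SAlg_K`. -/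
def comulHom : G.toCommSuperalg ⟶ tensor G.toCommSuperalg G.toCommSuperalg :=
  homMk G.comulAlg fun i a ha => gtOf_mem (G.comul_mem i a ha)

/-- `a ⊗ b ↦ (a ⊗ 1) δ(b)`. -/
def shear : G.sq →ₐ[K] G.sq := gtDesc (tensorInl G.toCommSuperalg G.toCommSuperalg) G.comulHom

/-- `a ⊗ b ↦ a S(b_1) ⊗ b_2`. -/
def shearInv : G.sq →ₗ[K] G.sq :=
  TensorProduct.lift ((LinearMap.mul K G.sq).compl₁₂ (inl _ _).toLinearMap
    (cv ((inl _ _).toLinearMap ∘ₗ G.antipode) (inr _ _).toLinearMap)) ∘ₗ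
    (gtOf G.toCommSuperalg G.toCommSuperalg).symm.toLinearMap

theorem shear_apply (a b : G) : G.shear (inl _ _ a * inr _ _ b) = inl _ _ a * G.comulAlg b := by
  rw [map_mul]
  exact congrArg₂ _ (gtDesc_inl _ _ a) (gtDesc_inr _ _ b)

theorem shearInv_apply (a b : G) : G.shearInv (inl _ _ a * inr _ _ b) =
    inl _ _ a * cv ((inl _ _).toLinearMap ∘ₗ G.antipode) (inr _ _).toLinearMap b := by
  rw [inl_mul_inr]
  rfl

theorem inl_mul_induction {M : Type*} [AddCommGroup M] [Module K M] {f g : G.sq →ₗ[K] M}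
    (h : ∀ a b : G, f (inl _ _ a * inr _ _ b) = g (inl _ _ a * inr _ _ b)) : f = g := by
  refine LinearMap.ext fun x => ?_
  induction x using gt_induction with
  | hadd x y hx hy => rw [map_add, map_add, hx, hy]
  | h i s hs j t ht => exact h s t

/-- The map b ↦ ∑ S(b_1) ⊗ b_2 is the convolution (inl∘S) * inr. The shear carries it to (inl∘S) *
inl * inr, which collapses to inr. -/
theorem shear_shearInv (x : G.sq) : G.shear (G.shearInv x) = x := by
  refine LinearMap.congr_fun (f := G.shear.toLinearMap ∘ₗ G.shearInv) (g := LinearMap.id)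
    (G.inl_mul_induction fun a b => ?_) x
  have h1 : G.shear.toLinearMap ∘ₗ (inl _ _).toLinearMap = (inl _ _).toLinearMap :=
    LinearMap.ext fun a => gtDesc_inl _ _ a
  have h2 : G.shear.toLinearMap ∘ₗ (inr _ _).toLinearMap = G.comulAlg.toLinearMap :=
    LinearMap.ext fun a => gtDesc_inr _ _ a
  have h : G.shear.toLinearMap ∘ₗ
      cv ((inl _ _).toLinearMap ∘ₗ G.antipode) (inr _ _).toLinearMap = (inr _ _).toLinearMap := by
    rw [comp_cv, ← LinearMap.comp_assoc, h1, h2, comulAlg_eq,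
      cv_cancel_left (G.cv_antipode_comp (inl _ _))]
  change G.shear (G.shearInv _) = _
  rw [shearInv_apply, map_mul]
  refine congrArg₂ _ (LinearMap.congr_fun h1 a) (LinearMap.congr_fun h b)

/-- `shearInv` is also a left inverse: it is linear over the left factor, and it maps δ(b) to inl *
(inl∘S) * inr = inr evaluated at b. -/
theorem shear_injective : Function.Injective G.shear := by
  have h : G.shearInv ∘ₗ G.shear.toLinearMap = LinearMap.id := by
    refine G.inl_mul_induction fun a b => ?_
    change G.shearInv (G.shear _) = _
    rw [shear_apply]
    have h3 : ∀ (a : G) (x : G.sq), G.shearInv (inl _ _ a * x) = inl _ _ a * G.shearInv x := by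
      intro a x
      induction x using gt_induction with
      | hadd x y hx hy => simp only [mul_add, map_add, hx, hy]
      | h i s hs j t ht =>
        rw [← mul_assoc, ← map_mul, shearInv_apply, shearInv_apply, map_mul, mul_assoc]
    have h4 : G.shearInv ∘ₗ G.comulAlg.toLinearMap = (inr _ _).toLinearMap := by
      have h5 : G.shearInv ∘ₗ G.comulAlg.toLinearMap = cv (inl _ _).toLinearMap
          (cv ((inl _ _).toLinearMap ∘ₗ G.antipode) (inr _ _).toLinearMap) := by
        refine LinearMap.ext fun a => ?_
        rw [cv_apply]
        change G.shearInv (gtOf _ _ (comul (R := K) a)) = _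
        induction comul (R := K) a with
        | zero => simp
        | add x y hx hy => simp only [map_add, hx, hy]
        | tmul x y => rw [← inl_mul_inr, shearInv_apply]; rfl
      rw [h5, cv_cancel_left (G.cv_comp_antipode (inl _ _))]
    rw [h3]
    exact congrArg _ (LinearMap.congr_fun h4 b)
  exact Function.LeftInverse.injective (LinearMap.congr_fun h)

/-- This presents S as the composite of `inr`, the inverse of the bijective algebra map `shear`, and
an algebra map. Multiplicativity of S follows without any computation with signs. -/
theorem antipode_eq (b : G) : G.idCounit (G.shearInv (inr _ _ b)) = G.antipode b := by
  have h := G.shearInv_apply 1 b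
  rw [map_one, one_mul, one_mul] at h
  rw [h]
  change (G.idCounit.toLinearMap ∘ₗ _) b = _
  rw [comp_cv]
  have h1 : G.idCounit.toLinearMap ∘ₗ (inr G.toCommSuperalg G.toCommSuperalg).toLinearMap =
      cvOne K _ _ := LinearMap.ext fun a => G.idCounit_inr a
  have h2 : G.idCounit.toLinearMap ∘ₗ (inl G.toCommSuperalg G.toCommSuperalg).toLinearMap ∘ₗ
      G.antipode = G.antipode := LinearMap.ext fun a => G.idCounit_inl _
  rw [h1, h2, cv_cvOne]

/-- The antipode as an algebra morphism. -/
def antipodeAlg : G.carrier →ₐ[K] G.carrier :=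
  AlgHom.ofLinearMap G.antipode
    (by
      have h : G.shearInv 1 = 1 := G.shear_injective (by rw [shear_shearInv, map_one])
      rw [← antipode_eq, map_one, h, map_one])
    (fun a b => by
      -- A right inverse of an injective multiplicative map is multiplicative.
      have h : ∀ x y, G.shearInv (x * y) = G.shearInv x * G.shearInv y := fun x y =>
        G.shear_injective (by
          rw [shear_shearInv, map_mul G.shear, shear_shearInv, shear_shearInv])
      rw [← antipode_eq, map_mul, h, map_mul, antipode_eq, antipode_eq])

theorem antipode_mul (a b : G) : G.antipode (a * b) = G.antipode a * G.antipode b :=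
  map_mul G.antipodeAlg a b

theorem antipode_one : G.antipode 1 = 1 := map_one G.antipodeAlg

/-- As S is an algebra map, S∘S is a left convolution inverse of S, while the identity is a right
one. -/
theorem antipode_comp_antipode : G.antipode ∘ₗ G.antipode = LinearMap.id :=
  (cv_left_inv_eq_right_inv (G.cv_antipode_comp G.antipodeAlg) G.cv_antipode_id).trans rfl |>.trans
    rfl

end AffineSupergroup

end
end Super

namespace Super
noncomputable section
open Coalgebra

/-! ### Points of G and H, inverses, and cosets. -/

namespace AffineSupergroup

open CommSuperalg

variable {K : Type u} [Field K] (G : AffineSupergroup K)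

/-- `δ(S(a)) = ∑ (1 ⊗ S(a_1)) (S(a_2) ⊗ 1)`. -/
theorem comulAlg_antipode : G.comulAlg.toLinearMap ∘ₗ G.antipode =
    cv ((inr G.toCommSuperalg G.toCommSuperalg).toLinearMap ∘ₗ G.antipode)
      ((inl G.toCommSuperalg G.toCommSuperalg).toLinearMap ∘ₗ G.antipode) := by
  -- δ∘S is a left inverse of δ = inl * inr, and the product of the inverses in the opposite order
  -- is a right inverse.
  refine cv_left_inv_eq_right_inv (G.cv_antipode_comp G.comulAlg) ?_
  rw [comulAlg_eq, cv_assoc, cv_cancel_left (G.cv_comp_antipode (inr _ _)),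
    G.cv_comp_antipode (inl _ _)]

/-- The antipode as an arrow of `SAlg_K`. -/
def antipodeHom : G.toCommSuperalg ⟶ G.toCommSuperalg := homMk G.antipodeAlg G.antipode_mem

/-- Points multiply by convolution, so the group laws of G(S) are instances of the convolution
identities. -/
theorem hom_mulPoints {S : CommSuperalg K} (g h : G.Points S) :
    (hom (G.mulPoints g h)).toLinearMap = cv (hom g).toLinearMap (hom h).toLinearMap := rfl

theorem points_ext {S : CommSuperalg K} {g h : G.Points S}
    (e : (hom g).toLinearMap = (hom h).toLinearMap) : g = h :=
  hom_ext fun a => LinearMap.congr_fun e a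

theorem mulPoints_assoc {S : CommSuperalg K} (g h k : G.Points S) :
    G.mulPoints (G.mulPoints g h) k = G.mulPoints g (G.mulPoints h k) :=
  G.points_ext (cv_assoc _ _ _)

/-- The inverse of a point of `G`. -/
def invPoint {S : CommSuperalg K} (g : G.Points S) : G.Points S := G.antipodeHom ≫ g

/-- The unit of `G(S)`. -/
def onePoint (S : CommSuperalg K) : G.Points S :=
  homMk ((Algebra.ofId K S.carrier).comp G.counitAlg) fun i a ha => by
    rcases zmod2_cases i with rfl | rfl
    · change algebraMap K S.carrier _ ∈ _
      rw [Algebra.algebraMap_eq_smul_one]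
      exact Submodule.smul_mem _ _ S.one_mem
    · change algebraMap K S.carrier (counit a) ∈ _
      rw [G.counit_mem a ha, map_zero]
      exact zero_mem _

theorem mulPoints_one {S : CommSuperalg K} (g : G.Points S) : G.mulPoints g (G.onePoint S) = g :=
  G.points_ext (cv_cvOne _)

theorem one_mulPoints {S : CommSuperalg K} (g : G.Points S) : G.mulPoints (G.onePoint S) g = g :=
  G.points_ext (cvOne_cv _)

theorem mulPoints_inv {S : CommSuperalg K} (g : G.Points S) :
    G.mulPoints g (G.invPoint g) = G.onePoint S :=
  G.points_ext (G.cv_comp_antipode _)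

end AffineSupergroup

namespace ClosedSupersubgroup

open CommSuperalg

variable {K : Type u} [Field K] {G : AffineSupergroup K} (H : ClosedSupersubgroup G)

theorem p_surjective : Function.Surjective H.p := H.surjective

theorem p_one : H.p 1 = 1 := map_one (hom H.proj)

theorem p_mul (a b : G) : H.p (a * b) = H.p a * H.p b := map_mul (hom H.proj) a b

theorem comul_comp_p : comul ∘ₗ H.p = TensorProduct.map H.p H.p ∘ₗ comul :=
  LinearMap.ext H.p_comul

theorem counit_comp_p : counit (R := K) ∘ₗ H.p = counit := LinearMap.ext H.p_counit

/-- Compatibility with antipodes is not part of the data of a closed supersubgroup. It follows since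
both composites are convolution inverses of p. -/
theorem p_antipode : H.p ∘ₗ G.antipode = H.antipode ∘ₗ H.p := by
  refine cv_left_inv_eq_right_inv (G.cv_antipode_comp (hom H.proj)) ?_
  have h : cv LinearMap.id H.antipode ∘ₗ H.p = cvOne K H.carrier H.carrier ∘ₗ H.p :=
    congrArg (· ∘ₗ H.p) H.toAffineSupergroup.cv_id_antipode
  rw [cv_comp _ _ _ H.comul_comp_p, cvOne_comp _ H.counit_comp_p] at h
  exact h

theorem p_antipode_apply (a : G) : H.p (G.antipode a) = H.antipode (H.p a) :=
  LinearMap.congr_fun H.p_antipode a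

/-- A morphism killing the kernel of `K[G] → K[H]` factors through `K[H]`. -/
theorem exists_point {S : CommSuperalg K} (k : G.Points S) (hk : ∀ a, H.p a = 0 → hom k a = 0) :
    ∃ h : H.toAffineSupergroup.Points S, k = H.proj ≫ h := by
  have key : ∀ a b, H.p a = H.p b → hom k a = hom k b := fun a b hab => by
    rw [← sub_eq_zero, ← map_sub]
    exact hk _ (by rw [map_sub, hab, sub_self])
  let s := Function.surjInv H.p_surjective
  have hs : ∀ c, H.p (s c) = c := Function.surjInv_eq H.p_surjective
  refine ⟨homMk (AlgHom.ofLinearMap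
    { toFun := fun c => hom k (s c)
      map_add' := fun c d => by rw [← map_add]; exact key _ _ (by rw [map_add, hs, hs, hs])
      map_smul' := fun c d => by
        rw [RingHom.id_apply, ← map_smul]; exact key _ _ (by rw [map_smul, hs, hs]) }
    (by
      change hom k (s 1) = 1
      rw [← map_one (hom k)]; exact key _ _ (by rw [hs, p_one]))
    (fun c d => by
      change hom k (s (c * d)) = hom k (s c) * hom k (s d)
      rw [← map_mul]; exact key _ _ (by rw [hs, p_mul, hs, hs]))) (fun i c hc => ?_), ?_⟩
  -- The set-theoretic section need not respect degrees. For homogeneous `c` the component of `s c`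
  -- of the other degree lies in the kernel of p, hence is killed by k.
  · change hom k (s c) ∈ _
    obtain ⟨x, hx, y, hy, hxy⟩ := G.decomp (s c)
    have hx' := H.p_even 0 x hx
    have hy' := H.p_even 1 y hy
    have hc' : H.p x + H.p y = c := by rw [← map_add, hxy, hs]
    rcases zmod2_cases i with rfl | rfl
    · have : H.p y = 0 := internal_disj H.isInternal (i := 0) (j := 1) (by decide)
        (by rw [eq_sub_of_add_eq' hc']; exact sub_mem hc hx') hy'
      rw [← hxy, map_add, hk y this, add_zero]
      exact hom_mem k hx
    · have : H.p x = 0 := internal_disj H.isInternal (i := 0) (j := 1) (by decide) hx'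
        (by rw [eq_sub_of_add_eq hc']; exact sub_mem hc hy')
      rw [← hxy, map_add, hk x this, zero_add]
      exact hom_mem k hy
  · refine hom_ext fun a => key _ _ ?_
    exact (hs _).symm

/-- The point g⁻¹g' comes from H(S) exactly when it kills the kernel of p. Membership in one coset
is thus a system of equations in S, which can be verified after a faithfully flat extension. -/
theorem sameCoset_iff {S : CommSuperalg K} (g g' : G.Points S) : H.SameCoset g g' ↔
    ∀ a, H.p a = 0 → cv ((hom g).toLinearMap ∘ₗ G.antipode) (hom g').toLinearMap a = 0 := by
  constructor
  · rintro ⟨h, rfl⟩ a ha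
    rw [G.hom_mulPoints, cv_cancel_left (G.cv_antipode_comp _)]
    change hom h (H.p a) = 0
    rw [ha, map_zero]
  · intro h0
    obtain ⟨h, hh⟩ := H.exists_point (G.mulPoints (G.invPoint g) g') h0
    refine ⟨h, ?_⟩
    rw [← hh, ← G.mulPoints_assoc, G.mulPoints_inv, G.one_mulPoints]

theorem proj_mulPoints {S : CommSuperalg K} (h h' : H.toAffineSupergroup.Points S) :
    G.mulPoints (H.proj ≫ h) (H.proj ≫ h') = H.proj ≫ H.toAffineSupergroup.mulPoints h h' := by
  refine G.points_ext ?_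
  exact (cv_comp (hom h).toLinearMap (hom h').toLinearMap H.p H.comul_comp_p).symm

theorem proj_onePoint (S : CommSuperalg K) :
    G.onePoint S = H.proj ≫ H.toAffineSupergroup.onePoint S :=
  G.points_ext (cvOne_comp _ H.counit_comp_p).symm

theorem sameCoset_refl {S : CommSuperalg K} (g : G.Points S) : H.SameCoset g g :=
  ⟨H.toAffineSupergroup.onePoint S, by rw [← H.proj_onePoint, G.mulPoints_one]⟩

theorem sameCoset_symm {S : CommSuperalg K} {g g' : G.Points S} (h : H.SameCoset g g') :
    H.SameCoset g' g := by
  obtain ⟨h, rfl⟩ := h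
  refine ⟨H.toAffineSupergroup.invPoint h, ?_⟩
  rw [G.mulPoints_assoc, H.proj_mulPoints, H.toAffineSupergroup.mulPoints_inv, ← H.proj_onePoint,
    G.mulPoints_one]

theorem sameCoset_trans {S : CommSuperalg K} {g g' g'' : G.Points S} (h : H.SameCoset g g')
    (h' : H.SameCoset g' g'') : H.SameCoset g g'' := by
  obtain ⟨h, rfl⟩ := h
  obtain ⟨h', rfl⟩ := h'
  refine ⟨H.toAffineSupergroup.mulPoints h h', ?_⟩
  rw [← H.proj_mulPoints, G.mulPoints_assoc]

/-- The graded tensor product `K[G] ⊗ K[H]`. -/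
abbrev gh : Type u := gt G.toCommSuperalg H.toCommSuperalg

/-- The right coaction as the convolution product inl * (inr∘p), in analogy with `comulAlg_eq`;
later formulas are solved for one of the factors. -/
theorem rightCoactAlg_eq : H.rightCoactAlg.toLinearMap =
    cv (inl G.toCommSuperalg H.toCommSuperalg).toLinearMap
      ((inr G.toCommSuperalg H.toCommSuperalg).toLinearMap ∘ₗ H.p) := by
  refine LinearMap.ext fun a => ?_
  rw [AlgHom.toLinearMap_apply, rightCoactAlg_apply, cv_apply]
  change gtOf _ _ (H.p.lTensor G.carrier (comul (R := K) a)) = _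
  induction comul (R := K) a with
  | zero => simp
  | add x y hx hy => simp only [map_add, hx, hy]
  | tmul x y =>
    simpa using (inl_mul_inr (S := G.toCommSuperalg) (T := H.toCommSuperalg) x (H.p y)).symm

theorem rightCoactAlg_eq_gtOf (a : G) :
    H.rightCoactAlg a = gtOf G.toCommSuperalg H.toCommSuperalg (H.rightCoact a) :=
  H.rightCoactAlg_apply a

end ClosedSupersubgroup

end
end Super

namespace Super
noncomputable section
set_option linter.unusedSectionVars false
open Coalgebra

/-! ## Tensor products over noncommutative algebras -/

section Balanced

variable {K R S S' S'' : Type u} [Field K] [Ring R] [Algebra K R] [Ring S] [Algebra K S]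
  [Ring S'] [Algebra K S'] [Ring S''] [Algebra K S'']

/-- An algebra `E` over `R` as a left `R`-module. -/
def Via (_ψ : R →ₐ[K] S) : Type u := S

instance (ψ : R →ₐ[K] S) : AddCommGroup (Via ψ) := inferInstanceAs (AddCommGroup S)
instance (ψ : R →ₐ[K] S) : Module K (Via ψ) := inferInstanceAs (Module K S)
instance (ψ : R →ₐ[K] S) : Module R (Via ψ) := Module.compHom S (ψ : R →+* S)

/-- The identification of `E` with the underlying space of the `R`-module `E`. -/
def toVia (ψ : R →ₐ[K] S) : S ≃ₗ[K] Via ψ := LinearEquiv.refl K S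

theorem smul_toVia (ψ : R →ₐ[K] S) (r : R) (s : S) : r • toVia ψ s = toVia ψ (ψ r * s) := rfl

instance (ψ : R →ₐ[K] S) : IsScalarTower K R (Via ψ) :=
  ⟨fun c r s => by
    change ψ (c • r) * (show S from s) = c • (ψ r * (show S from s))
    rw [map_smul, smul_mul_assoc]⟩

variable (φ : R →ₐ[K] S) (M : Type u) [AddCommGroup M] [Module K M] [Module R M]
  [IsScalarTower K R M] {M' M'' : Type u} [AddCommGroup M'] [Module K M'] [Module R M']
  [IsScalarTower K R M'] [AddCommGroup M''] [Module K M''] [Module R M'']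
  [IsScalarTower K R M'']

/-- The relations `φ(r) ⊗ m = 1 ⊗ rm` in `S ⊗_K M`. -/
def balRel : Submodule S (S ⊗[K] M) :=
  Submodule.span S {t | ∃ (r : R) (m : M), t = φ r ⊗ₜ[K] m - (1 : S) ⊗ₜ[K] (r • m)}

/-- The tensor product `S ⊗_R M`, for a morphism of algebras `R → S` and a left `R`-module `M`. -/
def Bal : Type u := (S ⊗[K] M) ⧸ balRel φ M

instance : AddCommGroup (Bal φ M) := inferInstanceAs (AddCommGroup ((S ⊗[K] M) ⧸ balRel φ M))
instance : Module S (Bal φ M) := inferInstanceAs (Module S ((S ⊗[K] M) ⧸ balRel φ M))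
instance : Module K (Bal φ M) := inferInstanceAs (Module K ((S ⊗[K] M) ⧸ balRel φ M))
instance : IsScalarTower K S (Bal φ M) :=
  inferInstanceAs (IsScalarTower K S ((S ⊗[K] M) ⧸ balRel φ M))

namespace Bal

/-- The projection `S ⊗_K M → S ⊗_R M`. -/
def mk : S ⊗[K] M →ₗ[S] Bal φ M := (balRel φ M).mkQ

variable {M}

/-- A pure tensor in `S ⊗_R M`. -/
def tmul (s : S) (m : M) : Bal φ M := mk φ M (s ⊗ₜ m)

theorem mk_tmul (s : S) (m : M) : mk φ M (s ⊗ₜ m) = tmul φ s m := rfl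

theorem mk_eq_zero {t : S ⊗[K] M} : mk φ M t = 0 ↔ t ∈ balRel φ M :=
  Submodule.Quotient.mk_eq_zero _

theorem mk_surjective : Function.Surjective (mk φ M) := Submodule.mkQ_surjective _

theorem add_tmul (s s' : S) (m : M) : tmul φ (s + s') m = tmul φ s m + tmul φ s' m := by
  rw [tmul, TensorProduct.add_tmul, map_add]; rfl

theorem tmul_add (s : S) (m m' : M) : tmul φ s (m + m') = tmul φ s m + tmul φ s m' := by
  rw [tmul, TensorProduct.tmul_add, map_add]; rfl

theorem smul_tmul (s s' : S) (m : M) : s • tmul φ s' m = tmul φ (s * s') m := by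
  rw [tmul, ← map_smul]; rfl

theorem tmul_zero (s : S) : tmul φ s (0 : M) = 0 := by
  rw [tmul, TensorProduct.tmul_zero, map_zero]

theorem zero_tmul (m : M) : tmul φ (0 : S) m = 0 := by
  rw [tmul, TensorProduct.zero_tmul, map_zero]

theorem tmul_smul_one (r : R) (m : M) : tmul φ 1 (r • m) = tmul φ (φ r) m := by
  refine (sub_eq_zero.1 ?_).symm
  rw [tmul, tmul, ← map_sub, mk_eq_zero]
  exact Submodule.subset_span ⟨r, m, rfl⟩

theorem tmul_smul (s : S) (r : R) (m : M) : tmul φ s (r • m) = tmul φ (s * φ r) m := by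
  rw [← smul_tmul, ← tmul_smul_one, smul_tmul, mul_one]

theorem smul_one_tmul (s : S) (m : M) : s • tmul φ 1 m = tmul φ s m := by
  rw [smul_tmul, mul_one]

theorem induction {P : Bal φ M → Prop} (h0 : P 0) (hadd : ∀ x y, P x → P y → P (x + y))
    (h : ∀ s m, P (tmul φ s m)) (x : Bal φ M) : P x := by
  obtain ⟨t, rfl⟩ := mk_surjective φ x
  induction t with
  | zero => rwa [map_zero]
  | add x y hx hy => rw [map_add]; exact hadd _ _ hx hy
  | tmul s m => exact h s m

variable {φ} in
theorem hom_ext {P : Type*} [AddCommGroup P] [Module K P] {f g : Bal φ M →ₗ[K] P}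
    (h : ∀ s m, f (tmul φ s m) = g (tmul φ s m)) : f = g := by
  refine LinearMap.ext fun x => ?_
  induction x using induction with
  | h0 => rw [map_zero, map_zero]
  | hadd x y hx hy => rw [map_add, map_add, hx, hy]
  | h s m => exact h s m

/-- The bilinear map `(s, m) ↦ s ⊗ m`, curried. -/
def mkLin : S ⊗[K] M →ₗ[K] Bal φ M := (mk φ M).restrictScalars K

/-- The map out of `S ⊗_R M` induced by a balanced map. -/
def lift {P : Type*} [AddCommGroup P] [Module K P] (f : S ⊗[K] M →ₗ[K] P)
    (h : ∀ s r m, f ((s * φ r) ⊗ₜ m) = f (s ⊗ₜ (r • m))) : Bal φ M →ₗ[K] P :=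
  ((balRel φ M).restrictScalars K).liftQ f (by
    intro t ht
    -- The relations are given with left factor 1 and generate an `S`-submodule, so the induction
    -- carries an arbitrary scalar that is set to 1 at the end.
    have key : ∀ t ∈ balRel φ M, ∀ s : S, f (s • t) = 0 := by
      intro t ht
      induction ht using Submodule.span_induction with
      | mem x hx =>
        obtain ⟨r, m, rfl⟩ := hx
        intro s
        rw [smul_sub, map_sub, TensorProduct.smul_tmul', TensorProduct.smul_tmul', smul_eq_mul,
          smul_eq_mul, mul_one, h, sub_self]
      | zero => intro s; rw [smul_zero, map_zero]
      | add x y _ _ hx hy => intro s; rw [smul_add, map_add, hx, hy, add_zero]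
      | smul a x _ hx => intro s; rw [smul_smul, hx]
    rw [LinearMap.mem_ker, ← one_smul S t]
    exact key t ht 1)

theorem lift_tmul {P : Type*} [AddCommGroup P] [Module K P] (f : S ⊗[K] M →ₗ[K] P)
    (h : ∀ s r m, f ((s * φ r) ⊗ₜ m) = f (s ⊗ₜ (r • m))) (s : S) (m : M) :
    lift φ f h (tmul φ s m) = f (s ⊗ₜ m) := rfl

/-- The map `S ⊗_R M → S ⊗_R M'` induced by an `R`-linear map. -/
def map (f : M →ₗ[R] M') : Bal φ M →ₗ[S] Bal φ M' :=
  { lift φ (mkLin φ ∘ₗ (f.restrictScalars K).lTensor S) (fun s r m => by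
      change tmul φ (s * φ r) (f m) = tmul φ s (f (r • m))
      rw [map_smul, tmul_smul]) with
    map_smul' := fun s x => by
      change lift φ _ _ (s • x) = s • lift φ _ _ x
      induction x using induction with
      | h0 => simp
      | hadd x y hx hy => rw [smul_add, map_add, map_add, hx, hy, smul_add]
      | h s' m =>
        rw [smul_tmul, lift_tmul, lift_tmul]
        change tmul φ _ _ = s • tmul φ _ _
        rw [smul_tmul]; rfl }

@[simp] theorem map_tmul (f : M →ₗ[R] M') (s : S) (m : M) :
    map φ f (tmul φ s m) = tmul φ s (f m) := rfl

theorem hom_ext' {P : Type*} [AddCommGroup P] [Module S P] {f g : Bal φ M →ₗ[S] P}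
    (h : ∀ m, f (tmul φ 1 m) = g (tmul φ 1 m)) : f = g := by
  refine LinearMap.ext fun x => ?_
  induction x using induction with
  | h0 => rw [map_zero, map_zero]
  | hadd x y hx hy => rw [map_add, map_add, hx, hy]
  | h s m => rw [← smul_one_tmul, map_smul, map_smul, h]

theorem map_zero_hom : map φ (0 : M →ₗ[R] M') = 0 :=
  hom_ext' φ fun m => by rw [map_tmul]; exact tmul_zero φ 1

theorem map_comp (g : M' →ₗ[R] M'') (f : M →ₗ[R] M') (x : Bal φ M) :
    map φ g (map φ f x) = map φ (g ∘ₗ f) x := by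
  refine LinearMap.congr_fun (f := map φ g ∘ₗ map φ f) (hom_ext' φ fun m => ?_) x
  rfl

/-- The map `S ⊗_R M → S' ⊗_R M` induced by a map `S → S'` of right `R`-modules. -/
def mapLeft {φ : R →ₐ[K] S} {φ' : R →ₐ[K] S'} (e : S →ₗ[K] S')
    (he : ∀ s r, e (s * φ r) = e s * φ' r) : Bal φ M →ₗ[K] Bal φ' M :=
  lift φ (mkLin φ' ∘ₗ e.rTensor M) (fun s r m => by
    change tmul φ' (e (s * φ r)) m = tmul φ' (e s) (r • m)
    rw [he, tmul_smul])

@[simp] theorem mapLeft_tmul {φ : R →ₐ[K] S} {φ' : R →ₐ[K] S'} (e : S →ₗ[K] S')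
    (he : ∀ s r, e (s * φ r) = e s * φ' r) (s : S) (m : M) :
    mapLeft e he (tmul φ s m) = tmul φ' (e s) m := rfl

theorem mapLeft_map {φ : R →ₐ[K] S} {φ' : R →ₐ[K] S'} (e : S →ₗ[K] S')
    (he : ∀ s r, e (s * φ r) = e s * φ' r) (f : M →ₗ[R] M') (x : Bal φ M) :
    mapLeft e he (map φ f x) = map φ' f (mapLeft e he x) := by
  induction x using induction with
  | h0 => simp
  | hadd x y hx hy => simp only [_root_.map_add, hx, hy]
  | h s m => rfl

end Bal

/-- `S` is faithfully flat as a right `R`-module. -/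
def LeftFF : Prop :=
  ∀ (M' M M'' : Type u) [AddCommGroup M'] [Module K M'] [Module R M'] [IsScalarTower K R M']
    [AddCommGroup M] [Module K M] [Module R M] [IsScalarTower K R M]
    [AddCommGroup M''] [Module K M''] [Module R M''] [IsScalarTower K R M'']
    (f : M' →ₗ[R] M) (g : M →ₗ[R] M''),
    Function.Exact f g ↔ Function.Exact (Bal.map φ f) (Bal.map φ g)

namespace LeftFF

variable {φ M} (hφ : LeftFF φ)
include hφ

/-- Injectivity of f is exactness of 0 : M → M followed by f; the zero endomorphism stands in for
the zero module. -/
theorem map_injective {f : M →ₗ[R] M'} (hf : Function.Injective f) :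
    Function.Injective (Bal.map φ f) := by
  have h : Function.Exact (0 : M →ₗ[R] M) f := by
    intro x
    rw [map_eq_zero_iff f hf]
    exact ⟨fun h => ⟨0, h.symm⟩, fun ⟨_, h⟩ => h.symm⟩
  rw [hφ, Bal.map_zero_hom] at h
  rw [injective_iff_map_eq_zero]
  intro x hx
  obtain ⟨y, rfl⟩ := (h x).1 hx
  rfl

/-- Two consecutive zero endomorphisms of M form an exact sequence precisely when M vanishes. -/
theorem eq_zero (h : ∀ x : Bal φ M, x = 0) (m : M) : m = 0 := by
  have : Function.Exact (0 : M →ₗ[R] M) (0 : M →ₗ[R] M) := by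
    rw [hφ]
    intro x
    rw [h x]
    exact ⟨fun _ => ⟨0, map_zero _⟩, fun _ => map_zero _⟩
  obtain ⟨_, h⟩ := (this m).1 rfl
  exact h.symm

/-- The elements m with 1 ⊗ m = 0 form a submodule N. By flatness S ⊗_R N embeds in S ⊗_R M, where
its image is zero; so S ⊗_R N = 0 and therefore N = 0. -/
theorem tmul_one_injective {m : M} (hm : Bal.tmul φ 1 m = 0) : m = 0 := by
  let N : Submodule R M :=
    { carrier := {m | Bal.tmul φ 1 m = 0}
      add_mem' := fun {a b} ha hb => by
        change Bal.tmul φ 1 (a + b) = 0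
        rw [Bal.tmul_add, show Bal.tmul φ 1 a = 0 from ha, show Bal.tmul φ 1 b = 0 from hb,
          add_zero]
      zero_mem' := Bal.tmul_zero φ 1
      smul_mem' := fun r a ha => by
        change Bal.tmul φ 1 (r • a) = 0
        rw [Bal.tmul_smul_one, ← Bal.smul_one_tmul, show Bal.tmul φ 1 a = 0 from ha, smul_zero] }
  have h0 : ∀ x : Bal φ N, x = 0 := fun x => by
    refine hφ.map_injective (f := N.subtype) N.subtype_injective ?_
    rw [map_zero]
    refine LinearMap.congr_fun (g := 0) (Bal.hom_ext' φ fun n => ?_) x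
    exact n.2
  exact congrArg Subtype.val (hφ.eq_zero h0 (⟨m, hm⟩ : N))

/-- Faithfully flat descent for elements: `R` is the equalizer of `S ⇉ S ⊗_R S`. -/
theorem mem_range {s : S} (hs : Bal.tmul φ s (toVia φ 1) = Bal.tmul φ 1 (toVia φ s)) :
    ∃ r, φ r = s := by
  let N : Submodule R (Via φ) :=
    { carrier := {m | ∃ r, toVia φ (φ r) = m}
      add_mem' := by
        rintro _ _ ⟨r, rfl⟩ ⟨r', rfl⟩
        exact ⟨r + r', by rw [map_add, map_add]⟩
      zero_mem' := ⟨0, by rw [map_zero, map_zero]⟩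
      smul_mem' := by
        rintro r _ ⟨r', rfl⟩
        exact ⟨r * r', by rw [map_mul, smul_toVia]⟩ }
  -- Modulo the image N of R the unit of S vanishes, so the hypothesis says that 1 ⊗ [s] = 0 in S
  -- ⊗_R (S/N), which forces [s] = 0.
  have h1 : N.mkQ (toVia φ 1) = 0 := by
    rw [Submodule.mkQ_apply, Submodule.Quotient.mk_eq_zero]
    exact ⟨1, by rw [map_one]⟩
  have h := congrArg (Bal.map φ N.mkQ) hs
  rw [Bal.map_tmul, Bal.map_tmul, h1, Bal.tmul_zero] at h
  have h2 := hφ.tmul_one_injective h.symm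
  rw [Submodule.mkQ_apply, Submodule.Quotient.mk_eq_zero] at h2
  exact h2

theorem injective {r : R} (hr : φ r = 0) : r = 0 := by
  refine hφ.tmul_one_injective (M := R) ?_
  have h := Bal.tmul_smul_one φ r (1 : R)
  rw [smul_eq_mul, mul_one, hr, Bal.zero_tmul] at h
  exact h

end LeftFF

end Balanced

end
end Super

namespace Super
noncomputable section
set_option linter.unusedSectionVars false
open Coalgebra

/-! ### Even and odd components, and the parity automorphism. -/

namespace CommSuperalg

variable {K : Type u} [Field K] (S : CommSuperalg K)

/-- The even component. -/
def ev : S.carrier →ₗ[K] S.carrier := GradedAlgebra.proj S.gr 0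

/-- The odd component. -/
def od : S.carrier →ₗ[K] S.carrier := GradedAlgebra.proj S.gr 1

variable {S}

theorem ev_mem (a : S) : S.ev a ∈ S.gr 0 := SetLike.coe_mem _

theorem od_mem (a : S) : S.od a ∈ S.gr 1 := SetLike.coe_mem _

theorem ev_of_even {a : S} (ha : a ∈ S.gr 0) : S.ev a = a := by
  rw [ev, GradedAlgebra.proj_apply, DirectSum.decompose_of_mem_same _ ha]

theorem ev_of_odd {a : S} (ha : a ∈ S.gr 1) : S.ev a = 0 := by
  rw [ev, GradedAlgebra.proj_apply, DirectSum.decompose_of_mem_ne _ ha (by decide)]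

theorem od_of_even {a : S} (ha : a ∈ S.gr 0) : S.od a = 0 := by
  rw [od, GradedAlgebra.proj_apply, DirectSum.decompose_of_mem_ne _ ha (by decide)]

theorem od_of_odd {a : S} (ha : a ∈ S.gr 1) : S.od a = a := by
  rw [od, GradedAlgebra.proj_apply, DirectSum.decompose_of_mem_same _ ha]

theorem ev_add_od (a : S) : S.ev a + S.od a = a := by
  obtain ⟨x, hx, y, hy, rfl⟩ := S.decomp a
  rw [map_add, map_add, ev_of_even hx, ev_of_odd hy, od_of_even hx, od_of_odd hy, add_zero,
    zero_add]

theorem ev_eq {a x y : S} (h : a = x + y) (hx : x ∈ S.gr 0) (hy : y ∈ S.gr 1) : S.ev a = x := by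
  rw [h, map_add, ev_of_even hx, ev_of_odd hy, add_zero]

theorem od_eq {a x y : S} (h : a = x + y) (hx : x ∈ S.gr 0) (hy : y ∈ S.gr 1) : S.od a = y := by
  rw [h, map_add, od_of_even hx, od_of_odd hy, zero_add]

theorem mul_eq (a b : S) : a * b = (S.ev a * S.ev b + S.od a * S.od b) +
    (S.ev a * S.od b + S.od a * S.ev b) := by
  conv_lhs => rw [← ev_add_od a, ← ev_add_od b]
  rw [add_mul, mul_add, mul_add]; abel

theorem ev_mul (a b : S) : S.ev (a * b) = S.ev a * S.ev b + S.od a * S.od b :=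
  ev_eq (mul_eq a b) (add_mem (S.mul_mem (ev_mem a) (ev_mem b)) (S.mul_mem (od_mem a) (od_mem b)))
    (add_mem (S.mul_mem (ev_mem a) (od_mem b)) (S.mul_mem (od_mem a) (ev_mem b)))

theorem od_mul (a b : S) : S.od (a * b) = S.ev a * S.od b + S.od a * S.ev b :=
  od_eq (mul_eq a b) (add_mem (S.mul_mem (ev_mem a) (ev_mem b)) (S.mul_mem (od_mem a) (od_mem b)))
    (add_mem (S.mul_mem (ev_mem a) (od_mem b)) (S.mul_mem (od_mem a) (ev_mem b)))

theorem odd_anticomm {a b : S} (ha : a ∈ S.gr 1) (hb : b ∈ S.gr 1) : a * b = -(b * a) := by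
  rw [S.supercomm 1 1 a ha b hb, one_mul, uzpow_one, Units.neg_smul, one_smul]

variable (S) in
/-- The parity automorphism `a ↦ (-1)^|a| a`. -/
def par : S.carrier →ₗ[K] S.carrier := S.ev - S.od

theorem par_of_even {a : S} (ha : a ∈ S.gr 0) : S.par a = a := by
  rw [par, LinearMap.sub_apply, ev_of_even ha, od_of_even ha, sub_zero]

theorem par_of_odd {a : S} (ha : a ∈ S.gr 1) : S.par a = -a := by
  rw [par, LinearMap.sub_apply, ev_of_odd ha, od_of_odd ha, zero_sub]

theorem par_par (a : S) : S.par (S.par a) = a := by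
  obtain ⟨x, hx, y, hy, rfl⟩ := S.decomp a
  rw [map_add, map_add, par_of_even hx, par_of_odd hy, par_of_even hx, map_neg, par_of_odd hy,
    neg_neg]

theorem odd_mul {a : S} (ha : a ∈ S.gr 1) (b : S) : a * b = S.par b * a := by
  refine S.homog_induction (P := fun b => a * b = S.par b * a)
    (fun x y hx hy => by rw [mul_add, map_add, add_mul, hx, hy]) (fun i b hb => ?_) b
  rcases zmod2_cases i with rfl | rfl
  · rw [par_of_even hb, even_comm S hb]
  · rw [par_of_odd hb, odd_anticomm ha hb, neg_mul]

theorem par_mul (a b : S) : S.par (a * b) = S.par a * S.par b := by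
  rw [par, LinearMap.sub_apply, ev_mul, od_mul]
  simp only [LinearMap.sub_apply]
  rw [sub_mul, mul_sub, mul_sub]; abel

end CommSuperalg

/-- Doubling loses no information about exactness. It is applied to M × M and again to its base
change. -/
theorem exact_prodMap {A B C : Type*} [Zero A] [Zero B] [Zero C] {f : A → B} {g : B → C}
    (hf : f 0 = 0) (hg : g 0 = 0) :
    Function.Exact (Prod.map f f) (Prod.map g g) ↔ Function.Exact f g := by
  constructor
  · intro h x
    constructor
    · intro hx
      obtain ⟨⟨a, b⟩, hab⟩ := (h (x, 0)).1 (Prod.ext hx hg)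
      exact ⟨a, congrArg Prod.fst hab⟩
    · rintro ⟨a, rfl⟩
      exact congrArg Prod.fst ((h (f a, f 0)).2 ⟨(a, 0), rfl⟩)
  · rintro h ⟨x, y⟩
    constructor
    · intro hx
      obtain ⟨a, ha⟩ := (h x).1 (congrArg Prod.fst hx)
      obtain ⟨b, hb⟩ := (h y).1 (congrArg Prod.snd hx)
      exact ⟨(a, b), Prod.ext ha hb⟩
    · rintro ⟨⟨a, b⟩, hab⟩
      obtain rfl : f a = x := congrArg Prod.fst hab
      obtain rfl : f b = y := congrArg Prod.snd hab
      exact Prod.ext ((h _).2 ⟨a, rfl⟩) ((h _).2 ⟨b, rfl⟩)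

/-! ## Faithful flatness for left modules -/

section Flip

open CommSuperalg

variable {K : Type u} [Field K] (R : CommSuperalg K) {S : Type u} [Ring S] [Algebra K S]
  (φ : R.carrier →ₐ[K] S) (σ : S →ₗ[K] S)

/-- `φ` maps `R` to the supercenter of `S`, where the grading of `S` is given by the parity
involution `σ`. -/
structure SuperCentral : Prop where
  invol : ∀ s, σ (σ s) = s
  even_mul : ∀ r ∈ R.gr 0, ∀ s, φ r * s = s * φ r
  odd_mul : ∀ r ∈ R.gr 1, ∀ s, φ r * s = σ s * φ r
  par_even : ∀ r ∈ R.gr 0, ∀ s, σ (φ r * s) = φ r * σ s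
  par_odd : ∀ r ∈ R.gr 1, ∀ s, σ (φ r * s) = -(φ r * σ s)

variable (M : Type u) [AddCommGroup M] [Module K M] [Module R M]
  [IsScalarTower K R M] {M' M'' : Type u} [AddCommGroup M'] [Module K M'] [Module R M']
  [IsScalarTower K R M']

variable {R} in
/-- `(m, n) r = (r_0 m - r_1 n, r_1 m + r_0 n)`. -/
def flipSmul (r : R) (x : M × M) : M × M :=
  (R.ev r • x.1 - R.od r • x.2, R.od r • x.1 + R.ev r • x.2)

/-- The right module structure on `M × M` attached to a left module `M`. -/
abbrev flipModule : Module R.carrierᵐᵒᵖ (M × M) where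
  smul r x := flipSmul M r.unop x
  one_smul x := by
    change (R.ev (1 : R) • x.1 - R.od (1 : R) • x.2, R.od (1 : R) • x.1 + R.ev (1 : R) • x.2) = x
    rw [ev_of_even R.one_mem, od_of_even R.one_mem, zero_smul, zero_smul, one_smul, one_smul,
      sub_zero, zero_add]
  mul_smul r s x := by
    obtain ⟨m, n⟩ := x
    obtain ⟨r⟩ := r
    obtain ⟨s⟩ := s
    change (R.ev (s * r) • m - R.od (s * r) • n, R.od (s * r) • m + R.ev (s * r) • n) =
      (R.ev r • (R.ev s • m - R.od s • n) - R.od r • (R.od s • m + R.ev s • n),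
        R.od r • (R.ev s • m - R.od s • n) + R.ev r • (R.od s • m + R.ev s • n))
    -- The minus sign in the first component of the action is matched by the anticommutation of the
    -- odd parts of r and s.
    rw [ev_mul, od_mul, even_comm R (ev_mem s) (R.ev r), even_comm R (ev_mem s) (R.od r),
      ← even_comm R (ev_mem r) (R.od s), odd_anticomm (od_mem s) (od_mem r)]
    simp only [smul_sub, smul_add, add_smul, neg_smul, smul_smul]
    refine Prod.ext ?_ ?_ <;> dsimp only <;> abel
  smul_zero r := by
    change (R.ev r.unop • (0 : M) - R.od r.unop • (0 : M),
      R.od r.unop • (0 : M) + R.ev r.unop • (0 : M)) = 0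
    simp
  smul_add r x y := by
    change (R.ev r.unop • (x.1 + y.1) - R.od r.unop • (x.2 + y.2),
      R.od r.unop • (x.1 + y.1) + R.ev r.unop • (x.2 + y.2)) =
      (R.ev r.unop • x.1 - R.od r.unop • x.2 + (R.ev r.unop • y.1 - R.od r.unop • y.2),
      R.od r.unop • x.1 + R.ev r.unop • x.2 + (R.od r.unop • y.1 + R.ev r.unop • y.2))
    simp only [smul_add]
    refine Prod.ext ?_ ?_ <;> dsimp only <;> abel
  add_smul r s x := by
    change (R.ev (r.unop + s.unop) • x.1 - R.od (r.unop + s.unop) • x.2,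
      R.od (r.unop + s.unop) • x.1 + R.ev (r.unop + s.unop) • x.2) =
      (R.ev r.unop • x.1 - R.od r.unop • x.2 + (R.ev s.unop • x.1 - R.od s.unop • x.2),
      R.od r.unop • x.1 + R.ev r.unop • x.2 + (R.od s.unop • x.1 + R.ev s.unop • x.2))
    simp only [map_add, add_smul]
    refine Prod.ext ?_ ?_ <;> dsimp only <;> abel
  zero_smul x := by
    change (R.ev (0 : R) • x.1 - R.od (0 : R) • x.2, R.od (0 : R) • x.1 + R.ev (0 : R) • x.2) = 0
    simp

/-- The right supermodule attached to a left module. -/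
abbrev flipMod : RightSupermod R where
  carrier := M × M
  rightModule := flipModule R M
  tower := letI := flipModule R M; ⟨fun c r x => by
    obtain ⟨m, n⟩ := x
    change (R.ev (c • r.unop) • m - R.od (c • r.unop) • n,
      R.od (c • r.unop) • m + R.ev (c • r.unop) • n) =
      (c • (R.ev r.unop • m - R.od r.unop • n), c • (R.od r.unop • m + R.ev r.unop • n))
    simp only [map_smul, smul_assoc, smul_sub, smul_add]⟩
  gr i := if i = 0 then LinearMap.range (LinearMap.inl K M M) else
    LinearMap.range (LinearMap.inr K M M)
  isInternal := by
    rw [internal_iff]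
    exact LinearMap.isCompl_range_inl_inr
  smul_mem i j x hx r hr := by
    change flipSmul M r x ∈ _
    rcases zmod2_cases i with rfl | rfl <;> rcases zmod2_cases j with rfl | rfl
    · obtain ⟨m, rfl⟩ := hx
      refine ⟨r • m, ?_⟩
      simp [flipSmul, ev_of_even hr, od_of_even hr]
    · obtain ⟨m, rfl⟩ := hx
      refine ⟨r • m, ?_⟩
      simp [flipSmul, ev_of_odd hr, od_of_odd hr]
    · obtain ⟨m, rfl⟩ := hx
      refine ⟨r • m, ?_⟩
      simp [flipSmul, ev_of_even hr, od_of_even hr]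
    · obtain ⟨m, rfl⟩ := hx
      refine ⟨-(r • m), ?_⟩
      simp [flipSmul, ev_of_odd hr, od_of_odd hr]

variable {M} in
/-- The morphism of right supermodules attached to a morphism of left modules. -/
def flipMap (f : M →ₗ[R] M') : (flipMod R M).Hom (flipMod R M') where
  toLin := (f.restrictScalars K).prodMap (f.restrictScalars K)
  even i x hx := by
    rcases zmod2_cases i with rfl | rfl
    · obtain ⟨m, rfl⟩ := hx
      exact ⟨f m, Prod.ext rfl (map_zero f).symm⟩
    · obtain ⟨m, rfl⟩ := hx
      exact ⟨f m, Prod.ext (map_zero f).symm rfl⟩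
  map_smul r x := by
    obtain ⟨m, n⟩ := x
    change (f (R.ev r • m - R.od r • n), f (R.od r • m + R.ev r • n)) =
      (R.ev r • f m - R.od r • f n, R.od r • f m + R.ev r • f n)
    simp only [map_sub, map_add, map_smul]

/-- `(m, n) ⊗ s ↦ α(s) ⊗ m + β(s) ⊗ n` as a linear map. -/
def flipToBal (α β : S →ₗ[K] S) : (M × M) ⊗[K] S →ₗ[K] Bal φ M :=
  TensorProduct.lift
    (((LinearMap.compl₁₂ (TensorProduct.mk K S M).flip LinearMap.id α).compr₂ (Bal.mkLin φ)) ∘ₗ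
        LinearMap.fst K M M +
      ((LinearMap.compl₁₂ (TensorProduct.mk K S M).flip LinearMap.id β).compr₂ (Bal.mkLin φ)) ∘ₗ
        LinearMap.snd K M M)

theorem flipToBal_tmul (α β : S →ₗ[K] S) (x : M × M) (s : S) :
    flipToBal R φ M α β (x ⊗ₜ s) = Bal.tmul φ (α s) x.1 + Bal.tmul φ (β s) x.2 := rfl

variable {M} in
/-- The class of `x ⊗ s` in the tensor product over `R`. -/
def flipTmul [Module R S] (x : M × M) (s : S) : TensorOver R S (flipMod R M) :=
  (tensorRel R S (flipMod R M)).mkQ (x ⊗ₜ s)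

variable {M} in
theorem flipTmul_smul [Module R S] (r : R) (x : M × M) (s : S) :
    flipTmul R (flipSmul M r x) s = flipTmul R x (r • s) := by
  refine sub_eq_zero.1 ?_
  refine (map_sub (tensorRel R S (flipMod R M)).mkQ _ _).symm.trans ?_
  refine (Submodule.Quotient.mk_eq_zero _).2 ?_
  exact Submodule.subset_span ⟨x, r, s, rfl⟩

/-- `s ⊗ m ↦ (m, 0) ⊗ α(s) + (0, m) ⊗ β(s)`. -/
def flipOfBal [Module R S] (α β : S →ₗ[K] S) : S ⊗[K] M →ₗ[K] TensorOver R S (flipMod R M) :=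
  (tensorRel R S (flipMod R M)).mkQ ∘ₗ
    TensorProduct.lift (((TensorProduct.mk K (M × M) S).flip.compl₁₂ α (LinearMap.inl K M M)) +
      ((TensorProduct.mk K (M × M) S).flip.compl₁₂ β (LinearMap.inr K M M)))

theorem flipOfBal_tmul [Module R S] (α β : S →ₗ[K] S) (s : S) (m : M) :
    flipOfBal R M α β (s ⊗ₜ m) = flipTmul R (m, 0) (α s) + flipTmul R (0, m) (β s) :=
  map_add (tensorRel R S (flipMod R M)).mkQ ((m, 0) ⊗ₜ[K] α s) ((0, m) ⊗ₜ[K] β s)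

variable {φ σ} (hσ : SuperCentral R φ σ)
include hσ

/-- This and `par_eq` turn left multiplication by φ(r) into right multiplications by φ(r_0) and
φ(r_1), which can cross the sign of S ⊗_R M. -/
theorem SuperCentral.mul_eq (r : R) (s : S) :
    φ r * s = s * φ (R.ev r) + σ s * φ (R.od r) := by
  conv_lhs => rw [← ev_add_od r, map_add, add_mul]
  rw [hσ.even_mul _ (ev_mem r), hσ.odd_mul _ (od_mem r)]

theorem SuperCentral.par_eq (r : R) (s : S) :
    σ (φ r * s) = σ s * φ (R.ev r) - s * φ (R.od r) := by
  conv_lhs => rw [← ev_add_od r, map_add, add_mul, map_add]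
  rw [hσ.par_even _ (ev_mem r), hσ.par_odd _ (od_mem r), hσ.even_mul _ (ev_mem r),
    hσ.odd_mul _ (od_mem r), hσ.invol, sub_eq_add_neg]

variable [Module R S] (hS : ∀ (r : R) (s : S), r • s = φ r * s)
include hS

/-- The first projection `(m, n) ⊗ s ↦ s ⊗ m + σ(s) ⊗ n`. -/
def flipFst : TensorOver R S (flipMod R M) →ₗ[K] Bal φ M :=
  Submodule.liftQ _ (flipToBal R φ M LinearMap.id σ) <| by
    rw [tensorRel, Submodule.span_le]
    rintro _ ⟨⟨m, n⟩, r, s, rfl⟩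
    rw [SetLike.mem_coe, LinearMap.mem_ker, map_sub, sub_eq_zero]
    change flipToBal R φ M LinearMap.id σ
      ((R.ev r • m - R.od r • n, R.od r • m + R.ev r • n) ⊗ₜ s) =
      flipToBal R φ M LinearMap.id σ ((m, n) ⊗ₜ (r • s))
    rw [flipToBal_tmul, flipToBal_tmul, hS, LinearMap.id_apply, LinearMap.id_apply,
      hσ.par_eq, hσ.mul_eq]
    simp only [← Bal.mk_tmul, TensorProduct.tmul_sub, TensorProduct.tmul_add,
      TensorProduct.sub_tmul, TensorProduct.add_tmul, map_sub, map_add]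
    simp only [Bal.mk_tmul, Bal.tmul_smul]
    abel

/-- The second projection `(m, n) ⊗ s ↦ σ(s) ⊗ m - s ⊗ n`. -/
def flipSnd : TensorOver R S (flipMod R M) →ₗ[K] Bal φ M :=
  Submodule.liftQ _ (flipToBal R φ M σ (-LinearMap.id)) <| by
    rw [tensorRel, Submodule.span_le]
    rintro _ ⟨⟨m, n⟩, r, s, rfl⟩
    rw [SetLike.mem_coe, LinearMap.mem_ker, map_sub, sub_eq_zero]
    change flipToBal R φ M σ (-LinearMap.id)
      ((R.ev r • m - R.od r • n, R.od r • m + R.ev r • n) ⊗ₜ s) =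
      flipToBal R φ M σ (-LinearMap.id) ((m, n) ⊗ₜ (r • s))
    rw [flipToBal_tmul, flipToBal_tmul, hS, LinearMap.neg_apply, LinearMap.neg_apply,
      LinearMap.id_apply, LinearMap.id_apply, hσ.par_eq, hσ.mul_eq]
    simp only [← Bal.mk_tmul, TensorProduct.tmul_sub, TensorProduct.tmul_add,
      TensorProduct.sub_tmul, TensorProduct.add_tmul, TensorProduct.neg_tmul, map_sub, map_add,
      map_neg]
    simp only [Bal.mk_tmul, Bal.tmul_smul]
    abel

/-- An odd r exchanges the two summands of M × M. So α and β only have to intertwine right with left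
multiplication by φ(r), each with itself for even r, and up to an exchange of α and β with a sign
for odd r. -/
theorem flipOfBal_balanced (α β : S →ₗ[K] S)
    (h0 : ∀ r ∈ R.gr 0, ∀ s, α (s * φ r) = φ r * α s ∧ β (s * φ r) = φ r * β s)
    (h1 : ∀ r ∈ R.gr 1, ∀ s, α (s * φ r) = φ r * β s ∧ β (s * φ r) = -(φ r * α s))
    (s : S) (r : R) (m : M) :
    flipOfBal R M α β ((s * φ r) ⊗ₜ m) = flipOfBal R M α β (s ⊗ₜ (r • m)) := by
  refine R.homog_induction (P := fun r => flipOfBal R M α β ((s * φ r) ⊗ₜ m) =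
    flipOfBal R M α β (s ⊗ₜ (r • m))) (fun x y hx hy => ?_) (fun i r hr => ?_) r
  · rw [map_add, mul_add, TensorProduct.add_tmul, map_add, hx, hy, add_smul,
      TensorProduct.tmul_add, map_add]
  · rw [flipOfBal_tmul, flipOfBal_tmul]
    rcases zmod2_cases i with rfl | rfl
    · have e1 := flipTmul_smul R r (m, 0) (α s)
      have e2 := flipTmul_smul R r (0, m) (β s)
      rw [show flipSmul M r (m, 0) = (r • m, 0) by
        simp [flipSmul, ev_of_even hr, od_of_even hr], hS] at e1
      rw [show flipSmul M r (0, m) = (0, r • m) by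
        simp [flipSmul, ev_of_even hr, od_of_even hr], hS] at e2
      rw [(h0 r hr s).1, (h0 r hr s).2, e1, e2]
    · have e1 := flipTmul_smul R r (0, m) (-α s)
      have e2 := flipTmul_smul R r (m, 0) (β s)
      rw [show flipSmul M r (0, m) = (-(r • m), 0) by
        simp [flipSmul, ev_of_odd hr, od_of_odd hr], hS, mul_neg] at e1
      rw [show flipSmul M r (m, 0) = (0, r • m) by
        simp [flipSmul, ev_of_odd hr, od_of_odd hr], hS] at e2
      rw [(h1 r hr s).1, (h1 r hr s).2, ← e1, ← e2, add_comm]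
      congr 1
      refine congrArg (tensorRel R S (flipMod R M)).mkQ ?_
      have : (-(r • m), (0 : M)) = -(r • m, (0 : M)) := by ext <;> simp
      rw [this, TensorProduct.neg_tmul, TensorProduct.tmul_neg, neg_neg]

/-- The first injection `s ⊗ m ↦ (m, 0) ⊗ s + (0, m) ⊗ σ(s)`. -/
def flipInl : Bal φ M →ₗ[K] TensorOver R S (flipMod R M) :=
  Bal.lift φ (flipOfBal R M LinearMap.id σ) <| flipOfBal_balanced R M hσ hS _ _
    (fun r hr s => ⟨(hσ.even_mul r hr s).symm, by
      rw [← hσ.even_mul r hr, hσ.par_even r hr]⟩)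
    (fun r hr s => ⟨by rw [hσ.odd_mul r hr, hσ.invol]; rfl, by
      have := hσ.par_odd r hr (σ s)
      rwa [hσ.odd_mul r hr, hσ.invol] at this⟩)

/-- The second injection `s ⊗ m ↦ (m, 0) ⊗ σ(s) - (0, m) ⊗ s`. -/
def flipInr : Bal φ M →ₗ[K] TensorOver R S (flipMod R M) :=
  Bal.lift φ (flipOfBal R M σ (-LinearMap.id)) <| flipOfBal_balanced R M hσ hS _ _
    (fun r hr s => ⟨by
      rw [← hσ.even_mul r hr, hσ.par_even r hr], by
      simp only [LinearMap.neg_apply, LinearMap.id_apply]; rw [hσ.even_mul r hr, neg_mul]⟩)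
    (fun r hr s => ⟨by
      have := hσ.par_odd r hr (σ s)
      rw [hσ.odd_mul r hr, hσ.invol] at this
      simp only [LinearMap.neg_apply, LinearMap.id_apply, mul_neg]; exact this, by
      simp only [LinearMap.neg_apply, LinearMap.id_apply]; rw [hσ.odd_mul r hr, hσ.invol]⟩)

/-- `(M × M) ⊗_R S` is the product of two copies of `S ⊗_R M`. -/
def flipEquiv (h2 : (2 : K) ≠ 0) :
    TensorOver R S (flipMod R M) ≃ₗ[K] Bal φ M × Bal φ M :=
  LinearEquiv.ofLinearMap ((flipFst R M hσ hS).prod (flipSnd R M hσ hS))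
    -- Each projection composed with its own injection is multiplication by 2, and the mixed
    -- composites vanish; hence the factor 2⁻¹.
    ((2 : K)⁻¹ • (flipInl R M hσ hS).coprod (flipInr R M hσ hS))
    (by
      refine LinearMap.ext fun ⟨x, y⟩ => ?_
      have hx : flipFst R M hσ hS (flipInl R M hσ hS x) = (2 : K) • x ∧
          flipSnd R M hσ hS (flipInl R M hσ hS x) = 0 := by
        induction x using Bal.induction with
        | h0 => simp
        | hadd x y hx hy => simp only [map_add, hx.1, hx.2, hy.1, hy.2, smul_add, add_zero,
            and_self]
        | h s m =>
          have e : flipInl R M hσ hS (Bal.tmul φ s m) =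
            flipTmul R (m, 0) s + flipTmul R (0, m) (σ s) := flipOfBal_tmul R M _ _ s m
          rw [e, map_add, map_add]
          constructor
          · change (Bal.tmul φ s m + Bal.tmul φ (σ s) 0) +
              (Bal.tmul φ (σ s) 0 + Bal.tmul φ (σ (σ s)) m) = _
            rw [hσ.invol, Bal.tmul_zero, two_smul]; abel
          · change (Bal.tmul φ (σ s) m + Bal.tmul φ (-s) 0) +
              (Bal.tmul φ (σ (σ s)) 0 + Bal.tmul φ (-(σ s)) m) = _
            rw [Bal.tmul_zero, Bal.tmul_zero, add_zero, zero_add, ← Bal.add_tmul, add_neg_cancel,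
              Bal.zero_tmul]
      have hy : flipFst R M hσ hS (flipInr R M hσ hS y) = 0 ∧
          flipSnd R M hσ hS (flipInr R M hσ hS y) = (2 : K) • y := by
        induction y using Bal.induction with
        | h0 => simp
        | hadd x y hx hy => simp only [map_add, hx.1, hx.2, hy.1, hy.2, smul_add, add_zero,
            and_self]
        | h s m =>
          have e : flipInr R M hσ hS (Bal.tmul φ s m) =
            flipTmul R (m, 0) (σ s) + flipTmul R (0, m) (-s) := flipOfBal_tmul R M _ _ s m
          rw [e, map_add, map_add]
          constructor
          · change (Bal.tmul φ (σ s) m + Bal.tmul φ (σ (σ s)) 0) +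
              (Bal.tmul φ (-s) 0 + Bal.tmul φ (σ (-s)) m) = _
            rw [Bal.tmul_zero, Bal.tmul_zero, add_zero, zero_add, ← Bal.add_tmul, map_neg,
              add_neg_cancel, Bal.zero_tmul]
          · change (Bal.tmul φ (σ (σ s)) m + Bal.tmul φ (-(σ s)) 0) +
              (Bal.tmul φ (σ (-s)) 0 + Bal.tmul φ (-(-s)) m) = _
            rw [hσ.invol, Bal.tmul_zero, Bal.tmul_zero, neg_neg, two_smul]; abel
      change (flipFst R M hσ hS ((2 : K)⁻¹ • (flipInl R M hσ hS x + flipInr R M hσ hS y)),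
        flipSnd R M hσ hS ((2 : K)⁻¹ • (flipInl R M hσ hS x + flipInr R M hσ hS y))) = (x, y)
      rw [map_smul, map_smul, map_add, map_add, hx.1, hx.2, hy.1, hy.2, add_zero, zero_add,
        inv_smul_smul₀ h2, inv_smul_smul₀ h2])
    (by
      refine Submodule.linearMap_qext _ (TensorProduct.ext' fun ⟨m, n⟩ s => ?_)
      change (2 : K)⁻¹ • (flipInl R M hσ hS (Bal.tmul φ s m + Bal.tmul φ (σ s) n) +
        flipInr R M hσ hS (Bal.tmul φ (σ s) m + Bal.tmul φ (-s) n)) = flipTmul R (m, n) s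
      have e1 : ∀ s m, flipInl R M hσ hS (Bal.tmul φ s m) =
            flipTmul R (m, 0) s + flipTmul R (0, m) (σ s) := flipOfBal_tmul R M _ _
      have e2 : ∀ s m, flipInr R M hσ hS (Bal.tmul φ s m) =
            flipTmul R (m, 0) (σ s) + flipTmul R (0, m) (-s) := flipOfBal_tmul R M _ _
      have e3 : ∀ (x : M × M) (s : S), flipTmul R x (-s) = - flipTmul R x s := fun x s =>
        (congrArg (tensorRel R S (flipMod R M)).mkQ (TensorProduct.tmul_neg x s)).trans
          (map_neg _ _)
      have e4 : flipTmul R (m, n) s = flipTmul R (m, 0) s + flipTmul R (0, n) s := by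
        rw [show ((m, n) : M × M) = (m, 0) + (0, n) by simp]
        exact (congrArg (tensorRel R S (flipMod R M)).mkQ (TensorProduct.add_tmul _ _ s)).trans
          (map_add _ _ _)
      rw [map_add, map_add, e1, e1, e2, e2, hσ.invol, map_neg, e3, e3, e4, neg_neg]
      rw [inv_smul_eq_iff₀ h2, two_smul]
      abel)

theorem flipEquiv_map (h2 : (2 : K) ≠ 0) (f : M →ₗ[R] M')
    (x : TensorOver R S (flipMod R M)) :
    flipEquiv R M' hσ hS h2 (TensorOver.map R S (flipMap R f) x) =
      Prod.map (Bal.map φ f) (Bal.map φ f) (flipEquiv R M hσ hS h2 x) := by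
  obtain ⟨x, rfl⟩ := Submodule.mkQ_surjective _ x
  induction x with
  | zero =>
    rw [map_zero, map_zero, map_zero, map_zero]
    exact Prod.ext (map_zero (Bal.map φ f)).symm (map_zero (Bal.map φ f)).symm
  | add x y hx hy =>
    rw [map_add, map_add, map_add, hx, hy, map_add]
    exact Prod.ext (map_add _ _ _).symm (map_add _ _ _).symm
  | tmul x s =>
    obtain ⟨m, n⟩ := x
    exact Prod.ext (map_add (Bal.map φ f) (Bal.tmul φ s m) (Bal.tmul φ (σ s) n)).symm
      (map_add (Bal.map φ f) (Bal.tmul φ (σ s) m) (Bal.tmul φ (-s) n)).symm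

/-- Faithful flatness for right supermodules implies faithful flatness for all left modules. -/
theorem leftFF_of_isFaithfullyFlat (h2 : (2 : K) ≠ 0) (h : IsFaithfullyFlat R S) : LeftFF φ := by
  intro M' M M'' _ _ _ _ _ _ _ _ _ _ _ _ f g
  have h1 := h _ _ _ (flipMap R f) (flipMap R g)
  have e1 : Function.Exact (flipMap R f).toLin (flipMap R g).toLin ↔ Function.Exact f g :=
    exact_prodMap (map_zero f) (map_zero g)
  have e2 : Function.Exact (TensorOver.map R S (flipMap R f)) (TensorOver.map R S (flipMap R g)) ↔
      Function.Exact (Prod.map (Bal.map φ f) (Bal.map φ f))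
        (Prod.map (Bal.map φ g) (Bal.map φ g)) := by
    constructor
    · intro hx y
      obtain ⟨y, rfl⟩ := (flipEquiv R M hσ hS h2).surjective y
      rw [← flipEquiv_map, LinearEquiv.map_eq_zero_iff, hx y]
      constructor
      · rintro ⟨z, rfl⟩
        exact ⟨flipEquiv R M' hσ hS h2 z, (flipEquiv_map R M' hσ hS h2 f z).symm⟩
      · rintro ⟨z, hz⟩
        obtain ⟨z, rfl⟩ := (flipEquiv R M' hσ hS h2).surjective z
        exact ⟨z, (flipEquiv R M hσ hS h2).injective ((flipEquiv_map R M' hσ hS h2 f z).trans hz)⟩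
    · intro hx y
      rw [← LinearEquiv.map_eq_zero_iff (flipEquiv R M'' hσ hS h2), flipEquiv_map, hx]
      constructor
      · rintro ⟨z, hz⟩
        obtain ⟨z, rfl⟩ := (flipEquiv R M' hσ hS h2).surjective z
        exact ⟨z, (flipEquiv R M hσ hS h2).injective ((flipEquiv_map R M' hσ hS h2 f z).trans hz)⟩
      · rintro ⟨z, rfl⟩
        exact ⟨flipEquiv R M' hσ hS h2 z, (flipEquiv_map R M' hσ hS h2 f z).symm⟩
  rw [← e1, h1, e2]
  exact exact_prodMap (map_zero _) (map_zero _)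

end Flip

end
end Super

namespace Super
noncomputable section
set_option linter.unusedSectionVars false
open Coalgebra

namespace CommSuperalg

variable {K : Type u} [Field K]

/-! ## Quotients and pushouts of commutative superalgebras -/

section Quotient

variable (E : CommSuperalg K) (J : Ideal E.carrier) (hJ : ∀ z ∈ J, E.ev z ∈ J ∧ E.od z ∈ J)
include hJ

/-- From zb = b z_0 + b' z_1, with b' the image of b under the parity automorphism, a left ideal
that contains the components of its elements absorbs right multiplication. -/
theorem isTwoSided_of_homogeneous : J.IsTwoSided where
  mul_mem_of_left {z} b hz := by
    have h : z * b = b * E.ev z + E.par b * E.od z := by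
      conv_lhs => rw [← ev_add_od z, add_mul]
      rw [even_comm E (ev_mem z), odd_mul (od_mem z)]
    rw [h]
    exact J.add_mem (J.mul_mem_left _ (hJ z hz).1) (J.mul_mem_left _ (hJ z hz).2)

/-- The quotient of a commutative superalgebra by a homogeneous ideal. -/
def quot : CommSuperalg K :=
  letI := E.isTwoSided_of_homogeneous J hJ
  let gr : ZMod 2 → Submodule K (E.carrier ⧸ J) :=
    fun i => (E.gr i).map (Ideal.Quotient.mkₐ K J).toLinearMap
  have hgr : DirectSum.IsInternal gr := by
    rw [internal_iff]
    constructor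
    · rw [Submodule.disjoint_def]
      rintro _ ⟨x, hx, rfl⟩ ⟨y, hy, hxy⟩
      have h : y - x ∈ J := by
        rw [← Ideal.Quotient.eq]; exact hxy
      have h' := (hJ _ h).1
      rw [map_sub, ev_of_odd hy, ev_of_even hx, zero_sub, neg_mem_iff] at h'
      exact Ideal.Quotient.eq_zero_iff_mem.2 h'
    · rw [codisjoint_iff, eq_top_iff]
      intro z _
      obtain ⟨z, rfl⟩ := Ideal.Quotient.mk_surjective z
      refine Submodule.mem_sup.2 ⟨_, ⟨_, E.ev_mem z, rfl⟩, _, ⟨_, E.od_mem z, rfl⟩, ?_⟩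
      exact (map_add (Ideal.Quotient.mk J) _ _).symm.trans (congrArg _ (ev_add_od z))
  { carrier := E.carrier ⧸ J
    gr := gr
    graded := gradedOfInternal hgr ⟨1, E.one_mem, map_one (Ideal.Quotient.mk J)⟩ (by
      rintro i j _ ⟨x, hx, rfl⟩ _ ⟨y, hy, rfl⟩
      exact ⟨x * y, E.mul_mem hx hy, map_mul (Ideal.Quotient.mk J) x y⟩)
    supercomm := by
      rintro i j _ ⟨x, hx, rfl⟩ _ ⟨y, hy, rfl⟩
      have h := congrArg (Ideal.Quotient.mkₐ K J).toLinearMap (E.supercomm i j x hx y hy)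
      rw [LinearMap.map_smul_of_tower] at h
      exact (map_mul (Ideal.Quotient.mk J) x y).symm.trans
        (h.trans (congrArg _ (map_mul (Ideal.Quotient.mk J) y x))) }

/-- The projection to the quotient superalgebra. -/
def quotMk : E ⟶ quot E J hJ :=
  letI := E.isTwoSided_of_homogeneous J hJ
  homMk (Ideal.Quotient.mkₐ K J) fun _ a ha => ⟨a, ha, rfl⟩

theorem quotMk_eq_zero {z : E} : hom (quotMk E J hJ) z = 0 ↔ z ∈ J :=
  letI := E.isTwoSided_of_homogeneous J hJ
  Ideal.Quotient.eq_zero_iff_mem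

end Quotient

section Pushout

variable {U S T : CommSuperalg K} (f : U ⟶ S) (g : U ⟶ T)

/-- The ideal of `S ⊗_K T` generated by the elements `f(u) ⊗ 1 - 1 ⊗ g(u)`. -/
def pushoutIdeal : Ideal (tensor S T).carrier :=
  Ideal.span {z | ∃ i, ∃ u ∈ U.gr i, z = inl S T (hom f u) - inr S T (hom g u)}

theorem diff_mem {i : ZMod 2} {u : U} (hu : u ∈ U.gr i) :
    inl S T (hom f u) - inr S T (hom g u) ∈ (tensor S T).gr i :=
  sub_mem (inl_mem (hom_mem f hu)) (inr_mem (hom_mem g hu))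

theorem pushoutIdeal_homogeneous (z : (tensor S T).carrier) (hz : z ∈ pushoutIdeal f g) :
    (tensor S T).ev z ∈ pushoutIdeal f g ∧ (tensor S T).od z ∈ pushoutIdeal f g := by
  induction hz using Submodule.span_induction with
  | mem z hz =>
    have h : z ∈ pushoutIdeal f g := Ideal.subset_span hz
    obtain ⟨i, u, hu, rfl⟩ := hz
    have hd := diff_mem f g hu
    rcases zmod2_cases i with rfl | rfl
    · rw [ev_of_even hd, od_of_even hd]
      exact ⟨h, zero_mem _⟩
    · rw [ev_of_odd hd, od_of_odd hd]
      exact ⟨zero_mem _, h⟩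
  | zero => rw [map_zero, map_zero]; exact ⟨zero_mem _, zero_mem _⟩
  | add x y _ _ hx hy =>
    rw [map_add, map_add]
    exact ⟨add_mem hx.1 hy.1, add_mem hx.2 hy.2⟩
  | smul a x _ hx =>
    rw [smul_eq_mul, ev_mul, od_mul]
    exact ⟨add_mem (Ideal.mul_mem_left _ _ hx.1) (Ideal.mul_mem_left _ _ hx.2),
      add_mem (Ideal.mul_mem_left _ _ hx.2) (Ideal.mul_mem_left _ _ hx.1)⟩

/-- The pushout `S ⊗_U T` in the category of commutative superalgebras. -/
def pushout : CommSuperalg K :=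
  quot (tensor S T) (pushoutIdeal f g) (pushoutIdeal_homogeneous f g)

/-- The first morphism to the pushout. -/
def pushoutInl : S ⟶ pushout f g :=
  tensorInl S T ≫ quotMk (tensor S T) (pushoutIdeal f g) (pushoutIdeal_homogeneous f g)

/-- The second morphism to the pushout. -/
def pushoutInr : T ⟶ pushout f g :=
  tensorInr S T ≫ quotMk (tensor S T) (pushoutIdeal f g) (pushoutIdeal_homogeneous f g)

theorem pushout_condition : f ≫ pushoutInl f g = g ≫ pushoutInr f g := by
  refine hom_ext fun u => ?_
  refine U.homog_induction (P := fun u => hom (f ≫ pushoutInl f g) u = hom (g ≫ pushoutInr f g) u)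
    (fun x y hx hy => by rw [map_add, map_add, hx, hy]) (fun i u hu => ?_) u
  refine sub_eq_zero.1 ?_
  refine (map_sub (hom (quotMk (tensor S T) (pushoutIdeal f g) (pushoutIdeal_homogeneous f g)))
    (inl S T (hom f u)) (inr S T (hom g u))).symm.trans ?_
  exact (quotMk_eq_zero _ _ _).2 (Ideal.subset_span ⟨i, u, hu, rfl⟩)

/-- Multiplying the generator attached to u by s ⊗ t gives, up to the sign of moving t past u, the
element sf(u) ⊗ t − s ⊗ g(u)t. So the ideal adds nothing to the balanced relations, and vanishing in
the pushout of superalgebras implies vanishing in S ⊗_U T. -/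
theorem mem_balRel_of_mem {z : (tensor S T).carrier} (hz : z ∈ pushoutIdeal f g) :
    (gtOf S T).symm z ∈ balRel (hom f) (Via (hom g)) := by
  have key : ∀ (i : ZMod 2) (u : U), u ∈ U.gr i → ∀ y : gt S T,
      (gtOf S T).symm (y * (inl S T (hom f u) - inr S T (hom g u))) ∈
        balRel (hom f) (Via (hom g)) := by
    intro i u hu y
    induction y using gt_induction with
    | hadd x y hx hy => rw [add_mul, map_add]; exact add_mem hx hy
    | h j s hs k t ht =>
      have e : inl S T s * inr S T t * (inl S T (hom f u) - inr S T (hom g u)) =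
          (-1 : ℤˣ) ^ (k * i) • (gtOf S T ((s * hom f u) ⊗ₜ t) -
            gtOf S T (s ⊗ₜ (hom g u * t))) := by
        rw [mul_assoc, (tensor S T).supercomm k i _ (inr_mem ht) _ (diff_mem f g hu), sub_mul,
          mul_smul_comm, mul_sub, ← mul_assoc, ← map_mul, ← map_mul, inl_mul_inr, inl_mul_inr]
      rw [e]
      have e2 : (gtOf S T).symm ((-1 : ℤˣ) ^ (k * i) • (gtOf S T ((s * hom f u) ⊗ₜ t) -
            gtOf S T (s ⊗ₜ (hom g u * t)))) = (-1 : ℤˣ) ^ (k * i) • ((s * hom f u) ⊗ₜ t -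
            s ⊗ₜ (hom g u * t)) := by
        refine (LinearMap.map_smul_of_tower (gtOf S T).symm.toLinearMap _ _).trans ?_
        rw [← map_sub]
        exact congrArg _ ((gtOf S T).symm_apply_apply _)
      rw [e2]
      have h3 : (s * hom f u) ⊗ₜ[K] (toVia (hom g) t) - s ⊗ₜ[K] (u • toVia (hom g) t) ∈
          balRel (hom f) (Via (hom g)) := by
        have h4 : hom f u ⊗ₜ[K] (toVia (hom g) t) - (1 : S) ⊗ₜ[K] (u • toVia (hom g) t) ∈
          balRel (hom f) (Via (hom g)) := Submodule.subset_span ⟨u, _, rfl⟩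
        have h5 := Submodule.smul_mem _ s h4
        rwa [smul_sub, TensorProduct.smul_tmul', TensorProduct.smul_tmul', smul_eq_mul,
          smul_eq_mul, mul_one] at h5
      rcases Int.units_eq_one_or ((-1 : ℤˣ) ^ (k * i)) with h | h <;> rw [h]
      · rw [one_smul]; exact h3
      · rw [Units.neg_smul, one_smul]; exact neg_mem h3
  induction hz using Submodule.span_induction with
  | mem z hz =>
    obtain ⟨i, u, hu, rfl⟩ := hz
    have := key i u hu 1
    rwa [one_mul] at this
  | zero => rw [map_zero]; exact zero_mem _
  | add x y _ _ hx hy => rw [map_add]; exact add_mem hx hy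
  | smul a x hx ih =>
    -- The balanced relations are a priori stable only under multiplication by S. The hypothesis for
    -- `x` alone is therefore useless, and the span is traversed again with `a` arbitrary.
    clear ih
    induction hx using Submodule.span_induction generalizing a with
    | mem z hz =>
      obtain ⟨i, u, hu, rfl⟩ := hz
      exact key i u hu a
    | zero => rw [smul_zero, map_zero]; exact zero_mem _
    | add x y _ _ hx hy => rw [smul_add, map_add]; exact add_mem (hx a) (hy a)
    | smul b x _ hx => rw [smul_smul]; exact hx (a * b)

/-- Equations in the pushout hold in the balanced tensor product. -/
theorem mk_eq_zero_of_pushout (x : S.carrier ⊗[K] T.carrier)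
    (hx : LinearMap.mul' K _ (TensorProduct.map (hom (pushoutInl f g)).toLinearMap
      (hom (pushoutInr f g)).toLinearMap x) = 0) :
    Bal.mk (hom f) (Via (hom g)) x = 0 := by
  refine (Bal.mk_eq_zero (hom f)).2 (mem_balRel_of_mem f g (z := gtOf S T x) ?_)
  refine (quotMk_eq_zero (tensor S T) (pushoutIdeal f g) (pushoutIdeal_homogeneous f g)).1 ?_
  refine Eq.trans ?_ hx
  refine LinearMap.congr_fun (f := (hom (quotMk (tensor S T) (pushoutIdeal f g)
    (pushoutIdeal_homogeneous f g))).toLinearMap ∘ₗ (gtOf S T).toLinearMap)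
    (g := LinearMap.mul' K (pushout f g).carrier ∘ₗ TensorProduct.map (hom (pushoutInl f g)).toLinearMap
      (hom (pushoutInr f g)).toLinearMap) (TensorProduct.ext' fun s t => ?_) x
  refine (congrArg (hom (quotMk (tensor S T) (pushoutIdeal f g)
    (pushoutIdeal_homogeneous f g))) (inl_mul_inr s t).symm).trans ?_
  exact map_mul _ _ _

/-- Translates agreement of two sections over the pushout into the equation required by descent for
elements. -/
theorem tmul_eq_of_pushout {s : S} {t : T}
    (h : hom (pushoutInl f g) s = hom (pushoutInr f g) t) :
    Bal.tmul (hom f) s (toVia (hom g) 1) = Bal.tmul (hom f) 1 (toVia (hom g) t) := by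
  refine sub_eq_zero.1 ?_
  refine (map_sub (Bal.mk (hom f) (Via (hom g))) _ _).symm.trans ?_
  refine mk_eq_zero_of_pushout f g (s ⊗ₜ 1 - 1 ⊗ₜ t) ?_
  rw [map_sub, map_sub, TensorProduct.map_tmul, TensorProduct.map_tmul, LinearMap.mul'_apply,
    LinearMap.mul'_apply]
  simp only [AlgHom.toLinearMap_apply, map_one, mul_one, one_mul]
  rw [h, sub_self]

end Pushout

end CommSuperalg

/-! ## Faithfully flat coverings -/

section Covering

open CommSuperalg

variable {K : Type u} [Field K]

theorem superCentral_hom {R S : CommSuperalg K} (f : R ⟶ S) : SuperCentral R (hom f) S.par where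
  invol := par_par
  even_mul r hr s := even_comm S (hom_mem f hr) s
  odd_mul r hr s := CommSuperalg.odd_mul (hom_mem f hr) s
  par_even r hr s := by rw [par_mul, par_of_even (hom_mem f hr)]
  par_odd r hr s := by rw [par_mul, par_of_odd (hom_mem f hr), neg_mul]

theorem leftFF_hom (h2 : (2 : K) ≠ 0) {R S : CommSuperalg K} (f : R ⟶ S) [Module R S]
    (hS : ∀ (r : R) (s : S), r • s = hom f r * s) (h : IsFaithfullyFlat R S) : LeftFF (hom f) :=
  leftFF_of_isFaithfullyFlat R (superCentral_hom f) hS h2 h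

variable {R : CommSuperalg K} {n : ℕ} {S : Fin n → CommSuperalg K} (f : ∀ i, R ⟶ S i)

/-- The morphism to the product of the members of a covering. -/
def piHom : R.carrier →ₐ[K] (∀ i, (S i).carrier) := AlgHom.pi fun i => hom (f i)

theorem piHom_apply (r : R) (i : Fin n) : piHom f r i = hom (f i) r := rfl

theorem leftFF_piHom (h2 : (2 : K) ≠ 0) (h : IsFFCovering R S f) : LeftFF (piHom f) := by
  let _ : Module R (∀ i, S i) :=
    Module.compHom _ (RingHom.pi fun i => ((alg (f i)).toAlgHom : R →+* S i))
  refine leftFF_of_isFaithfullyFlat R (σ := LinearMap.pi fun i => (S i).par ∘ₗ LinearMap.proj i)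
    ?_ (fun r s => rfl) h2 h
  exact
  { invol := fun s => funext fun i => par_par (s i)
    even_mul := fun r hr s => funext fun i => (superCentral_hom (f i)).even_mul r hr (s i)
    odd_mul := fun r hr s => funext fun i => (superCentral_hom (f i)).odd_mul r hr (s i)
    par_even := fun r hr s => funext fun i => (superCentral_hom (f i)).par_even r hr (s i)
    par_odd := fun r hr s => funext fun i => (superCentral_hom (f i)).par_odd r hr (s i) }

theorem single_piHom_mul (j : Fin n) (r : R) (s : S j) :
    Pi.single j (hom (f j) r * s) = piHom f r * Pi.single j s := by
  ext i
  by_cases h : i = j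
  · subst h; simp [piHom_apply]
  · simp [h]

/-- The inclusion of a factor as a map of left modules. -/
def singleVia (j : Fin n) : Via (hom (f j)) →ₗ[R] Via (piHom f) :=
  { (LinearMap.single K (fun i => (S i).carrier) j) with
    map_smul' := fun r s => single_piHom_mul f j r s }

/-- The map of `S_i ⊗_R M` to `(∏ S_i) ⊗_R M`. -/
def singleBal (i : Fin n) (M : Type u) [AddCommGroup M] [Module K M] [Module R M]
    [IsScalarTower K R M] : Bal (hom (f i)) M →ₗ[K] Bal (piHom f) M :=
  Bal.mapLeft (LinearMap.single K (fun i => (S i).carrier) i) (fun s r => by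
    change Pi.single i (s * hom (f i) r) = Pi.single i s * piHom f r
    ext k
    by_cases h : k = i
    · subst h; simp [piHom_apply]
    · simp [h])

/-- Decomposing both factors along the idempotents of the product splits the equation in P ⊗_R P,
for P = ∏ S_i, into the given equations in S_i ⊗_R S_j. Then descent for elements applies to R → P.
-/
theorem piHom_mem_range (h : LeftFF (piHom f)) (s : ∀ i, S i)
    (hs : ∀ i j, Bal.tmul (hom (f i)) (s i) (toVia (hom (f j)) 1) =
      Bal.tmul (hom (f i)) 1 (toVia (hom (f j)) (s j))) : ∃ r, piHom f r = s := by
  refine h.mem_range ?_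
  have key : ∀ i j, Bal.tmul (piHom f) (Pi.single i (s i)) (toVia (piHom f) (Pi.single j 1)) =
      Bal.tmul (piHom f) (Pi.single i 1) (toVia (piHom f) (Pi.single j (s j))) := fun i j =>
    congrArg (fun x => Bal.map (piHom f) (singleVia f j) (singleBal f i _ x)) (hs i j)
  have e1 : ∀ x y : ∀ i, S i, Bal.tmul (piHom f) x (toVia (piHom f) y) =
      ∑ i, ∑ j, Bal.tmul (piHom f) (Pi.single i (x i)) (toVia (piHom f) (Pi.single j (y j))) := by
    intro x y
    have ex : x = ∑ i, Pi.single i (x i) := (Finset.univ_sum_single x).symm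
    have ey : y = ∑ i, Pi.single i (y i) := (Finset.univ_sum_single y).symm
    conv_lhs => rw [ex, ey]
    change Bal.mk (piHom f) (Via (piHom f)) ((∑ i, Pi.single i (x i)) ⊗ₜ
      toVia (piHom f) (∑ i, Pi.single i (y i))) = _
    rw [map_sum, TensorProduct.sum_tmul]
    simp only [TensorProduct.tmul_sum, map_sum]
    rfl
  rw [e1, e1]
  exact Finset.sum_congr rfl fun i _ => Finset.sum_congr rfl fun j _ => key i j

/-- Affine superschemes are dur sheaves. -/
theorem isDurSheaf_SSp (h2 : (2 : K) ≠ 0) (B : CommSuperalg K) : IsDurSheaf (SSp B) := by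
  intro R n S f hcov x hx
  have hff := leftFF_piHom f h2 hcov
  have hin : Function.Injective (piHom f) := by
    rw [injective_iff_map_eq_zero]
    exact fun r hr => hff.injective hr
  have hr : ∀ b : B, ∃ r, piHom f r = piHom (fun i => (x i).down) b := fun b => by
    refine piHom_mem_range f hff _ fun i j => ?_
    -- Compatibility of the family is used for the universal completion of the square, the pushout.
    refine tmul_eq_of_pushout (f i) (f j) ?_
    have := congrArg ULift.down (hx i j _ _ _ (pushout_condition (f i) (f j)))
    exact congrArg (fun k => hom k b) this
  let ψ : B.carrier →ₐ[K] R.carrier := ((AlgEquiv.ofInjective (piHom f) hin).symm :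
    (piHom f).range →ₐ[K] R.carrier).comp
      ((piHom (fun i => (x i).down)).codRestrict (piHom f).range fun b => hr b)
  have hψ : ∀ b, piHom f (ψ b) = piHom (fun i => (x i).down) b := fun b =>
    congrArg Subtype.val ((AlgEquiv.ofInjective (piHom f) hin).apply_symm_apply
      ⟨piHom (fun i => (x i).down) b, hr b⟩)
  -- The glued morphism is even because a component of the wrong degree vanishes in every member of
  -- the covering, hence vanishes.
  have hgr : ∀ i, ∀ b ∈ B.gr i, ψ b ∈ R.gr i := by
    intro i b hb
    have hb' : ∀ k, hom (f k) (ψ b) ∈ (S k).gr i := fun k => by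
      rw [← piHom_apply, hψ]
      exact hom_mem _ hb
    obtain ⟨r0, h0, r1, h1, e⟩ := R.decomp (ψ b)
    rw [← e] at hb' ⊢
    rcases zmod2_cases i with rfl | rfl
    · have : r1 = 0 := hin <| by
        rw [map_zero]
        refine funext fun k => internal_disj (S k).isInternal (i := 0) (j := 1) (by decide) ?_
          (hom_mem (f k) h1)
        have h := sub_mem (hb' k) (hom_mem (f k) h0)
        rwa [map_add, add_sub_cancel_left] at h
      rwa [this, add_zero]
    · have : r0 = 0 := hin <| by
        rw [map_zero]
        refine funext fun k => internal_disj (S k).isInternal (i := 0) (j := 1) (by decide)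
          (hom_mem (f k) h0) ?_
        have h := sub_mem (hb' k) (hom_mem (f k) h1)
        rwa [map_add, add_sub_cancel_right] at h
      rwa [this, zero_add]
  refine ⟨ULift.up (homMk ψ hgr), fun i => ?_, fun y hy => ?_⟩
  · refine ULift.ext _ _ (hom_ext fun b => ?_)
    exact congrFun (hψ b) i
  · refine ULift.ext _ _ (hom_ext fun b => hin (funext fun i => ?_))
    refine Eq.trans ?_ (congrFun (hψ b) i).symm
    exact congrArg (fun k => hom (ULift.down k) b) (hy i)

end Covering

end
end Super

namespace Super
noncomputable section
set_option linter.unusedSectionVars false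
open Coalgebra

/-! ### Galois maps B → K[G] and affine quotients. -/

namespace ClosedSupersubgroup

open CommSuperalg

variable {K : Type u} [Field K] {G : AffineSupergroup K} (H : ClosedSupersubgroup G)

/-- The generic point of `SSp B`. -/
def genericPoint (B : CommSuperalg K) : (SSp B).obj B :=
  (ULift.up (𝟙 B) : ULift.{u + 1} (B ⟶ B))

section Galois

variable {B : CommSuperalg K} (φ : B ⟶ G.toCommSuperalg)

/-- The map `a ↦ ∑ S(a_1) ⊗ a_2` to `K[G] ⊗_B K[G]`. -/
def galMap (φ : B ⟶ G.toCommSuperalg) : G.carrier →ₗ[K] Bal (hom φ) (Via (hom φ)) :=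
  Bal.mkLin (hom φ) ∘ₗ TensorProduct.map G.antipode (toVia (hom φ)).toLinearMap ∘ₗ comul

/-- `B → K[G]` takes values in the invariants and separates cosets, in the sense that the map
`a ↦ ∑ S(a_1) ⊗ a_2` to `K[G] ⊗_B K[G]` factors through `K[H]`. -/
structure IsGalois : Prop where
  invariant : ∀ b, H.rightCoact (hom φ b) = hom φ b ⊗ₜ 1
  galMap_eq_zero : ∀ a, H.p a = 0 → galMap φ a = 0

variable {H φ}

/-- For invariant b the coaction is b ⊗ 1, so (gh)(b) = g(b) h(1) = g(b). -/
theorem comp_eq_of_sameCoset (hφ : ∀ b, H.rightCoact (hom φ b) = hom φ b ⊗ₜ 1)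
    {S : CommSuperalg K} {g g' : G.Points S} (h : H.SameCoset g g') : φ ≫ g = φ ≫ g' := by
  obtain ⟨h, rfl⟩ := h
  refine hom_ext fun b => ?_
  rw [hom_comp_apply, hom_comp_apply]
  refine Eq.trans ?_ (LinearMap.congr_fun (G.hom_mulPoints g (H.proj ≫ h)) (hom φ b)).symm
  have e : ∀ t : G.carrier ⊗[K] G.carrier, TensorProduct.map (hom g).toLinearMap
      (hom (H.proj ≫ h)).toLinearMap t = TensorProduct.map (hom g).toLinearMap
      (hom h).toLinearMap (H.p.lTensor G.carrier t) := fun t =>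
    (TensorProduct.map_map (hom g).toLinearMap (hom h).toLinearMap LinearMap.id H.p t).symm
  rw [cv_apply, e, show H.p.lTensor G.carrier (comul (hom φ b)) = hom φ b ⊗ₜ 1 from hφ b]
  simp

/-- If g and g' agree on B, then multiplying g on the left factor with g' on the right one is well
defined on K[G] ⊗_B K[G] and maps the class of ∑ S(a_1) ⊗ a_2 to (g⁻¹g')(a). So g⁻¹g' kills the
kernel of p. -/
theorem sameCoset_of_comp_eq (hφ : ∀ a, H.p a = 0 → galMap φ a = 0) {S : CommSuperalg K}
    {g g' : G.Points S} (h : φ ≫ g = φ ≫ g') : H.SameCoset g g' := by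
  rw [sameCoset_iff]
  intro a ha
  let Φ : Bal (hom φ) (Via (hom φ)) →ₗ[K] S.carrier :=
    Bal.lift (hom φ) (LinearMap.mul' K S.carrier ∘ₗ TensorProduct.map (hom g).toLinearMap
      ((hom g').toLinearMap ∘ₗ (toVia (hom φ)).symm.toLinearMap)) (fun s r m => by
        change hom g (s * hom φ r) * hom g' (show G.carrier from m) =
          hom g s * hom g' (hom φ r * (show G.carrier from m))
        rw [map_mul, map_mul, mul_assoc]
        exact congrArg (fun z => hom g s * (hom z r * hom g' (show G.carrier from m))) h)
  have e : Φ (galMap φ a) = cv ((hom g).toLinearMap ∘ₗ G.antipode) (hom g').toLinearMap a := by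
    rw [cv_apply]
    change LinearMap.mul' K S.carrier (TensorProduct.map _ _ (TensorProduct.map _ _ _)) = _
    rw [← LinearMap.comp_apply (TensorProduct.map _ _), ← TensorProduct.map_comp]
    rfl
  rw [← e, hφ a ha, map_zero]

/-- The map from the naive quotient to `SSp B`. -/
def naiveToSSp (hφ : ∀ b, H.rightCoact (hom φ b) = hom φ b ⊗ₜ 1) :
    H.naiveQuotient ⋙ uliftFunctor.{u + 1} ⟶ SSp B where
  app S := TypeCat.ofHom fun x => ULift.up (Quot.lift (fun g => φ ≫ g)
    (fun _ _ h => comp_eq_of_sameCoset hφ h) x.down)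
  naturality S T f := by
    ext ⟨x⟩
    induction x using Quot.ind
    rfl

/-- The class of the identity point of G descends along the one-member covering B → K[G]: two points
of G with the same restriction to B lie in one coset, so its pullbacks agree. A morphism to a dur
sheaf Z therefore yields one element of Z(B), which by Yoneda is a morphism from SSp B. -/
theorem isAssociatedDurSheaf_of_isGalois (h2 : (2 : K) ≠ 0) (hφ : H.IsGalois φ)
    (hcov : IsFFCovering B (fun _ : Fin 1 => G.toCommSuperalg) fun _ => φ) :
    IsAssociatedDurSheaf (naiveToSSp hφ.invariant) := by
  refine ⟨isDurSheaf_SSp h2 B, fun Z hZ β => ?_⟩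
  let q : ∀ {S : CommSuperalg K}, G.Points S → (H.naiveQuotient ⋙ uliftFunctor.{u + 1}).obj S :=
    fun g => ULift.up (Quot.mk _ g)
  have hβ : ∀ {S T : CommSuperalg K} (f : S ⟶ T) (g : G.Points S),
      Z.map f (β.app S (q g)) = β.app T (q (g ≫ f)) := fun {S T} f g =>
    (NatTrans.naturality_apply β f (q g)).symm
  obtain ⟨z, hz, hu⟩ := hZ B 1 _ _ hcov (fun _ => β.app _ (q (𝟙 G.toCommSuperalg)))
    (fun i j T g h e => by
      rw [hβ, hβ]
      refine congrArg (β.app T) (congrArg ULift.up (Quot.sound ?_))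
      exact sameCoset_of_comp_eq hφ.galMap_eq_zero e)
  let γ : SSp B ⟶ Z :=
    { app := fun S => TypeCat.ofHom fun x => Z.map x.down z
      naturality := fun S T f => by
        ext x
        exact FunctorToTypes.map_comp_apply Z x.down f z }
  refine ⟨γ, ?_, fun γ' hγ' => ?_⟩
  · ext S ⟨x⟩
    induction x using Quot.ind
    rename_i g
    refine (FunctorToTypes.map_comp_apply Z φ g z).trans ?_
    exact (congrArg _ (hz 0)).trans (hβ g _)
  -- A second factorization is determined by its value at the generic point, and that value
  -- restricts over K[G] to the class of the identity.
  · have e : γ'.app B (genericPoint B) = z := by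
      refine hu _ fun _ => ?_
      refine (NatTrans.naturality_apply γ' φ (genericPoint B)).symm.trans ?_
      rw [← hγ']
      rfl
    ext S x
    have := NatTrans.naturality_apply γ' x.down (genericPoint B)
    rw [e] at this
    exact this

end Galois

end ClosedSupersubgroup

end
end Super

namespace Super
noncomputable section
set_option linter.unusedSectionVars false
open Coalgebra

/-! ### Consequences of affineness: separation of cosets and the generic point. -/

section Local

open CommSuperalg

variable {K : Type u} [Field K] {R : CommSuperalg K} {n : ℕ} {S : Fin n → CommSuperalg K}
  (f : ∀ i, R ⟶ S i)

/-- Elements of a module vanish if they vanish on the members of a faithfully flat covering. -/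
theorem eq_zero_of_cover (h : LeftFF (piHom f)) {M : Type u} [AddCommGroup M] [Module K M]
    [Module R M] [IsScalarTower K R M] {m : M} (hm : ∀ i, Bal.tmul (hom (f i)) 1 m = 0) :
    m = 0 := by
  refine h.tmul_one_injective ?_
  have e : (1 : ∀ i, S i) = ∑ i, Pi.single i 1 := (Finset.univ_sum_single 1).symm
  change Bal.mk (piHom f) M ((1 : ∀ i, S i) ⊗ₜ m) = 0
  rw [e, TensorProduct.sum_tmul, map_sum]
  refine Finset.sum_eq_zero fun i _ => ?_
  exact (congrArg (singleBal f i M) (hm i)).trans (map_zero _)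

end Local

namespace ClosedSupersubgroup

open CommSuperalg

variable {K : Type u} [Field K] {G : AffineSupergroup K} (H : ClosedSupersubgroup G)

/-- A family of subsets of `G(T)`, for the superalgebras `T` over `S`, that is stable under
morphisms and local for faithfully flat coverings. -/
@[ext]
structure ClosedFamily (G : AffineSupergroup K) (S : CommSuperalg K) : Type (u + 1) where
  mem : ∀ T : CommSuperalg K, (S ⟶ T) → G.Points T → Prop
  map : ∀ {T T' : CommSuperalg K} (x : S ⟶ T) (f : T ⟶ T') (g : G.Points T),
    mem T x g → mem T' (x ≫ f) (g ≫ f)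
  closed : ∀ (U : CommSuperalg K) (n : ℕ) (V : Fin n → CommSuperalg K) (v : ∀ i, U ⟶ V i),
    IsFFCovering U V v → ∀ (T : CommSuperalg K) (k : U ⟶ T) (x : S ⟶ T) (g : G.Points T),
    (∀ (i : Fin n) (T' : CommSuperalg K) (a : T ⟶ T') (b : V i ⟶ T'), k ≫ a = v i ≫ b →
      mem T' (x ≫ a) (g ≫ a)) → mem T x g

/-- The `K`-functor of closed families. -/
def closedFamilies (G : AffineSupergroup K) : CommSuperalg K ⥤ Type (u + 1) where
  obj S := ClosedFamily G S
  map {S S'} f := TypeCat.ofHom fun Z =>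
    { mem := fun T x g => Z.mem T (f ≫ x) g
      map := fun x k g h => by rw [← Category.assoc]; exact Z.map _ k g h
      closed := fun U n V v hv T k x g h => Z.closed U n V v hv T k (f ≫ x) g
        fun i T' a b e => by rw [Category.assoc]; exact h i T' a b e }
  map_id S := by
    ext Z T x g
    change Z.mem T (𝟙 S ≫ x) g ↔ Z.mem T x g
    rw [Category.id_comp]
  map_comp f f' := by
    ext Z T x g
    change Z.mem T ((f ≫ f') ≫ x) g ↔ Z.mem T (f ≫ f' ≫ x) g
    rw [Category.assoc]

/-- The associated sheaf is known only through maps to given dur sheaves, so a sheaf is needed that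
remembers cosets. Families of subsets of G(T), for T over S, glue by testing membership over the
members of a covering, and the locality built into a family makes the result unique. -/
theorem isDurSheaf_closedFamilies : IsDurSheaf (closedFamilies G) := by
  intro R n S f hcov Z hZ
  let Z' : ∀ i, ClosedFamily G (S i) := Z
  have hZ' : ∀ (i j : Fin n) (T : CommSuperalg K) (c : S i ⟶ T) (d : S j ⟶ T) (g : G.Points T),
      f i ≫ c = f j ≫ d → (Z' i).mem T c g → (Z' j).mem T d g := by
    intro i j T c d g e h
    have h1 := congrArg (fun W : ClosedFamily G T => W.mem T (𝟙 T) g) (hZ i j T c d e)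
    change (Z' i).mem T (c ≫ 𝟙 T) g = (Z' j).mem T (d ≫ 𝟙 T) g at h1
    rw [Category.comp_id, Category.comp_id] at h1
    rwa [← h1]
  -- Membership in the glued family is tested at every T' that receives both T and some member of
  -- the covering, compatibly over R.
  let W : ClosedFamily G R :=
    { mem := fun T x g => ∀ (i : Fin n) (T' : CommSuperalg K) (c : S i ⟶ T') (k : T ⟶ T'),
        f i ≫ c = x ≫ k → (Z' i).mem T' c (g ≫ k)
      map := fun x k g h i T' c l e => by
        rw [Category.assoc]
        exact h i T' c (k ≫ l) (by rw [e, Category.assoc])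
      closed := fun U m V v hv T k x g h i T1 c l e => by
        refine (Z' i).closed U m V v hv T1 (k ≫ l) c (g ≫ l) fun j T' a b e' => ?_
        have h1 := h j T' (l ≫ a) b (by rw [← Category.assoc, e']) i T' (c ≫ a) (𝟙 T')
          (by rw [Category.comp_id, ← Category.assoc, e, Category.assoc])
        rwa [Category.comp_id, ← Category.assoc] at h1 }
  refine ⟨W, fun i => ?_, fun W' hW' => ?_⟩
  · refine ClosedFamily.ext (funext fun T => funext fun x => funext fun g => propext ?_)
    constructor
    · intro h
      have h1 := h i T x (𝟙 T) (by rw [Category.comp_id])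
      rwa [Category.comp_id] at h1
    · intro h j T' c k e
      refine hZ' i j T' (x ≫ k) c (g ≫ k) (by rw [e, Category.assoc]) ?_
      exact (Z' i).map x k g h
  · let W'' : ClosedFamily G R := W'
    have e : ∀ i T x g, W''.mem T (f i ≫ x) g = (Z' i).mem T x g := fun i T x g =>
      congrArg (fun V : ClosedFamily G (S i) => V.mem T x g) (hW' i)
    refine ClosedFamily.ext (funext fun T => funext fun x => funext fun g => propext ?_)
    constructor
    · intro h i T' c k e'
      rw [← e, e']
      exact W''.map x k g h
    · intro h
      -- Locality of the competing family, applied to the given covering itself, yields uniqueness.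
      refine W''.closed R n S f hcov T x x g fun i T' a b e' => ?_
      rw [e', e]
      exact h i T' b a e'.symm

/-- The closed family of the points in a coset. -/
def cosetFamily (h2 : (2 : K) ≠ 0) {S : CommSuperalg K} (g : G.Points S) : ClosedFamily G S where
  mem T x g' := H.SameCoset (g ≫ x) g'
  map {T T'} x f g' h := by
    obtain ⟨h, rfl⟩ := h
    refine ⟨h ≫ f, ?_⟩
    rw [G.mulPoints_comp, Category.assoc, Category.assoc]
  closed U n V v hv T k x g' h := by
    -- Lying in one coset is expressed by equations in T. They are checked over the covering of U by
    -- viewing T as a U-module and passing to the pushouts of V_i and T.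
    rw [sameCoset_iff]
    intro a ha
    refine eq_zero_of_cover v (leftFF_piHom v h2 hv) (M := Via (hom k))
      (m := toVia (hom k) (cv ((hom (g ≫ x)).toLinearMap ∘ₗ G.antipode) (hom g').toLinearMap a))
      fun i => ?_
    have h1 := h i (pushout (v i) k) (pushoutInr (v i) k) (pushoutInl (v i) k)
      (pushout_condition (v i) k).symm
    rw [sameCoset_iff] at h1
    refine mk_eq_zero_of_pushout (v i) k (1 ⊗ₜ _) ?_
    change hom (pushoutInl (v i) k) 1 * hom (pushoutInr (v i) k)
      (cv ((hom (g ≫ x)).toLinearMap ∘ₗ G.antipode) (hom g').toLinearMap a) = 0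
    rw [map_one, one_mul]
    refine Eq.trans ?_ (h1 a ha)
    exact LinearMap.congr_fun (comp_cv (hom (pushoutInr (v i) k))
      ((hom (g ≫ x)).toLinearMap ∘ₗ G.antipode) (hom g').toLinearMap) a

/-- The map from the naive quotient to the closed families. -/
def naiveToClosedFamilies (h2 : (2 : K) ≠ 0) :
    H.naiveQuotient ⋙ uliftFunctor.{u + 1} ⟶ closedFamilies G where
  app S := TypeCat.ofHom fun x => Quot.lift (H.cosetFamily h2) (fun g g' h =>
    ClosedFamily.ext (funext fun T => funext fun x => funext fun k => propext
      (by
        have h' : H.SameCoset (g ≫ x) (g' ≫ x) := by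
          obtain ⟨h, rfl⟩ := h
          refine ⟨h ≫ x, ?_⟩
          rw [G.mulPoints_comp, Category.assoc]
        exact ⟨fun e => H.sameCoset_trans (H.sameCoset_symm h') e,
          fun e => H.sameCoset_trans h' e⟩))) x.down
  naturality S T f := by
    ext ⟨x⟩
    induction x using Quot.ind
    rename_i g
    refine ClosedFamily.ext (funext fun T => funext fun x => funext fun k => ?_)
    change H.SameCoset ((g ≫ f) ≫ x) k = H.SameCoset (g ≫ f ≫ x) k
    rw [Category.assoc]

section Associated

variable {H} {B : CommSuperalg K} {α : H.naiveQuotient ⋙ uliftFunctor.{u + 1} ⟶ SSp B}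

/-- The class of a point in the naive quotient. -/
def cls (H : ClosedSupersubgroup G) {S : CommSuperalg K} (g : G.Points S) :
    (H.naiveQuotient ⋙ uliftFunctor.{u + 1}).obj S :=
  (ULift.up (Quot.mk _ g) : ULift.{u + 1} (Quot (H.SameCoset (S := S))))

/-- The morphism `B → K[G]` given by the image of the generic point. -/
def coordMap (α : H.naiveQuotient ⋙ uliftFunctor.{u + 1} ⟶ SSp B) : B ⟶ G.toCommSuperalg :=
  (α.app G.toCommSuperalg (H.cls (𝟙 G.toCommSuperalg)) :
    ULift.{u + 1} (B ⟶ G.toCommSuperalg)).down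

/-- Naturality along g, applied to the class of the identity point: the Yoneda description of α. -/
theorem app_cls {S : CommSuperalg K} (g : G.Points S) :
    (α.app S (H.cls g) : ULift.{u + 1} (B ⟶ S)).down = coordMap α ≫ g :=
  congrArg ULift.down (NatTrans.naturality_apply α g (H.cls (𝟙 G.toCommSuperalg)))

/-- The map to coset families factors through α by the universal property. Points with the same
image under α thus have the same coset family, and the coset of g' contains g'. -/
theorem sameCoset_of_coordMap (h2 : (2 : K) ≠ 0) (hα : IsAssociatedDurSheaf α)
    {S : CommSuperalg K} {g g' : G.Points S} (h : coordMap α ≫ g = coordMap α ≫ g') :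
    H.SameCoset g g' := by
  obtain ⟨γ, hγ, _⟩ := hα.2 _ isDurSheaf_closedFamilies (H.naiveToClosedFamilies h2)
  have e : α.app S (H.cls g) = α.app S (H.cls g') := by
    refine ULift.ext _ _ ?_
    exact (app_cls g).trans (h.trans (app_cls g').symm)
  have e' : (H.naiveToClosedFamilies h2).app S (H.cls g) =
      (H.naiveToClosedFamilies h2).app S (H.cls g') := by
    rw [← hγ]
    exact congrArg (γ.app S) e
  have e2 := congrArg (fun Z : ClosedFamily G S => Z.mem S (𝟙 S) g') e'
  change H.SameCoset (g ≫ 𝟙 S) g' = H.SameCoset (g' ≫ 𝟙 S) g' at e2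
  rw [Category.comp_id, Category.comp_id] at e2
  rw [e2]
  exact H.sameCoset_refl g'

theorem coordMap_eq_of_sameCoset {S : CommSuperalg K} {g g' : G.Points S}
    (h : H.SameCoset g g') : coordMap α ≫ g = coordMap α ≫ g' := by
  refine (app_cls g).symm.trans (Eq.trans ?_ (app_cls g'))
  refine congrArg (fun y => (α.app S y : ULift.{u + 1} (B ⟶ S)).down) ?_
  exact congrArg ULift.up (Quot.sound h)

/-- Two universal instances suffice. Invariance compares i1 and i1·i2 over K[G] ⊗ K[H]; the Galois
condition is the fact that the two tautological points of G over the pushout K[G] ⊗_B K[G] lie in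
one coset. -/
theorem isGalois_coordMap (h2 : (2 : K) ≠ 0) (hα : IsAssociatedDurSheaf α) :
    H.IsGalois (coordMap α) where
  invariant b := by
    let i1 : G.Points (tensor G.toCommSuperalg H.toCommSuperalg) := tensorInl _ _
    let i2 : H.toAffineSupergroup.Points (tensor G.toCommSuperalg H.toCommSuperalg) :=
      tensorInr _ _
    have h : H.SameCoset i1 (G.mulPoints i1 (H.proj ≫ i2)) := ⟨i2, rfl⟩
    have e := congrArg (fun k => hom k b) (coordMap_eq_of_sameCoset (α := α) h)
    have e1 : hom (G.mulPoints i1 (H.proj ≫ i2)) (hom (coordMap α) b) =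
        H.rightCoactAlg (hom (coordMap α) b) := by
      have := LinearMap.congr_fun (G.hom_mulPoints i1 (H.proj ≫ i2)) (hom (coordMap α) b)
      refine this.trans ?_
      exact (LinearMap.congr_fun H.rightCoactAlg_eq (hom (coordMap α) b)).symm
    refine (gtOf G.toCommSuperalg H.toCommSuperalg).injective ?_
    rw [← rightCoactAlg_eq_gtOf, ← e1]
    exact e.symm
  galMap_eq_zero a ha := by
    have h := sameCoset_of_coordMap h2 hα (pushout_condition (coordMap α) (coordMap α))
    rw [sameCoset_iff] at h
    refine mk_eq_zero_of_pushout (coordMap α) (coordMap α)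
      (TensorProduct.map G.antipode LinearMap.id (comul a)) ?_
    refine Eq.trans ?_ (h a ha)
    rw [cv_apply, TensorProduct.map_map]
    rfl

/-- A property of the points of `SSp B` that is stable under morphisms, local for faithfully flat
coverings, and true for the points that come from `G`, is true for the generic point. -/
theorem property_generic (h2 : (2 : K) ≠ 0) (hα : IsAssociatedDurSheaf α)
    (P : ∀ T : CommSuperalg K, (B ⟶ T) → Prop)
    (hmap : ∀ (T T' : CommSuperalg K) (x : B ⟶ T) (f : T ⟶ T'), P T x → P T' (x ≫ f))
    (hlocal : ∀ (T : CommSuperalg K) (n : ℕ) (S : Fin n → CommSuperalg K) (f : ∀ i, T ⟶ S i),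
      IsFFCovering T S f → ∀ x : B ⟶ T, (∀ i, P (S i) (x ≫ f i)) → P T x)
    (hG : ∀ (T : CommSuperalg K) (g : G.Points T), P T (coordMap α ≫ g)) : P B (𝟙 B) := by
  -- The subfunctor of SSp B cut out by P. Since P is local and SSp B is a sheaf, it is a dur sheaf.
  let Z : CommSuperalg K ⥤ Type (u + 1) :=
    { obj := fun T => ULift.{u + 1} {x : B ⟶ T // P T x}
      map := fun {T T'} f => TypeCat.ofHom fun x => ULift.up ⟨x.down.1 ≫ f,
        hmap T T' _ f x.down.2⟩
      map_id := fun T => by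
        refine ConcreteCategory.hom_ext (C := Type (u + 1)) _ _ fun x => ?_
        refine ULift.ext _ _ ?_
        refine Subtype.ext ?_
        exact Category.comp_id x.down.1
      map_comp := fun f f' => by
        refine ConcreteCategory.hom_ext (C := Type (u + 1)) _ _ fun x => ?_
        refine ULift.ext _ _ ?_
        refine Subtype.ext ?_
        exact (Category.assoc x.down.1 f f').symm }
  let ι : Z ⟶ SSp B :=
    { app := fun T => TypeCat.ofHom fun x => ULift.up x.down.1
      naturality := fun T T' f => by ext x; rfl }
  have hZ : IsDurSheaf Z := by
    intro R n S f hcov x hx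
    obtain ⟨y, hy, hu⟩ := isDurSheaf_SSp h2 B R n S f hcov (fun i => ι.app (S i) (x i))
      (fun i j T g h e => congrArg (ι.app T) (hx i j T g h e))
    have hy' : ∀ i, (y : ULift.{u + 1} (B ⟶ R)).down ≫ f i = (x i).down.1 := fun i =>
      congrArg ULift.down (hy i)
    refine ⟨ULift.up ⟨(y : ULift.{u + 1} (B ⟶ R)).down, hlocal R n S f hcov _ fun i => ?_⟩,
      fun i => ?_, fun z hz => ?_⟩
    · rw [hy' i]; exact (x i).down.2
    · exact ULift.ext _ _ (Subtype.ext (hy' i))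
    · have := hu (ι.app R z) fun i => congrArg (ι.app (S i)) (hz i)
      exact ULift.ext _ _ (Subtype.ext (congrArg ULift.down this))
  have hP : ∀ (T : CommSuperalg K) (y : (H.naiveQuotient ⋙ uliftFunctor.{u + 1}).obj T),
      P T (α.app T y : ULift.{u + 1} (B ⟶ T)).down := by
    rintro T ⟨y⟩
    induction y using Quot.ind
    rename_i g
    have := hG T g
    rw [← app_cls] at this
    exact this
  let β : H.naiveQuotient ⋙ uliftFunctor.{u + 1} ⟶ Z :=
    { app := fun T => TypeCat.ofHom fun y =>
        ULift.up ⟨(α.app T y : ULift.{u + 1} (B ⟶ T)).down, hP T y⟩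
      naturality := fun T T' f => ConcreteCategory.hom_ext (C := Type (u + 1)) _ _ fun y =>
        ULift.ext _ _ (Subtype.ext (congrArg ULift.down (NatTrans.naturality_apply α f y))) }
  -- α takes values in Z, so it factors through the inclusion of Z. By uniqueness in the universal
  -- property the identity of SSp B factors as well, and the generic point satisfies P.
  obtain ⟨γ, hγ, _⟩ := hα.2 Z hZ β
  obtain ⟨_, _, hu⟩ := hα.2 (SSp B) hα.1 α
  have e0 : α ≫ γ ≫ ι = α := by rw [← Category.assoc, hγ]; rfl
  have e1 : γ ≫ ι = 𝟙 (SSp B) := (hu _ e0).trans (hu _ (Category.comp_id α)).symm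
  have e2 : (γ.app B (genericPoint B)).down.1 = 𝟙 B :=
    congrArg (fun κ : SSp B ⟶ SSp B =>
      (κ.app B (genericPoint B) : ULift.{u + 1} (B ⟶ B)).down) e1
  rw [← e2]
  exact (γ.app B (genericPoint B)).down.2

end Associated

end ClosedSupersubgroup

end
end Super

namespace Super
noncomputable section
set_option linter.unusedSectionVars false
open Coalgebra

/-! ## Convolution on modules -/

section ModuleConvolution

variable {K C E M : Type*} [Field K] [AddCommGroup C] [Module K C] [Coalgebra K C] [Ring E]
  [Algebra K E] [AddCommGroup M] [Module K M] [Module E M] [IsScalarTower K E M]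

/-- The scalar multiplication as a linear map. -/
def actLin (K E M : Type*) [Field K] [Ring E] [Algebra K E] [AddCommGroup M] [Module K M]
    [Module E M] [IsScalarTower K E M] : E ⊗[K] M →ₗ[K] M :=
  TensorProduct.lift (Algebra.lsmul K K M).toLinearMap

@[simp] theorem actLin_tmul (e : E) (m : M) : actLin K E M (e ⊗ₜ m) = e • m := rfl

/-- The convolution `c ↦ ∑ f(c_1) x(c_2)` of a map to an algebra and a map to a module. -/
def mcv (f : C →ₗ[K] E) (x : C →ₗ[K] M) : C →ₗ[K] M :=
  actLin K E M ∘ₗ TensorProduct.map f x ∘ₗ comul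

theorem mcv_apply (f : C →ₗ[K] E) (x : C →ₗ[K] M) (c : C) :
    mcv f x c = actLin K E M (TensorProduct.map f x (comul c)) := rfl

theorem mcv_eq_cv (f g : C →ₗ[K] E) : mcv f g = cv f g := rfl

/-- Coassociativity. With `cvOne_mcv` it makes the linear maps C → M a module over the convolution
algebra of maps C → E. -/
theorem mcv_mcv (f g : C →ₗ[K] E) (x : C →ₗ[K] M) : mcv f (mcv g x) = mcv (cv f g) x := by
  ext c
  have e1 : ∀ t : C ⊗[K] C, TensorProduct.map f (mcv g x) t =
      (actLin K E M).lTensor E (TensorProduct.map f (TensorProduct.map g x)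
        (comul.lTensor C t)) := fun t => by
    induction t with
    | zero => simp
    | add x y hx hy => simp only [map_add, hx, hy]
    | tmul a b => rfl
  have e2 : ∀ t : C ⊗[K] C, actLin K E M ((actLin K E M).lTensor E (TensorProduct.map f
      (TensorProduct.map g x) (TensorProduct.assoc K C C C (comul.rTensor C t)))) =
      actLin K E M (TensorProduct.map (cv f g) x t) := fun t => by
    induction t with
    | zero => simp
    | add x y hx hy => simp only [map_add, hx, hy]
    | tmul a b =>
      rw [LinearMap.rTensor_tmul, TensorProduct.map_tmul, cv_apply]
      induction (comul a : C ⊗[K] C) with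
      | zero => simp
      | add x y hx hy => simp only [map_add, TensorProduct.add_tmul, hx, hy]
      | tmul a b => simp [mul_smul]
  rw [mcv_apply, mcv_apply, e1, ← Coalgebra.coassoc_apply, e2]

@[simp] theorem cvOne_mcv (x : C →ₗ[K] M) : mcv (cvOne K C E) x = x := by
  ext c
  have e : ∀ t : C ⊗[K] C, actLin K E M (TensorProduct.map (cvOne K C E) x t) =
      x (TensorProduct.lid K C (counit.rTensor C t)) := fun t => by
    induction t with
    | zero => simp
    | add x y hx hy => simp only [map_add, hx, hy]
    | tmul a b => simp [cvOne_apply]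
  rw [mcv_apply, e, Coalgebra.rTensor_counit_comul]
  simp

theorem comp_mcv {M' : Type*} [AddCommGroup M'] [Module K M'] [Module E M'] [IsScalarTower K E M']
    (φ : M →ₗ[K] M') (hφ : ∀ (e : E) (m : M), φ (e • m) = e • φ m) (f : C →ₗ[K] E)
    (x : C →ₗ[K] M) : φ ∘ₗ mcv f x = mcv f (φ ∘ₗ x) := by
  ext c
  rw [LinearMap.comp_apply, mcv_apply, mcv_apply]
  induction (comul c : C ⊗[K] C) with
  | zero => simp
  | add x y hx hy => simp only [map_add, hx, hy]
  | tmul a b => simp [hφ]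

/-- By coassociativity, convolution on the left leg commutes with splitting off a right leg. -/
theorem mcv_rTensor (f : C →ₗ[K] E) (x : C →ₗ[K] M) (c : C) :
    (mcv f x).rTensor C (comul c) = mcv f (x.rTensor C ∘ₗ comul) c := by
  have e1 : ∀ t : C ⊗[K] C, actLin K E (M ⊗[K] C) (TensorProduct.map f
      (x.rTensor C ∘ₗ comul) t) = actLin K E (M ⊗[K] C) (TensorProduct.map f (x.rTensor C)
        (comul.lTensor C t)) := fun t => by
    induction t with
    | zero => simp
    | add x y hx hy => simp only [map_add, hx, hy]
    | tmul a b => rfl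
  have e2 : ∀ t : C ⊗[K] C, actLin K E (M ⊗[K] C) (TensorProduct.map f (x.rTensor C)
      (TensorProduct.assoc K C C C (comul.rTensor C t))) = (mcv f x).rTensor C t := fun t => by
    induction t with
    | zero => simp
    | add x y hx hy => simp only [map_add, hx, hy]
    | tmul a b =>
      rw [LinearMap.rTensor_tmul, LinearMap.rTensor_tmul, mcv_apply]
      induction (comul a : C ⊗[K] C) with
      | zero => simp
      | add x y hx hy => simp only [map_add, TensorProduct.add_tmul, hx, hy]
      | tmul a b => simp [TensorProduct.smul_tmul']
  rw [mcv_apply, e1, ← Coalgebra.coassoc_apply, e2]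

end ModuleConvolution

/-! ## Balanced tensor products and vector spaces -/

namespace Bal

variable {K R S : Type u} [Field K] [Ring R] [Algebra K R] [Ring S] [Algebra K S]
  (φ : R →ₐ[K] S) (M : Type u) [AddCommGroup M] [Module K M] [Module R M] [IsScalarTower K R M]
  (V : Type u) [AddCommGroup V] [Module K V]

/-- The map `(s ⊗ m) ⊗ v ↦ s ⊗ (m ⊗ v)`. -/
def assocMap : Bal φ M ⊗[K] V →ₗ[K] Bal φ (M ⊗[K] V) :=
  TensorProduct.lift (lift φ (TensorProduct.curry
    (mkLin φ ∘ₗ (TensorProduct.assoc K S M V).toLinearMap)) fun s r m => by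
      ext v
      change tmul φ (s * φ r) (m ⊗ₜ v) = tmul φ s ((r • m) ⊗ₜ v)
      rw [← TensorProduct.smul_tmul', tmul_smul])

variable {M V}

@[simp] theorem assocMap_tmul (s : S) (m : M) (v : V) :
    assocMap φ M V (tmul φ s m ⊗ₜ v) = tmul φ s (m ⊗ₜ v) := rfl

theorem assocMap_smul (s : S) (x : Bal φ M) (v : V) :
    assocMap φ M V ((s • x) ⊗ₜ v) = s • assocMap φ M V (x ⊗ₜ v) := by
  induction x using induction with
  | h0 => simp
  | hadd x y hx hy => simp only [smul_add, TensorProduct.add_tmul, map_add, hx, hy]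
  | h t m => rw [smul_tmul, assocMap_tmul, assocMap_tmul, smul_tmul]

theorem assocMap_smul' (s : S) (x : Bal φ M ⊗[K] V) :
    assocMap φ M V (s • x) = s • assocMap φ M V x := by
  induction x with
  | zero => simp
  | add x y hx hy => simp only [smul_add, map_add, hx, hy]
  | tmul x v => exact assocMap_smul φ s x v

end Bal

end
end Super

namespace Super
noncomputable section
set_option linter.unusedSectionVars false
open Coalgebra

/-- A linear map factors through a surjection if it vanishes on its kernel. -/
theorem exists_factor {K V W X : Type*} [Field K] [AddCommGroup V] [Module K V] [AddCommGroup W]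
    [Module K W] [AddCommGroup X] [Module K X] {p : V →ₗ[K] W} (hp : Function.Surjective p)
    (q : V →ₗ[K] X) (h : ∀ v, p v = 0 → q v = 0) : ∃ q' : W →ₗ[K] X, q' ∘ₗ p = q := by
  obtain ⟨s, hs⟩ := p.exists_rightInverse_of_surjective (LinearMap.range_eq_top.2 hp)
  refine ⟨q ∘ₗ s, LinearMap.ext fun v => ?_⟩
  have h1 : q (s (p v) - v) = 0 := h _ (by
    rw [map_sub, sub_eq_zero]; exact LinearMap.congr_fun hs (p v))
  rw [map_sub, sub_eq_zero] at h1
  exact h1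

/-- The map `m ⊗ v ↦ m ⊗ f(v)` as a map of left modules. -/
def tensorRight {K : Type u} [Field K] (R M : Type u) [Ring R] [Algebra K R] [AddCommGroup M]
    [Module K M] [Module R M] [IsScalarTower K R M] {V V' : Type u} [AddCommGroup V] [Module K V]
    [AddCommGroup V'] [Module K V'] (f : V →ₗ[K] V') : M ⊗[K] V →ₗ[R] M ⊗[K] V' :=
  TensorProduct.AlgebraTensorModule.map LinearMap.id f

/-! ### Cotensor products after base change along a point of G. -/

namespace ClosedSupersubgroup

open CommSuperalg

variable {K : Type u} [Field K] {G : AffineSupergroup K} {H : ClosedSupersubgroup G}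
  {B : CommSuperalg K} {φ : B ⟶ G.toCommSuperalg}

section Coaction

variable (hφ : ∀ b, H.rightCoact (hom φ b) = hom φ b ⊗ₜ 1)

/-- The coaction on `K[G]` as a map of left `B`-modules. -/
def coactVia (hφ : ∀ b, H.rightCoact (hom φ b) = hom φ b ⊗ₜ 1) :
    Via (hom φ) →ₗ[B.carrier] Via (hom φ) ⊗[K] H.carrier :=
  { (H.rightCoact : G.carrier →ₗ[K] G.carrier ⊗[K] H.carrier) with
    map_smul' := fun b a => by
      refine (H.rightCoact_mul (hom φ b) a (hφ b)).trans ?_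
      change _ = b • (show Via (hom φ) ⊗[K] H.carrier from H.rightCoact a)
      generalize H.rightCoact a = t
      induction t with
      | zero => rw [map_zero]; exact (smul_zero (A := Via (hom φ) ⊗[K] H.carrier) b).symm
      | add x y hx hy => rw [map_add, hx, hy]; exact (smul_add (A := Via (hom φ) ⊗[K] H.carrier) b x y).symm
      | tmul x y => rfl }

/-- The map `a ⊗ v ↦ ρ(a) ⊗ v`. -/
def coactLin (V : Type u) [AddCommGroup V] [Module K V] :
    Via (hom φ) ⊗[K] V →ₗ[B.carrier] Via (hom φ) ⊗[K] (H.carrier ⊗[K] V) :=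
  (TensorProduct.AlgebraTensorModule.assoc K K B.carrier (Via (hom φ)) H.carrier V).toLinearMap ∘ₗ
    TensorProduct.AlgebraTensorModule.map (coactVia hφ) LinearMap.id

theorem coactLin_tmul {V : Type u} [AddCommGroup V] [Module K V] (a : G) (v : V) :
    coactLin hφ V (toVia (hom φ) a ⊗ₜ v) =
      TensorProduct.assoc K G.carrier H.carrier V (H.rightCoact a ⊗ₜ v) := rfl

/-- The map whose kernel is the cotensor product, as a map of `B`-modules. -/
def cotensorLin (N : LeftSComod H.toAffineSupergroup) :
    Via (hom φ) ⊗[K] N.carrier →ₗ[B.carrier] Via (hom φ) ⊗[K] (H.carrier ⊗[K] N.carrier) :=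
  coactLin hφ N.carrier - tensorRight B.carrier (Via (hom φ)) N.coact

end Coaction

section Descent

variable (hφ : H.IsGalois φ) {S : CommSuperalg K} (g : G.toCommSuperalg ⟶ S)
include hφ

/-- The Galois condition, pushed forward along g on the left factor, says that ∑ g(S(a_1)) ⊗ a_2
vanishes when p(a) = 0. -/
theorem exists_galois : ∃ q : H.carrier →ₗ[K] Bal (hom (φ ≫ g)) (Via (hom φ)),
    q ∘ₗ H.p = mcv ((hom g).toLinearMap ∘ₗ G.antipode)
      (Bal.mkLin (hom (φ ≫ g)) ∘ₗ TensorProduct.mk K S.carrier (Via (hom φ)) 1 ∘ₗ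
        (toVia (hom φ)).toLinearMap) := by
  refine exists_factor H.p_surjective _ fun a ha => ?_
  have h := congrArg (Bal.mapLeft (φ := hom φ) (φ' := hom (φ ≫ g)) (hom g).toLinearMap
    (fun s r => map_mul (hom g) s (hom φ r))) (hφ.galMap_eq_zero a ha)
  rw [map_zero] at h
  refine Eq.trans ?_ h
  rw [mcv_apply]
  change _ = Bal.mapLeft (hom g).toLinearMap _ (Bal.mkLin (hom φ) (TensorProduct.map _ _ _))
  induction (comul a : G.carrier ⊗[K] G.carrier) with
  | zero => simp only [map_zero]
  | add x y hx hy => simp only [map_add, hx, hy]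
  | tmul a b =>
    change hom g (G.antipode a) • Bal.tmul (hom (φ ≫ g)) 1 (toVia (hom φ) b) =
      Bal.tmul (hom (φ ≫ g)) (hom g (G.antipode a)) (toVia (hom φ) b)
    rw [Bal.smul_one_tmul]

/-- The map `C → S ⊗_B A`, `p(a) ↦ ∑ g(S(a_1)) ⊗ a_2`. -/
def galois : H.carrier →ₗ[K] Bal (hom (φ ≫ g)) (Via (hom φ)) := (exists_galois hφ g).choose

variable {g} in
/-- `a ↦ 1 ⊗ a`. -/
def oneTmul (φ : B ⟶ G.toCommSuperalg) (g : G.toCommSuperalg ⟶ S) :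
    G.carrier →ₗ[K] Bal (hom (φ ≫ g)) (Via (hom φ)) :=
  Bal.mkLin (hom (φ ≫ g)) ∘ₗ TensorProduct.mk K S.carrier (Via (hom φ)) 1 ∘ₗ
        (toVia (hom φ)).toLinearMap

theorem galois_comp : galois hφ g ∘ₗ H.p =
    mcv ((hom g).toLinearMap ∘ₗ G.antipode) (oneTmul φ g) := (exists_galois hφ g).choose_spec

theorem galois_p (a : G) : galois hφ g (H.p a) =
    mcv ((hom g).toLinearMap ∘ₗ G.antipode) (oneTmul φ g) a :=
  LinearMap.congr_fun (galois_comp hφ g) a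

/-- The defining formula solved for 1 ⊗ a: convolving with g cancels g∘S. -/
theorem mcv_galois : mcv (hom g).toLinearMap (galois hφ g ∘ₗ H.p) = oneTmul φ g := by
  rw [galois_comp, mcv_mcv, G.cv_comp_antipode, cvOne_mcv]

variable (V : Type u) [AddCommGroup V] [Module K V]

/-- `s ⊗ (p(a) ⊗ v) ↦ ∑ s g(S(a_1)) ⊗ (a_2 ⊗ v)`. -/
def unfold : S.carrier ⊗[K] (H.carrier ⊗[K] V) →ₗ[K]
    Bal (hom (φ ≫ g)) (Via (hom φ) ⊗[K] V) :=
  actLin K S.carrier (Bal (hom (φ ≫ g)) (Via (hom φ) ⊗[K] V)) ∘ₗ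
    (Bal.assocMap (hom (φ ≫ g)) (Via (hom φ)) V ∘ₗ (galois hφ g).rTensor V).lTensor S.carrier

variable {V} in
theorem unfold_tmul (s : S) (c : H.carrier) (v : V) : unfold hφ g V (s ⊗ₜ (c ⊗ₜ v)) =
    s • Bal.assocMap (hom (φ ≫ g)) (Via (hom φ)) V (galois hφ g c ⊗ₜ v) := rfl

omit hφ in
/-- `s ⊗ (a ⊗ v) ↦ s g(a) ⊗ v`. -/
def fold (φ : B ⟶ G.toCommSuperalg) (g : G.toCommSuperalg ⟶ S) (V : Type u) [AddCommGroup V]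
    [Module K V] : Bal (hom (φ ≫ g)) (Via (hom φ) ⊗[K] V) →ₗ[K] S.carrier ⊗[K] V :=
  Bal.lift (hom (φ ≫ g)) ((actLin K S.carrier S.carrier ∘ₗ
    ((hom g).toLinearMap ∘ₗ (toVia (hom φ)).symm.toLinearMap).lTensor S.carrier).rTensor V ∘ₗ
      (TensorProduct.assoc K S.carrier (Via (hom φ)) V).symm.toLinearMap) fun s r m => by
    induction m with
    | zero => simp
    | add x y hx hy => simp only [smul_add, TensorProduct.tmul_add, map_add, hx, hy]
    | tmul a v =>
      change ((s * hom g (hom φ r)) * hom g (show G.carrier from a)) ⊗ₜ[K] v =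
        (s * hom g (hom φ r * (show G.carrier from a))) ⊗ₜ[K] v
      rw [map_mul, mul_assoc]

omit hφ in
theorem fold_tmul {V : Type u} [AddCommGroup V] [Module K V] (s : S) (a : G) (v : V) :
    fold φ g V (Bal.tmul (hom (φ ≫ g)) s (toVia (hom φ) a ⊗ₜ v)) = (s * hom g a) ⊗ₜ v := rfl

omit hφ in
theorem fold_smul {V : Type u} [AddCommGroup V] [Module K V] (s : S)
    (x : Bal (hom (φ ≫ g)) (Via (hom φ) ⊗[K] V)) : fold φ g V (s • x) = s • fold φ g V x := by
  induction x using Bal.induction with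
  | h0 => simp
  | hadd x y hx hy => simp only [smul_add, map_add, hx, hy]
  | h t m =>
    induction m with
    | zero => rw [Bal.tmul_zero, smul_zero, map_zero, smul_zero]
    | add x y hx hy => rw [Bal.tmul_add, smul_add, map_add, map_add, smul_add, hx, hy]
    | tmul a v =>
      rw [Bal.smul_tmul]
      change ((s * t) * hom g (show G.carrier from a)) ⊗ₜ[K] v = s • ((t * hom g _) ⊗ₜ[K] v)
      rw [TensorProduct.smul_tmul', smul_eq_mul, mul_assoc]
      rfl

variable {V}

/-- `fold ∘ unfold` is the counit of the second factor. -/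
theorem fold_unfold (x : S.carrier ⊗[K] (H.carrier ⊗[K] V)) : fold φ g V (unfold hφ g V x) =
    (TensorProduct.lid K V ∘ₗ counit.rTensor V).lTensor S.carrier x := by
  -- With c = p(a) this is the antipode identity ∑ g(S(a_1)) g(a_2) = ε(a).
  have key : ∀ (c : H.carrier) (v : V), fold φ g V (Bal.assocMap (hom (φ ≫ g)) (Via (hom φ)) V
      (galois hφ g c ⊗ₜ v)) = counit (R := K) c • (1 ⊗ₜ v) := by
    intro c v
    obtain ⟨a, rfl⟩ := H.p_surjective c
    let Φ : Bal (hom (φ ≫ g)) (Via (hom φ)) →ₗ[K] S.carrier ⊗[K] V :=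
      fold φ g V ∘ₗ Bal.assocMap (hom (φ ≫ g)) (Via (hom φ)) V ∘ₗ (TensorProduct.mk K _ V).flip v
    have hΦ : ∀ (s : S) x, Φ (s • x) = s • Φ x := fun s x =>
      (congrArg (fold φ g V) (Bal.assocMap_smul _ s x v)).trans (fold_smul g s _)
    change Φ _ = _
    rw [galois_p, H.p_counit]
    have h1 := LinearMap.congr_fun (comp_mcv Φ hΦ ((hom g).toLinearMap ∘ₗ G.antipode)
      (oneTmul φ g)) a
    refine h1.trans ?_
    let Ψ : S.carrier →ₗ[K] S.carrier ⊗[K] V := (TensorProduct.mk K S.carrier V).flip v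
    have h2 : Φ ∘ₗ oneTmul φ g = Ψ ∘ₗ (hom g).toLinearMap := LinearMap.ext fun b => by
      change (1 * hom g b) ⊗ₜ[K] v = hom g b ⊗ₜ[K] v
      rw [one_mul]
    have hΨ : ∀ (s x : S), Ψ (s • x) = s • Ψ x := fun s x => rfl
    rw [h2, ← LinearMap.congr_fun (comp_mcv Ψ hΨ _ _) a, LinearMap.comp_apply, mcv_eq_cv,
      G.cv_antipode_comp (hom g), cvOne_apply, Algebra.algebraMap_eq_smul_one]
    change ((counit (R := K) a • (1 : S.carrier)) ⊗ₜ[K] v) = _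
    rw [TensorProduct.smul_tmul']
  induction x with
  | zero => simp
  | add x y hx hy => simp only [map_add, hx, hy]
  | tmul s x =>
    induction x with
    | zero => simp
    | add x y hx hy => simp only [TensorProduct.tmul_add, map_add, hx, hy]
    | tmul c v =>
      rw [unfold_tmul, fold_smul, key]
      simp [TensorProduct.smul_tmul']

/-- `unfold ∘ fold` is the identity on coactions. -/
theorem unfold_fold (x : Bal (hom (φ ≫ g)) (Via (hom φ) ⊗[K] V)) :
    unfold hφ g V (fold φ g (H.carrier ⊗[K] V)
      (Bal.map (hom (φ ≫ g)) (coactLin hφ.invariant V) x)) = x := by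
  induction x using Bal.induction with
  | h0 => simp
  | hadd x y hx hy => simp only [map_add, hx, hy]
  | h s m =>
    induction m with
    | zero => rw [Bal.tmul_zero, map_zero, map_zero, map_zero]
    | add x y hx hy => rw [Bal.tmul_add, map_add, map_add, map_add, hx, hy]
    | tmul a v =>
      obtain ⟨a, rfl⟩ := (toVia (hom φ)).surjective a
      rw [Bal.map_tmul, coactLin_tmul]
      have e : ∀ t : G.carrier ⊗[K] G.carrier, unfold hφ g V (fold φ g (H.carrier ⊗[K] V)
          (Bal.tmul (hom (φ ≫ g)) s (show Via (hom φ) ⊗[K] (H.carrier ⊗[K] V) from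
            TensorProduct.assoc K G.carrier H.carrier V (H.p.lTensor G.carrier t ⊗ₜ v)))) =
          s • Bal.assocMap (hom (φ ≫ g)) (Via (hom φ)) V
            (actLin K S.carrier _ (TensorProduct.map (hom g).toLinearMap
              (galois hφ g ∘ₗ H.p) t) ⊗ₜ v) := fun t => by
        refine LinearMap.congr_fun
          (f := unfold hφ g V ∘ₗ fold φ g (H.carrier ⊗[K] V) ∘ₗ Bal.mkLin (hom (φ ≫ g)) ∘ₗ
            TensorProduct.mk K S.carrier (Via (hom φ) ⊗[K] (H.carrier ⊗[K] V)) s ∘ₗ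
            (TensorProduct.assoc K G.carrier H.carrier V).toLinearMap ∘ₗ
            (TensorProduct.mk K _ V).flip v ∘ₗ H.p.lTensor G.carrier)
          (g := (Algebra.lsmul K K (Bal (hom (φ ≫ g)) (Via (hom φ) ⊗[K] V)) s) ∘ₗ
            Bal.assocMap (hom (φ ≫ g)) (Via (hom φ)) V ∘ₗ (TensorProduct.mk K _ V).flip v ∘ₗ
            actLin K S.carrier _ ∘ₗ TensorProduct.map (hom g).toLinearMap (galois hφ g ∘ₗ H.p))
          (TensorProduct.ext' fun x y => ?_) t
        change unfold hφ g V ((s * hom g x) ⊗ₜ (H.p y ⊗ₜ v)) =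
          s • Bal.assocMap (hom (φ ≫ g)) (Via (hom φ)) V
            ((hom g x • galois hφ g (H.p y)) ⊗ₜ v)
        rw [unfold_tmul, Bal.assocMap_smul, smul_smul]
      refine (e (comul a)).trans ?_
      -- The sum ∑ g(a_1) · galois(p(a_2)) left by the coaction equals 1 ⊗ a.
      have h := LinearMap.congr_fun (mcv_galois hφ g) a
      rw [mcv_apply] at h
      rw [h]
      change s • Bal.tmul (hom (φ ≫ g)) 1 (toVia (hom φ) a ⊗ₜ v) = _
      rw [Bal.smul_one_tmul]

theorem unfold_smul (s : S) (x : S.carrier ⊗[K] (H.carrier ⊗[K] V)) :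
    unfold hφ g V (s • x) = s • unfold hφ g V x := by
  induction x with
  | zero => simp
  | add x y hx hy => simp only [smul_add, map_add, hx, hy]
  | tmul t x =>
    induction x with
    | zero => simp
    | add x y hx hy => simp only [TensorProduct.tmul_add, smul_add, map_add, hx, hy]
    | tmul c v =>
      rw [TensorProduct.smul_tmul', unfold_tmul, unfold_tmul, smul_smul, smul_eq_mul]

/-- Two linear maps on `S ⊗ (C ⊗ V)` agree if they agree on `1 ⊗ (p(a) ⊗ v)`. -/
theorem unfold_ext {M : Type*} [AddCommGroup M] [Module K M] [Module S.carrier M]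
    {F F' : S.carrier ⊗[K] (H.carrier ⊗[K] V) →ₗ[K] M}
    (hF : ∀ (s : S) x, F (s • x) = s • F x) (hF' : ∀ (s : S) x, F' (s • x) = s • F' x)
    (h : ∀ a v, F (1 ⊗ₜ (H.p a ⊗ₜ v)) = F' (1 ⊗ₜ (H.p a ⊗ₜ v))) : F = F' := by
  refine TensorProduct.ext' fun s x => ?_
  induction x with
  | zero => simp
  | add x y hx hy => rw [TensorProduct.tmul_add, map_add, map_add, hx, hy]
  | tmul c v =>
    obtain ⟨a, rfl⟩ := H.p_surjective c
    have e : s ⊗ₜ[K] (H.p a ⊗ₜ[K] v) = s • ((1 : S.carrier) ⊗ₜ[K] (H.p a ⊗ₜ[K] v)) := by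
      rw [TensorProduct.smul_tmul', smul_eq_mul, mul_one]
    rw [e, hF, hF', h]

/-- On c = p(a) both sides are ∑ g(S(a_1)) ⊗ a_2 ⊗ p(a_3) ⊗ v: coacting on the unfolded element
amounts to comultiplying the factor K[H] first. -/
theorem map_coactLin_unfold (x : S.carrier ⊗[K] (H.carrier ⊗[K] V)) :
    Bal.map (hom (φ ≫ g)) (coactLin hφ.invariant V) (unfold hφ g V x) =
      unfold hφ g (H.carrier ⊗[K] V) (((TensorProduct.assoc K H.carrier H.carrier V).toLinearMap ∘ₗ
        comul.rTensor V).lTensor S.carrier x) := by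
  refine LinearMap.congr_fun
    (f := (Bal.map (hom (φ ≫ g)) (coactLin hφ.invariant V)).restrictScalars K ∘ₗ unfold hφ g V)
    (g := unfold hφ g (H.carrier ⊗[K] V) ∘ₗ ((TensorProduct.assoc K H.carrier H.carrier
      V).toLinearMap ∘ₗ comul.rTensor V).lTensor S.carrier)
    (unfold_ext hφ (fun s x => ?_) (fun s x => ?_) fun a v => ?_) x
  · change Bal.map _ _ (unfold hφ g V (s • x)) = s • Bal.map _ _ (unfold hφ g V x)
    rw [unfold_smul, map_smul]
  · change unfold hφ g _ (LinearMap.lTensor S.carrier _ (s • x)) = s • unfold hφ g _ _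
    rw [← unfold_smul]
    congr 1
    induction x with
    | zero => simp
    | add x y hx hy => simp only [smul_add, map_add, hx, hy]
    | tmul t x => rfl
  · let M' := Bal (hom (φ ≫ g)) (Via (hom φ) ⊗[K] (H.carrier ⊗[K] V))
    let Ξ : Bal (hom (φ ≫ g)) (Via (hom φ)) →ₗ[K] M' :=
      (Bal.map (hom (φ ≫ g)) (coactLin hφ.invariant V)).restrictScalars K ∘ₗ
        Bal.assocMap (hom (φ ≫ g)) (Via (hom φ)) V ∘ₗ (TensorProduct.mk K _ V).flip v
    have hΞ : ∀ (s : S) y, Ξ (s • y) = s • Ξ y := fun s y => by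
      change Bal.map _ _ (Bal.assocMap _ _ _ ((s • y) ⊗ₜ v)) = _
      rw [Bal.assocMap_smul, map_smul]; rfl
    let Θ : Bal (hom (φ ≫ g)) (Via (hom φ)) ⊗[K] G.carrier →ₗ[K] M' :=
      Bal.assocMap (hom (φ ≫ g)) (Via (hom φ)) (H.carrier ⊗[K] V) ∘ₗ
        ((TensorProduct.mk K H.carrier V).flip v ∘ₗ H.p).lTensor _
    have hΘ : ∀ (s : S) y, Θ (s • y) = s • Θ y := fun s y => by
      change Bal.assocMap _ _ _ (LinearMap.lTensor _ _ (s • y)) = s • Bal.assocMap _ _ _ _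
      rw [← Bal.assocMap_smul']
      congr 1
      induction y with
      | zero => simp
      | add x y hx hy => simp only [smul_add, map_add, hx, hy]
      | tmul t x => rfl
    have e1 : Ξ (galois hφ g (H.p a)) = Θ ((galois hφ g ∘ₗ H.p).rTensor G.carrier (comul a)) := by
      rw [galois_p, galois_comp, mcv_rTensor]
      refine (LinearMap.congr_fun (comp_mcv Ξ hΞ _ _) a).trans ?_
      refine Eq.trans ?_ (LinearMap.congr_fun (comp_mcv Θ hΘ _ _) a).symm
      congr 2
      refine LinearMap.ext fun b => ?_
      change Bal.tmul (hom (φ ≫ g)) 1 (show Via (hom φ) ⊗[K] (H.carrier ⊗[K] V) from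
        TensorProduct.assoc K G.carrier H.carrier V (H.p.lTensor G.carrier (comul b) ⊗ₜ v)) =
          Θ ((oneTmul φ g).rTensor G.carrier (comul b))
      refine LinearMap.congr_fun (f := Bal.mkLin (hom (φ ≫ g)) ∘ₗ
            TensorProduct.mk K S.carrier (Via (hom φ) ⊗[K] (H.carrier ⊗[K] V)) 1 ∘ₗ
            (TensorProduct.assoc K G.carrier H.carrier V).toLinearMap ∘ₗ
            (TensorProduct.mk K _ V).flip v ∘ₗ H.p.lTensor G.carrier)
          (g := Θ ∘ₗ (oneTmul φ g).rTensor G.carrier) (TensorProduct.ext' fun x y => rfl) (comul b)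
    change Bal.map _ _ (unfold hφ g V (1 ⊗ₜ (H.p a ⊗ₜ v))) = unfold hφ g _ (1 ⊗ₜ
      (TensorProduct.assoc K H.carrier H.carrier V (comul (H.p a) ⊗ₜ v)))
    rw [unfold_tmul, one_smul, H.p_comul]
    refine e1.trans ?_
    refine LinearMap.congr_fun (f := Θ ∘ₗ (galois hφ g ∘ₗ H.p).rTensor G.carrier)
      (g := unfold hφ g _ ∘ₗ TensorProduct.mk K S.carrier _ 1 ∘ₗ
        (TensorProduct.assoc K H.carrier H.carrier V).toLinearMap ∘ₗ
          (TensorProduct.mk K _ V).flip v ∘ₗ TensorProduct.map H.p H.p)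
      (TensorProduct.ext' fun x y => ?_) (comul a)
    exact (one_smul S.carrier _).symm

theorem map_tensorRight_unfold {V' : Type u} [AddCommGroup V'] [Module K V'] (f : V →ₗ[K] V')
    (x : S.carrier ⊗[K] (H.carrier ⊗[K] V)) :
    Bal.map (hom (φ ≫ g)) (tensorRight B.carrier (Via (hom φ)) f) (unfold hφ g V x) =
      unfold hφ g V' ((f.lTensor H.carrier).lTensor S.carrier x) := by
  induction x with
  | zero => simp
  | add x y hx hy => simp only [map_add, hx, hy]
  | tmul s x =>
    induction x with
    | zero => simp
    | add x y hx hy => simp only [TensorProduct.tmul_add, map_add, hx, hy]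
    | tmul c v =>
      rw [LinearMap.lTensor_tmul, LinearMap.lTensor_tmul, unfold_tmul, unfold_tmul, map_smul]
      congr 1
      generalize galois hφ g c = y
      induction y using Bal.induction with
      | h0 => simp
      | hadd x y hx hy => simp only [TensorProduct.add_tmul, map_add, hx, hy]
      | h s m => rfl

omit hφ in
theorem fold_map_tensorRight {V' : Type u} [AddCommGroup V'] [Module K V'] (f : V →ₗ[K] V')
    (x : Bal (hom (φ ≫ g)) (Via (hom φ) ⊗[K] V)) :
    fold φ g V' (Bal.map (hom (φ ≫ g)) (tensorRight B.carrier (Via (hom φ)) f) x) =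
      f.lTensor S.carrier (fold φ g V x) := by
  induction x using Bal.induction with
  | h0 => simp
  | hadd x y hx hy => simp only [map_add, hx, hy]
  | h s m =>
    induction m with
    | zero => rw [Bal.tmul_zero, map_zero, map_zero, map_zero, map_zero]
    | add x y hx hy => rw [Bal.tmul_add, map_add, map_add, map_add, map_add, hx, hy]
    | tmul a v => rfl

section Inflate

variable (N : LeftSComod H.toAffineSupergroup)

/-- The inverse of `S ⊗_B (A □_C N) → S ⊗ N`. -/
def inflate : S.carrier ⊗[K] N.carrier →ₗ[K] Bal (hom (φ ≫ g)) (Via (hom φ) ⊗[K] N.carrier) :=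
  unfold hφ g N.carrier ∘ₗ N.coact.lTensor S.carrier

theorem map_cotensorLin (y : Bal (hom (φ ≫ g)) (Via (hom φ) ⊗[K] N.carrier)) :
    Bal.map (hom (φ ≫ g)) (cotensorLin hφ.invariant N) y =
      Bal.map (hom (φ ≫ g)) (coactLin hφ.invariant N.carrier) y -
        Bal.map (hom (φ ≫ g)) (tensorRight B.carrier (Via (hom φ)) N.coact) y := by
  induction y using Bal.induction with
  | h0 => simp
  | hadd x y hx hy => rw [map_add, map_add, map_add, hx, hy]; abel
  | h s m =>
    exact map_sub ((Bal.mk (hom (φ ≫ g)) _).restrictScalars K ∘ₗ TensorProduct.mk K S.carrier _ s)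
      _ _

/-- By coassociativity of N, comultiplying K[H] and coacting on N agree on τ_N(n), so the two halves
of the cotensor equation cancel. -/
theorem map_cotensorLin_inflate (x : S.carrier ⊗[K] N.carrier) :
    Bal.map (hom (φ ≫ g)) (cotensorLin hφ.invariant N) (inflate hφ g N x) = 0 := by
  rw [map_cotensorLin hφ g N, inflate, LinearMap.comp_apply, map_coactLin_unfold, map_tensorRight_unfold, sub_eq_zero]
  congr 1
  induction x with
  | zero => simp
  | add x y hx hy => simp only [map_add, hx, hy]
  | tmul s n =>
    rw [LinearMap.lTensor_tmul, LinearMap.lTensor_tmul, LinearMap.lTensor_tmul]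
    exact congrArg _ (N.coassoc n)

theorem fold_inflate (x : S.carrier ⊗[K] N.carrier) :
    fold φ g N.carrier (inflate hφ g N x) = x := by
  rw [inflate, LinearMap.comp_apply, fold_unfold]
  induction x with
  | zero => simp
  | add x y hx hy => simp only [map_add, hx, hy]
  | tmul s n =>
    rw [LinearMap.lTensor_tmul, LinearMap.lTensor_tmul]
    exact congrArg _ (N.counit_coact n)

/-- On the kernel the coaction of N may be traded for that of K[G], and `unfold_fold` applies. With
`fold_inflate` and `map_cotensorLin_inflate` this identifies the kernel of the base changed cotensor
equation with S ⊗ N for every S carrying a point of G, without any flatness. -/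
theorem inflate_fold {x : Bal (hom (φ ≫ g)) (Via (hom φ) ⊗[K] N.carrier)}
    (hx : Bal.map (hom (φ ≫ g)) (cotensorLin hφ.invariant N) x = 0) :
    inflate hφ g N (fold φ g N.carrier x) = x := by
  rw [map_cotensorLin hφ g N, sub_eq_zero] at hx
  rw [inflate, LinearMap.comp_apply, ← fold_map_tensorRight, ← hx, unfold_fold]

variable {N} in
theorem map_inflate {N' : LeftSComod H.toAffineSupergroup} (f : N ⟶ N')
    (x : S.carrier ⊗[K] N.carrier) :
    Bal.map (hom (φ ≫ g)) (tensorRight B.carrier (Via (hom φ)) (LeftSComod.lin f))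
      (inflate hφ g N x) = inflate hφ g N' ((LeftSComod.lin f).lTensor S.carrier x) := by
  rw [inflate, LinearMap.comp_apply, map_tensorRight_unfold, inflate, LinearMap.comp_apply]
  congr 1
  induction x with
  | zero => simp
  | add x y hx hy => simp only [map_add, hx, hy]
  | tmul s n =>
    simp only [LinearMap.lTensor_tmul]
    exact congrArg _ (LeftSComod.Hom.colinear f n).symm

end Inflate

end Descent

end ClosedSupersubgroup

end
end Super

namespace Super
noncomputable section
set_option linter.unusedSectionVars false
open Coalgebra

/-! ## Lifting along coverings -/

namespace Bal

variable {K R S T : Type u} [Field K] [Ring R] [Algebra K R] [Ring S] [Algebra K S] [Ring T]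
  [Algebra K T] (φ : R →ₐ[K] S) (ψ : S →ₐ[K] T) (M : Type u) [AddCommGroup M] [Module K M]
  [Module R M] [IsScalarTower K R M] {M' : Type u} [AddCommGroup M'] [Module K M']
  [Module R M'] [IsScalarTower K R M']

/-- The map `T ⊗_R M → T ⊗_S (S ⊗_R M)`. -/
def nest : Bal (ψ.comp φ) M →ₗ[K] Bal ψ (Bal φ M) :=
  lift (ψ.comp φ) (mkLin ψ ∘ₗ (mkLin φ ∘ₗ TensorProduct.mk K S M 1).lTensor T)
    fun t r m => by
      change tmul ψ (t * ψ (φ r)) (tmul φ 1 m) = tmul ψ t (tmul φ 1 (r • m))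
      rw [tmul_smul_one, ← smul_one_tmul φ (φ r), tmul_smul]

variable {M} in
theorem nest_map (f : M →ₗ[R] M') (x : Bal (ψ.comp φ) M) :
    nest φ ψ M' (map (ψ.comp φ) f x) = map ψ (map φ f) (nest φ ψ M x) := by
  induction x using induction with
  | h0 => simp
  | hadd x y hx hy => simp only [_root_.map_add, hx, hy]
  | h s m => rfl

end Bal

section Lifting

open CommSuperalg

variable {K : Type u} [Field K] {B : CommSuperalg K} {M₁ M₂ M₃ : Type u} [AddCommGroup M₁]
  [Module K M₁] [Module B M₁] [IsScalarTower K B M₁] [AddCommGroup M₂] [Module K M₂] [Module B M₂]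
  [IsScalarTower K B M₂] [AddCommGroup M₃] [Module K M₃] [Module B M₃] [IsScalarTower K B M₃]
  (D : M₁ →ₗ[B.carrier] M₂) (π : M₁ →ₗ[B.carrier] M₃) (y : M₃)

/-- The element `1 ⊗ y` lifts along `π` to the kernel of `D`, after base change along `x`. -/
def Lifts (T : CommSuperalg K) (x : B ⟶ T) : Prop :=
  ∃ w : Bal (hom x) M₁, Bal.map (hom x) D w = 0 ∧ Bal.map (hom x) π w = Bal.tmul (hom x) 1 y

variable {D π y}

theorem Lifts.comp {T T' : CommSuperalg K} {x : B ⟶ T} (h : Lifts D π y T x) (f : T ⟶ T') :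
    Lifts D π y T' (x ≫ f) := by
  obtain ⟨w, h1, h2⟩ := h
  have he : ∀ s r, (hom f).toLinearMap (s * hom x r) = (hom f).toLinearMap s * hom (x ≫ f) r :=
    fun s r => map_mul (hom f) s _
  refine ⟨Bal.mapLeft (hom f).toLinearMap he w, ?_, ?_⟩
  · rw [← Bal.mapLeft_map, h1, map_zero]
  · rw [← Bal.mapLeft_map, h2, Bal.mapLeft_tmul]
    exact congrArg (fun s => Bal.tmul _ s y) (map_one (hom f))

/-- The lifts over the members add up to a lift over their product P. By flatness it comes from P ⊗
E, with E the kernel of D over T. Hence 1 ⊗ y becomes zero over P modulo the image of E, and by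
faithful flatness it is zero already over T. -/
theorem Lifts.of_cover {T : CommSuperalg K} {n : ℕ} {S : Fin n → CommSuperalg K}
    {f : ∀ i, T ⟶ S i} (hf : LeftFF (piHom f)) {x : B ⟶ T}
    (h : ∀ i, Lifts D π y (S i) (x ≫ f i)) : Lifts D π y T x := by
  choose w h1 h2 using h
  let W : Bal (piHom f) (Bal (hom x) M₁) :=
    ∑ i, singleBal f i _ (Bal.nest (hom x) (hom (f i)) M₁ (w i))
  have nat : ∀ {M : Type u} [AddCommGroup M] [Module K M] [Module B M] [IsScalarTower K B M]
      (F : M₁ →ₗ[B.carrier] M), Bal.map (piHom f) (Bal.map (hom x) F) W =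
        ∑ i, singleBal f i _ (Bal.nest (hom x) (hom (f i)) M
          (Bal.map (hom (x ≫ f i)) F (w i))) := fun F => by
    rw [map_sum]
    refine Finset.sum_congr rfl fun i _ => ?_
    refine (Bal.mapLeft_map _ _ _ _).symm.trans ?_
    exact congrArg _ (Bal.nest_map (hom x) (hom (f i)) F (w i)).symm
  have hD : Bal.map (piHom f) (Bal.map (hom x) D) W = 0 := by
    rw [nat D]
    refine Finset.sum_eq_zero fun i _ => ?_
    rw [h1]
    exact (congrArg (singleBal f i _) (map_zero (Bal.nest (hom x) (hom (f i)) M₂))).trans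
      (map_zero _)
  have hπ : Bal.map (piHom f) (Bal.map (hom x) π) W =
      Bal.tmul (piHom f) 1 (Bal.tmul (hom x) 1 y) := by
    rw [nat π]
    have e : (1 : ∀ i, S i) = ∑ i, Pi.single i 1 := (Finset.univ_sum_single 1).symm
    rw [← Bal.mk_tmul, e, TensorProduct.sum_tmul, map_sum]
    refine Finset.sum_congr rfl fun i _ => ?_
    rw [h2]; rfl
  let E := LinearMap.ker (Bal.map (hom x) D)
  have hex : Function.Exact E.subtype (Bal.map (hom x) D) := LinearMap.exact_subtype_ker_map _
  obtain ⟨w', hw'⟩ := ((hf _ _ _ _ _).1 hex W).1 hD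
  let Q := LinearMap.range (Bal.map (hom x) π ∘ₗ E.subtype)
  -- Q is the image of the kernel of D; a lift over T exists exactly when the class of 1 ⊗ y modulo
  -- Q vanishes.
  have hQ : Q.mkQ (Bal.tmul (hom x) 1 y) = 0 := by
    refine hf.tmul_one_injective ?_
    rw [← Bal.map_tmul, ← hπ, ← hw', Bal.map_comp, Bal.map_comp]
    have : Q.mkQ ∘ₗ Bal.map (hom x) π ∘ₗ E.subtype = 0 :=
      LinearMap.range_le_ker_iff.1 (by rw [Submodule.ker_mkQ])
    rw [LinearMap.comp_assoc, this, Bal.map_zero_hom]; rfl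
  obtain ⟨⟨v, hv⟩, e⟩ := (Submodule.Quotient.mk_eq_zero _).1 hQ
  exact ⟨v, hv, e⟩

/-- The action map B ⊗_B M → M is natural in M and carries a lift over B to a lift in the module
itself. -/
theorem Lifts.of_id (h : Lifts D π y B (𝟙 B)) : ∃ m, D m = 0 ∧ π m = y := by
  obtain ⟨w, h1, h2⟩ := h
  have c : ∀ {M : Type u} [AddCommGroup M] [Module K M] [Module B M] [IsScalarTower K B M]
    (s r : B) (m : M), actLin K B M ((s * hom (𝟙 B) r) ⊗ₜ m) = actLin K B M (s ⊗ₜ (r • m)) := by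
    intro M _ _ _ _ s r m
    exact mul_smul s r m
  have nat : ∀ {M : Type u} [AddCommGroup M] [Module K M] [Module B M] [IsScalarTower K B M]
      (F : M₁ →ₗ[B.carrier] M), F (Bal.lift (hom (𝟙 B)) (actLin K B.carrier M₁) c w) =
        Bal.lift (hom (𝟙 B)) (actLin K B.carrier M) c (Bal.map (hom (𝟙 B)) F w) := by
    intro M _ _ _ _ F
    refine LinearMap.congr_fun
      (f := F.restrictScalars K ∘ₗ Bal.lift (hom (𝟙 B)) (actLin K B.carrier M₁) c)
      (g := Bal.lift (hom (𝟙 B)) (actLin K B.carrier M) c ∘ₗ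
        (Bal.map (hom (𝟙 B)) F).restrictScalars K) (Bal.hom_ext fun s m => ?_) w
    exact map_smul F s m
  refine ⟨_, (nat D).trans ?_, (nat π).trans ?_⟩
  · rw [h1, map_zero]
  · rw [h2, Bal.lift_tmul]
    exact one_smul _ y

end Lifting

/-! ### Surjectivity from affineness and from coflatness. -/

namespace ClosedSupersubgroup

open CommSuperalg

variable {K : Type u} [Field K] {G : AffineSupergroup K} {H : ClosedSupersubgroup G}

/-- `K[G] □_{K[H]} ?` preserves surjections. -/
def PreservesSurjections (H : ClosedSupersubgroup G) : Prop :=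
  ∀ (N N' : LeftSComod H.toAffineSupergroup) (f : N ⟶ N'),
    Function.Surjective (LeftSComod.lin f) → Function.Surjective (cotensorMap H.rightCoact f)

/-- Nothing is known yet about flatness of K[G] over B. Instead, liftability of an element of K[G] □
N' is treated as a property of points of SSp B: it is local, and over a point coming from G the
cotensor products become T ⊗ N → T ⊗ N', which is surjective. Hence it holds at the generic point.
-/
theorem preservesSurjections_of_isQuotientAffine (h2 : (2 : K) ≠ 0) (h : H.IsQuotientAffine) :
    H.PreservesSurjections := by
  obtain ⟨B, α, hα⟩ := h
  have hgal := isGalois_coordMap h2 hα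
  intro N N' f hf y
  let φ := coordMap α
  let y' : Via (hom φ) ⊗[K] N'.carrier := y.1
  have key : Lifts (cotensorLin hgal.invariant N)
      (tensorRight B.carrier (Via (hom φ)) (LeftSComod.lin f)) y' B (𝟙 B) := by
    refine property_generic h2 hα (fun T x => Lifts _ _ y' T x) (fun T T' x f h => h.comp f)
      (fun T n S f hf x h => Lifts.of_cover (leftFF_piHom f h2 hf) h) fun T g => ?_
    obtain ⟨z, hz⟩ := LinearMap.lTensor_surjective T.carrier hf
      (fold φ g N'.carrier (Bal.tmul (hom (φ ≫ g)) 1 y'))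
    refine ⟨inflate hgal g N z, map_cotensorLin_inflate hgal g N z, ?_⟩
    rw [map_inflate, hz]
    refine inflate_fold hgal g N' ?_
    rw [Bal.map_tmul]
    have : cotensorLin hgal.invariant N' y' = 0 := y.2
    rw [this, Bal.tmul_zero]
  obtain ⟨m, h1, h2⟩ := key.of_id
  exact ⟨⟨m, h1⟩, Subtype.ext h2⟩

/-- Surjectivity of f is exactness of f followed by the zero endomorphism of N', and the zero
endomorphism induces zero on the cotensor product. -/
theorem preservesSurjections_of_isFaithfullyCoflat (h : IsFaithfullyCoflat H.rightCoact) :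
    H.PreservesSurjections := by
  intro N N' f hf
  let z : N' ⟶ N' := (⟨0, fun i _ _ => zero_mem _, fun v => by simp⟩ : LeftSComod.Hom N' N')
  have h1 : Function.Exact (LeftSComod.lin f) (LeftSComod.lin z) := fun y =>
    ⟨fun _ => hf y, fun _ => rfl⟩
  intro y
  refine ((h N N' N' f z).1 h1 y).1 (Subtype.ext ?_)
  change (0 : N'.carrier →ₗ[K] N'.carrier).lTensor G.carrier y.1 = 0
  rw [LinearMap.lTensor_zero]; rfl

end ClosedSupersubgroup

end
end Super

namespace Super
noncomputable section
set_option linter.unusedSectionVars false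
open Coalgebra

/-! ## A criterion for faithful flatness -/

section Split

variable {K : Type u} [Field K]

/-- A sequence that is a natural retract of an exact sequence is exact. -/
theorem exact_of_retract {X' X X'' Y' Y Y'' : Type*} [Zero X''] [Zero Y''] {f : X' → X}
    {g : X → X''} {f' : Y' → Y} {g' : Y → Y''} {i : X → Y} {i'' : X'' → Y''} {i' : X' → Y'}
    {r' : Y' → X'} {r : Y → X} {r'' : Y'' → X''} (hi'' : i'' 0 = 0) (hr'' : r'' 0 = 0)
    (h1 : ∀ x, i (f x) = f' (i' x)) (h2 : ∀ x, i'' (g x) = g' (i x))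
    (h3 : ∀ y, r (f' y) = f (r' y)) (h4 : ∀ y, r'' (g' y) = g (r y))
    (h5 : ∀ x, r (i x) = x) (h : Function.Exact f' g') : Function.Exact f g := by
  intro x
  constructor
  · intro hx
    obtain ⟨y, hy⟩ := (h (i x)).1 (by rw [← h2, hx, hi''])
    exact ⟨r' y, by rw [← h3, hy, h5]⟩
  · rintro ⟨z, rfl⟩
    have := (h (f' (i' z))).2 ⟨_, rfl⟩
    rw [← h5 (f z), h1, ← h4, this, hr'']

variable (R : CommSuperalg K) {Y : Type u} [AddCommGroup Y] [Module K Y] [Module R Y]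
  [IsScalarTower K R Y]

/-- The right action on a supermodule as a linear map. -/
def rightAct (X : RightSupermod R) : X.carrier ⊗[K] R.carrier →ₗ[K] X.carrier :=
  TensorProduct.lift (LinearMap.mk₂ K (fun x r => MulOpposite.op r • x)
    (fun x y r => smul_add _ x y) (fun c x r => by
      rw [smul_comm])
    (fun x r s => by rw [MulOpposite.op_add, add_smul])
    (fun c x r => by rw [MulOpposite.op_smul, smul_assoc]))

/-- A left module that is a direct summand of a free module `R ⊗_K Y` and that contains `R` as a
direct summand is faithfully flat. -/
theorem isFaithfullyFlat_of_split (θ : Y →ₗ[K] R.carrier ⊗[K] Y)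
    (hθ : ∀ (r : R) y, θ (r • y) = r • θ y) (hθ' : ∀ y, actLin K R.carrier Y (θ y) = y)
    (t : Y →ₗ[K] R.carrier) (ht : ∀ (r : R) y, t (r • y) = r * t y) (y₀ : Y) (hy₀ : t y₀ = 1) :
    IsFaithfullyFlat R Y := by
  -- The section θ induces a natural section of the projection X ⊗_K Y → X ⊗_R Y. So the sequence
  -- over R is a retract of the one over the field, which is exact.
  let s : ∀ X : RightSupermod R, TensorOver R Y X →ₗ[K] X.carrier ⊗[K] Y := fun X =>
    Submodule.liftQ _ ((rightAct R X).rTensor Y ∘ₗ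
      (TensorProduct.assoc K X.carrier R.carrier Y).symm.toLinearMap ∘ₗ θ.lTensor X.carrier) (by
        rw [tensorRel, Submodule.span_le]
        rintro _ ⟨x, r, y, rfl⟩
        rw [SetLike.mem_coe, LinearMap.mem_ker, map_sub, sub_eq_zero]
        simp only [LinearMap.comp_apply, LinearMap.lTensor_tmul, hθ]
        induction (θ y) with
        | zero => simp
        | add a b ha hb => simp only [smul_add, TensorProduct.tmul_add, map_add, ha, hb]
        | tmul a b =>
          change (MulOpposite.op a • MulOpposite.op r • x) ⊗ₜ[K] b =
            (MulOpposite.op (r * a) • x) ⊗ₜ[K] b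
          rw [smul_smul]; rfl)
  have hs : ∀ (X : RightSupermod R) x, (tensorRel R Y X).mkQ (s X x) = x := by
    intro X x
    obtain ⟨x, rfl⟩ := Submodule.mkQ_surjective _ x
    induction x with
    | zero => simp only [map_zero]
    | add x y hx hy => simp only [map_add, hx, hy]
    | tmul x y =>
      conv_rhs => rw [← hθ' y]
      change (tensorRel R Y X).mkQ ((rightAct R X).rTensor Y
        ((TensorProduct.assoc K X.carrier R.carrier Y).symm (x ⊗ₜ θ y))) = _
      induction (θ y) with
      | zero => simp
      | add a b ha hb => simp only [TensorProduct.tmul_add, map_add, ha, hb]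
      | tmul a b =>
        refine sub_eq_zero.1 ((map_sub (tensorRel R Y X).mkQ _ _).symm.trans ?_)
        exact (Submodule.Quotient.mk_eq_zero _).2 (Submodule.subset_span ⟨x, a, b, rfl⟩)
  have hsn : ∀ {X X' : RightSupermod R} (f : X.Hom X') x,
      s X' (TensorOver.map R Y f x) = f.toLin.rTensor Y (s X x) := by
    intro X X' f x
    obtain ⟨x, rfl⟩ := Submodule.mkQ_surjective _ x
    induction x with
    | zero => simp only [map_zero]
    | add x y hx hy => simp only [map_add, hx, hy]
    | tmul x y =>
      change (rightAct R X').rTensor Y ((TensorProduct.assoc K X'.carrier R.carrier Y).symm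
        (f.toLin x ⊗ₜ θ y)) = f.toLin.rTensor Y ((rightAct R X).rTensor Y
          ((TensorProduct.assoc K X.carrier R.carrier Y).symm (x ⊗ₜ θ y)))
      induction (θ y) with
      | zero => simp
      | add a b ha hb => simp only [TensorProduct.tmul_add, map_add, ha, hb]
      | tmul a b =>
        change (MulOpposite.op a • f.toLin x) ⊗ₜ[K] b = f.toLin (MulOpposite.op a • x) ⊗ₜ[K] b
        rw [f.map_smul]
  -- The map t induces X ⊗_R Y → X, a natural retraction of x ↦ x ⊗ y₀. So the original sequence is
  -- a retract of the tensored one.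
  let q : ∀ X : RightSupermod R, TensorOver R Y X →ₗ[K] X.carrier := fun X =>
    Submodule.liftQ _ (rightAct R X ∘ₗ t.lTensor X.carrier) (by
        rw [tensorRel, Submodule.span_le]
        rintro _ ⟨x, r, y, rfl⟩
        rw [SetLike.mem_coe, LinearMap.mem_ker, map_sub, sub_eq_zero]
        change MulOpposite.op (t y) • MulOpposite.op r • x = MulOpposite.op (t (r • y)) • x
        rw [ht, smul_smul]; rfl)
  intro X' X X'' f g
  constructor
  · intro h
    have hK : Function.Exact (f.toLin.rTensor Y) (g.toLin.rTensor Y) :=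
      Module.Flat.rTensor_exact Y h
    exact exact_of_retract (i' := s X') (i := s X) (i'' := s X'') (r' := (tensorRel R Y X').mkQ)
      (r := (tensorRel R Y X).mkQ) (r'' := (tensorRel R Y X'').mkQ) (map_zero _) (map_zero _)
      (hsn f) (hsn g) (fun y => rfl) (fun y => rfl) (hs X) hK
  · intro h
    let j : ∀ X : RightSupermod R, X.carrier → TensorOver R Y X := fun X x =>
      (tensorRel R Y X).mkQ (x ⊗ₜ y₀)
    have hq : ∀ {X X' : RightSupermod R} (f : X.Hom X') x,
        q X' (TensorOver.map R Y f x) = f.toLin (q X x) := by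
      intro X X' f x
      obtain ⟨x, rfl⟩ := Submodule.mkQ_surjective _ x
      induction x with
      | zero => simp only [map_zero]
      | add x y hx hy => simp only [map_add, hx, hy]
      | tmul x y => exact (f.map_smul (t y) x).symm
    refine exact_of_retract (i' := j X') (i := j X) (i'' := j X'') (r' := q X') (r := q X)
      (r'' := q X'') ?_ (map_zero _) (fun y => rfl) (fun y => rfl) (hq f) (hq g) (fun x => ?_) h
    · change (tensorRel R Y X'').mkQ ((0 : X''.carrier) ⊗ₜ y₀) = 0
      rw [TensorProduct.zero_tmul, map_zero]
    · change MulOpposite.op (t y₀) • x = x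
      rw [hy₀]; exact one_smul _ x

end Split

/-! ## Coideal subalgebras as superalgebras -/

namespace LeftCoidealSubalg

open CommSuperalg

variable {K : Type u} [Field K] {G : AffineSupergroup K} (B : LeftCoidealSubalg G)

/-- A coideal supersubalgebra as a commutative superalgebra. -/
abbrev toSuper : CommSuperalg K where
  carrier := B.alg
  gr i := (G.gr i).comap B.alg.val.toLinearMap
  graded := gradedOfInternal (by
      rw [internal_iff]
      constructor
      · rw [Submodule.disjoint_def]
        intro x h0 h1
        exact Subtype.ext (internal_disj G.isInternal (by decide) h0 h1)
      · rw [codisjoint_iff, eq_top_iff]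
        intro b _
        obtain ⟨x, hx, y, hy, e⟩ := B.decomp b
        exact Submodule.mem_sup.2 ⟨x, hx, y, hy, e⟩) G.one_mem
    (fun i j x hx y hy => G.mul_mem hx hy)
  supercomm i j a ha b hb := by
    have h := G.supercomm i j _ ha _ hb
    rcases Int.units_eq_one_or ((-1 : ℤˣ) ^ (i * j)) with e | e <;> rw [e] at h ⊢
    · rw [one_smul] at h ⊢
      exact Subtype.ext h
    · rw [Units.neg_smul, one_smul] at h ⊢
      exact Subtype.ext h

/-- The inclusion of a coideal supersubalgebra. -/
def incl : B.toSuper ⟶ G.toCommSuperalg := homMk B.alg.val fun _ _ h => h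

end LeftCoidealSubalg

end
end Super

namespace Super
noncomputable section
set_option linter.unusedSectionVars false
open Coalgebra

/-- By coassociativity the sum ∑ f(c_1) x(c_2 ⊗ c_3) may be computed on the first two legs with the
last one frozen. -/
theorem mcv_comul {K C E M : Type*} [Field K] [AddCommGroup C] [Module K C] [Coalgebra K C]
    [Ring E] [Algebra K E] [AddCommGroup M] [Module K M] [Module E M] [IsScalarTower K E M]
    (f : C →ₗ[K] E) (x L : C ⊗[K] C →ₗ[K] M)
    (h : ∀ a b, mcv f (x ∘ₗ (TensorProduct.mk K C C).flip b) a = L (a ⊗ₜ b)) :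
    mcv f (x ∘ₗ comul) = L ∘ₗ comul := by
  ext c
  have e1 : ∀ t : C ⊗[K] C, TensorProduct.map f (x ∘ₗ comul) t =
      TensorProduct.map f x (comul.lTensor C t) := fun t => by
    induction t with
    | zero => simp
    | add x y hx hy => simp only [map_add, hx, hy]
    | tmul a b => rfl
  have e2 : ∀ t : C ⊗[K] C, actLin K E M (TensorProduct.map f x
      (TensorProduct.assoc K C C C (comul.rTensor C t))) = L t := fun t => by
    induction t with
    | zero => simp
    | add x y hx hy => simp only [map_add, hx, hy]
    | tmul a b =>
      rw [← h, LinearMap.rTensor_tmul, mcv_apply]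
      induction (comul a : C ⊗[K] C) with
      | zero => simp
      | add x y hx hy => simp only [map_add, TensorProduct.add_tmul, hx, hy]
      | tmul a b => rfl
  rw [mcv_apply, e1, ← Coalgebra.coassoc_apply, e2, LinearMap.comp_apply]

/-! ### Splittings: the trace onto the invariants and the section of R ⊗ K[G] → K[G]. -/

namespace ClosedSupersubgroup

open CommSuperalg

variable {K : Type u} [Field K] {G : AffineSupergroup K} (H : ClosedSupersubgroup G)

/-- An even unital map `ℓ : K[H] → K[G]` with `∑ (1 ⊗ c_1) ρ(ℓ(c_2)) = ℓ(c) ⊗ 1`, where `ρ` is the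
right coaction. -/
structure IsSplitting (ℓ : H.carrier →ₗ[K] G.carrier) : Prop where
  even : IsEven H.gr G.gr ℓ
  map_one : ℓ 1 = 1
  cv_eq : cv (inr G.toCommSuperalg H.toCommSuperalg).toLinearMap
    (H.rightCoactAlg.toLinearMap ∘ₗ ℓ) = (inl G.toCommSuperalg H.toCommSuperalg).toLinearMap ∘ₗ ℓ

namespace IsSplitting

variable {H} {ℓ : H.carrier →ₗ[K] G.carrier} (hℓ : H.IsSplitting ℓ)

/-- `a ⊗ c ↦ a ℓ(c)`. -/
def contract (ℓ : H.carrier →ₗ[K] G.carrier) : H.gh →ₗ[K] G.carrier :=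
  LinearMap.mul' K G.carrier ∘ₗ ℓ.lTensor G.carrier ∘ₗ
    (gtOf G.toCommSuperalg H.toCommSuperalg).symm.toLinearMap

theorem contract_gtOf (t : G.carrier ⊗[K] H.carrier) :
    contract ℓ (gtOf G.toCommSuperalg H.toCommSuperalg t) =
      LinearMap.mul' K G.carrier (ℓ.lTensor G.carrier t) := rfl

theorem contract_tmul (a : G) (c : H.carrier) :
    contract ℓ (inl G.toCommSuperalg H.toCommSuperalg a * inr _ _ c) = a * ℓ c := by
  rw [inl_mul_inr, contract_gtOf]; rfl

theorem contract_inl_mul (a : G) (z : H.gh) :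
    contract ℓ (inl _ _ a * z) = a * contract ℓ z := by
  induction z using gt_induction with
  | hadd x y hx hy => rw [mul_add, map_add, map_add, hx, hy, mul_add]
  | h i s hs j t ht => rw [← mul_assoc, ← map_mul, contract_tmul, contract_tmul, mul_assoc]

include hℓ in
-- Since ℓ is even, the sign from moving b past c in the tensor product is the sign from moving b
-- past ℓ(c) in K[G].
theorem contract_mul_inl (z : H.gh) (b : G) :
    contract ℓ (z * inl _ _ b) = contract ℓ z * b := by
  induction b using G.homog_induction with
  | hadd x y hx hy => rw [map_add, mul_add, map_add, hx, hy, mul_add]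
  | h k b hb =>
    induction z using gt_induction with
    | hadd x y hx hy => rw [add_mul, map_add, map_add, hx, hy, add_mul]
    | h i s hs j t ht =>
      rw [contract_tmul, mul_assoc, inr_mul_inl ht hb, mul_smul_comm, ← mul_assoc, ← _root_.map_mul,
        LinearMap.map_smul_of_tower, contract_tmul, mul_assoc, mul_assoc,
        G.supercomm _ _ _ (hℓ.even j t ht) _ hb, mul_smul_comm]

/-- The projection `a ↦ ∑ a_1 ℓ(p(a_2))` onto the invariants. -/
def trace (ℓ : H.carrier →ₗ[K] G.carrier) : G.carrier →ₗ[K] G.carrier :=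
  contract ℓ ∘ₗ H.rightCoactAlg.toLinearMap

theorem trace_eq_cv : trace ℓ = cv LinearMap.id (ℓ ∘ₗ H.p) := by
  ext a
  change contract ℓ (H.rightCoactAlg a) = _
  rw [rightCoactAlg_eq_gtOf, contract_gtOf, cv_apply]
  change LinearMap.mul' K _ (ℓ.lTensor _ (H.p.lTensor _ _)) = _
  rw [← LinearMap.comp_apply (ℓ.lTensor _), ← LinearMap.lTensor_comp]
  rfl

include hℓ in
-- The coaction maps ∑ a_1 ℓ(p(a_2)) to inl * (inr∘p) * (ρ∘ℓ∘p) at a, with ρ the right coaction. By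
-- the splitting identity the last two factors convolve to inl∘ℓ∘p, so the result is trace(a) ⊗ 1.
theorem trace_mem (a : G) : trace ℓ a ∈ H.invariants.alg := by
  rw [mem_invariants]
  refine (gtOf G.toCommSuperalg H.toCommSuperalg).injective ?_
  rw [← rightCoactAlg_eq_gtOf]
  change _ = inl _ _ (trace ℓ a)
  refine LinearMap.congr_fun (f := H.rightCoactAlg.toLinearMap ∘ₗ trace ℓ)
    (g := (inl G.toCommSuperalg H.toCommSuperalg).toLinearMap ∘ₗ trace ℓ) ?_ a
  have h := congrArg (fun f => f ∘ₗ H.p) hℓ.cv_eq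
  simp only [cv_comp _ _ _ H.comul_comp_p] at h
  rw [trace_eq_cv, comp_cv, comp_cv, LinearMap.comp_id, LinearMap.comp_id, rightCoactAlg_eq,
    cv_assoc, ← rightCoactAlg_eq]
  exact congrArg _ h

theorem rightCoactAlg_of_mem {r : G} (hr : r ∈ H.invariants.alg) :
    H.rightCoactAlg r = inl _ _ r := by
  rw [rightCoactAlg_eq_gtOf, (H.mem_invariants r).1 hr]; rfl

theorem trace_mul {r : G} (hr : r ∈ H.invariants.alg) (a : G) :
    trace ℓ (r * a) = r * trace ℓ a := by
  change contract ℓ (H.rightCoactAlg (r * a)) = _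
  rw [_root_.map_mul, rightCoactAlg_of_mem hr, contract_inl_mul]; rfl

include hℓ in
theorem trace_one : trace ℓ (1 : G) = 1 := by
  change contract ℓ (H.rightCoactAlg 1) = _
  have := contract_tmul (ℓ := ℓ) (1 : G) (1 : H.carrier)
  rw [_root_.map_one] at this ⊢
  rw [_root_.map_one, mul_one] at this
  rw [this, hℓ.map_one, mul_one]

/-- The projection onto the invariants. -/
def traceInv : G.carrier →ₗ[K] H.invariants.toSuper.carrier :=
  (trace ℓ).codRestrict (Subalgebra.toSubmodule H.invariants.alg) (trace_mem hℓ)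

/-- `a ⊗ b ↦ ∑ t(a S(b_1)) ⊗ b_2` for the projection `t` onto the invariants. -/
def spread : G.carrier ⊗[K] G.carrier →ₗ[K] H.invariants.toSuper.carrier ⊗[K] G.carrier :=
  (traceInv hℓ ∘ₗ LinearMap.mul' K G.carrier).rTensor G.carrier ∘ₗ
    (TensorProduct.assoc K G.carrier G.carrier G.carrier).symm.toLinearMap ∘ₗ
      (G.antipode.rTensor G.carrier ∘ₗ comul).lTensor G.carrier

/-- The formula ρ = inl * (inr∘p) for the right coaction, solved for inr∘p∘S. -/
theorem inr_antipode : (inr G.toCommSuperalg H.toCommSuperalg).toLinearMap ∘ₗ H.p ∘ₗ G.antipode =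
    cv (H.rightCoactAlg.toLinearMap ∘ₗ G.antipode)
      (inl G.toCommSuperalg H.toCommSuperalg).toLinearMap := by
  have h := cv_cancel_left (G.cv_antipode_comp H.rightCoactAlg)
    ((inr G.toCommSuperalg H.toCommSuperalg).toLinearMap ∘ₗ H.p ∘ₗ G.antipode)
  rw [← h]
  congr 1
  rw [rightCoactAlg_eq, cv_assoc]
  have h2 := G.cv_comp_antipode ((inr G.toCommSuperalg H.toCommSuperalg).comp (hom H.proj))
  exact (congrArg _ h2).trans (cv_cvOne _)

/-- As `contract` is linear over K[G] on the right, the sum ∑ t(aS(b_1)) b_2 collapses through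
`inr_antipode`. The point is that the result depends on b only through p(b). -/
theorem mul_spread (a b : G) :
    LinearMap.mul' K G.carrier ((H.invariants.alg.val.toLinearMap).rTensor G.carrier
      (spread hℓ (a ⊗ₜ b))) = contract ℓ (H.rightCoactAlg a * inr _ _ (H.p (G.antipode b))) := by
  have h := LinearMap.congr_fun (inr_antipode (H := H)) b
  refine Eq.trans ?_ (congrArg (fun z => contract ℓ (H.rightCoactAlg a * z)) h.symm)
  change LinearMap.mul' K G.carrier (LinearMap.rTensor _ _ (LinearMap.rTensor _ _
    ((TensorProduct.assoc K G.carrier G.carrier G.carrier).symm (a ⊗ₜ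
      G.antipode.rTensor G.carrier (comul b))))) = contract ℓ (_ * LinearMap.mul' K _
        (TensorProduct.map _ _ (comul b)))
  induction (comul b : G.carrier ⊗[K] G.carrier) with
  | zero => simp
  | add x y hx hy => simp only [map_add, TensorProduct.tmul_add, mul_add, hx, hy]
  | tmul x y =>
    change trace ℓ (a * G.antipode x) * y =
      contract ℓ (H.rightCoactAlg a * (H.rightCoactAlg (G.antipode x) * inl _ _ y))
    rw [← mul_assoc, contract_mul_inl hℓ, ← _root_.map_mul]; rfl

theorem spread_smul (r : H.invariants.toSuper.carrier) (t : G.carrier ⊗[K] G.carrier) :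
    spread hℓ ((LinearMap.mulLeft K (r : G.carrier)).rTensor G.carrier t) = r • spread hℓ t := by
  induction t with
  | zero => simp
  | add x y hx hy => simp only [map_add, smul_add, hx, hy]
  | tmul a b =>
    change LinearMap.rTensor _ _ ((TensorProduct.assoc K G.carrier G.carrier G.carrier).symm
      (((r : G.carrier) * a) ⊗ₜ G.antipode.rTensor G.carrier (comul b))) =
      r • LinearMap.rTensor _ _ ((TensorProduct.assoc K G.carrier G.carrier G.carrier).symm
      (a ⊗ₜ G.antipode.rTensor G.carrier (comul b)))
    induction (comul b : G.carrier ⊗[K] G.carrier) with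
    | zero => simp
    | add x y hx hy => simp only [map_add, TensorProduct.tmul_add, smul_add, hx, hy]
    | tmul x y =>
      change traceInv hℓ ((r : G.carrier) * a * G.antipode x) ⊗ₜ[K] y =
        (r * traceInv hℓ (a * G.antipode x)) ⊗ₜ[K] y
      congr 1
      refine Subtype.ext ?_
      rw [mul_assoc]
      exact trace_mul r.2 _

/-- A linear section of the projection `K[G] → K[H]`. -/
def section_ (H : ClosedSupersubgroup G) : H.carrier →ₗ[K] G.carrier :=
  (H.p.exists_rightInverse_of_surjective (LinearMap.range_eq_top.2 H.p_surjective)).choose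

theorem p_section (c : H.carrier) : H.p (section_ H c) = c :=
  LinearMap.congr_fun
    (H.p.exists_rightInverse_of_surjective (LinearMap.range_eq_top.2 H.p_surjective)).choose_spec c

/-- A section of the multiplication `R ⊗ K[G] → K[G]`. -/
def splitMul : G.carrier →ₗ[K] H.invariants.toSuper.carrier ⊗[K] G.carrier :=
  spread hℓ ∘ₗ (section_ H).lTensor G.carrier ∘ₗ H.rightCoact

theorem splitMul_smul (r : H.invariants.toSuper.carrier) (a : G) :
    splitMul hℓ ((r : G.carrier) * a) = r • splitMul hℓ a := by
  refine Eq.trans ?_ (spread_smul hℓ r _)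
  change spread hℓ ((section_ H).lTensor G.carrier (H.rightCoact _)) = _
  rw [H.rightCoact_mul _ _ r.2]
  refine congrArg (spread hℓ) ?_
  change _ = LinearMap.rTensor _ _ ((section_ H).lTensor G.carrier (H.rightCoact a))
  generalize H.rightCoact a = t
  induction t with
  | zero => simp
  | add x y hx hy => simp only [map_add, hx, hy]
  | tmul x y => rfl

/-- `splitMul` feeds an arbitrary linear section of p into `spread`. By `mul_spread` only p of it
survives the multiplication, so the outcome is the contraction of ρ * (inr∘p∘S) = inl with ρ the
right coaction, that is a·ℓ(1) = a. -/
theorem mul_splitMul (a : G) :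
    LinearMap.mul' K G.carrier ((H.invariants.alg.val.toLinearMap).rTensor G.carrier
      (splitMul hℓ a)) = a := by
  have e : ∀ t : G.carrier ⊗[K] G.carrier, LinearMap.mul' K G.carrier
      ((H.invariants.alg.val.toLinearMap).rTensor G.carrier (spread hℓ
        ((section_ H).lTensor G.carrier (H.p.lTensor G.carrier t)))) =
      contract ℓ (LinearMap.mul' K _ (TensorProduct.map H.rightCoactAlg.toLinearMap
        (((inr G.toCommSuperalg H.toCommSuperalg).comp (hom H.proj)).toLinearMap ∘ₗ G.antipode)
          t)) := fun t => by
    induction t with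
    | zero => simp
    | add x y hx hy => simp only [map_add, hx, hy]
    | tmul x y =>
      refine (mul_spread hℓ x (section_ H (H.p y))).trans ?_
      rw [p_antipode_apply, p_section, ← p_antipode_apply]
      rfl
  refine (e (comul a)).trans ?_
  change contract ℓ (cv _ _ a) = a
  have h2 := G.cv_comp_antipode ((inr G.toCommSuperalg H.toCommSuperalg).comp (hom H.proj))
  have h3 : cv H.rightCoactAlg.toLinearMap
      (((inr G.toCommSuperalg H.toCommSuperalg).comp (hom H.proj)).toLinearMap ∘ₗ G.antipode) =
      (inl G.toCommSuperalg H.toCommSuperalg).toLinearMap := by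
    rw [rightCoactAlg_eq, cv_assoc]
    exact (congrArg _ h2).trans (cv_cvOne _)
  rw [h3, AlgHom.toLinearMap_apply]
  have := contract_tmul (ℓ := ℓ) a (1 : H.carrier)
  rw [_root_.map_one, mul_one] at this
  rw [this, hℓ.map_one, mul_one]

end IsSplitting

end ClosedSupersubgroup

end
end Super

namespace Super
noncomputable section
set_option linter.unusedSectionVars false
open Coalgebra

/-! ### A splitting makes K[G] a faithfully flat Galois extension of its invariants. -/

namespace ClosedSupersubgroup

open CommSuperalg

variable {K : Type u} [Field K] {G : AffineSupergroup K} (H : ClosedSupersubgroup G)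

/-- `K[G]` is faithfully flat on both sides over its invariants, which separate the cosets. -/
structure IsFFGalois : Prop where
  isGalois : H.IsGalois H.invariants.incl
  leftFF : LeftFF (hom H.invariants.incl)
  isFFCovering : IsFFCovering H.invariants.toSuper (fun _ : Fin 1 => G.toCommSuperalg)
    fun _ => H.invariants.incl

namespace IsSplitting

variable {H} {ℓ : H.carrier →ₗ[K] G.carrier} (hℓ : H.IsSplitting ℓ)

theorem actLin_splitMul (a : G) : actLin K H.invariants.toSuper.carrier G.carrier (splitMul hℓ a) = a := by
  conv_rhs => rw [← mul_splitMul hℓ a]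
  generalize splitMul hℓ a = t
  induction t with
  | zero => simp
  | add x y hx hy => simp only [map_add, hx, hy]
  | tmul x y => rfl

include hℓ in
-- `splitMul` makes K[G] a direct summand of R ⊗ K[G], and the trace, which maps 1 to 1, makes R a
-- direct summand of K[G].
theorem isFaithfullyFlat : IsFaithfullyFlat H.invariants.toSuper G.carrier :=
  isFaithfullyFlat_of_split H.invariants.toSuper (splitMul hℓ) (splitMul_smul hℓ)
    (actLin_splitMul hℓ) (traceInv hℓ)
    (fun r a => Subtype.ext (trace_mul r.2 a)) 1 (Subtype.ext (trace_one hℓ))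

include hℓ in
-- A covering refers to the product of its members. The splitting data are transported to the
-- product over a one-element index set.
theorem isFFCovering : IsFFCovering H.invariants.toSuper (fun _ : Fin 1 => G.toCommSuperalg)
    fun _ => H.invariants.incl := by
  let e : G.carrier →ₗ[K] (Fin 1 → G.carrier) := LinearMap.pi fun _ => LinearMap.id
  have key : IsFaithfullyFlat H.invariants.toSuper (∀ _ : Fin 1, G.carrier) :=
    isFaithfullyFlat_of_split H.invariants.toSuper
    (e.lTensor _ ∘ₗ splitMul hℓ ∘ₗ LinearMap.proj 0)
    (fun r a => by
      refine (congrArg (e.lTensor _) (splitMul_smul hℓ r (a 0))).trans ?_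
      exact map_smul (TensorProduct.AlgebraTensorModule.map
        (LinearMap.id : H.invariants.toSuper.carrier →ₗ[H.invariants.toSuper.carrier] _) e) r _)
    (fun a => by
      have h := mul_splitMul hℓ (a 0)
      refine funext fun i => ?_
      rw [Subsingleton.elim i 0, ← h]
      change actLin K _ (Fin 1 → G.carrier) (e.lTensor _ (splitMul hℓ (a 0))) 0 = _
      rw [h]
      conv_rhs => rw [← h]
      generalize splitMul hℓ (a 0) = t
      induction t with
      | zero => simp
      | add x y hx hy => simp only [map_add, Pi.add_apply, hx, hy]
      | tmul x y => rfl)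
    (traceInv hℓ ∘ₗ LinearMap.proj 0)
    (fun r a => Subtype.ext (trace_mul r.2 (a 0))) (fun _ => 1) (Subtype.ext (trace_one hℓ))
  exact key

/-- The map `r ⊗ a ↦ r ⊗ a` to the tensor product over the invariants. -/
def toBal (H : ClosedSupersubgroup G) : H.invariants.toSuper.carrier ⊗[K] G.carrier →ₗ[K]
    Bal (hom H.invariants.incl) (Via (hom H.invariants.incl)) :=
  Bal.mkLin (hom H.invariants.incl) ∘ₗ TensorProduct.map (hom H.invariants.incl).toLinearMap
    (toVia (hom H.invariants.incl)).toLinearMap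

/-- In K[G] ⊗_R K[G] the factors in R move to the right, where they multiply out to a by
`mul_splitMul`. -/
theorem toBal_splitMul (a : G) :
    toBal H (splitMul hℓ a) = Bal.tmul (hom H.invariants.incl) 1 (toVia _ a) := by
  conv_rhs => rw [← mul_splitMul hℓ a]
  generalize splitMul hℓ a = t
  induction t with
  | zero => simp only [map_zero]; exact (Bal.tmul_zero _ _).symm
  | add x y hx hy => simp only [map_add, hx, hy]; exact (Bal.tmul_add _ _ _ _).symm
  | tmul x y => exact (Bal.tmul_smul_one (hom H.invariants.incl) x (toVia _ y)).symm

theorem inr_p : (inr G.toCommSuperalg H.toCommSuperalg).toLinearMap ∘ₗ H.p =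
    cv ((inl G.toCommSuperalg H.toCommSuperalg).toLinearMap ∘ₗ G.antipode)
      H.rightCoactAlg.toLinearMap := by
  rw [rightCoactAlg_eq, cv_cancel_left (G.cv_antipode_comp _)]

/-- The sum ∑ S(a_1) t(a_2 y), with t the trace, depends on a only through p(a): pull S(a_1) into
the contraction and cancel it against the left leg of the coaction of a_2. -/
theorem cv_antipode_trace_mul (y : G) (a : G) :
    cv G.antipode (trace ℓ ∘ₗ LinearMap.mulRight K y) a =
      contract ℓ (inr _ _ (H.p a) * H.rightCoactAlg y) := by
  have h := LinearMap.congr_fun (inr_p (H := H)) a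
  refine Eq.trans ?_ (congrArg (fun z => contract ℓ (z * H.rightCoactAlg y)) h.symm)
  rw [cv_apply, cv_apply]
  induction (comul a : G.carrier ⊗[K] G.carrier) with
  | zero => simp
  | add x y hx hy => simp only [map_add, add_mul, hx, hy]
  | tmul x z =>
    change G.antipode x * contract ℓ (H.rightCoactAlg (z * y)) =
      contract ℓ (inl _ _ (G.antipode x) * H.rightCoactAlg z * _)
    rw [mul_assoc, ← _root_.map_mul, contract_inl_mul]

/-- The map through which the Galois map factors. -/
def galFactor (ℓ : H.carrier →ₗ[K] G.carrier) : H.carrier ⊗[K] H.carrier →ₗ[K]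
    Bal (hom H.invariants.incl) (Via (hom H.invariants.incl)) :=
  Bal.mkLin (hom H.invariants.incl) ∘ₗ
    TensorProduct.map (contract ℓ ∘ₗ LinearMap.mul' K H.gh ∘ₗ TensorProduct.map
      (inr G.toCommSuperalg H.toCommSuperalg).toLinearMap
      (H.rightCoactAlg.toLinearMap ∘ₗ G.antipode)) (toVia (hom H.invariants.incl)).toLinearMap ∘ₗ
    (TensorProduct.assoc K H.carrier G.carrier G.carrier).symm.toLinearMap ∘ₗ
    (comul ∘ₗ section_ H).lTensor H.carrier

/-- Here b enters through the chosen lift of p(b), and a enters through p(a) by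
`cv_antipode_trace_mul`, applied with y = S(x) for each left factor x of the comultiplied lift. -/
theorem mcv_toBal_spread (a b : G) :
    mcv (M := Bal (hom H.invariants.incl) (Via (hom H.invariants.incl))) G.antipode
      ((toBal H ∘ₗ spread hℓ ∘ₗ (section_ H ∘ₗ H.p).lTensor G.carrier) ∘ₗ
        (TensorProduct.mk K G.carrier G.carrier).flip b) a =
      galFactor ℓ (H.p a ⊗ₜ H.p b) := by
  have e : ∀ t : G.carrier ⊗[K] G.carrier,
      mcv (M := Bal (hom H.invariants.incl) (Via (hom H.invariants.incl))) G.antipode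
        (toBal H ∘ₗ (traceInv hℓ ∘ₗ LinearMap.mul' K G.carrier).rTensor G.carrier ∘ₗ
    (TensorProduct.assoc K G.carrier G.carrier G.carrier).symm.toLinearMap ∘ₗ
      (TensorProduct.mk K G.carrier (G.carrier ⊗[K] G.carrier)).flip
        (G.antipode.rTensor G.carrier t)) a =
      Bal.mkLin (hom H.invariants.incl) (
    TensorProduct.map (contract ℓ ∘ₗ LinearMap.mul' K H.gh ∘ₗ TensorProduct.map
      (inr G.toCommSuperalg H.toCommSuperalg).toLinearMap
      (H.rightCoactAlg.toLinearMap ∘ₗ G.antipode)) (toVia (hom H.invariants.incl)).toLinearMap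
      ((TensorProduct.assoc K H.carrier G.carrier G.carrier).symm (H.p a ⊗ₜ t))) := fun t => by
    induction t with
    | zero =>
      simp only [map_zero, TensorProduct.tmul_zero, LinearMap.comp_zero]
      rw [mcv_apply, TensorProduct.map_zero_right]
      simp
    | add x y hx hy =>
      simp only [map_add, TensorProduct.tmul_add, LinearMap.comp_add, ← hx, ← hy]
      rw [mcv_apply, TensorProduct.map_add_right]
      simp only [LinearMap.add_apply, map_add]
      rfl
    | tmul x y =>
      have h := cv_antipode_trace_mul (ℓ := ℓ) (G.antipode x) a
      change _ = Bal.tmul _ (contract ℓ (inr _ _ (H.p a) * H.rightCoactAlg (G.antipode x)))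
        (toVia _ y)
      rw [← h, mcv_apply, cv_apply]
      induction (comul a : G.carrier ⊗[K] G.carrier) with
      | zero => simp only [map_zero]; exact (Bal.zero_tmul _ _).symm
      | add x y hx hy => simp only [map_add, hx, hy]; exact (Bal.add_tmul _ _ _ _).symm
      | tmul z w => exact Bal.smul_tmul _ _ _ _
  exact e (comul (section_ H (H.p b)))

include hℓ in
-- Replace 1 ⊗ a_2 in ∑ S(a_1) ⊗ a_2 by its splitting. This gives ∑ S(a_1) t(a_2 S(b_1)) ⊗ b_2 with
-- b the chosen lift of p(a_3), where a_1 and a_2 matter only through p by `mcv_toBal_spread`. Hence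
-- the whole expression is a function of p(a).
theorem galMap_eq : galMap H.invariants.incl = galFactor ℓ ∘ₗ comul ∘ₗ H.p := by
  have h1 : galMap H.invariants.incl =
      mcv (M := Bal (hom H.invariants.incl) (Via (hom H.invariants.incl))) G.antipode
        ((toBal H ∘ₗ spread hℓ ∘ₗ (section_ H ∘ₗ H.p).lTensor G.carrier) ∘ₗ comul) := by
    refine LinearMap.ext fun a => ?_
    rw [mcv_apply]
    change Bal.mkLin _ (TensorProduct.map _ _ (comul a)) = _
    induction (comul a : G.carrier ⊗[K] G.carrier) with
    | zero => simp only [map_zero]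
    | add x y hx hy => simp only [map_add, hx, hy]
    | tmul x y =>
      have h := toBal_splitMul hℓ y
      change Bal.tmul _ (G.antipode x) (toVia _ y) = G.antipode x • toBal H (spread hℓ
        ((section_ H ∘ₗ H.p).lTensor G.carrier (comul y)))
      rw [LinearMap.lTensor_comp]
      refine Eq.trans ?_ (congrArg (fun z => G.antipode x • z) h.symm)
      exact (Bal.smul_one_tmul _ _ _).symm
  rw [h1, mcv_comul _ _ (galFactor ℓ ∘ₗ TensorProduct.map H.p H.p)
    (fun a b => mcv_toBal_spread hℓ a b), LinearMap.comp_assoc, H.comul_comp_p]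

include hℓ in
theorem isFFGalois (h2 : (2 : K) ≠ 0) : H.IsFFGalois where
  isGalois := ⟨fun b => b.2, fun a ha => by
    rw [galMap_eq hℓ, LinearMap.comp_apply, LinearMap.comp_apply, ha, map_zero, map_zero]⟩
  leftFF := leftFF_hom (h2) H.invariants.incl (fun _ _ => rfl) (isFaithfullyFlat hℓ)
  isFFCovering := isFFCovering hℓ

end IsSplitting

theorem IsFFGalois.isQuotientAffine {H : ClosedSupersubgroup G} (h2 : (2 : K) ≠ 0) (h : H.IsFFGalois) :
    H.IsQuotientAffine :=
  ⟨_, _, isAssociatedDurSheaf_of_isGalois h2 h.isGalois h.isFFCovering⟩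

end ClosedSupersubgroup

end
end Super

namespace Super
noncomputable section
set_option linter.unusedSectionVars false
open Coalgebra

/-! ## Finite dimensional right comodules and their duals -/

section DualHom

variable (K V X : Type*) [Field K] [AddCommGroup V] [Module K V] [AddCommGroup X] [Module K X]

/-- The map `X ⊗ V* → Hom(V, X)`. -/
def homOfTensor : X ⊗[K] Module.Dual K V →ₗ[K] V →ₗ[K] X :=
  dualTensorHom K V X ∘ₗ (TensorProduct.comm K X (Module.Dual K V)).toLinearMap

variable {K V X}

@[simp] theorem homOfTensor_tmul (x : X) (ξ : Module.Dual K V) (v : V) :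
    homOfTensor K V X (x ⊗ₜ ξ) v = ξ v • x := rfl

theorem homOfTensor_bijective [FiniteDimensional K V] :
    Function.Bijective (homOfTensor K V X) :=
  (dualTensorHomEquiv (R := K) (M := V) (N := X)).bijective.comp
    (TensorProduct.comm K X (Module.Dual K V)).bijective

theorem homOfTensor_rTensor {Y : Type*} [AddCommGroup Y] [Module K Y] (f : X →ₗ[K] Y)
    (t : X ⊗[K] Module.Dual K V) :
    homOfTensor K V Y (f.rTensor _ t) = f ∘ₗ homOfTensor K V X t := by
  induction t with
  | zero => simp
  | add x y hx hy => simp only [map_add, LinearMap.comp_add, hx, hy]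
  | tmul x ξ => ext v; simp

theorem homOfTensor_lTensor {V' : Type*} [AddCommGroup V'] [Module K V'] (j : V' →ₗ[K] V)
    (t : X ⊗[K] Module.Dual K V) :
    homOfTensor K V' X (j.dualMap.lTensor X t) = homOfTensor K V X t ∘ₗ j := by
  induction t with
  | zero => simp
  | add x y hx hy => simp only [map_add, LinearMap.add_comp, hx, hy]
  | tmul x ξ => ext v; simp

end DualHom

variable {K : Type u} [Field K]

/-- A right supercomodule. -/
structure RightSComod (C : AffineSupergroup K) where
  carrier : Type u
  [addCommGroup : AddCommGroup carrier]
  [module : Module K carrier]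
  gr : ZMod 2 → Submodule K carrier
  isInternal : DirectSum.IsInternal gr
  coact : carrier →ₗ[K] carrier ⊗[K] C.carrier
  coact_mem : IsEven gr (tensorGr gr C.gr) coact
  coassoc : ∀ v, TensorProduct.assoc K carrier C.carrier C.carrier
    (coact.rTensor C.carrier (coact v)) =
      (comul (R := K) (A := C.carrier)).lTensor carrier (coact v)
  counit_coact : ∀ v, TensorProduct.rid K carrier
    ((counit (R := K) (A := C.carrier)).lTensor carrier (coact v)) = v

attribute [instance] RightSComod.addCommGroup RightSComod.module

namespace RightSComod

variable {C : AffineSupergroup K} (V : RightSComod C)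

/-- `ξ ↦ (v ↦ ∑ ξ(v_0) v_1)`. -/
def coeff : Module.Dual K V.carrier →ₗ[K] V.carrier →ₗ[K] C.carrier where
  toFun ξ := (TensorProduct.lid K C.carrier).toLinearMap ∘ₗ ξ.rTensor C.carrier ∘ₗ V.coact
  map_add' ξ η := by
    rw [LinearMap.rTensor_add, LinearMap.add_comp, LinearMap.comp_add]
  map_smul' c ξ := by
    rw [LinearMap.rTensor_smul, LinearMap.smul_comp, LinearMap.comp_smul]; rfl

theorem coeff_apply (ξ : Module.Dual K V.carrier) (v : V.carrier) :
    V.coeff ξ v = TensorProduct.lid K C.carrier (ξ.rTensor C.carrier (V.coact v)) := rfl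

/-- The grading of the dual space. -/
def dualGr (i : ZMod 2) : Submodule K (Module.Dual K V.carrier) where
  carrier := {ξ | ∀ v ∈ V.gr (i + 1), ξ v = 0}
  add_mem' := fun ha hb v hv => by rw [LinearMap.add_apply, ha v hv, hb v hv, add_zero]
  zero_mem' := fun v _ => rfl
  smul_mem' := fun c ξ h v hv => by rw [LinearMap.smul_apply, h v hv, smul_zero]

theorem eq_of_ne_add_one : ∀ {i j : ZMod 2}, ¬j = i + 1 → j = i := by decide

theorem dualGr_internal : DirectSum.IsInternal V.dualGr := by
  rw [internal_iff]
  constructor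
  · rw [Submodule.disjoint_def]
    intro ξ h0 h1
    ext v
    obtain ⟨x, hx, y, hy, rfl⟩ := internal_decomp V.isInternal v
    rw [map_add, h0 y hy, h1 x hx]; simp
  · rw [codisjoint_iff, eq_top_iff]
    intro ξ _
    obtain ⟨p0, p1, a, b, c, d⟩ := exists_proj V.isInternal
    refine Submodule.mem_sup.2 ⟨ξ ∘ₗ p0, fun v hv => ?_, ξ ∘ₗ p1, fun v hv => ?_, ?_⟩
    · rw [LinearMap.comp_apply, b v hv, map_zero]
    · rw [LinearMap.comp_apply, c v hv, map_zero]
    · ext v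
      obtain ⟨x, hx, y, hy, rfl⟩ := internal_decomp V.isInternal v
      simp [a x hx, b y hy, c x hx, d y hy]

theorem homOfTensor_mem {X : Type*} [AddCommGroup X] [Module K X] {gr : ZMod 2 → Submodule K X}
    {i j : ZMod 2} {t : X ⊗[K] Module.Dual K V.carrier} (ht : t ∈ tensorGr gr V.dualGr i)
    {v : V.carrier} (hv : v ∈ V.gr j) : homOfTensor K V.carrier X t v ∈ gr (i + j) := by
  induction ht using Submodule.span_induction with
  | mem x hx =>
    obtain ⟨k, l, rfl, x, hx, ξ, hξ, rfl⟩ := hx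
    rw [homOfTensor_tmul]
    by_cases h : j = l + 1
    · subst h
      rw [hξ v hv, zero_smul]; exact zero_mem _
    · obtain rfl := eq_of_ne_add_one h
      rw [add_assoc, CharTwo.add_self_eq_zero, add_zero]
      exact Submodule.smul_mem _ _ hx
  | zero => simp
  | add x y _ _ hx hy => rw [map_add]; exact add_mem hx hy
  | smul a x _ hx => rw [map_smul]; exact Submodule.smul_mem _ a hx

theorem coeff_mem {i j : ZMod 2} {ξ : Module.Dual K V.carrier} (hξ : ξ ∈ V.dualGr i)
    {v : V.carrier} (hv : v ∈ V.gr j) : V.coeff ξ v ∈ C.gr (i + j) := by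
  have h := V.coact_mem j v hv
  rw [coeff_apply]
  generalize V.coact v = t at h
  induction h using Submodule.span_induction with
  | mem x hx =>
    obtain ⟨k, l, rfl, v, hv, c, hc, rfl⟩ := hx
    rw [LinearMap.rTensor_tmul, TensorProduct.lid_tmul]
    by_cases h : k = i + 1
    · subst h
      rw [hξ v hv, zero_smul]; exact zero_mem _
    · obtain rfl := eq_of_ne_add_one h
      rw [← add_assoc, CharTwo.add_self_eq_zero, zero_add]
      exact Submodule.smul_mem _ _ hc
  | zero => simp
  | add x y _ _ hx hy => rw [map_add, map_add]; exact add_mem hx hy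
  | smul a x _ hx => rw [map_smul, map_smul]; exact Submodule.smul_mem _ a hx

/-- The component of the other degree defines a map that shifts degrees by two different amounts,
hence is zero; finite dimension makes the tensor zero as well. -/
theorem mem_tensorGr_of_homOfTensor [FiniteDimensional K V.carrier] {X : Type*} [AddCommGroup X]
    [Module K X] {gr : ZMod 2 → Submodule K X} (hX : DirectSum.IsInternal gr) {i : ZMod 2}
    {t : X ⊗[K] Module.Dual K V.carrier}
    (h : ∀ j, ∀ v ∈ V.gr j, homOfTensor K V.carrier X t v ∈ gr (i + j)) :
    t ∈ tensorGr gr V.dualGr i := by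
  obtain ⟨a, ha, b, hb, rfl⟩ := internal_decomp (tensorGr_internal hX V.dualGr_internal) t
  have key : ∀ {i k : ZMod 2} {a b : X ⊗[K] Module.Dual K V.carrier},
      a ∈ tensorGr gr V.dualGr i → b ∈ tensorGr gr V.dualGr k → i ≠ k →
      (∀ j, ∀ v ∈ V.gr j, homOfTensor K V.carrier X (a + b) v ∈ gr (i + j)) → b = 0 := by
    intro i k a b ha hb hik h
    refine homOfTensor_bijective.1 ?_
    rw [map_zero]
    have hj : ∀ j, ∀ v ∈ V.gr j, homOfTensor K V.carrier X b v = 0 := fun j v hv => by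
      refine internal_disj hX (i := i + j) (j := k + j) (fun e => hik (add_right_cancel e)) ?_
        (V.homOfTensor_mem hb hv)
      have h1 := sub_mem (h j v hv) (V.homOfTensor_mem ha hv)
      rwa [map_add, LinearMap.add_apply, add_sub_cancel_left] at h1
    ext v
    obtain ⟨x, hx, y, hy, rfl⟩ := internal_decomp V.isInternal v
    rw [map_add, hj 0 x hx, hj 1 y hy]; simp
  rcases zmod2_cases i with rfl | rfl
  · rw [key ha hb (by decide) h, add_zero]; exact ha
  · rw [add_comm] at h
    rw [key hb ha (by decide) h, zero_add]; exact hb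

variable [FiniteDimensional K V.carrier]

/-- The coaction on the dual of a finite dimensional right comodule. -/
def dualCoact : Module.Dual K V.carrier →ₗ[K] C.carrier ⊗[K] Module.Dual K V.carrier :=
  (LinearEquiv.ofBijective (homOfTensor K V.carrier C.carrier)
    homOfTensor_bijective).symm.toLinearMap ∘ₗ V.coeff

theorem homOfTensor_dualCoact (ξ : Module.Dual K V.carrier) :
    homOfTensor K V.carrier C.carrier (V.dualCoact ξ) = V.coeff ξ :=
  LinearEquiv.apply_symm_apply (LinearEquiv.ofBijective (homOfTensor K V.carrier C.carrier)
    homOfTensor_bijective) _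

/-- Under X ⊗ V* ≅ Hom(V, X) the coaction of the dual is composition with the coaction of V.
Comodule axioms and cotensor equations for V* are read off from V through it. -/
theorem homOfTensor_lTensor_dualCoact {X : Type*} [AddCommGroup X] [Module K X]
    (t : X ⊗[K] Module.Dual K V.carrier) :
    homOfTensor K V.carrier (X ⊗[K] C.carrier)
      ((TensorProduct.assoc K X C.carrier _).symm (V.dualCoact.lTensor X t)) =
      (homOfTensor K V.carrier X t).rTensor C.carrier ∘ₗ V.coact := by
  induction t with
  | zero => simp
  | add x y hx hy => simp only [map_add, LinearMap.rTensor_add, LinearMap.add_comp, hx, hy]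
  | tmul x ξ =>
    have e : ∀ s : C.carrier ⊗[K] Module.Dual K V.carrier,
        homOfTensor K V.carrier (X ⊗[K] C.carrier) ((TensorProduct.assoc K X C.carrier _).symm
          (x ⊗ₜ s)) = TensorProduct.mk K X C.carrier x ∘ₗ homOfTensor K V.carrier C.carrier s :=
      fun s => by
        induction s with
        | zero => simp
        | add x y hx hy => simp only [map_add, TensorProduct.tmul_add, LinearMap.comp_add, hx, hy]
        | tmul c η => ext v; simp
    rw [LinearMap.lTensor_tmul, e, homOfTensor_dualCoact]
    ext v
    rw [LinearMap.comp_apply, LinearMap.comp_apply, coeff_apply]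
    induction (V.coact v) with
    | zero => simp
    | add x y hx hy => simp only [map_add, hx, hy]
    | tmul v c => simp [TensorProduct.smul_tmul]

/-- The dual of a finite dimensional right comodule. -/
def dual : LeftSComod C where
  carrier := Module.Dual K V.carrier
  gr := V.dualGr
  isInternal := V.dualGr_internal
  coact := V.dualCoact
  coact_mem i ξ hξ := V.mem_tensorGr_of_homOfTensor C.isInternal fun j v hv => by
    rw [homOfTensor_dualCoact]
    exact V.coeff_mem hξ hv
  coassoc ξ := by
    -- Both sides are compared as maps V → C ⊗ C, where the claim is the coassociativity of V with ξ
    -- applied to the first factor.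
    apply (TensorProduct.assoc K C.carrier C.carrier (Module.Dual K V.carrier)).symm.injective
    apply homOfTensor_bijective.1
    rw [LinearEquiv.symm_apply_apply, homOfTensor_rTensor, homOfTensor_lTensor_dualCoact,
      homOfTensor_dualCoact]
    ext v
    have h := congrArg (fun t => TensorProduct.lid K (C.carrier ⊗[K] C.carrier)
      (ξ.rTensor _ t)) (V.coassoc v)
    refine Eq.trans ?_ (h.symm.trans ?_)
    · rw [LinearMap.comp_apply, coeff_apply]
      generalize V.coact v = t
      induction t with
      | zero => simp
      | add x y hx hy => simp only [map_add, hx, hy]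
      | tmul v c => simp
    · rw [LinearMap.comp_apply]
      generalize V.coact v = t
      induction t with
      | zero => simp
      | add x y hx hy => simp only [map_add, hx, hy]
      | tmul v c =>
        rw [LinearMap.rTensor_tmul, LinearMap.rTensor_tmul, coeff_apply]
        generalize V.coact v = t
        induction t with
        | zero => simp
        | add x y hx hy => simp only [map_add, TensorProduct.add_tmul, hx, hy]
        | tmul v c => simp [TensorProduct.smul_tmul']
  counit_coact ξ := by
    have e : ∀ t : C.carrier ⊗[K] Module.Dual K V.carrier,
        TensorProduct.lid K _ ((counit (R := K) (A := C.carrier)).rTensor _ t) =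
          counit ∘ₗ homOfTensor K V.carrier C.carrier t := fun t => by
      induction t with
      | zero => simp
      | add x y hx hy => simp only [map_add, LinearMap.comp_add, hx, hy]
      | tmul c ξ => ext v; simp [mul_comm]
    rw [e, homOfTensor_dualCoact]
    ext v
    conv_rhs => rw [← V.counit_coact v]
    rw [LinearMap.comp_apply, coeff_apply]
    generalize V.coact v = t
    induction t with
    | zero => simp
    | add x y hx hy => simp only [map_add, hx, hy]
    | tmul v c => simp [mul_comm]

end RightSComod

/-! ### Colinear maps as elements of a cotensor product. -/

namespace ClosedSupersubgroup

open RightSComod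

variable {G : AffineSupergroup K} {H : ClosedSupersubgroup G}

/-- So K[G] □ V* is the space of right colinear maps V → K[G], not necessarily even. -/
theorem mem_cotensor_dual (V : RightSComod H.toAffineSupergroup) [FiniteDimensional K V.carrier]
    (x : G.carrier ⊗[K] Module.Dual K V.carrier) :
    x ∈ cotensor H.rightCoact V.dual ↔
      H.rightCoact ∘ₗ homOfTensor K V.carrier G.carrier x =
        (homOfTensor K V.carrier G.carrier x).rTensor H.carrier ∘ₗ V.coact := by
  rw [← homOfTensor_rTensor, ← homOfTensor_lTensor_dualCoact, homOfTensor_bijective.1.eq_iff]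
  change TensorProduct.assoc K G.carrier H.carrier _ (H.rightCoact.rTensor _ x) -
    V.dualCoact.lTensor G.carrier x = 0 ↔ _
  rw [sub_eq_zero, ← LinearEquiv.eq_symm_apply]

/-- Colinear maps to `K[G]` extend from subcomodules of finite dimensional right comodules. -/
theorem PreservesSurjections.exists_extension (h : PreservesSurjections H)
    (V' V : RightSComod H.toAffineSupergroup) [FiniteDimensional K V'.carrier]
    [FiniteDimensional K V.carrier] (j : V'.carrier →ₗ[K] V.carrier) (hj : Function.Injective j)
    (hje : IsEven V'.gr V.gr j) (hjc : ∀ v, V.coact (j v) = j.rTensor H.carrier (V'.coact v))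
    (f : V'.carrier →ₗ[K] G.carrier)
    (hf : H.rightCoact ∘ₗ f = f.rTensor H.carrier ∘ₗ V'.coact) :
    ∃ g : V.carrier →ₗ[K] G.carrier,
      H.rightCoact ∘ₗ g = g.rTensor H.carrier ∘ₗ V.coact ∧ g ∘ₗ j = f := by
  let q : V.dual ⟶ V'.dual := LeftSComod.Hom.mk j.dualMap
    (fun i ξ hξ v hv => hξ _ (hje _ v hv)) (fun ξ => by
      apply homOfTensor_bijective.1
      refine (V'.homOfTensor_dualCoact _).trans ?_
      refine Eq.trans ?_ (homOfTensor_lTensor j (V.dualCoact ξ)).symm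
      refine Eq.trans ?_ (congrArg (fun f => f ∘ₗ j) (V.homOfTensor_dualCoact ξ).symm)
      ext v
      have e : ∀ t : V'.carrier ⊗[K] H.carrier, (ξ.comp j).rTensor H.carrier t =
          LinearMap.rTensor H.carrier ξ (j.rTensor H.carrier t) := fun t =>
        LinearMap.congr_fun (LinearMap.rTensor_comp H.carrier ξ j) t
      refine congrArg (TensorProduct.lid K H.carrier) ((e (V'.coact v)).trans ?_)
      rw [← hjc]
      rfl)
  -- The dual of an injection is surjective, and the surjection it induces on cotensor products is
  -- restriction of colinear maps along j.
  have hq : Function.Surjective (LeftSComod.lin q) := LinearMap.dualMap_surjective_of_injective hj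
  obtain ⟨x, hx⟩ := homOfTensor_bijective.2 f
  obtain ⟨y, hy⟩ := h _ _ q hq ⟨x, (mem_cotensor_dual V' x).2 (by rw [hx, hf])⟩
  refine ⟨homOfTensor K V.carrier G.carrier y.1, (mem_cotensor_dual V y.1).1 y.2, ?_⟩
  refine (homOfTensor_lTensor j y.1).symm.trans ?_
  rw [← hx]
  exact congrArg (homOfTensor K V'.carrier G.carrier) (congrArg Subtype.val hy)

end ClosedSupersubgroup

end
end Super

namespace Super
noncomputable section
set_option linter.unusedSectionVars false
open Coalgebra

/-! ## Slices of tensors -/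

section Slice

variable {K X Y C : Type*} [Field K] [AddCommGroup X] [Module K X] [AddCommGroup Y] [Module K Y]
  [AddCommGroup C] [Module K C]

variable (X) in
/-- The map `x ⊗ c ↦ ξ(c) x`. -/
def slice (ξ : Module.Dual K C) : X ⊗[K] C →ₗ[K] X :=
  (TensorProduct.rid K X).toLinearMap ∘ₗ ξ.lTensor X

@[simp] theorem slice_tmul (ξ : Module.Dual K C) (x : X) (c : C) :
    slice X ξ (x ⊗ₜ c) = ξ c • x := rfl

theorem slice_rTensor (ξ : Module.Dual K C) (f : X →ₗ[K] Y) (t : X ⊗[K] C) :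
    slice Y ξ (f.rTensor C t) = f (slice X ξ t) := by
  induction t with
  | zero => simp
  | add x y hx hy => simp only [map_add, hx, hy]
  | tmul x c => simp

theorem slice_ext {t s : X ⊗[K] C} (h : ∀ ξ, slice X ξ t = slice X ξ s) : t = s := by
  classical
  refine (TensorProduct.equivFinsuppOfBasisRight (Module.Basis.ofVectorSpace K C)).injective ?_
  ext i
  rw [TensorProduct.equivFinsuppOfBasisRight_apply, TensorProduct.equivFinsuppOfBasisRight_apply]
  exact h _

/-- All slices of the image of t in (X/U) ⊗ C vanish, so the image vanishes. Being a subcomodule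
thereby reduces to stability under the operators `hit ξ`. -/
theorem mem_range_of_slice (U : Submodule K X) {t : X ⊗[K] C} (h : ∀ ξ, slice X ξ t ∈ U) :
    t ∈ LinearMap.range (U.subtype.rTensor C) := by
  have h0 : U.mkQ.rTensor C t = 0 := slice_ext fun ξ => by
    rw [slice_rTensor, map_zero]
    exact (Submodule.Quotient.mk_eq_zero _).2 (h ξ)
  exact (Module.Flat.rTensor_exact C (f := U.subtype) (g := U.mkQ)
    (LinearMap.exact_subtype_mkQ U) t).1 h0

theorem mem_of_even_injective {𝒱 : ZMod 2 → Submodule K X} {𝒲 : ZMod 2 → Submodule K Y}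
    (hV : DirectSum.IsInternal 𝒱) (hW : DirectSum.IsInternal 𝒲) {f : X →ₗ[K] Y}
    (hf : IsEven 𝒱 𝒲 f) (hi : Function.Injective f) {i : ZMod 2} {v : X} (hv : f v ∈ 𝒲 i) :
    v ∈ 𝒱 i := by
  obtain ⟨a, ha, b, hb, rfl⟩ := internal_decomp hV v
  rw [map_add] at hv
  rcases zmod2_cases i with rfl | rfl
  · have : b = 0 := hi <| by
      rw [map_zero]
      refine internal_disj hW (i := 0) (j := 1) (by decide) ?_ (hf 1 b hb)
      simpa using sub_mem hv (hf 0 a ha)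
    rwa [this, add_zero]
  · have : a = 0 := hi <| by
      rw [map_zero]
      refine internal_disj hW (i := 0) (j := 1) (by decide) (hf 0 a ha) ?_
      simpa using sub_mem hv (hf 1 b hb)
    rwa [this, zero_add]

end Slice

variable {K : Type u} [Field K]

/-! ### Subcomodules of a Hopf superalgebra and local finiteness. -/

namespace AffineSupergroup

variable (C : AffineSupergroup K)

/-- The operator `c ↦ ∑ ξ(c_2) c_1`. -/
def hit (ξ : Module.Dual K C.carrier) : C.carrier →ₗ[K] C.carrier := slice C.carrier ξ ∘ₗ comul

theorem hit_counit (c : C.carrier) : C.hit counit c = c := by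
  change TensorProduct.rid K C.carrier (counit.lTensor C.carrier (comul c)) = c
  rw [Coalgebra.lTensor_counit_comul]
  simp

/-- Graded subspaces stable under all the operators `hit ξ`. -/
structure IsRightSub (U : Submodule K C.carrier) : Prop where
  homog : ∀ x ∈ C.gr 0, ∀ y ∈ C.gr 1, x + y ∈ U → x ∈ U
  hit_mem : ∀ ξ, ∀ x ∈ U, C.hit ξ x ∈ U

variable {C}

theorem IsRightSub.inf {U U' : Submodule K C.carrier} (h : C.IsRightSub U) (h' : C.IsRightSub U') :
    C.IsRightSub (U ⊓ U') where
  homog x hx y hy hxy := ⟨h.homog x hx y hy hxy.1, h'.homog x hx y hy hxy.2⟩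
  hit_mem ξ x hx := ⟨h.hit_mem ξ x hx.1, h'.hit_mem ξ x hx.2⟩

theorem rTensor_inj {X Y Z : Type*} [AddCommGroup X] [Module K X] [AddCommGroup Y] [Module K Y]
    [AddCommGroup Z] [Module K Z] {f : X →ₗ[K] Y} (hf : Function.Injective f) :
    Function.Injective (f.rTensor Z) :=
  Module.Flat.rTensor_preserves_injective_linearMap f hf

section ToRight

variable {U : Submodule K C.carrier} (h : C.IsRightSub U)
include h

theorem IsRightSub.comul_mem (x : U) :
    comul (R := K) (x : C.carrier) ∈ LinearMap.range (U.subtype.rTensor C.carrier) :=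
  mem_range_of_slice U fun ξ => h.hit_mem ξ x x.2

/-- The coaction on a right subcomodule. -/
def IsRightSub.coact : U →ₗ[K] U ⊗[K] C.carrier :=
  (LinearEquiv.ofInjective (U.subtype.rTensor C.carrier)
    (rTensor_inj U.subtype_injective)).symm.toLinearMap ∘ₗ
      (comul ∘ₗ U.subtype).codRestrict _ h.comul_mem

theorem IsRightSub.rTensor_coact (x : U) :
    U.subtype.rTensor C.carrier (h.coact x) = comul (R := K) (x : C.carrier) :=
  congrArg Subtype.val (LinearEquiv.apply_symm_apply
    (LinearEquiv.ofInjective (U.subtype.rTensor C.carrier) (rTensor_inj U.subtype_injective))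
    ((comul ∘ₗ U.subtype).codRestrict _ h.comul_mem x))

theorem IsRightSub.slice_coact (ξ : Module.Dual K C.carrier) (x : U) :
    slice U ξ (h.coact x) = ⟨C.hit ξ x, h.hit_mem ξ x x.2⟩ := by
  apply U.subtype_injective
  rw [← slice_rTensor, h.rTensor_coact]; rfl

theorem IsRightSub.isInternal : DirectSum.IsInternal fun i => (C.gr i).comap U.subtype := by
  rw [internal_iff]
  constructor
  · rw [Submodule.disjoint_def]
    intro x h0 h1
    exact Subtype.ext (internal_disj C.isInternal (by decide) h0 h1)
  · rw [codisjoint_iff, eq_top_iff]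
    rintro ⟨x, hx⟩ _
    obtain ⟨a, ha, b, hb, rfl⟩ := internal_decomp C.isInternal x
    have ha' := h.homog a ha b hb hx
    have hb' : b ∈ U := by simpa using U.sub_mem hx ha'
    exact Submodule.mem_sup.2 ⟨⟨a, ha'⟩, ha, ⟨b, hb'⟩, hb, rfl⟩

/-- A stable subspace as a right comodule. -/
def IsRightSub.toRight : RightSComod C where
  carrier := U
  gr i := (C.gr i).comap U.subtype
  isInternal := h.isInternal
  coact := h.coact
  coact_mem i v hv := by
    refine mem_of_even_injective (tensorGr_internal h.isInternal C.isInternal)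
      (tensorGr_internal C.isInternal C.isInternal) (f := U.subtype.rTensor C.carrier)
      (map_mem_tensorGr (g := LinearMap.id) (fun _ _ h => h) (fun _ _ h => h))
      (rTensor_inj U.subtype_injective) ?_
    rw [h.rTensor_coact]
    exact C.comul_mem i _ hv
  coassoc v := by
    have e1 : ∀ t : U ⊗[K] C.carrier, U.subtype.rTensor (C.carrier ⊗[K] C.carrier)
        (TensorProduct.assoc K U C.carrier C.carrier (h.coact.rTensor C.carrier t)) =
        TensorProduct.assoc K C.carrier C.carrier C.carrier
          (comul.rTensor C.carrier (U.subtype.rTensor C.carrier t)) := fun t => by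
      induction t with
      | zero => simp
      | add x y hx hy => simp only [map_add, hx, hy]
      | tmul x c =>
        simp only [LinearMap.rTensor_tmul]
        refine Eq.trans ?_ (congrArg (fun z => TensorProduct.assoc K C.carrier C.carrier C.carrier
          (z ⊗ₜ c)) (h.rTensor_coact x))
        generalize h.coact x = s
        induction s with
        | zero => simp
        | add x y hx hy => simp only [map_add, TensorProduct.add_tmul, hx, hy]
        | tmul x y => simp
    have e2 : ∀ t : U ⊗[K] C.carrier, U.subtype.rTensor (C.carrier ⊗[K] C.carrier)
        (comul.lTensor U t) = comul.lTensor C.carrier (U.subtype.rTensor C.carrier t) := fun t => by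
      induction t with
      | zero => simp
      | add x y hx hy => simp only [map_add, hx, hy]
      | tmul x y => simp
    apply rTensor_inj (Z := C.carrier ⊗[K] C.carrier) U.subtype_injective
    rw [e1, e2, h.rTensor_coact, Coalgebra.coassoc_apply]
  counit_coact v := by
    refine (h.slice_coact counit v).trans (Subtype.ext ?_)
    exact C.hit_counit v

end ToRight

variable (C) in
/-- The right subcomodule generated by `c`. -/
def gen (c : C.carrier) : Submodule K C.carrier :=
  LinearMap.range ((LinearMap.mk₂ K (fun (ξ : Module.Dual K C.carrier) t => slice C.carrier ξ t)
    (fun ξ η t => by rw [slice, LinearMap.lTensor_add, LinearMap.comp_add]; rfl)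
    (fun k ξ t => by rw [slice, LinearMap.lTensor_smul, LinearMap.comp_smul]; rfl)
    (fun ξ => map_add _) (fun k ξ => map_smul (slice C.carrier ξ) k)).flip (comul c))

theorem mem_gen_self (c : C.carrier) : c ∈ C.gen c := ⟨counit, C.hit_counit c⟩

/-- All slices of δ(c) lie in the span of the left factors of one finite expression of δ(c). -/
instance (c : C.carrier) : FiniteDimensional K (C.gen c) := by
  obtain ⟨S, hS⟩ := TensorProduct.exists_finset (R := K) (comul (R := K) c)
  have : FiniteDimensional K (Submodule.span K (Prod.fst '' (S : Set (C.carrier × C.carrier)))) :=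
    FiniteDimensional.span_of_finite K (S.finite_toSet.image _)
  refine Submodule.finiteDimensional_of_le
    (S₂ := Submodule.span K (Prod.fst '' (S : Set (C.carrier × C.carrier)))) ?_
  rintro _ ⟨ξ, rfl⟩
  change slice C.carrier ξ (comul c) ∈ _
  rw [hS, map_sum]
  exact sum_mem fun i hi => Submodule.smul_mem _ _ (Submodule.subset_span ⟨i, hi, rfl⟩)

theorem hit_mem_gr {i j : ZMod 2} {c : C.carrier} (hc : c ∈ C.gr i) {ξ : Module.Dual K C.carrier}
    (hξ : ∀ x ∈ C.gr (j + 1), ξ x = 0) : C.hit ξ c ∈ C.gr (i + j) := by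
  have h := C.comul_mem i c hc
  change slice _ ξ (comul c) ∈ _
  generalize comul (R := K) c = t at h
  induction h using Submodule.span_induction with
  | mem x hx =>
    obtain ⟨k, l, rfl, v, hv, c, hc, rfl⟩ := hx
    rw [slice_tmul]
    by_cases h : l = j + 1
    · subst h
      rw [hξ c hc, zero_smul]; exact zero_mem _
    · obtain rfl := RightSComod.eq_of_ne_add_one h
      rw [add_assoc, CharTwo.add_self_eq_zero, add_zero]
      exact Submodule.smul_mem _ _ hv
  | zero => simp
  | add x y _ _ hx hy => rw [map_add]; exact add_mem hx hy
  | smul a x _ hx => rw [map_smul]; exact Submodule.smul_mem _ a hx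

/-- Stability holds because `hit η` after `hit ξ` is `hit` of the convolution of η and ξ. For
homogeneity ξ is cut into its parts supported on even and on odd elements, which shift the
homogeneous c by fixed degrees. -/
theorem isRightSub_gen {i : ZMod 2} {c : C.carrier} (hc : c ∈ C.gr i) :
    C.IsRightSub (C.gen c) where
  homog := by
    rintro x hx y hy ⟨ξ, hξ⟩
    change C.hit ξ c = x + y at hξ
    obtain ⟨p0, p1, a, b, d, e⟩ := exists_proj C.isInternal
    have hsum : ξ = ξ ∘ₗ p0 + ξ ∘ₗ p1 := by
      refine LinearMap.ext fun z => ?_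
      obtain ⟨z0, h0, z1, h1, rfl⟩ := C.decomp z
      simp [a z0 h0, b z1 h1, d z0 h0, e z1 h1]
    have h0 : C.hit (ξ ∘ₗ p0) c ∈ C.gr (i + 0) := hit_mem_gr hc fun x hx => by
      rw [LinearMap.comp_apply, b x hx, map_zero]
    have h1 : C.hit (ξ ∘ₗ p1) c ∈ C.gr (i + 1) := hit_mem_gr hc fun x hx => by
      rw [LinearMap.comp_apply, d x hx, map_zero]
    have hadd : C.hit (ξ ∘ₗ p0) c + C.hit (ξ ∘ₗ p1) c = x + y := by
      rw [← hξ]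
      conv_rhs => rw [hsum]
      change _ = slice _ _ _
      rw [slice, LinearMap.lTensor_add, LinearMap.comp_add]
      rfl
    have key : ∀ {a b a' b' : C.carrier}, a ∈ C.gr 0 → b ∈ C.gr 1 → a' ∈ C.gr 0 → b' ∈ C.gr 1 →
        a + b = a' + b' → a = a' := fun {a b a' b'} ha hb ha' hb' e => by
      have := internal_disj C.isInternal (by decide) (sub_mem ha ha') (i := 0) (j := 1) (by
        rw [show a - a' = b' - b by rw [sub_eq_sub_iff_add_eq_add, e, add_comm]]
        exact sub_mem hb' hb)
      exact sub_eq_zero.1 this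
    rcases zmod2_cases i with rfl | rfl
    · exact ⟨ξ ∘ₗ p0, key h0 h1 hx hy hadd⟩
    · rw [add_comm] at hadd
      exact ⟨ξ ∘ₗ p1, key h1 h0 hx hy hadd⟩
  hit_mem := by
    rintro η _ ⟨ξ, rfl⟩
    refine ⟨LinearMap.mul' K K ∘ₗ TensorProduct.map η ξ ∘ₗ comul, ?_⟩
    change slice _ _ (comul c) = slice _ η (comul (slice _ ξ (comul c)))
    have e1 : ∀ t : C.carrier ⊗[K] C.carrier,
        slice C.carrier (LinearMap.mul' K K ∘ₗ TensorProduct.map η ξ ∘ₗ comul) t =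
        slice C.carrier (LinearMap.mul' K K ∘ₗ TensorProduct.map η ξ)
          (comul.lTensor C.carrier t) := fun t => by
      induction t with
      | zero => simp
      | add x y hx hy => simp only [map_add, hx, hy]
      | tmul x y => simp
    have e2 : ∀ t : C.carrier ⊗[K] C.carrier,
        slice C.carrier (LinearMap.mul' K K ∘ₗ TensorProduct.map η ξ)
          (TensorProduct.assoc K C.carrier C.carrier C.carrier (comul.rTensor C.carrier t)) =
        slice C.carrier η (comul (slice C.carrier ξ t)) := fun t => by
      induction t with
      | zero => simp
      | add x y hx hy => simp only [map_add, hx, hy]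
      | tmul x y =>
        simp only [LinearMap.rTensor_tmul, slice_tmul, map_smul]
        induction (comul x : C.carrier ⊗[K] C.carrier) with
        | zero => simp
        | add x y hx hy => simp only [map_add, TensorProduct.add_tmul, smul_add, hx, hy]
        | tmul x z =>
          simp only [TensorProduct.assoc_tmul, slice_tmul, LinearMap.comp_apply,
            TensorProduct.map_tmul, LinearMap.mul'_apply]
          rw [mul_comm, mul_smul]
    rw [e1, ← Coalgebra.coassoc_apply, e2]

end AffineSupergroup

end
end Super

namespace Super
noncomputable section
set_option linter.unusedSectionVars false
open Coalgebra

/-! ### A unital right colinear map K[H] → K[G] by Zorn's lemma. -/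

namespace ClosedSupersubgroup

open CommSuperalg AffineSupergroup

variable {K : Type u} [Field K] {G : AffineSupergroup K} (H : ClosedSupersubgroup G)

/-- Partial right colinear maps from `K[H]` to `K[G]`. -/
structure IsPartialColinear (f : H.carrier →ₗ.[K] G.carrier) : Prop where
  homog : ∀ x ∈ H.gr 0, ∀ y ∈ H.gr 1, x + y ∈ f.domain → x ∈ f.domain
  mem_graph : ∀ z ∈ f.graph, ∀ ξ : Module.Dual K H.carrier,
    (H.hit ξ z.1, slice G.carrier ξ (H.rightCoact z.2)) ∈ f.graph

variable {H}

theorem IsPartialColinear.isRightSub {f : H.carrier →ₗ.[K] G.carrier}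
    (hf : H.IsPartialColinear f) : H.IsRightSub f.domain where
  homog := hf.homog
  hit_mem ξ x hx := LinearPMap.mem_domain_of_mem_graph
    (hf.mem_graph _ (f.mem_graph ⟨x, hx⟩) ξ)

theorem IsPartialColinear.map_hit {f : H.carrier →ₗ.[K] G.carrier}
    (hf : H.IsPartialColinear f) (ξ : Module.Dual K H.carrier) (x : f.domain) :
    f ⟨H.hit ξ x, hf.isRightSub.hit_mem ξ x x.2⟩ = slice G.carrier ξ (H.rightCoact (f x)) := by
  have h := hf.mem_graph _ (f.mem_graph x) ξ
  obtain ⟨y, hy1, hy2⟩ := (LinearPMap.mem_graph_iff f).1 h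
  exact (congrArg f (Subtype.ext hy1.symm)).trans hy2

theorem isPartialColinear_mk {U : Submodule K H.carrier} (hU : H.IsRightSub U)
    {g : U →ₗ[K] G.carrier} (hg : H.rightCoact ∘ₗ g = g.rTensor H.carrier ∘ₗ hU.coact) :
    H.IsPartialColinear ⟨U, g⟩ where
  homog := hU.homog
  mem_graph z hz ξ := by
    obtain ⟨y, hy1, hy2⟩ := (LinearPMap.mem_graph_iff _).1 hz
    refine (LinearPMap.mem_graph_iff _).2 ⟨⟨H.hit ξ z.1, ?_⟩, rfl, ?_⟩
    · rw [← hy1]; exact hU.hit_mem ξ y y.2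
    · have h := congrArg (slice G.carrier ξ) (LinearMap.congr_fun hg y)
      rw [LinearMap.comp_apply, LinearMap.comp_apply, slice_rTensor, hU.slice_coact] at h
      rw [← hy2]
      refine Eq.trans ?_ h.symm
      exact congrArg g (Subtype.ext (congrArg (H.hit ξ) hy1.symm))

theorem coact_inclusion {U U' : Submodule K H.carrier} (hU : H.IsRightSub U)
    (hU' : H.IsRightSub U') (hle : U ≤ U') (v : U) :
    hU'.coact (Submodule.inclusion hle v) =
      (Submodule.inclusion hle).rTensor H.carrier (hU.coact v) := by
  refine slice_ext fun ξ => ?_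
  rw [slice_rTensor, hU.slice_coact, hU'.slice_coact]
  rfl

theorem rightCoact_comp_eq {U : Submodule K H.carrier} (hU : H.IsRightSub U)
    (g : U →ₗ[K] G.carrier) (hg : ∀ ξ (x : U), g ⟨H.hit ξ x, hU.hit_mem ξ x x.2⟩ =
      slice G.carrier ξ (H.rightCoact (g x))) :
    H.rightCoact ∘ₗ g = g.rTensor H.carrier ∘ₗ hU.coact := by
  refine LinearMap.ext fun x => slice_ext fun ξ => ?_
  rw [LinearMap.comp_apply, LinearMap.comp_apply, slice_rTensor, hU.slice_coact, hg]

/-- If a homogeneous c lies outside the domain, f restricts to the finite dimensional intersection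
of the domain with the subcomodule generated by c, extends from there to that subcomodule, and glues
with f to a larger partial map. -/
theorem IsPartialColinear.domain_eq_top (h : PreservesSurjections H)
    {f : H.carrier →ₗ.[K] G.carrier} (hf : Maximal H.IsPartialColinear f) : f.domain = ⊤ := by
  by_contra hne
  -- A homogeneous c is chosen since only homogeneous elements are known to generate graded
  -- subcomodules.
  obtain ⟨c, i, hc, hcf⟩ : ∃ c i, c ∈ H.gr i ∧ c ∉ f.domain := by
    by_contra! hall
    refine hne (eq_top_iff.2 fun x _ => ?_)
    obtain ⟨a, ha, b, hb, rfl⟩ := H.decomp x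
    exact add_mem (hall a 0 ha) (hall b 1 hb)
  have hE := isRightSub_gen hc
  have hE' := hf.prop.isRightSub.inf hE
  have : FiniteDimensional K (f.domain ⊓ H.gen c : Submodule K H.carrier) :=
    Submodule.finiteDimensional_of_le inf_le_right
  have : FiniteDimensional K hE'.toRight.carrier :=
    inferInstanceAs (FiniteDimensional K (f.domain ⊓ H.gen c : Submodule K H.carrier))
  have : FiniteDimensional K hE.toRight.carrier :=
    inferInstanceAs (FiniteDimensional K (H.gen c))
  obtain ⟨g, hg, hgf⟩ := h.exists_extension hE'.toRight hE.toRight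
    (Submodule.inclusion inf_le_right) (Submodule.inclusion_injective _) (fun i v hv => hv)
    (coact_inclusion hE' hE inf_le_right)
    (f.toFun ∘ₗ Submodule.inclusion inf_le_left)
    (rightCoact_comp_eq hE' _ fun ξ x => hf.prop.map_hit ξ ⟨x.1, x.2.1⟩)
  have hG := isPartialColinear_mk hE hg
  have hagree : ∀ (x : f.domain) (y : (LinearPMap.mk (H.gen c) g).domain),
      (x : H.carrier) = y → f x = (LinearPMap.mk (H.gen c) g) y := fun x y hxy => by
    have := LinearMap.congr_fun hgf ⟨x.1, x.2, by rw [hxy]; exact y.2⟩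
    refine (Eq.trans ?_ this).symm
    exact congrArg g (Subtype.ext hxy.symm)
  have hsup : H.IsPartialColinear (f.sup ⟨H.gen c, g⟩ hagree) := by
    constructor
    · intro x hx y hy hxy
      obtain ⟨a, ha, b, hb, e⟩ := Submodule.mem_sup.1 hxy
      obtain ⟨a0, ha0, a1, ha1, rfl⟩ := H.decomp a
      obtain ⟨b0, hb0, b1, hb1, rfl⟩ := H.decomp b
      have e0 : x = a0 + b0 := by
        refine sub_eq_zero.1 (internal_disj H.isInternal (i := 0) (j := 1) (by decide)
          (sub_mem hx (add_mem ha0 hb0)) ?_)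
        rw [show x - (a0 + b0) = (a1 + b1) - y by
          rw [sub_eq_sub_iff_add_eq_add, ← e]; abel]
        exact sub_mem (add_mem ha1 hb1) hy
      rw [e0]
      exact Submodule.mem_sup.2 ⟨a0, hf.prop.homog a0 ha0 a1 ha1 ha, b0,
        hE.homog b0 hb0 b1 hb1 hb, rfl⟩
    · intro z hz ξ
      obtain ⟨y, hy1, hy2⟩ := (LinearPMap.mem_graph_iff _).1 hz
      obtain ⟨a, ha, b, hb, e⟩ := Submodule.mem_sup.1 y.2
      have h1 := hf.prop.mem_graph _ (f.mem_graph ⟨a, ha⟩) ξ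
      have h2 := hG.mem_graph _ ((LinearPMap.mk (H.gen c) g).mem_graph ⟨b, hb⟩) ξ
      have h3 := add_mem (LinearPMap.le_graph_of_le (LinearPMap.left_le_sup f _ hagree) h1)
        (LinearPMap.le_graph_of_le (LinearPMap.right_le_sup f _ hagree) h2)
      have h4 := LinearPMap.sup_apply hagree ⟨a, ha⟩ ⟨b, hb⟩ y e
      convert h3 using 1
      rw [← hy1, ← hy2, h4, ← e]
      simp only [map_add]
      rfl
  have hle : f.sup ⟨H.gen c, g⟩ hagree ≤ f := hf.2 hsup (LinearPMap.left_le_sup _ _ _)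
  exact hcf (hle.1 (Submodule.mem_sup_right (mem_gen_self c)))

/-- Colinearity is a condition on single elements of the graph, and every element of the union of a
chain lies in the graph of one member. -/
theorem exists_maximal_partialColinear (f₀ : H.carrier →ₗ.[K] G.carrier)
    (h₀ : H.IsPartialColinear f₀) : ∃ f, f₀ ≤ f ∧ Maximal H.IsPartialColinear f := by
  refine zorn_le_nonempty₀ {f | H.IsPartialColinear f} (fun c hc hch y hy => ?_) f₀ h₀
  have hd : DirectedOn (· ≤ ·) c := hch.directedOn
  refine ⟨LinearPMap.sSup c hd, ⟨?_, ?_⟩, fun z hz => LinearPMap.le_sSup hd hz⟩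
  · intro a ha b hb hab
    obtain ⟨f, hf, hm⟩ := (LinearPMap.mem_domain_sSup_iff ⟨y, hy⟩ hd).1 hab
    exact (LinearPMap.mem_domain_sSup_iff ⟨y, hy⟩ hd).2 ⟨f, hf, (hc hf).homog a ha b hb hm⟩
  · intro z hz ξ
    obtain ⟨x, hx1, hx2⟩ := (LinearPMap.mem_graph_iff _).1 hz
    obtain ⟨f, hf, hm⟩ := (LinearPMap.mem_domain_sSup_iff ⟨y, hy⟩ hd).1 x.2
    have hzf : z ∈ f.graph := (LinearPMap.mem_graph_iff _).2 ⟨⟨x, hm⟩, hx1, by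
      rw [← hx2]
      exact (LinearPMap.sSup_apply hd hf ⟨x, hm⟩).symm⟩
    exact LinearPMap.le_graph_of_le (LinearPMap.le_sSup hd hf) ((hc hf).mem_graph z hzf ξ)

/-- A unital right colinear map `K[H] → K[G]`. -/
structure IsSection (l : H.carrier →ₗ[K] G.carrier) : Prop where
  even : IsEven H.gr G.gr l
  map_one : l 1 = 1
  colinear : H.rightCoact ∘ₗ l = l.rTensor H.carrier ∘ₗ comul

theorem rightCoact_one : H.rightCoact (1 : G.carrier) = 1 ⊗ₜ 1 :=
  (H.mem_invariants 1).1 (one_mem _)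

theorem comul_one' (C : AffineSupergroup K) : comul (R := K) (1 : C.carrier) = 1 ⊗ₜ 1 :=
  C.comul_one

theorem hit_one (ξ : Module.Dual K H.carrier) : H.hit ξ (1 : H.carrier) = ξ 1 • 1 := by
  change slice _ ξ (comul (R := K) (1 : H.carrier)) = _
  rw [comul_one' H.toAffineSupergroup, slice_tmul]

/-- A maximal extension of the map that is the identity on scalars. -/
theorem PreservesSurjections.exists_colinear (h : PreservesSurjections H) :
    ∃ l : H.carrier →ₗ[K] G.carrier, l 1 = 1 ∧
      H.rightCoact ∘ₗ l = l.rTensor H.carrier ∘ₗ comul := by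
  have hε : counit (R := K) (1 : H.carrier) = 1 := H.counit_one
  -- On the line through 1 the counit is the coordinate, so this sends c·1 to c·1. It is colinear
  -- because δ(1) = 1 ⊗ 1 in K[H] and the coaction sends 1 to 1 ⊗ 1 in K[G] ⊗ K[H].
  let f₀ : H.carrier →ₗ.[K] G.carrier :=
    ⟨Submodule.span K {1}, (Algebra.linearMap K G.carrier ∘ₗ counit) ∘ₗ Submodule.subtype _⟩
  have h₀ : H.IsPartialColinear f₀ := by
    constructor
    · intro x hx y hy hxy
      obtain ⟨c, hc⟩ := Submodule.mem_span_singleton.1 hxy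
      have hy0 : y = 0 := internal_disj H.isInternal (i := 1) (j := 0) (by decide) hy (by
        rw [show y = x + y - x by abel, ← hc]
        exact sub_mem (Submodule.smul_mem _ _ H.one_mem) hx)
      rwa [hy0, add_zero] at hxy
    · intro z hz ξ
      obtain ⟨x, hx1, hx2⟩ := (LinearPMap.mem_graph_iff _).1 hz
      obtain ⟨c, hc⟩ := Submodule.mem_span_singleton.1 x.2
      have hz1 : z.1 = c • 1 := by rw [← hx1, hc]
      have hz2 : z.2 = c • 1 := by
        rw [← hx2]
        change algebraMap K G.carrier (counit (x : H.carrier)) = _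
        rw [← hc, map_smul, hε, smul_eq_mul, mul_one, Algebra.algebraMap_eq_smul_one]
      refine (LinearPMap.mem_graph_iff _).2 ⟨⟨(c * ξ 1) • 1, Submodule.smul_mem _ _
        (Submodule.mem_span_singleton_self _)⟩, ?_, ?_⟩
      · rw [hz1, map_smul, hit_one, smul_smul]
      · rw [hz2, map_smul, map_smul, rightCoact_one, slice_tmul, smul_smul]
        change algebraMap K G.carrier (counit ((c * ξ 1) • (1 : H.carrier))) = _
        rw [map_smul, hε, smul_eq_mul, mul_one, Algebra.algebraMap_eq_smul_one]
  obtain ⟨f, hf₀, hf⟩ := exists_maximal_partialColinear f₀ h₀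
  have htop := IsPartialColinear.domain_eq_top h hf
  have hmem : ∀ x, x ∈ f.domain := fun x => htop ▸ Submodule.mem_top
  refine ⟨f.toFun ∘ₗ LinearMap.id.codRestrict f.domain hmem, ?_, ?_⟩
  · have h1 : (1 : H.carrier) ∈ f₀.domain := Submodule.mem_span_singleton_self _
    refine (hf₀.2 (x := ⟨1, h1⟩) (y := ⟨1, hmem 1⟩) rfl).symm.trans ?_
    change algebraMap K G.carrier (counit (1 : H.carrier)) = 1
    rw [hε, _root_.map_one]
  · refine LinearMap.ext fun x => slice_ext fun ξ => ?_
    refine (hf.prop.map_hit ξ ⟨x, hmem x⟩).symm.trans ?_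
    exact (slice_rTensor ξ (f.toFun ∘ₗ LinearMap.id.codRestrict f.domain hmem) (comul x)).symm

/-- On a tensor product the parity automorphism is the tensor product of the parity automorphisms,
and even maps commute with parity. -/
theorem comp_par {S T U : CommSuperalg K} {f : S.carrier →ₗ[K] T.carrier ⊗[K] U.carrier}
    (hf : IsEven S.gr (tensorGr T.gr U.gr) f) :
    f ∘ₗ S.par = TensorProduct.map T.par U.par ∘ₗ f := by
  have key : ∀ i, ∀ t ∈ tensorGr T.gr U.gr i, TensorProduct.map T.par U.par t =
      (if i = 0 then t else -t) := fun i t ht => by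
    induction ht using Submodule.span_induction with
    | mem x hx =>
      obtain ⟨k, l, rfl, v, hv, c, hc, rfl⟩ := hx
      rcases zmod2_cases k with rfl | rfl <;> rcases zmod2_cases l with rfl | rfl
      · rw [if_pos (by decide), TensorProduct.map_tmul, par_of_even hv, par_of_even hc]
      · rw [if_neg (by decide), TensorProduct.map_tmul, par_of_even hv, par_of_odd hc,
          TensorProduct.tmul_neg]
      · rw [if_neg (by decide), TensorProduct.map_tmul, par_of_odd hv, par_of_even hc,
          TensorProduct.neg_tmul]
      · rw [if_pos (by decide), TensorProduct.map_tmul, par_of_odd hv, par_of_odd hc,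
          TensorProduct.neg_tmul, TensorProduct.tmul_neg, neg_neg]
    | zero => split_ifs <;> simp
    | add x y _ _ hx hy => rw [map_add, hx, hy]; split_ifs <;> [rfl; rw [neg_add]]
    | smul a x _ hx => rw [map_smul, hx]; split_ifs <;> [rfl; rw [smul_neg]]
  refine LinearMap.ext fun a => ?_
  rw [LinearMap.comp_apply, LinearMap.comp_apply]
  induction a using S.homog_induction with
  | hadd a b ha hb => simp only [map_add, ha, hb]
  | h i a ha =>
    rw [key i _ (hf i a ha)]
    rcases zmod2_cases i with rfl | rfl
    · rw [par_of_even ha, if_pos rfl]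
    · rw [par_of_odd ha, if_neg (by decide), map_neg]

/-- Zorn's lemma gives no control over parity. The average of l and its parity conjugate is the even
part of l; it is still unital, and still colinear because coaction and comultiplication commute with
parity. -/
theorem PreservesSurjections.exists_isSection (h2 : (2 : K) ≠ 0) (h : PreservesSurjections H) :
    ∃ l : H.carrier →ₗ[K] G.carrier, IsSection l := by
  obtain ⟨l, h1, hc⟩ := h.exists_colinear
  refine ⟨(2 : K)⁻¹ • (l + G.par ∘ₗ l ∘ₗ H.par), ⟨fun i v hv => ?_, ?_, ?_⟩⟩
  · obtain ⟨x, hx, y, hy, e⟩ := G.decomp (l v)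
    rw [LinearMap.smul_apply, LinearMap.add_apply, LinearMap.comp_apply, LinearMap.comp_apply]
    rcases zmod2_cases i with rfl | rfl
    · rw [par_of_even hv, ← e, map_add, par_of_even hx, par_of_odd hy,
        show x + y + (x + -y) = (2 : K) • x by rw [two_smul]; abel, smul_smul,
        inv_mul_cancel₀ h2, one_smul]
      exact hx
    · rw [par_of_odd hv, map_neg, map_neg, ← e, map_add, par_of_even hx, par_of_odd hy,
        show x + y + -(x + -y) = (2 : K) • y by rw [two_smul]; abel, smul_smul,
        inv_mul_cancel₀ h2, one_smul]
      exact hy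
  · rw [LinearMap.smul_apply, LinearMap.add_apply, LinearMap.comp_apply, LinearMap.comp_apply,
      par_of_even H.one_mem, h1, par_of_even G.one_mem, ← two_smul K (1 : G.carrier), smul_smul,
      inv_mul_cancel₀ h2, one_smul]
  · have hG := comp_par H.rightCoact_even (T := G.toCommSuperalg) (U := H.toCommSuperalg)
      (S := G.toCommSuperalg)
    have hH := comp_par H.comul_mem (T := H.toCommSuperalg) (U := H.toCommSuperalg)
      (S := H.toCommSuperalg)
    have hp : H.par ∘ₗ H.par = LinearMap.id := LinearMap.ext fun x => par_par x
    have e : H.rightCoact ∘ₗ G.par ∘ₗ l ∘ₗ H.par =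
        (G.par ∘ₗ l ∘ₗ H.par).rTensor H.carrier ∘ₗ comul := by
      rw [← LinearMap.comp_assoc, hG, LinearMap.comp_assoc, ← LinearMap.comp_assoc _ l, hc,
        LinearMap.comp_assoc H.par, hH, ← LinearMap.comp_assoc, ← LinearMap.comp_assoc,
        LinearMap.rTensor, LinearMap.rTensor, ← TensorProduct.map_comp, ← TensorProduct.map_comp,
        LinearMap.comp_id, hp, LinearMap.comp_assoc]
    rw [LinearMap.comp_smul, LinearMap.comp_add, hc, e, LinearMap.rTensor_smul,
      LinearMap.rTensor_add, LinearMap.smul_comp, LinearMap.add_comp]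

end ClosedSupersubgroup

end
end Super

namespace Super
noncomputable section
set_option linter.unusedSectionVars false
open Coalgebra

variable {K : Type u} [Field K]

/-! ### Exchanging left and right colinearity by antipodes. -/

namespace AffineSupergroup

open CommSuperalg

/-- S reverses the legs of δ with a Koszul sign. As f and g are even and E is supercommutative,
exchanging their values absorbs this sign. -/
theorem cv_comp_antipode_eq_swap (C : AffineSupergroup K) {E : CommSuperalg K}
    {f g : C.carrier →ₗ[K] E.carrier} (hf : IsEven C.gr E.gr f) (hg : IsEven C.gr E.gr g) :
    cv f g ∘ₗ C.antipode = cv (g ∘ₗ C.antipode) (f ∘ₗ C.antipode) := by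
  let Φ : C.sq →ₗ[K] E.carrier := LinearMap.mul' K E.carrier ∘ₗ TensorProduct.map f g ∘ₗ
    (gtOf C.toCommSuperalg C.toCommSuperalg).symm.toLinearMap
  have hΦ : ∀ c d : C.carrier, Φ (inr _ _ d * inl _ _ c) = g d * f c := fun c d => by
    induction c using C.homog_induction with
    | hadd a b ha hb => simp only [map_add, mul_add, ha, hb]
    | h i c hc =>
      induction d using C.homog_induction with
      | hadd a b ha hb => simp only [map_add, add_mul, ha, hb]
      | h j d hd =>
        rw [inr_mul_inl hd hc, LinearMap.map_smul_of_tower, inl_mul_inr,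
          E.supercomm _ _ _ (hg j d hd) _ (hf i c hc)]
        rfl
  have h1 : cv f g = Φ ∘ₗ C.comulAlg.toLinearMap := rfl
  rw [h1, LinearMap.comp_assoc, comulAlg_antipode]
  refine LinearMap.ext fun c => ?_
  rw [LinearMap.comp_apply, cv_apply, cv_apply]
  induction (comul c : C.carrier ⊗[K] C.carrier) with
  | zero => simp only [map_zero]
  | add x y hx hy => simp only [map_add, hx, hy]
  | tmul x y => exact hΦ _ _

end AffineSupergroup

namespace ClosedSupersubgroup

open CommSuperalg AffineSupergroup

variable {G : AffineSupergroup K} {H : ClosedSupersubgroup G}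

theorem isEven_inl {C : AffineSupergroup K} {S T : CommSuperalg K} {f : C.carrier →ₗ[K] S.carrier}
    (hf : IsEven C.gr S.gr f) : IsEven C.gr (tensor S T).gr ((inl S T).toLinearMap ∘ₗ f) :=
  fun i c hc => inl_mem (hf i c hc)

theorem isEven_inr {C : AffineSupergroup K} {S T : CommSuperalg K} {f : C.carrier →ₗ[K] T.carrier}
    (hf : IsEven C.gr T.gr f) : IsEven C.gr (tensor S T).gr ((inr S T).toLinearMap ∘ₗ f) :=
  fun i c hc => inr_mem (hf i c hc)

variable (H) in
/-- The left coaction as a morphism of superalgebras. -/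
def leftCoactAlg : G.carrier →ₐ[K] gt H.toCommSuperalg G.toCommSuperalg :=
  (gtDesc (E := tensor H.toCommSuperalg G.toCommSuperalg)
    (H.proj ≫ tensorInl H.toCommSuperalg G.toCommSuperalg)
    (tensorInr H.toCommSuperalg G.toCommSuperalg)).comp G.comulAlg

theorem leftCoactAlg_eq : H.leftCoactAlg.toLinearMap =
    cv ((inl H.toCommSuperalg G.toCommSuperalg).toLinearMap ∘ₗ H.p)
      (inr H.toCommSuperalg G.toCommSuperalg).toLinearMap := by
  refine LinearMap.ext fun a => ?_
  exact gtDesc_gtOf _ _ _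

theorem leftCoactAlg_eq_gtOf (a : G) :
    H.leftCoactAlg a = gtOf H.toCommSuperalg G.toCommSuperalg (H.leftCoact a) := by
  refine (LinearMap.congr_fun leftCoactAlg_eq a).trans ?_
  rw [cv_apply]
  change _ = gtOf _ _ (H.p.rTensor _ (comul a))
  induction (comul a : G.carrier ⊗[K] G.carrier) with
  | zero => simp
  | add x y hx hy => simp only [map_add, hx, hy]
  | tmul x y => exact inl_mul_inr _ _

/-- A unital left colinear map `K[H] → K[G]`. -/
structure IsLeftSection (l : H.carrier →ₗ[K] G.carrier) : Prop where
  even : IsEven H.gr G.gr l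
  map_one : l 1 = 1
  colinear : H.leftCoact ∘ₗ l = l.lTensor H.carrier ∘ₗ comul

/-- Restates left colinearity as a convolution identity in the graded tensor product, where the
algebra structure can be used. -/
theorem leftCoact_comp_iff (l : H.carrier →ₗ[K] G.carrier) :
    H.leftCoact ∘ₗ l = l.lTensor H.carrier ∘ₗ comul ↔ H.leftCoactAlg.toLinearMap ∘ₗ l =
      cv (inl H.toCommSuperalg G.toCommSuperalg).toLinearMap
        ((inr H.toCommSuperalg G.toCommSuperalg).toLinearMap ∘ₗ l) := by
  have e : ∀ c, gtOf H.toCommSuperalg G.toCommSuperalg (l.lTensor H.carrier (comul c)) =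
      cv (inl H.toCommSuperalg G.toCommSuperalg).toLinearMap
        ((inr H.toCommSuperalg G.toCommSuperalg).toLinearMap ∘ₗ l) c := fun c => by
    rw [cv_apply]
    induction (comul c : H.carrier ⊗[K] H.carrier) with
    | zero => simp
    | add x y hx hy => simp only [map_add, hx, hy]
    | tmul x y => exact (inl_mul_inr _ _).symm
  constructor
  · intro h
    refine LinearMap.ext fun c => ?_
    rw [← e]
    exact (leftCoactAlg_eq_gtOf (l c)).trans (congrArg _ (LinearMap.congr_fun h c))
  · intro h
    refine LinearMap.ext fun c => (gtOf H.toCommSuperalg G.toCommSuperalg).injective ?_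
    refine (leftCoactAlg_eq_gtOf (l c)).symm.trans ((LinearMap.congr_fun h c).trans ?_)
    exact (e c).symm

/-- The right coaction of S(l(c)) is the convolution of inr∘S with inl∘S∘l, because S reverses legs
and l is left colinear. Convolving with inr on the left cancels inr∘S. -/
theorem IsLeftSection.isSplitting {l : H.carrier →ₗ[K] G.carrier} (hl : IsLeftSection l) :
    H.IsSplitting (G.antipode ∘ₗ l) where
  even i c hc := G.antipode_mem i _ (hl.even i c hc)
  map_one := by rw [LinearMap.comp_apply, hl.map_one, G.antipode_one]
  cv_eq := by
    have h := G.cv_comp_antipode_eq_swap (E := tensor G.toCommSuperalg H.toCommSuperalg)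
      (f := (inl G.toCommSuperalg H.toCommSuperalg).toLinearMap)
      (g := (inr G.toCommSuperalg H.toCommSuperalg).toLinearMap ∘ₗ H.p)
      (isEven_inl (f := LinearMap.id) fun _ _ h => h) (isEven_inr H.p_even)
    have h2 : H.rightCoactAlg.toLinearMap ∘ₗ G.antipode ∘ₗ l =
        cv ((inr G.toCommSuperalg H.toCommSuperalg).toLinearMap ∘ₗ H.antipode)
          ((inl G.toCommSuperalg H.toCommSuperalg).toLinearMap ∘ₗ G.antipode ∘ₗ l) := by
      rw [← LinearMap.comp_assoc, rightCoactAlg_eq]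
      refine (congrArg (fun f => f ∘ₗ l) h).trans ?_
      have e : ∀ t : G.carrier ⊗[K] G.carrier, LinearMap.mul' K H.gh (TensorProduct.map
          (((inr G.toCommSuperalg H.toCommSuperalg).toLinearMap ∘ₗ H.p) ∘ₗ G.antipode)
          ((inl G.toCommSuperalg H.toCommSuperalg).toLinearMap ∘ₗ G.antipode) t) =
          LinearMap.mul' K H.gh (TensorProduct.map
          ((inr G.toCommSuperalg H.toCommSuperalg).toLinearMap ∘ₗ H.antipode)
          ((inl G.toCommSuperalg H.toCommSuperalg).toLinearMap ∘ₗ G.antipode)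
          (H.p.rTensor G.carrier t)) := fun t => by
        rw [LinearMap.comp_assoc, H.p_antipode, ← LinearMap.comp_assoc]
        exact congrArg _ (LinearMap.congr_fun (LinearMap.map_comp_rTensor _ _ _ H.p).symm t)
      refine LinearMap.ext fun c => (e (comul (l c))).trans ?_
      have hc := LinearMap.congr_fun hl.colinear c
      change H.p.rTensor G.carrier (comul (l c)) = _ at hc
      rw [hc, cv_apply]
      exact congrArg _ (LinearMap.congr_fun (LinearMap.map_comp_lTensor _ _ _ l) (comul c))
    rw [h2]
    exact cv_cancel_left (H.cv_comp_antipode _) _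

/-- Precomposing and postcomposing with antipodes reverses the legs on both sides, so right
colinearity becomes left colinearity; S∘S = id on K[H] restores the argument. -/
theorem IsSection.isLeftSection {l : H.carrier →ₗ[K] G.carrier} (hl : IsSection l) :
    IsLeftSection (G.antipode ∘ₗ l ∘ₗ H.antipode) where
  even i c hc := G.antipode_mem i _ (hl.even i _ (H.antipode_mem i c hc))
  map_one := by
    rw [LinearMap.comp_apply, LinearMap.comp_apply, H.antipode_one, hl.map_one, G.antipode_one]
  colinear := by
    rw [leftCoact_comp_iff]
    have h := G.cv_comp_antipode_eq_swap (E := tensor H.toCommSuperalg G.toCommSuperalg)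
      (f := (inl H.toCommSuperalg G.toCommSuperalg).toLinearMap ∘ₗ H.p)
      (g := (inr H.toCommSuperalg G.toCommSuperalg).toLinearMap)
      (isEven_inl H.p_even) (isEven_inr (f := LinearMap.id) fun _ _ h => h)
    have h' : H.leftCoactAlg.toLinearMap ∘ₗ G.antipode ∘ₗ l =
        cv ((inr H.toCommSuperalg G.toCommSuperalg).toLinearMap ∘ₗ G.antipode ∘ₗ l)
          ((inl H.toCommSuperalg G.toCommSuperalg).toLinearMap ∘ₗ H.antipode) := by
      rw [← LinearMap.comp_assoc, leftCoactAlg_eq]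
      refine (congrArg (fun f => f ∘ₗ l) h).trans ?_
      have e : ∀ t : G.carrier ⊗[K] G.carrier, LinearMap.mul' K _ (TensorProduct.map
          ((inr H.toCommSuperalg G.toCommSuperalg).toLinearMap ∘ₗ G.antipode)
          (((inl H.toCommSuperalg G.toCommSuperalg).toLinearMap ∘ₗ H.p) ∘ₗ G.antipode) t) =
          LinearMap.mul' K _ (TensorProduct.map
          ((inr H.toCommSuperalg G.toCommSuperalg).toLinearMap ∘ₗ G.antipode)
          ((inl H.toCommSuperalg G.toCommSuperalg).toLinearMap ∘ₗ H.antipode)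
          (H.p.lTensor G.carrier t)) := fun t => by
        rw [LinearMap.comp_assoc, H.p_antipode, ← LinearMap.comp_assoc]
        exact congrArg _ (LinearMap.congr_fun (LinearMap.map_comp_lTensor _ _ _ H.p).symm t)
      refine LinearMap.ext fun c => (e (comul (l c))).trans ?_
      have hc := LinearMap.congr_fun hl.colinear c
      change H.p.lTensor G.carrier (comul (l c)) = _ at hc
      rw [hc, cv_apply]
      exact congrArg _ (LinearMap.congr_fun (LinearMap.map_comp_rTensor _ _ _ l) (comul c))
    have h2 := H.cv_comp_antipode_eq_swap (E := tensor H.toCommSuperalg G.toCommSuperalg)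
      (f := (inr H.toCommSuperalg G.toCommSuperalg).toLinearMap ∘ₗ G.antipode ∘ₗ l)
      (g := (inl H.toCommSuperalg G.toCommSuperalg).toLinearMap ∘ₗ H.antipode)
      (isEven_inr fun i c hc => G.antipode_mem i _ (hl.even i c hc)) (isEven_inl H.antipode_mem)
    have h3 := (congrArg (fun f => f ∘ₗ H.antipode) h').trans h2
    refine h3.trans ?_
    rw [LinearMap.comp_assoc, H.antipode_comp_antipode, LinearMap.comp_id]
    rfl

end ClosedSupersubgroup

end
end Super

/-! ### A left section gives an injective cogenerator, and conversely. -/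

namespace Super
noncomputable section
set_option linter.unusedSectionVars false
open Coalgebra

variable {K : Type u} [Field K]

theorem exists_even_odd {V W : Type*} [AddCommGroup V] [Module K V] [AddCommGroup W] [Module K W]
    {𝒱 : ZMod 2 → Submodule K V} {𝒲 : ZMod 2 → Submodule K W} (hV : DirectSum.IsInternal 𝒱)
    (hW : DirectSum.IsInternal 𝒲) (g : V →ₗ[K] W) :
    ∃ g0 g1 : V →ₗ[K] W, g = g0 + g1 ∧ (∀ i, ∀ v ∈ 𝒱 i, g0 v ∈ 𝒲 i) ∧
      ∀ i, ∀ v ∈ 𝒱 i, g1 v ∈ 𝒲 (i + 1) := by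
  obtain ⟨p0, p1, a, b, c, d⟩ := exists_proj hV
  obtain ⟨q0, q1, a', b', c', d'⟩ := exists_proj hW
  have m0 : ∀ w, q0 w ∈ 𝒲 0 := fun w => by
    obtain ⟨x, hx, y, hy, rfl⟩ := internal_decomp hW w
    rw [map_add, a' x hx, b' y hy, add_zero]; exact hx
  have m1 : ∀ w, q1 w ∈ 𝒲 1 := fun w => by
    obtain ⟨x, hx, y, hy, rfl⟩ := internal_decomp hW w
    rw [map_add, c' x hx, d' y hy, zero_add]; exact hy
  refine ⟨q0 ∘ₗ g ∘ₗ p0 + q1 ∘ₗ g ∘ₗ p1, q0 ∘ₗ g ∘ₗ p1 + q1 ∘ₗ g ∘ₗ p0, ?_, ?_, ?_⟩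
  · have hq : ∀ w, q0 w + q1 w = w := fun w => by
      obtain ⟨x, hx, y, hy, rfl⟩ := internal_decomp hW w
      rw [map_add, map_add, a' x hx, b' y hy, c' x hx, d' y hy, add_zero, zero_add]
    ext v
    obtain ⟨x, hx, y, hy, rfl⟩ := internal_decomp hV v
    simp only [LinearMap.add_apply, LinearMap.comp_apply, map_add, a x hx, b y hy, c x hx, d y hy,
      map_zero, add_zero, zero_add]
    conv_lhs => rw [← hq (g x), ← hq (g y)]
    abel
  · intro i v hv
    rcases zmod2_cases i with rfl | rfl
    · simp [a v hv, c v hv, m0]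
    · simp [b v hv, d v hv, m1]
  · intro i v hv
    rcases zmod2_cases i with rfl | rfl
    · simp [a v hv, c v hv, m1]
    · simp [b v hv, d v hv, m0, CharTwo.add_self_eq_zero]

namespace LeftSComod

variable {C : AffineSupergroup K}

theorem lin_ext {V W : LeftSComod C} {f g : V ⟶ W} (h : ∀ v, lin f v = lin g v) : f = g :=
  Hom.ext (LinearMap.ext h)

theorem lin_comp {V W X : LeftSComod C} (f : V ⟶ W) (g : W ⟶ X) (v : V.carrier) :
    lin (f ≫ g) v = lin g (lin f v) := rfl

theorem coact_lin {V W : LeftSComod C} (f : V ⟶ W) (v : V.carrier) :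
    W.coact (lin f v) = (lin f).lTensor C.carrier (V.coact v) := Hom.colinear f v

theorem lin_mem {V W : LeftSComod C} (f : V ⟶ W) {i : ZMod 2} {v : V.carrier} (hv : v ∈ V.gr i) :
    lin f v ∈ W.gr i := Hom.even f i v hv

/-- The kernel of a morphism of supercomodules. -/
def ker {V W : LeftSComod C} (f : V ⟶ W) : LeftSComod C :=
  V.sub (LinearMap.ker (lin f))
    (fun _ hx _ hy h => ClosedSupersubgroup.even_ker W.isInternal (Hom.even f) hx hy h)
    (fun x => mem_range_ker_subtype (lin f) _ (by
      change (lin f).lTensor C.carrier (V.coact x.1) = 0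
      rw [← coact_lin, LinearMap.mem_ker.1 x.2, map_zero]))

/-- The inclusion of the kernel. -/
def kerι {V W : LeftSComod C} (f : V ⟶ W) : ker f ⟶ V :=
  Hom.mk (LinearMap.ker (lin f)).subtype (fun _ _ h => h)
    (fun v => (V.sub_coact _ _ _ v).symm)

/-- The zero morphism. -/
def zeroHom (V W : LeftSComod C) : V ⟶ W :=
  Hom.mk 0 (fun _ _ _ => zero_mem _) (fun v => by simp)

/-- The inclusion of the kernel and the zero map agree after composition with f, hence are equal. -/
theorem injective_of_mono {V W : LeftSComod C} (f : V ⟶ W) [Mono f] :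
    Function.Injective (lin f) := by
  rw [injective_iff_map_eq_zero]
  intro v hv
  have h : kerι f = zeroHom (ker f) V := by
    rw [← cancel_mono f]
    refine lin_ext fun x => ?_
    exact (LinearMap.mem_ker.1 x.2).trans (map_zero (lin f)).symm
  exact congrArg (fun g : ker f ⟶ V => lin g (⟨v, hv⟩ : LinearMap.ker (lin f))) h

theorem mono_of_injective {V W : LeftSComod C} (f : V ⟶ W) (hf : Function.Injective (lin f)) :
    Mono f :=
  ⟨fun g h e => lin_ext fun x => hf (congrArg (fun k => lin k x) e)⟩

end LeftSComod

namespace ClosedSupersubgroup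

open CommSuperalg AffineSupergroup LeftSComod

variable {G : AffineSupergroup K} {H : ClosedSupersubgroup G}

namespace IsLeftSection

variable {l : H.carrier →ₗ[K] G.carrier} (hl : IsLeftSection l)

/-- The map `c ⊗ a ↦ ∑ l(c S(p(a_1))) a_2`. -/
def retract (l : H.carrier →ₗ[K] G.carrier) : H.carrier ⊗[K] G.carrier →ₗ[K] G.carrier :=
  LinearMap.mul' K G.carrier ∘ₗ
    (l ∘ₗ LinearMap.mul' K H.carrier ∘ₗ (H.antipode ∘ₗ H.p).lTensor H.carrier).rTensor G.carrier ∘ₗ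
    (TensorProduct.assoc K H.carrier G.carrier G.carrier).symm.toLinearMap ∘ₗ
    comul.lTensor H.carrier

theorem retract_tmul (c : H.carrier) (a : G) : retract l (c ⊗ₜ a) =
    cv (l ∘ₗ LinearMap.mulLeft K c ∘ₗ H.antipode ∘ₗ H.p) LinearMap.id a := by
  rw [cv_apply]
  change LinearMap.mul' K G.carrier (LinearMap.rTensor _ _
    ((TensorProduct.assoc K H.carrier G.carrier G.carrier).symm (c ⊗ₜ comul a))) = _
  induction (comul a : G.carrier ⊗[K] G.carrier) with
  | zero => simp
  | add x y hx hy => simp only [map_add, TensorProduct.tmul_add, hx, hy]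
  | tmul x y => rfl

include hl in
theorem retract_mem {i : ZMod 2} {t : H.carrier ⊗[K] G.carrier}
    (ht : t ∈ tensorGr H.gr G.gr i) : retract l t ∈ G.gr i := by
  induction ht using Submodule.span_induction with
  | mem x hx =>
    obtain ⟨j, k, rfl, c, hc, a, ha, rfl⟩ := hx
    rw [retract_tmul, cv_apply]
    have h := G.comul_mem k a ha
    generalize comul (R := K) a = t at h
    induction h using Submodule.span_induction with
    | mem x hx =>
      obtain ⟨m, n, rfl, x, hx, y, hy, rfl⟩ := hx
      rw [← add_assoc]
      exact G.mul_mem (hl.even _ _ (H.mul_mem hc (H.antipode_mem _ _ (H.p_even _ _ hx)))) hy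
    | zero => simp
    | add x y _ _ hx hy => rw [map_add, map_add]; exact add_mem hx hy
    | smul a x _ hx => rw [map_smul, map_smul]; exact Submodule.smul_mem _ a hx
  | zero => simp
  | add x y _ _ hx hy => rw [map_add]; exact add_mem hx hy
  | smul a x _ hx => rw [map_smul]; exact Submodule.smul_mem _ a hx

include hl in
-- The composite is ∑ l(p(a_1) S(p(a_2))) a_3, which collapses to l(1) a = a.
theorem retract_leftCoact (a : G) : retract l (H.leftCoact a) = a := by
  let x : G.carrier ⊗[K] G.carrier →ₗ[K] G.carrier := retract l ∘ₗ H.p.rTensor G.carrier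
  have e : ∀ t : G.carrier ⊗[K] G.carrier, retract l (H.p.rTensor G.carrier t) =
      LinearMap.mul' K G.carrier ((l ∘ₗ LinearMap.mul' K H.carrier ∘ₗ
        TensorProduct.map H.p (H.antipode ∘ₗ H.p)).rTensor G.carrier
        ((TensorProduct.assoc K G.carrier G.carrier G.carrier).symm
          (comul.lTensor G.carrier t))) := fun t => by
    induction t with
    | zero => simp
    | add x y hx hy => simp only [map_add, hx, hy]
    | tmul x y =>
      rw [LinearMap.rTensor_tmul, retract_tmul, cv_apply, LinearMap.lTensor_tmul]
      induction (comul y : G.carrier ⊗[K] G.carrier) with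
      | zero => simp
      | add x y hx hy => simp only [map_add, TensorProduct.tmul_add, hx, hy]
      | tmul y z => rfl
  have e2 : ∀ t : G.carrier ⊗[K] G.carrier, LinearMap.mul' K G.carrier
      ((l ∘ₗ LinearMap.mul' K H.carrier ∘ₗ TensorProduct.map H.p (H.antipode ∘ₗ H.p)).rTensor
        G.carrier (comul.rTensor G.carrier t)) =
      TensorProduct.lid K G.carrier (counit.rTensor G.carrier t) := fun t => by
    induction t with
    | zero => simp
    | add x y hx hy => simp only [map_add, hx, hy]
    | tmul x y =>
      have h := LinearMap.congr_fun (G.cv_comp_antipode (hom H.proj)) x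
      change l (LinearMap.mul' K H.carrier (TensorProduct.map H.p (H.antipode ∘ₗ H.p)
        (comul x))) * y = counit (R := K) x • y
      rw [← H.p_antipode]
      refine (congrArg (fun z => l z * y) h).trans ?_
      rw [cvOne_apply, Algebra.algebraMap_eq_smul_one, map_smul, hl.map_one, smul_mul_assoc,
        one_mul]
  change retract l (H.p.rTensor G.carrier (comul a)) = a
  rw [e, ← Coalgebra.coassoc_apply, LinearEquiv.symm_apply_apply, e2,
    Coalgebra.rTensor_counit_comul]
  simp

/-- `x ⊗ y ↦ x ⊗ l(y)` on graded tensor products. -/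
def pushRight (l : H.carrier →ₗ[K] G.carrier) :
    gt H.toCommSuperalg H.toCommSuperalg →ₗ[K] gt H.toCommSuperalg G.toCommSuperalg :=
  (gtOf H.toCommSuperalg G.toCommSuperalg).toLinearMap ∘ₗ l.lTensor H.carrier ∘ₗ
    (gtOf H.toCommSuperalg H.toCommSuperalg).symm.toLinearMap

theorem pushRight_mul (x y : H.carrier) :
    pushRight l (inl _ _ x * inr _ _ y) = inl _ _ x * inr _ _ (l y) := by
  rw [inl_mul_inr, inl_mul_inr]; rfl

include hl in
-- As l is even, moving c past y and past l(y) costs the same sign.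
theorem pushRight_mul_inl (c : H.carrier) (z : gt H.toCommSuperalg H.toCommSuperalg) :
    pushRight l (z * inl _ _ c) = pushRight l z * inl _ _ c := by
  induction c using H.homog_induction with
  | hadd a b ha hb => simp only [map_add, mul_add, ha, hb]
  | h k c hc =>
    induction z using gt_induction with
    | hadd x y hx hy => rw [add_mul, map_add, map_add, hx, hy, add_mul]
    | h i s hs j t ht =>
      rw [mul_assoc, inr_mul_inl ht hc, mul_smul_comm, ← mul_assoc, ← _root_.map_mul,
        LinearMap.map_smul_of_tower, pushRight_mul, pushRight_mul, mul_assoc,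
        inr_mul_inl (hl.even _ _ ht) hc, mul_smul_comm, ← mul_assoc, _root_.map_mul]

include hl in
theorem leftCoactAlg_apply (c : H.carrier) :
    H.leftCoactAlg (l c) = pushRight l (H.comulAlg c) := by
  refine (leftCoactAlg_eq_gtOf (l c)).trans ?_
  exact congrArg _ (LinearMap.congr_fun hl.colinear c)

include hl in
-- The heart of colinearity of `retract`. In the coaction of l(cS(p(a_1))) a_2 the reversed left leg
-- of S(p(a_1)) meets the left leg of a_2 and cancels, so only the left leg of c survives. With
-- `retract_leftCoact` this makes K[G] a direct summand of the cofree comodule K[H] ⊗ K[G].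
theorem leftCoactAlg_retract (c : H.carrier) (a : G) : H.leftCoactAlg (retract l (c ⊗ₜ a)) =
    gtOf H.toCommSuperalg G.toCommSuperalg ((retract l).lTensor H.carrier
      (TensorProduct.assoc K H.carrier H.carrier G.carrier (comul c ⊗ₜ a))) := by
  let L : G.carrier →ₗ[K] gt H.toCommSuperalg G.toCommSuperalg := H.leftCoactAlg.toLinearMap
  let Sp : G.carrier →ₗ[K] H.carrier := H.antipode ∘ₗ H.p
  let f : gt H.toCommSuperalg H.toCommSuperalg → G.carrier →ₗ[K]
      gt H.toCommSuperalg G.toCommSuperalg := fun z => pushRight l ∘ₗ LinearMap.mulLeft K z ∘ₗ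
        (inr H.toCommSuperalg H.toCommSuperalg).toLinearMap ∘ₗ Sp
  -- Coaction of the factor containing l: colinearity of l turns it into δ(c) δ(S(p(b))), and the
  -- leg S(p(b_2)) is split off on the right.
  have h1 : L ∘ₗ (l ∘ₗ LinearMap.mulLeft K c ∘ₗ H.antipode ∘ₗ H.p) =
      cv (f (H.comulAlg c)) ((inl H.toCommSuperalg G.toCommSuperalg).toLinearMap ∘ₗ Sp) := by
    refine LinearMap.ext fun b => ?_
    have hS : H.comulAlg (Sp b) = cv
        ((inr H.toCommSuperalg H.toCommSuperalg).toLinearMap ∘ₗ Sp)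
        ((inl H.toCommSuperalg H.toCommSuperalg).toLinearMap ∘ₗ Sp) b := by
      refine (LinearMap.congr_fun H.comulAlg_antipode (H.p b)).trans ?_
      exact LinearMap.congr_fun (cv_comp _ _ H.p H.comul_comp_p) b
    change H.leftCoactAlg (l (c * Sp b)) = _
    rw [leftCoactAlg_apply hl, _root_.map_mul, hS, cv_apply, cv_apply]
    induction (comul b : G.carrier ⊗[K] G.carrier) with
    | zero => simp
    | add x y hx hy => simp only [map_add, mul_add, hx, hy]
    | tmul x y =>
      change pushRight l (_ * (inr _ _ (Sp x) * inl _ _ (Sp y))) =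
        pushRight l (_ * inr _ _ (Sp x)) * inl _ _ (Sp y)
      rw [← mul_assoc, pushRight_mul_inl hl]
  -- The leg that was split off cancels the left leg of the coaction of the remaining factor of a.
  have h2 : cv ((inl H.toCommSuperalg G.toCommSuperalg).toLinearMap ∘ₗ Sp) L =
      (inr H.toCommSuperalg G.toCommSuperalg).toLinearMap := by
    change cv (_ ∘ₗ H.antipode ∘ₗ H.p) H.leftCoactAlg.toLinearMap = _
    rw [leftCoactAlg_eq, ← H.p_antipode]
    exact cv_cancel_left (G.cv_antipode_comp
      ((inl H.toCommSuperalg G.toCommSuperalg).comp (hom H.proj))) _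
  rw [retract_tmul]
  refine (LinearMap.congr_fun (comp_cv H.leftCoactAlg _ _) a).trans ?_
  refine (LinearMap.congr_fun (congrArg (fun z => cv z _) h1) a).trans ?_
  rw [LinearMap.comp_id, cv_assoc]
  refine (LinearMap.congr_fun (congrArg (cv _) h2) a).trans ?_
  have h3 : ∀ t : H.carrier ⊗[K] H.carrier,
      cv (f (gtOf _ _ t)) (inr H.toCommSuperalg G.toCommSuperalg).toLinearMap a =
      gtOf H.toCommSuperalg G.toCommSuperalg ((retract l).lTensor H.carrier
      (TensorProduct.assoc K H.carrier H.carrier G.carrier (t ⊗ₜ a))) := fun t => by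
    induction t with
    | zero =>
      rw [cv_apply]
      have : f 0 = 0 := LinearMap.ext fun b => by simp [f]
      simp [this]
    | add x y hx hy =>
      have : f (gtOf _ _ x + gtOf _ _ y) = f (gtOf _ _ x) + f (gtOf _ _ y) :=
        LinearMap.ext fun b => by simp [f, add_mul]
      rw [map_add, this, TensorProduct.add_tmul, map_add, map_add, map_add, ← hx, ← hy, cv_apply,
        TensorProduct.map_add_left, LinearMap.add_apply, map_add]
      rfl
    | tmul x y =>
      rw [TensorProduct.assoc_tmul, LinearMap.lTensor_tmul, retract_tmul, ← inl_mul_inr,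
        ← inl_mul_inr, cv_apply, cv_apply]
      induction (comul a : G.carrier ⊗[K] G.carrier) with
      | zero => simp
      | add x y hx hy => simp only [map_add, mul_add, hx, hy]
      | tmul b d =>
        change pushRight l (inl _ _ x * inr _ _ y * inr _ _ (Sp b)) * inr _ _ d =
          inl _ _ x * inr _ _ (l (y * Sp b) * d)
        rw [mul_assoc, ← _root_.map_mul (inr H.toCommSuperalg H.toCommSuperalg), pushRight_mul,
          _root_.map_mul (inr H.toCommSuperalg G.toCommSuperalg), mul_assoc]
  exact h3 (comul c)

include hl in
theorem leftCoact_retract (t : H.carrier ⊗[K] G.carrier) : H.leftCoact (retract l t) =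
    (retract l).lTensor H.carrier (cofreeCoact H.toAffineSupergroup G.carrier t) := by
  induction t with
  | zero => simp
  | add x y hx hy => simp only [map_add, hx, hy]
  | tmul c a =>
    refine (gtOf H.toCommSuperalg G.toCommSuperalg).injective ?_
    rw [← leftCoactAlg_eq_gtOf, leftCoactAlg_retract hl]
    rfl

/-- The colinear map to `K[G]` made from a linear one. -/
def average (l : H.carrier →ₗ[K] G.carrier) {W : LeftSComod H.toAffineSupergroup}
    (g : W.carrier →ₗ[K] G.carrier) : W.carrier →ₗ[K] G.carrier :=
  retract l ∘ₗ g.lTensor H.carrier ∘ₗ W.coact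

include hl in
-- `average` factors as the coaction of W, then id ⊗ g into the cofree comodule, then `retract`;
-- each of the three is colinear.
theorem leftCoact_average {W : LeftSComod H.toAffineSupergroup} (g : W.carrier →ₗ[K] G.carrier)
    (w : W.carrier) : H.leftCoact (average l g w) =
      (average l g).lTensor H.carrier (W.coact w) := by
  have e : ∀ t : H.carrier ⊗[K] W.carrier,
      cofreeCoact H.toAffineSupergroup G.carrier (g.lTensor H.carrier t) =
      (g.lTensor H.carrier).lTensor H.carrier (TensorProduct.assoc K H.carrier H.carrier W.carrier
        (comul.rTensor W.carrier t)) := fun t => by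
    induction t with
    | zero => simp
    | add x y hx hy => simp only [map_add, hx, hy]
    | tmul c w =>
      simp only [cofreeCoact, LinearMap.comp_apply, LinearMap.lTensor_tmul, LinearMap.rTensor_tmul,
        LinearEquiv.coe_coe]
      induction (comul c : H.carrier ⊗[K] H.carrier) with
      | zero => simp
      | add x y hx hy => simp only [map_add, TensorProduct.add_tmul, hx, hy]
      | tmul x y => simp
  rw [average, LinearMap.comp_apply, LinearMap.comp_apply, leftCoact_retract hl, e]
  refine (congrArg (fun z => (retract l).lTensor H.carrier ((g.lTensor H.carrier).lTensor
    H.carrier z)) (W.coassoc w)).trans ?_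
  rw [LinearMap.lTensor_comp, LinearMap.lTensor_comp]
  rfl

include hl in
theorem average_mem {W : LeftSComod H.toAffineSupergroup} {g : W.carrier →ₗ[K] G.carrier}
    {k : ZMod 2} (hg : ∀ i, ∀ v ∈ W.gr i, g v ∈ G.gr (i + k)) {i : ZMod 2} {w : W.carrier}
    (hw : w ∈ W.gr i) : average l g w ∈ G.gr (i + k) := by
  refine retract_mem hl ?_
  have h := W.coact_mem i w hw
  change g.lTensor H.carrier (W.coact w) ∈ _
  generalize W.coact w = t at h
  induction h using Submodule.span_induction with
  | mem x hx =>
    obtain ⟨j, n, rfl, c, hc, v, hv, rfl⟩ := hx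
    exact tmul_mem_tensorGr hc (hg n v hv) (add_assoc j n k).symm
  | zero => simp
  | add x y _ _ hx hy => rw [map_add]; exact add_mem hx hy
  | smul a x _ hx => rw [map_smul]; exact Submodule.smul_mem _ a hx

/-- The morphism to `K[G]` made from an even map. -/
def averageHom {W : LeftSComod H.toAffineSupergroup} (g : W.carrier →ₗ[K] G.carrier)
    (hg : ∀ i, ∀ v ∈ W.gr i, g v ∈ G.gr i) : W ⟶ H.coordLeft :=
  Hom.mk (average l g) (fun i w hw => by
    have h := average_mem hl (k := 0) (g := g) (fun i v hv => by rw [add_zero]; exact hg i v hv) hw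
    rwa [add_zero] at h) (leftCoact_average hl g)

/-- The morphism to the parity shift of `K[G]` made from an odd map. -/
def averageShift {W : LeftSComod H.toAffineSupergroup} (g : W.carrier →ₗ[K] G.carrier)
    (hg : ∀ i, ∀ v ∈ W.gr i, g v ∈ G.gr (i + 1)) : W ⟶ H.coordLeft.parityShift :=
  Hom.mk (average l g) (fun i w hw => average_mem hl hg hw) (leftCoact_average hl g)

include hl in
-- For colinear f the map id ⊗ f carries the coaction of w to that of f(w), and `retract` splits the
-- coaction of K[G].
theorem average_eq_of_colinear {W : LeftSComod H.toAffineSupergroup} (f : W ⟶ H.coordLeft) :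
    average l (lin f) = lin f := by
  refine LinearMap.ext fun w => ?_
  have h := coact_lin f w
  change retract l ((lin f).lTensor H.carrier (W.coact w)) = _
  rw [← h]
  exact retract_leftCoact hl _

include hl in
-- Extend f linearly, keep the even part and average it. Averaging is compatible with the inclusion
-- j and does not change the colinear map f.
theorem injective_coordLeft : Injective H.coordLeft where
  factors {X Y} f j _ := by
    obtain ⟨q, hq⟩ := (lin j).exists_leftInverse_of_injective
      (LinearMap.ker_eq_bot.2 (injective_of_mono j))
    let fl : X.carrier →ₗ[K] G.carrier := lin f
    have hfl : ∀ i, ∀ a ∈ X.gr i, fl a ∈ G.gr i := fun i a ha => lin_mem f ha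
    obtain ⟨g0, g1, hg, h0, h1⟩ := exists_even_odd Y.isInternal G.isInternal (fl ∘ₗ q)
    have hj : ∀ x, g0 (lin j x) = fl x := fun x => by
      obtain ⟨a, ha, b, hb, rfl⟩ := internal_decomp X.isInternal x
      have key : ∀ i, ∀ a ∈ X.gr i, g0 (lin j a) = fl a := fun i a ha => by
        have e : fl a = g0 (lin j a) + g1 (lin j a) := by
          rw [← LinearMap.add_apply, ← hg, LinearMap.comp_apply]
          exact congrArg fl (LinearMap.congr_fun hq a).symm
        -- The odd part vanishes on the image of j: its value has degree i + 1 and is a difference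
        -- of elements of degree i.
        have h2 : g1 (lin j a) = 0 := internal_disj G.isInternal (i := i + 1) (j := i)
          (by simp) (h1 i _ (lin_mem j ha)) (by
            rw [show g1 (lin j a) = fl a - g0 (lin j a) from (sub_eq_of_eq_add' e).symm]
            exact sub_mem (hfl i a ha) (h0 i _ (lin_mem j ha)))
        rw [e, h2, add_zero]
      rw [map_add, map_add, map_add, key 0 a ha, key 1 b hb]
    refine ⟨averageHom hl g0 h0, lin_ext fun x => ?_⟩
    rw [lin_comp]
    refine Eq.trans ?_ (LinearMap.congr_fun (average_eq_of_colinear hl f) x)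
    change retract l (g0.lTensor H.carrier (Y.coact (lin j x))) =
      retract l (fl.lTensor H.carrier (X.coact x))
    rw [coact_lin, ← LinearMap.comp_apply (g0.lTensor H.carrier), ← LinearMap.lTensor_comp]
    exact congrArg (fun z => retract l (LinearMap.lTensor H.carrier z (X.coact x)))
      (LinearMap.ext hj)

theorem counit_retract (c : H.carrier) (a : G) :
    counit (R := K) (retract l (c ⊗ₜ a)) = counit (R := K) (l (c * H.antipode (H.p a))) := by
  rw [retract_tmul]
  refine (LinearMap.congr_fun (comp_cv G.counitAlg _ _) a).trans ?_
  have h : G.counitAlg.toLinearMap ∘ₗ LinearMap.id = cvOne K G.carrier K := rfl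
  rw [h, cv_cvOne]
  rfl

include hl in
-- The averaged map is a lift along p of w ↦ ∑ ξ(w_0) w_{-1}. Applying ε to the average, only p of
-- the lift matters, and ∑ c_1 S(c_2) = ε(c) leaves ξ(w).
theorem counit_average {W : LeftSComod H.toAffineSupergroup} (ξ : Module.Dual K W.carrier)
    (w : W.carrier) : counit (R := K) (average l (IsSplitting.section_ H ∘ₗ
      (TensorProduct.rid K H.carrier).toLinearMap ∘ₗ ξ.lTensor H.carrier ∘ₗ W.coact) w) = ξ w := by
  have e1 : ∀ t : H.carrier ⊗[K] W.carrier, counit (R := K) (retract l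
      ((IsSplitting.section_ H ∘ₗ (TensorProduct.rid K H.carrier).toLinearMap ∘ₗ
        ξ.lTensor H.carrier ∘ₗ W.coact).lTensor H.carrier t)) =
      counit (R := K) (l (LinearMap.mul' K H.carrier (H.antipode.lTensor H.carrier
        (((TensorProduct.rid K H.carrier).toLinearMap ∘ₗ ξ.lTensor H.carrier).lTensor H.carrier
          (W.coact.lTensor H.carrier t))))) := fun t => by
    induction t with
    | zero => simp
    | add x y hx hy => simp only [map_add, hx, hy]
    | tmul c v =>
      rw [LinearMap.lTensor_tmul, counit_retract, LinearMap.comp_apply, IsSplitting.p_section]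
      rfl
  have e2 : ∀ t : H.carrier ⊗[K] W.carrier,
      counit (R := K) (l (LinearMap.mul' K H.carrier (H.antipode.lTensor H.carrier
        (((TensorProduct.rid K H.carrier).toLinearMap ∘ₗ ξ.lTensor H.carrier).lTensor H.carrier
          (TensorProduct.assoc K H.carrier H.carrier W.carrier (comul.rTensor W.carrier t)))))) =
      ξ (TensorProduct.lid K W.carrier (counit.rTensor W.carrier t)) := fun t => by
    induction t with
    | zero => simp
    | add x y hx hy => simp only [map_add, hx, hy]
    | tmul c v =>
      have h3 : ∀ s : H.carrier ⊗[K] H.carrier, LinearMap.mul' K H.carrier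
          (H.antipode.lTensor H.carrier
            (((TensorProduct.rid K H.carrier).toLinearMap ∘ₗ ξ.lTensor H.carrier).lTensor H.carrier
              (TensorProduct.assoc K H.carrier H.carrier W.carrier (s ⊗ₜ v)))) =
          ξ v • LinearMap.mul' K H.carrier (H.antipode.lTensor H.carrier s) := fun s => by
        induction s with
        | zero => simp
        | add x y hx hy => simp only [map_add, TensorProduct.add_tmul, smul_add, hx, hy]
        | tmul x y => simp
      have h4 : LinearMap.mul' K H.carrier (H.antipode.lTensor H.carrier (comul c)) =
          algebraMap K H.carrier (counit c) := LinearMap.congr_fun H.cv_id_antipode c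
      rw [LinearMap.rTensor_tmul, h3, h4, Algebra.algebraMap_eq_smul_one]
      simp only [map_smul, hl.map_one, LinearMap.rTensor_tmul, TensorProduct.lid_tmul]
      rw [G.counit_one, smul_eq_mul, smul_eq_mul, smul_eq_mul, mul_one, mul_comm]
  change counit (R := K) (retract l (LinearMap.lTensor _ _ (W.coact w))) = _
  rw [e1, ← W.coassoc, e2, W.counit_coact]

include hl in
-- A functional nonzero on f(v) − g(v) is, by `counit_average`, the counit of an averaged map. The
-- even and odd parts of the averaged map give morphisms to K[G] and to its shift; if both equalized
-- f and g, the functional would vanish.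
theorem isInjectiveCogenerator : H.IsInjectiveCogenerator := by
  refine ⟨injective_coordLeft hl, fun V W f g h => lin_ext fun v => ?_⟩
  by_contra hne
  have hw : lin f v - lin g v ≠ 0 := sub_ne_zero.2 hne
  obtain ⟨ξ, hξ⟩ := Module.Projective.exists_dual_ne_zero K hw
  rw [← counit_average hl] at hξ
  obtain ⟨g0, g1, hg, h0, h1⟩ := exists_even_odd W.isInternal G.isInternal
    (IsSplitting.section_ H ∘ₗ (TensorProduct.rid K H.carrier).toLinearMap ∘ₗ
      ξ.lTensor H.carrier ∘ₗ W.coact)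
  have e0 : average l g0 (lin f v) = average l g0 (lin g v) := congrArg (fun k => lin k v)
    (h H.coordLeft (by simp) (averageHom hl g0 h0))
  have e1 : average l g1 (lin f v) = average l g1 (lin g v) := congrArg (fun k => lin k v)
    (h H.coordLeft.parityShift (by simp) (averageShift hl g1 h1))
  refine hξ ?_
  have hadd : average l (g0 + g1) = average l g0 + average l g1 := by
    rw [average, LinearMap.lTensor_add, LinearMap.add_comp, LinearMap.comp_add]
    rfl
  rw [hg, hadd, map_sub, LinearMap.add_apply, LinearMap.add_apply, e0, e1, sub_self, map_zero]

end IsLeftSection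

/-- The trivial supercomodule. -/
def trivialComod (C : AffineSupergroup K) : LeftSComod C where
  carrier := K
  gr i := if i = 0 then ⊤ else ⊥
  isInternal := by
    rw [internal_iff]
    exact isCompl_top_bot
  coact := TensorProduct.mk K C.carrier K 1
  coact_mem i v hv := by
    rcases zmod2_cases i with rfl | rfl
    · exact tmul_mem_tensorGr C.one_mem (by simp) (add_zero 0)
    · have : v = 0 := by simpa using hv
      rw [this, map_zero]; exact zero_mem _
  coassoc v := by
    have h : comul (R := K) (1 : C.carrier) = 1 ⊗ₜ 1 := C.comul_one
    simp [h]
  counit_coact v := by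
    have h : counit (R := K) (1 : C.carrier) = 1 := C.counit_one
    simp [h]

theorem leftCoact_one (H : ClosedSupersubgroup G) : H.leftCoact (1 : G.carrier) = 1 ⊗ₜ 1 := by
  change H.p.rTensor G.carrier (comul 1) = _
  rw [show comul (R := K) (1 : G.carrier) = 1 ⊗ₜ 1 from G.comul_one, LinearMap.rTensor_tmul,
    H.p_one]

/-- The unit of `K[G]` as a morphism of supercomodules. -/
def unitHom (H : ClosedSupersubgroup G) : trivialComod H.toAffineSupergroup ⟶ H.coordLeft :=
  Hom.mk (LinearMap.toSpanSingleton K G.carrier 1)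
    (fun i (v : K) hv => by
      rcases zmod2_cases i with rfl | rfl
      · exact Submodule.smul_mem _ _ G.one_mem
      · have hv0 : v = 0 := (Submodule.mem_bot K).1 hv
        change v • (1 : G.carrier) ∈ G.gr 1
        rw [hv0, zero_smul]; exact zero_mem _)
    (fun (v : K) => by
      change H.leftCoact (v • (1 : G.carrier)) = 1 ⊗ₜ (v • (1 : G.carrier))
      rw [map_smul, leftCoact_one, TensorProduct.tmul_smul])

instance (H : ClosedSupersubgroup G) : Mono (unitHom H) := by
  refine mono_of_injective _ ((injective_iff_map_eq_zero _).2 fun (v : K) hv => ?_)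
  have h1 := congrArg (counit (R := K)) (show v • (1 : G.carrier) = 0 from hv)
  rwa [map_smul, G.counit_one, map_zero, smul_eq_mul, mul_one] at h1

/-- An affine supergroup as a closed supersubgroup of itself. -/
def selfSub (C : AffineSupergroup K) : ClosedSupersubgroup C where
  toAffineSupergroup := C
  proj := 𝟙 C.toCommSuperalg
  surjective := Function.surjective_id
  comul_proj a := (LinearMap.congr_fun TensorProduct.map_id _).symm
  counit_proj a := rfl

/-- Injectivity extends the unit K → K[G] along the unit K → K[H], and the extension is a unital
colinear map. -/
theorem IsInjectiveCogenerator.exists_isLeftSection (h : H.IsInjectiveCogenerator) :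
    ∃ l : H.carrier →ₗ[K] G.carrier, IsLeftSection l := by
  have := h.1
  -- K[H] as a comodule over itself is obtained by viewing H as a closed supersubgroup of H.
  let j : trivialComod H.toAffineSupergroup ⟶ (selfSub H.toAffineSupergroup).coordLeft :=
    unitHom (selfSub H.toAffineSupergroup)
  have hj : Mono j := inferInstanceAs (Mono (unitHom (selfSub H.toAffineSupergroup)))
  obtain ⟨F, hF⟩ := Injective.factors (unitHom H) j
  refine ⟨lin F, fun i v hv => lin_mem F hv, ?_, LinearMap.ext fun c => ?_⟩
  · have h1 := congrArg (fun k => lin k (1 : K)) hF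
    change lin F ((1 : K) • (1 : H.carrier)) = (1 : K) • (1 : G.carrier) at h1
    rwa [one_smul, one_smul] at h1
  · refine (coact_lin F c).trans ?_
    change LinearMap.lTensor _ _ ((LinearMap.id : H.carrier →ₗ[K] H.carrier).rTensor _ _) = _
    rw [LinearMap.rTensor_id]
    rfl

end ClosedSupersubgroup

end
end Super

/-! ### Cokernels of Hopf supermodules, and surjectivity from an equivalence. -/

namespace Super
noncomputable section
set_option linter.unusedSectionVars false
open Coalgebra

variable {K : Type u} [Field K]

namespace LeftSComod

variable {C : AffineSupergroup K}

section Quot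

variable (V : LeftSComod C) (U : Submodule K V.carrier)
  (hU : ∀ x ∈ V.gr 0, ∀ y ∈ V.gr 1, x + y ∈ U → x ∈ U)
  (h : ∀ x ∈ U, U.mkQ.lTensor C.carrier (V.coact x) = 0)

/-- The quotient of a supercomodule by a subsupercomodule. -/
def quot : LeftSComod C where
  carrier := V.carrier ⧸ U
  gr i := (V.gr i).map U.mkQ
  isInternal := by
    rw [internal_iff]
    constructor
    · rw [Submodule.disjoint_def]
      rintro _ ⟨x, hx, rfl⟩ ⟨y, hy, hxy⟩
      have h1 : x + -y ∈ U := by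
        rw [← sub_eq_add_neg]
        exact (Submodule.Quotient.eq U).1 hxy.symm
      exact (Submodule.Quotient.mk_eq_zero U).2 (hU x hx _ (neg_mem hy) h1)
    · rw [codisjoint_iff, ← Submodule.map_sup, ((internal_iff _).1 V.isInternal).sup_eq_top,
        Submodule.map_top, Submodule.range_mkQ]
  coact := U.liftQ (U.mkQ.lTensor C.carrier ∘ₗ V.coact) h
  coact_mem := by
    rintro i _ ⟨v, hv, rfl⟩
    exact map_mem_tensorGr (f := LinearMap.id) (g := U.mkQ) (𝒲' := fun i => (V.gr i).map U.mkQ)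
      (fun _ _ h => h) (fun i x hx => ⟨x, hx, rfl⟩) i _ (V.coact_mem i v hv)
  coassoc v := by
    obtain ⟨v, rfl⟩ := U.mkQ_surjective v
    have e1 : ∀ t : C.carrier ⊗[K] V.carrier, TensorProduct.assoc K C.carrier C.carrier _
        ((comul (R := K)).rTensor _ (U.mkQ.lTensor C.carrier t)) =
        (U.mkQ.lTensor C.carrier).lTensor C.carrier (TensorProduct.assoc K C.carrier C.carrier _
          ((comul (R := K)).rTensor _ t)) := fun t => by
      induction t with
      | zero => simp
      | add x y hx hy => simp only [map_add, hx, hy]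
      | tmul c v =>
        simp only [LinearMap.lTensor_tmul, LinearMap.rTensor_tmul]
        induction (comul (R := K) c) with
        | zero => simp
        | add x y hx hy => simp only [map_add, TensorProduct.add_tmul, hx, hy]
        | tmul x y => rfl
    refine (e1 (V.coact v)).trans ?_
    rw [V.coassoc]
    refine (LinearMap.congr_fun (LinearMap.lTensor_comp C.carrier _ _) _).symm.trans ?_
    exact LinearMap.congr_fun (LinearMap.lTensor_comp C.carrier
      (U.liftQ (U.mkQ.lTensor C.carrier ∘ₗ V.coact) h) U.mkQ) (V.coact v)
  counit_coact v := by
    obtain ⟨v, rfl⟩ := U.mkQ_surjective v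
    have e1 : ∀ t : C.carrier ⊗[K] V.carrier, TensorProduct.lid K _
        ((counit (R := K)).rTensor _ (U.mkQ.lTensor C.carrier t)) =
        U.mkQ (TensorProduct.lid K _ ((counit (R := K)).rTensor _ t)) := fun t => by
      induction t with
      | zero => simp
      | add x y hx hy => simp only [map_add, hx, hy]
      | tmul c v => simp
    refine (e1 (V.coact v)).trans ?_
    rw [V.counit_coact]

/-- The projection to the quotient. -/
def quotπ : V ⟶ quot V U hU h :=
  Hom.mk U.mkQ (fun i x hx => ⟨x, hx, rfl⟩) fun _ => rfl

/-- The morphism out of the quotient induced by a morphism that vanishes on the subobject. -/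
def quotDesc {W : LeftSComod C} (f : V ⟶ W) (hf : ∀ x ∈ U, lin f x = 0) : quot V U hU h ⟶ W :=
  Hom.mk (U.liftQ (lin f) hf)
    (by rintro i _ ⟨v, hv, rfl⟩; exact lin_mem f hv)
    (fun v => by
      obtain ⟨v, rfl⟩ := U.mkQ_surjective v
      refine (coact_lin f v).trans ?_
      exact LinearMap.congr_fun (LinearMap.lTensor_comp C.carrier (U.liftQ (lin f) hf) U.mkQ)
        (V.coact v))

end Quot

theorem range_homog {V W : LeftSComod C} (f : V ⟶ W) (x : W.carrier) (hx : x ∈ W.gr 0)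
    (y : W.carrier) (hy : y ∈ W.gr 1) (h : x + y ∈ LinearMap.range (lin f)) :
    x ∈ LinearMap.range (lin f) := by
  obtain ⟨v, hv⟩ := h
  obtain ⟨a, ha, b, hb, rfl⟩ := internal_decomp V.isInternal v
  have h1 : lin f a - x = y - lin f b := by
    rw [sub_eq_sub_iff_add_eq_add, ← map_add, hv, add_comm]
  have h2 : lin f a - x = 0 := internal_disj W.isInternal (i := 0) (j := 1) (by decide)
    (sub_mem (lin_mem f ha) hx) (h1 ▸ sub_mem hy (lin_mem f hb))
  exact ⟨a, sub_eq_zero.1 h2⟩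

theorem mkQ_coact_range {V W : LeftSComod C} (f : V ⟶ W) (x : W.carrier)
    (hx : x ∈ LinearMap.range (lin f)) :
    (LinearMap.range (lin f)).mkQ.lTensor C.carrier (W.coact x) = 0 := by
  obtain ⟨v, rfl⟩ := hx
  rw [coact_lin, ← LinearMap.comp_apply, ← LinearMap.lTensor_comp, LinearMap.range_mkQ_comp,
    LinearMap.lTensor_zero, LinearMap.zero_apply]

theorem isIso_of_bijective {V W : LeftSComod C} (f : V ⟶ W) (hf : Function.Bijective (lin f)) :
    IsIso f := by
  let e := LinearEquiv.ofBijective (lin f) hf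
  have he : ∀ w, lin f (e.symm w) = w := e.apply_symm_apply
  refine ⟨Hom.mk e.symm.toLinearMap (fun i w hw => ?_) (fun w => ?_), lin_ext fun v => ?_,
    lin_ext fun w => he w⟩
  · obtain ⟨x, hx, y, hy, hxy⟩ := internal_decomp V.isInternal (e.symm w)
    have hw' : lin f x + lin f y = w := by rw [← map_add, hxy, he]
    change e.symm w ∈ V.gr i
    rcases zmod2_cases i with rfl | rfl
    · have : lin f y = 0 := internal_disj W.isInternal (i := 0) (j := 1) (by decide)
        (by rw [← add_sub_cancel_left (lin f x) (lin f y), hw']; exact sub_mem hw (lin_mem f hx))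
        (lin_mem f hy)
      rw [← hxy, hf.1 (this.trans (map_zero _).symm), add_zero]
      exact hx
    · have : lin f x = 0 := internal_disj W.isInternal (i := 0) (j := 1) (by decide) (lin_mem f hx)
        (by rw [← add_sub_cancel_right (lin f x) (lin f y), hw']; exact sub_mem hw (lin_mem f hy))
      rw [← hxy, hf.1 (this.trans (map_zero _).symm), zero_add]
      exact hy
  · obtain ⟨v, rfl⟩ := hf.2 w
    change V.coact (e.symm (e v)) = _
    rw [e.symm_apply_apply, coact_lin, ← LinearMap.comp_apply, ← LinearMap.lTensor_comp]
    have : e.symm.toLinearMap ∘ₗ lin f = LinearMap.id := LinearMap.ext e.symm_apply_apply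
    rw [this, LinearMap.lTensor_id, LinearMap.id_apply]
  · exact e.symm_apply_apply v

theorem epi_of_surjective {V W : LeftSComod C} (f : V ⟶ W) (hf : Function.Surjective (lin f)) :
    Epi f :=
  ⟨fun g h e => lin_ext fun w => by
    obtain ⟨v, rfl⟩ := hf w
    exact congrArg (fun k => lin k v) e⟩

end LeftSComod

namespace HopfSMod

open LeftSComod

variable {G : AffineSupergroup K} {B : LeftCoidealSubalg G}

/-- The morphism of supercomodules underlying a morphism of Hopf supermodules. -/
def comodHom {M N : HopfSMod B} (f : M ⟶ N) : M.toLeftSComod ⟶ N.toLeftSComod :=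
  Hom.toHom f

theorem lin_smul {M N : HopfSMod B} (f : M ⟶ N) (b : B.alg) (m : M.carrier) :
    lin (comodHom f) (b • m) = b • lin (comodHom f) m := Hom.map_smul f b m

/-- The morphism of Hopf supermodules with a given underlying morphism of supercomodules. -/
def homMk {M N : HopfSMod B} (f : M.toLeftSComod ⟶ N.toLeftSComod)
    (hf : ∀ (b : B.alg) (m : M.carrier), lin f (b • m) = b • lin f m) : M ⟶ N :=
  Hom.mk f hf

theorem comodHom_ext {M N : HopfSMod B} {f g : M ⟶ N}
    (h : ∀ m, lin (comodHom f) m = lin (comodHom g) m) : f = g :=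
  Hom.ext (LinearMap.ext h)

theorem isIso_of_bijective {M N : HopfSMod B} (f : M ⟶ N)
    (hf : Function.Bijective (lin (comodHom f))) : IsIso f := by
  have h := LeftSComod.isIso_of_bijective (comodHom f) hf
  have h1 : ∀ m, lin (inv (comodHom f)) (lin (comodHom f) m) = m := fun m =>
    congrArg (fun k => lin k m) (IsIso.hom_inv_id (comodHom f))
  have h2 : ∀ n, lin (comodHom f) (lin (inv (comodHom f)) n) = n := fun n =>
    congrArg (fun k => lin k n) (IsIso.inv_hom_id (comodHom f))
  refine ⟨homMk (inv (comodHom f)) fun b n => hf.1 ?_, comodHom_ext h1, comodHom_ext h2⟩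
  rw [h2, lin_smul, h2]

/-- The range of a morphism as a submodule over the coideal subalgebra. -/
def range {M N : HopfSMod B} (f : M ⟶ N) : Submodule B.alg N.carrier :=
  { LinearMap.range (lin (comodHom f)) with
    smul_mem' := by
      rintro b _ ⟨m, rfl⟩
      exact ⟨b • m, lin_smul f b m⟩ }

/-- The cokernel of a morphism of Hopf supermodules. -/
def coker {M N : HopfSMod B} (f : M ⟶ N) : HopfSMod B :=
  letI i1 : Module B.alg (N.carrier ⧸ LinearMap.range (lin (comodHom f))) :=
    inferInstanceAs (Module B.alg (N.carrier ⧸ range f))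
  letI i2 : IsScalarTower K B.alg (N.carrier ⧸ LinearMap.range (lin (comodHom f))) :=
    inferInstanceAs (IsScalarTower K B.alg (N.carrier ⧸ range f))
  { toLeftSComod := quot N.toLeftSComod (LinearMap.range (lin (comodHom f)))
      (range_homog (comodHom f)) (mkQ_coact_range (comodHom f))
    bmodule := i1
    tower := i2
    smul_mem := by
      rintro i j b hb _ ⟨m, hm, rfl⟩
      exact ⟨b • m, N.smul_mem i j b hb m hm, rfl⟩
    coact_smul := fun b m => by
      obtain ⟨m, rfl⟩ := Submodule.mkQ_surjective _ m
      refine Eq.trans ?_ (B.superAct_map (M' := N.carrier ⧸ LinearMap.range (lin (comodHom f)))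
        (LinearMap.range (lin (comodHom f))).mkQ (fun _ _ => rfl) (B.coact b) (N.coact m))
      rw [← N.coact_smul]
      rfl }

/-- The projection to the cokernel. -/
def cokerπ {M N : HopfSMod B} (f : M ⟶ N) : N ⟶ coker f :=
  homMk (quotπ N.toLeftSComod (LinearMap.range (lin (comodHom f)))
      (range_homog (comodHom f)) (mkQ_coact_range (comodHom f))) fun _ _ => rfl

/-- The projection to the cokernel and the zero morphism agree after f, so the cokernel vanishes. -/
theorem surjective_of_epi {M N : HopfSMod B} (f : M ⟶ N) [Epi f] :
    Function.Surjective (lin (comodHom f)) := by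
  have h : cokerπ f = homMk (zeroHom _ _) (fun b n => (smul_zero b).symm) := by
    rw [← cancel_epi f]
    exact comodHom_ext fun m => (Submodule.Quotient.mk_eq_zero _).2 ⟨m, rfl⟩
  exact fun n => (Submodule.Quotient.mk_eq_zero _).1
    (congrArg (fun k => lin (comodHom k) n) h)

end HopfSMod

/-- Surjections of supercomodules are epimorphisms, equivalences preserve epimorphisms, and
epimorphisms of Hopf supermodules are surjective. -/
theorem ClosedSupersubgroup.preservesSurjections_of_isEquivalence {G : AffineSupergroup K}
    {H : ClosedSupersubgroup G} (h : H.ind.IsEquivalence) : H.PreservesSurjections := by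
  intro N N' f hf
  have := LeftSComod.epi_of_surjective f hf
  exact HopfSMod.surjective_of_epi (H.ind.map f)

end
end Super

/-! ### Faithful coflatness from a faithfully flat Galois extension. -/

namespace Super
noncomputable section
set_option linter.unusedSectionVars false
open Coalgebra

variable {K : Type u} [Field K]

namespace ClosedSupersubgroup

open CommSuperalg LeftSComod

variable {G : AffineSupergroup K} (H : ClosedSupersubgroup G)

/-- The inclusion of the invariants, in the form used for balanced tensor products. -/
abbrev base : H.invariants.toSuper.carrier →ₐ[K] G.carrier :=
  hom (H.invariants.incl ≫ 𝟙 G.toCommSuperalg)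

/-- The inclusion `K[G] □ N → K[G] ⊗ N` as a map of modules over the invariants. -/
def indLin (N : LeftSComod H.toAffineSupergroup) : (H.indComod N).carrier
    →ₗ[H.invariants.toSuper.carrier] Via (hom H.invariants.incl) ⊗[K] N.carrier :=
  { H.indIncl N with map_smul' := fun _ _ => rfl }

/-- The map `K[G] ⊗_R (K[G] □ N) → K[G] ⊗ N`, `a ⊗ ∑ b ⊗ n ↦ ∑ ab ⊗ n`. -/
def indFold (N : LeftSComod H.toAffineSupergroup) :
    Bal H.base (H.indComod N).carrier →ₗ[K] G.carrier ⊗[K] N.carrier :=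
  fold H.invariants.incl (𝟙 G.toCommSuperalg) N.carrier ∘ₗ
    (Bal.map H.base (H.indLin N)).restrictScalars K

theorem indFold_tmul (N : LeftSComod H.toAffineSupergroup) (a : G)
    (x : (H.indComod N).carrier) :
    H.indFold N (Bal.tmul H.base a x) = a • H.indIncl N x := by
  refine (congrArg (fold H.invariants.incl (𝟙 G.toCommSuperalg) N.carrier)
    (Bal.smul_one_tmul H.base a (H.indLin N x)).symm).trans ?_
  rw [fold_smul]
  congr 1
  change fold _ _ _ (Bal.tmul H.base 1 (H.indIncl N x)) = _
  generalize H.indIncl N x = t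
  let Φ : G.carrier ⊗[K] N.carrier →ₗ[K] G.carrier ⊗[K] N.carrier :=
    fold H.invariants.incl (𝟙 G.toCommSuperalg) N.carrier ∘ₗ Bal.mkLin H.base ∘ₗ
      TensorProduct.mk K G.carrier (Via (hom H.invariants.incl) ⊗[K] N.carrier) 1
  change Φ t = t
  induction t with
  | zero => rw [map_zero]
  | add x y hx hy => rw [map_add, hx, hy]
  | tmul b n =>
    refine (fold_tmul (𝟙 G.toCommSuperalg) 1 b n).trans ?_
    exact congrArg (fun z => z ⊗ₜ[K] n) (one_mul b)

variable {H} in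
-- Flatness identifies K[G] ⊗_R (K[G] □ N) with the kernel of the base changed cotensor equation.
-- The descent isomorphism for S = K[G] and its identity point identifies that kernel with K[G] ⊗ N.
theorem IsFFGalois.indFold_bijective (h : H.IsFFGalois) (N : LeftSComod H.toAffineSupergroup) :
    Function.Bijective (H.indFold N) := by
  have hff : LeftFF H.base := h.leftFF
  have hex : Function.Exact (H.indLin N) (cotensorLin h.isGalois.invariant N) := fun x =>
    ⟨fun hx => ⟨⟨x, hx⟩, rfl⟩, fun ⟨y, hy⟩ => hy ▸ y.2⟩
  have hex' := (hff _ _ _ _ _).1 hex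
  constructor
  · rw [injective_iff_map_eq_zero]
    intro y hy
    have h1 := inflate_fold h.isGalois (𝟙 G.toCommSuperalg) N ((hex' _).2 ⟨y, rfl⟩)
    have h2 : Bal.map H.base (H.indLin N) y = 0 := by
      rw [← h1]
      exact (congrArg _ hy).trans (map_zero _)
    exact hff.map_injective (cotensor H.rightCoact N).subtype_injective
      (h2.trans (map_zero _).symm)
  · intro t
    obtain ⟨y, hy⟩ := (hex' _).1 (map_cotensorLin_inflate h.isGalois (𝟙 G.toCommSuperalg) N t)
    exact ⟨y, (congrArg _ hy).trans (fold_inflate h.isGalois (𝟙 G.toCommSuperalg) N t)⟩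

/-- The map of modules underlying `ind f`. -/
def indMapLin {N N' : LeftSComod H.toAffineSupergroup} (f : N ⟶ N') : (H.indComod N).carrier
    →ₗ[H.invariants.toSuper.carrier] (H.indComod N').carrier :=
  { cotensorMap H.rightCoact f with map_smul' := H.cotensorMap_smul f }

theorem indFold_map {N N' : LeftSComod H.toAffineSupergroup} (f : N ⟶ N')
    (y : Bal H.base (H.indComod N).carrier) :
    H.indFold N' (Bal.map H.base (H.indMapLin f) y) =
      (lin f).lTensor G.carrier (H.indFold N y) := by
  induction y using Bal.induction with
  | h0 => simp
  | hadd x y hx hy => simp only [map_add, hx, hy]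
  | h a x =>
    rw [Bal.map_tmul, indFold_tmul, indFold_tmul]
    change a • (lin f).lTensor G.carrier (H.indIncl N x) = _
    generalize H.indIncl N x = t
    induction t with
    | zero => simp
    | add x y hx hy => simp only [map_add, smul_add, hx, hy]
    | tmul b n => rfl

variable {H} in
-- Exactness of the cotensored sequence is tested after the faithfully flat base change to K[G].
-- There it becomes the sequence tensored with K[G] over the field, exact precisely when the
-- original one is.
theorem IsFFGalois.isFaithfullyCoflat (h : H.IsFFGalois) : IsFaithfullyCoflat H.rightCoact := by
  intro N' N N'' f g
  have hff : LeftFF H.base := h.leftFF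
  have h1 : Function.Exact (cotensorMap H.rightCoact f) (cotensorMap H.rightCoact g) ↔
      Function.Exact (Bal.map H.base (H.indMapLin f)) (Bal.map H.base (H.indMapLin g)) :=
    hff _ _ _ (H.indMapLin f) (H.indMapLin g)
  have h2 : Function.Exact (Bal.map H.base (H.indMapLin f)) (Bal.map H.base (H.indMapLin g)) ↔
      Function.Exact ((lin f).lTensor G.carrier) ((lin g).lTensor G.carrier) :=
    Function.Exact.iff_of_ladder_addEquiv
      (e₁ := (LinearEquiv.ofBijective _ (h.indFold_bijective N')).toAddEquiv)
      (e₂ := (LinearEquiv.ofBijective _ (h.indFold_bijective N)).toAddEquiv)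
      (e₃ := (LinearEquiv.ofBijective _ (h.indFold_bijective N'')).toAddEquiv)
      (f₁₂ := (Bal.map H.base (H.indMapLin f)).toAddMonoidHom)
      (f₂₃ := (Bal.map H.base (H.indMapLin g)).toAddMonoidHom)
      (g₁₂ := ((lin f).lTensor G.carrier).toAddMonoidHom)
      (g₂₃ := ((lin g).lTensor G.carrier).toAddMonoidHom)
      (AddMonoidHom.ext fun y => (H.indFold_map f y).symm)
      (AddMonoidHom.ext fun y => (H.indFold_map g y).symm) |>.symm
  rw [h1, h2]
  -- Faithful flatness over the field needs K[G] ≠ 0, which holds as ε(1) = 1.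
  have : Nontrivial G.carrier := ⟨1, 0, fun e => by
    have h3 : counit (R := K) (1 : G.carrier) = 1 := G.counit_one
    rw [e, map_zero] at h3
    exact zero_ne_one h3⟩
  exact (Module.FaithfullyFlat.lTensor_exact_iff_exact K G.carrier (lin f) (lin g)).symm

end ClosedSupersubgroup

end
end Super

/-! ### The reduction M/R⁺M of a Hopf supermodule. -/

namespace Super
noncomputable section
set_option linter.unusedSectionVars false
open Coalgebra

variable {K : Type u} [Field K]

theorem rTensor_lTensor_comm {V V' W W' : Type*} [AddCommGroup V] [Module K V] [AddCommGroup V']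
    [Module K V'] [AddCommGroup W] [Module K W] [AddCommGroup W'] [Module K W'] (f : V →ₗ[K] V')
    (g : W →ₗ[K] W') (t : V ⊗[K] W) :
    f.rTensor W' (g.lTensor V t) = g.lTensor V' (f.rTensor W t) :=
  LinearMap.congr_fun ((LinearMap.rTensor_comp_lTensor ..).trans
    (LinearMap.lTensor_comp_rTensor ..).symm) t

namespace LeftSComod

section Convolution

variable {C : AffineSupergroup K} (V : LeftSComod C) {E X : Type*} [Ring E] [Algebra K E]
  [AddCommGroup X] [Module K X] [Module E X] [IsScalarTower K E X]

/-- The convolution `v ↦ ∑ f(v_{-1}) x(v_0)`. -/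
def conv (f : C.carrier →ₗ[K] E) (x : V.carrier →ₗ[K] X) : V.carrier →ₗ[K] X :=
  actLin K E X ∘ₗ TensorProduct.map f x ∘ₗ V.coact

theorem conv_conv (f g : C.carrier →ₗ[K] E) (x : V.carrier →ₗ[K] X) :
    V.conv f (V.conv g x) = V.conv (cv f g) x := by
  refine LinearMap.ext fun v => ?_
  have e1 : ∀ t : C.carrier ⊗[K] V.carrier, actLin K E X (TensorProduct.map f (V.conv g x) t) =
      actLin K E X ((actLin K E X).lTensor E (TensorProduct.map f (TensorProduct.map g x)
        (V.coact.lTensor C.carrier t))) := fun t => by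
    induction t with
    | zero => simp
    | add x y hx hy => simp only [map_add, hx, hy]
    | tmul a b => rfl
  have e2 : ∀ t : C.carrier ⊗[K] V.carrier, actLin K E X ((actLin K E X).lTensor E
      (TensorProduct.map f (TensorProduct.map g x)
        (TensorProduct.assoc K C.carrier C.carrier V.carrier (comul.rTensor V.carrier t)))) =
      actLin K E X (TensorProduct.map (cv f g) x t) := fun t => by
    induction t with
    | zero => simp
    | add x y hx hy => simp only [map_add, hx, hy]
    | tmul a b =>
      rw [LinearMap.rTensor_tmul, TensorProduct.map_tmul, cv_apply]
      induction (comul a : C.carrier ⊗[K] C.carrier) with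
      | zero => simp
      | add x y hx hy => simp only [map_add, TensorProduct.add_tmul, hx, hy]
      | tmul y z => simp [mul_smul]
  refine (e1 _).trans ?_
  rw [← V.coassoc, e2]
  rfl

theorem cvOne_conv (x : V.carrier →ₗ[K] X) : V.conv (cvOne K C.carrier E) x = x := by
  refine LinearMap.ext fun v => ?_
  have e : ∀ t : C.carrier ⊗[K] V.carrier, actLin K E X (TensorProduct.map (cvOne K C.carrier E) x t)
      = x (TensorProduct.lid K V.carrier (counit.rTensor V.carrier t)) := fun t => by
    induction t with
    | zero => simp
    | add x y hx hy => simp only [map_add, hx, hy]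
    | tmul a b => simp [cvOne_apply]
  refine (e _).trans ?_
  rw [V.counit_coact]

theorem comp_conv {X' : Type*} [AddCommGroup X'] [Module K X'] [Module E X'] [IsScalarTower K E X']
    (φ : X →ₗ[K] X') (hφ : ∀ (e : E) (m : X), φ (e • m) = e • φ m) (f : C.carrier →ₗ[K] E)
    (x : V.carrier →ₗ[K] X) : φ ∘ₗ V.conv f x = V.conv f (φ ∘ₗ x) := by
  refine LinearMap.ext fun v => ?_
  change φ (actLin K E X (TensorProduct.map f x (V.coact v))) =
    actLin K E X' (TensorProduct.map f (φ ∘ₗ x) (V.coact v))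
  induction V.coact v with
  | zero => simp
  | add x y hx hy => simp only [map_add, hx, hy]
  | tmul a b => simp [hφ]

end Convolution

end LeftSComod

namespace LeftCoidealSubalg

variable {G : AffineSupergroup K} (B : LeftCoidealSubalg G) {M X : Type u} [AddCommGroup M]
  [Module K M] [Module B.alg M] [IsScalarTower K B.alg M] [AddCommGroup X] [Module K X]
  [Module G.carrier X] [IsScalarTower K G.carrier X]

/-- A map out of `K[G] ⊗ M` turns the action of `K[G] ⊗ B` into multiplication by elements of
`K[G]` if it does so on homogeneous elements. -/
theorem superAct_eq_smul (F : G.carrier ⊗[K] M →ₗ[K] X) (e : G.carrier ⊗[K] B.alg →ₗ[K] G.carrier)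
    (h : ∀ (i j : ZMod 2) (c : G) (b : B.alg) (a : G) (m : M), (b : G.carrier) ∈ G.gr i →
      a ∈ G.gr j → (-1 : ℤˣ) ^ (i * j) • F ((c * a) ⊗ₜ (b • m)) = e (c ⊗ₜ b) • F (a ⊗ₜ m))
    (t : G.carrier ⊗[K] B.alg) (s : G.carrier ⊗[K] M) : F (B.superAct M t s) = e t • F s := by
  induction t with
  | zero => simp
  | add x y hx hy => simp only [map_add, LinearMap.add_apply, add_smul, hx, hy]
  | tmul c b =>
    induction s with
    | zero => simp
    | add x y hx hy => simp only [map_add, smul_add, hx, hy]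
    | tmul a m =>
      obtain ⟨a0, ha0, a1, ha1, rfl⟩ := G.decomp a
      obtain ⟨b0, hb0, b1, hb1, rfl⟩ := B.decomp b
      have h' : ∀ i j, ∀ b : B.alg, (b : G.carrier) ∈ G.gr i → ∀ a ∈ G.gr j,
          F (B.superAct M (c ⊗ₜ b) (a ⊗ₜ m)) = e (c ⊗ₜ b) • F (a ⊗ₜ m) := fun i j b hb a ha => by
        rw [B.superAct_tmul M i j c b hb a ha, LinearMap.map_smul_of_tower, h i j c b a m hb ha]
      simp only [TensorProduct.tmul_add, TensorProduct.add_tmul, map_add, LinearMap.add_apply,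
        add_smul, smul_add, h' 0 0 b0 hb0 a0 ha0, h' 0 1 b0 hb0 a1 ha1, h' 1 0 b1 hb1 a0 ha0,
        h' 1 1 b1 hb1 a1 ha1]

/-- `c ⊗ b ↦ c ε(b)`. -/
def idCounit : G.carrier ⊗[K] B.alg →ₗ[K] G.carrier :=
  (TensorProduct.rid K G.carrier).toLinearMap ∘ₗ
    (counit ∘ₗ B.alg.val.toLinearMap).lTensor G.carrier

theorem idCounit_coact (b : B.alg) : B.idCounit (B.coact b) = b := by
  rw [idCounit, LinearMap.lTensor_comp]
  change TensorProduct.rid K G.carrier (counit.lTensor G.carrier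
    (B.alg.val.toLinearMap.lTensor G.carrier (B.coact b))) = b
  rw [B.lTensor_coact, Coalgebra.lTensor_counit_comul, TensorProduct.rid_tmul, one_smul]

/-- `c ⊗ b ↦ S(c) b`. -/
def antipodeMul : G.carrier ⊗[K] B.alg →ₗ[K] G.carrier :=
  LinearMap.mul' K G.carrier ∘ₗ TensorProduct.map G.antipode B.alg.val.toLinearMap

theorem antipodeMul_coact (b : B.alg) :
    B.antipodeMul (B.coact b) = algebraMap K G.carrier (counit (b : G.carrier)) := by
  refine Eq.trans ?_ (LinearMap.congr_fun G.cv_antipode_id (b : G.carrier))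
  rw [cv_apply, ← B.lTensor_coact]
  change LinearMap.mul' K G.carrier (TensorProduct.map G.antipode _ (B.coact b)) = _
  induction B.coact b with
  | zero => simp
  | add x y hx hy => simp only [map_add, hx, hy]
  | tmul x y => rfl

end LeftCoidealSubalg

namespace ClosedSupersubgroup

open CommSuperalg LeftSComod

variable {G : AffineSupergroup K} (H : ClosedSupersubgroup G)

/-- A supercomodule over `K[G]` as a supercomodule over `K[H]`. -/
def restrict (V : LeftSComod G) : LeftSComod H.toAffineSupergroup where
  carrier := V.carrier
  gr := V.gr
  isInternal := V.isInternal
  coact := H.p.rTensor V.carrier ∘ₗ V.coact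
  coact_mem i v hv := map_mem_tensorGr (g := LinearMap.id) H.p_even (fun _ _ h => h) i _
    (V.coact_mem i v hv)
  coassoc v := by
    have e1 : ∀ t : G.carrier ⊗[K] V.carrier, TensorProduct.assoc K H.carrier H.carrier V.carrier
        (comul.rTensor V.carrier (H.p.rTensor V.carrier t)) =
        TensorProduct.map H.p (H.p.rTensor V.carrier)
          (TensorProduct.assoc K G.carrier G.carrier V.carrier (comul.rTensor V.carrier t)) :=
      fun t => by
        induction t with
        | zero => simp
        | add x y hx hy => simp only [map_add, hx, hy]
        | tmul c v =>
          simp only [LinearMap.rTensor_tmul, H.p_comul]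
          induction (comul (R := K) c) with
          | zero => simp
          | add x y hx hy => simp only [map_add, TensorProduct.add_tmul, hx, hy]
          | tmul x y => rfl
    have e2 : ∀ t : G.carrier ⊗[K] V.carrier, TensorProduct.map H.p (H.p.rTensor V.carrier)
        (V.coact.lTensor G.carrier t) = (H.p.rTensor V.carrier ∘ₗ V.coact).lTensor H.carrier
          (H.p.rTensor V.carrier t) := fun t => by
      induction t with
      | zero => simp
      | add x y hx hy => simp only [map_add, hx, hy]
      | tmul c v => rfl
    exact (e1 _).trans ((congrArg _ (V.coassoc v)).trans (e2 _))
  counit_coact v := by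
    have e : ∀ t : G.carrier ⊗[K] V.carrier, counit.rTensor V.carrier (H.p.rTensor V.carrier t) =
        counit.rTensor V.carrier t := fun t => by
      rw [← LinearMap.comp_apply, ← LinearMap.rTensor_comp, H.counit_comp_p]
    exact (congrArg _ (e _)).trans (V.counit_coact v)

/-- Restriction of morphisms from `K[G]` to `K[H]`. -/
def restrictMap {V W : LeftSComod G} (f : V ⟶ W) : H.restrict V ⟶ H.restrict W :=
  Hom.mk (lin (C := G) f) (Hom.even (C := G) f) fun v => by
    change H.p.rTensor W.carrier (W.coact (lin (C := G) f v)) =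
      LinearMap.lTensor H.carrier (lin (C := G) f) (H.p.rTensor V.carrier (V.coact v))
    exact (congrArg _ (coact_lin (C := G) f v)).trans (rTensor_lTensor_comm ..)

section Reduction

variable (M : HopfSMod H.invariants)

/-- The subspace `R⁺ M`, for the augmentation ideal `R⁺` of the invariants. -/
def augSpan : Submodule K M.carrier :=
  Submodule.span K {x | ∃ r : H.invariants.alg, counit (R := K) (r : G.carrier) = 0 ∧
    ∃ m : M.carrier, x = r • m}

theorem eq_zero_of_mem_augSpan {X : Type*} [AddCommGroup X] [Module K X] (f : M.carrier →ₗ[K] X)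
    (h : ∀ (r : H.invariants.alg) (m : M.carrier), counit (R := K) (r : G.carrier) = 0 →
      f (r • m) = 0) (x : M.carrier) (hx : x ∈ H.augSpan M) : f x = 0 := by
  have : H.augSpan M ≤ LinearMap.ker f := by
    rw [augSpan, Submodule.span_le]
    rintro _ ⟨r, hr, m, rfl⟩
    exact h r m hr
  exact this hx

theorem mkQ_smul (r : H.invariants.alg) (m : M.carrier) :
    (H.augSpan M).mkQ (r • m) = counit (R := K) (r : G.carrier) • (H.augSpan M).mkQ m := by
  rw [← map_smul, ← sub_eq_zero, ← map_sub]
  refine (Submodule.Quotient.mk_eq_zero _).2 (Submodule.subset_span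
    ⟨r - counit (R := K) (r : G.carrier) • 1, ?_, m, ?_⟩)
  · change counit (R := K) ((r : G.carrier) - counit (R := K) (r : G.carrier) • (1 : G.carrier)) = 0
    rw [map_sub, map_smul, G.counit_one, smul_eq_mul, mul_one, sub_self]
  · rw [sub_smul, smul_assoc, one_smul]

/-- Since ε kills odd elements, ε(r) = 0 forces ε to vanish on both components of r. Hence R⁺M is
stable under the projection to the even part. -/
theorem augSpan_homog (x : M.carrier) (hx : x ∈ M.gr 0) (y : M.carrier) (hy : y ∈ M.gr 1)
    (h : x + y ∈ H.augSpan M) : x ∈ H.augSpan M := by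
  obtain ⟨p0, p1, a00, a01, -, -⟩ := exists_proj M.isInternal
  have key : ∀ z ∈ H.augSpan M, p0 z ∈ H.augSpan M := fun z hz => by
    induction hz using Submodule.span_induction with
    | mem z hz =>
      obtain ⟨r, hr, m, rfl⟩ := hz
      obtain ⟨r0, hr0, r1, hr1, rfl⟩ := H.invariants.decomp r
      obtain ⟨m0, hm0, m1, hm1, rfl⟩ := internal_decomp M.isInternal m
      have h1 : counit (R := K) (r1 : G.carrier) = 0 := G.counit_mem _ hr1
      have h0 : counit (R := K) (r0 : G.carrier) = 0 := by
        have := hr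
        rw [Subalgebra.coe_add, map_add, h1, add_zero] at this
        exact this
      have e : p0 ((r0 + r1) • (m0 + m1)) = r0 • m0 + r1 • m1 := by
        simp only [add_smul, smul_add, map_add]
        rw [a00 _ (M.smul_mem 0 0 r0 hr0 m0 hm0), a01 _ (M.smul_mem 0 1 r0 hr0 m1 hm1),
          a01 _ (M.smul_mem 1 0 r1 hr1 m0 hm0), a00 _ (M.smul_mem 1 1 r1 hr1 m1 hm1)]
        abel
      rw [e]
      exact add_mem (Submodule.subset_span ⟨r0, h0, m0, rfl⟩)
        (Submodule.subset_span ⟨r1, h1, m1, rfl⟩)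
    | zero => rw [map_zero]; exact zero_mem _
    | add x y _ _ hx hy => rw [map_add]; exact add_mem hx hy
    | smul c x _ hx => rw [map_smul]; exact Submodule.smul_mem _ c hx
  have h1 := key _ h
  rwa [map_add, a00 x hx, a01 y hy, add_zero] at h1

/-- The map `m ↦ ∑ m_{-1} ⊗ [m_0]`. -/
def unitLin : M.carrier →ₗ[K] G.carrier ⊗[K] (M.carrier ⧸ H.augSpan M) :=
  (H.augSpan M).mkQ.lTensor G.carrier ∘ₗ M.coact

/-- Modulo R⁺M the ring R acts through ε, so ∑ r_1 ⊗ r_2 acts as ∑ r_1 ε(r_2) = r. Odd r_2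
contribute nothing, and the sign in the Hopf condition disappears. -/
theorem unitLin_smul (r : H.invariants.alg) (m : M.carrier) :
    H.unitLin M (r • m) = (r : G.carrier) • H.unitLin M m := by
  refine (congrArg _ (M.coact_smul r m)).trans ?_
  refine (H.invariants.superAct_eq_smul ((H.augSpan M).mkQ.lTensor G.carrier)
    H.invariants.idCounit (fun i j c b a m hb ha => ?_) _ _).trans ?_
  · rw [LinearMap.lTensor_tmul, mkQ_smul, LinearMap.lTensor_tmul]
    change _ = ((counit (R := K) (b : G.carrier) • c) * a) ⊗ₜ[K] _
    rcases zmod2_cases i with rfl | rfl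
    · rw [zero_mul, uzpow_zero, one_smul, TensorProduct.tmul_smul, smul_mul_assoc,
        TensorProduct.smul_tmul']
    · have hb0 : counit (R := K) (b : G.carrier) = 0 := G.counit_mem _ hb
      rw [hb0, zero_smul, zero_smul, TensorProduct.tmul_zero, smul_zero, zero_mul,
        TensorProduct.zero_tmul]
  · rw [H.invariants.idCounit_coact]
    rfl

/-- Apply ε to the first factor of the equation (id ⊗ p)δ(r) = r ⊗ 1. -/
theorem p_eq_of_invariant (r : H.invariants.alg) :
    H.p (r : G.carrier) = algebraMap K H.carrier (counit (r : G.carrier)) := by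
  have e : ∀ t : G.carrier ⊗[K] G.carrier, TensorProduct.lid K H.carrier
      (counit.rTensor H.carrier (H.p.lTensor G.carrier t)) =
      H.p (TensorProduct.lid K G.carrier (counit.rTensor G.carrier t)) := fun t => by
    induction t with
    | zero => simp
    | add x y hx hy => simp only [map_add, hx, hy]
    | tmul x y => simp
  have h1 : TensorProduct.lid K H.carrier (counit.rTensor H.carrier (H.rightCoact r)) = _ :=
    e (comul (r : G.carrier))
  rw [Coalgebra.rTensor_counit_comul, TensorProduct.lid_tmul, one_smul,
    (show H.rightCoact (r : G.carrier) = (r : G.carrier) ⊗ₜ 1 from r.2)] at h1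
  rw [← h1, LinearMap.rTensor_tmul, TensorProduct.lid_tmul, Algebra.algebraMap_eq_smul_one]

/-- The coaction of rm modulo R⁺M carries the factor p(r), which is the scalar ε(r), so R⁺M is a
subcomodule over K[H]. -/
theorem mkQ_restrict_coact (x : M.carrier) (hx : x ∈ H.augSpan M) :
    (H.augSpan M).mkQ.lTensor H.carrier ((H.restrict M.toLeftSComod).coact x) = 0 := by
  have e : ∀ m : M.carrier, (H.augSpan M).mkQ.lTensor H.carrier
      ((H.restrict M.toLeftSComod).coact m) = H.p.rTensor _ (H.unitLin M m) := fun m => by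
    change (H.augSpan M).mkQ.lTensor H.carrier (H.p.rTensor M.carrier (M.coact m)) =
      H.p.rTensor _ ((H.augSpan M).mkQ.lTensor G.carrier (M.coact m))
    rw [rTensor_lTensor_comm]
  rw [e]
  refine H.eq_zero_of_mem_augSpan M (H.p.rTensor _ ∘ₗ H.unitLin M) (fun r m hr => ?_) x hx
  rw [LinearMap.comp_apply, unitLin_smul]
  induction H.unitLin M m with
  | zero => simp
  | add x y hx hy => simp only [map_add, smul_add, hx, hy, add_zero]
  | tmul a v =>
    rw [TensorProduct.smul_tmul', LinearMap.rTensor_tmul, smul_eq_mul, H.p_mul,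
      p_eq_of_invariant, hr, map_zero, zero_mul, TensorProduct.zero_tmul]

/-- The reduction `M / R⁺ M` of a Hopf supermodule. -/
def reduce : LeftSComod H.toAffineSupergroup :=
  quot (H.restrict M.toLeftSComod) (H.augSpan M) (H.augSpan_homog M) (H.mkQ_restrict_coact M)

/-- The projection to the reduction. -/
def reduceπ : H.restrict M.toLeftSComod ⟶ H.reduce M :=
  quotπ (H.restrict M.toLeftSComod) (H.augSpan M) (H.augSpan_homog M) (H.mkQ_restrict_coact M)

/-- The map `K[G] ⊗_R M → K[G] ⊗ M/R⁺M`, `a ⊗ m ↦ ∑ a m_{-1} ⊗ [m_0]`. -/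
def reduceFold : Bal H.base M.carrier →ₗ[K] G.carrier ⊗[K] (M.carrier ⧸ H.augSpan M) :=
  Bal.lift H.base (actLin K G.carrier (G.carrier ⊗[K] (M.carrier ⧸ H.augSpan M)) ∘ₗ
      (H.unitLin M).lTensor G.carrier) fun a r m => by
    change (a * (r : G.carrier)) • H.unitLin M m = a • H.unitLin M (r • m)
    rw [H.unitLin_smul, smul_smul]

theorem reduceFold_tmul (a : G) (m : M.carrier) :
    H.reduceFold M (Bal.tmul H.base a m) = a • H.unitLin M m := rfl

/-- The map `m ↦ 1 ⊗ m`. -/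
def balOne : M.carrier →ₗ[K] Bal H.base M.carrier :=
  Bal.mkLin H.base ∘ₗ TensorProduct.mk K G.carrier M.carrier 1

/-- In K[G] ⊗_R M the element attached to rm is ∑ S(r_1) r_2 S(m_{-1}) ⊗ m_0 = ε(r) ∑ S(m_{-1}) ⊗
m_0. Hence m ↦ ∑ S(m_{-1}) ⊗ m_0 descends to M/R⁺M. -/
theorem conv_antipode_smul (r : H.invariants.alg) (m : M.carrier) :
    M.conv G.antipode (H.balOne M) (r • m) =
      counit (R := K) (r : G.carrier) • M.conv G.antipode (H.balOne M) m := by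
  refine (congrArg (fun t => actLin K G.carrier _ (TensorProduct.map G.antipode (H.balOne M) t))
    (M.coact_smul r m)).trans ?_
  refine (H.invariants.superAct_eq_smul (actLin K G.carrier (Bal H.base M.carrier) ∘ₗ
    TensorProduct.map G.antipode (H.balOne M)) H.invariants.antipodeMul
    (fun i j c b a m hb ha => ?_) _ _).trans ?_
  · change (-1 : ℤˣ) ^ (i * j) • G.antipode (c * a) • Bal.tmul H.base 1 (b • m) =
      (G.antipode c * (b : G.carrier)) • G.antipode a • Bal.tmul H.base 1 m
    rw [Bal.smul_one_tmul, Bal.smul_one_tmul, Bal.tmul_smul, Bal.smul_tmul, G.antipode_mul]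
    -- The sign of the Hopf condition is the one that arises when b moves past S(a).
    have h1 := G.supercomm i j _ hb _ (G.antipode_mem j a ha)
    rw [mul_assoc, mul_assoc, h1]
    change _ • Bal.tmul H.base (G.antipode c * (G.antipode a * (b : G.carrier))) m = _
    rcases Int.units_eq_one_or ((-1 : ℤˣ) ^ (i * j)) with e | e <;> rw [e]
    · simp only [one_smul]
    · simp only [Units.neg_smul, one_smul, mul_neg]
      exact (map_neg (Bal.mkLin H.base ∘ₗ (TensorProduct.mk K G.carrier M.carrier).flip m) _).symm
  · rw [H.invariants.antipodeMul_coact, algebraMap_smul]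
    rfl

/-- The inverse of `reduceFold`. -/
def reduceUnfold : G.carrier ⊗[K] (M.carrier ⧸ H.augSpan M) →ₗ[K] Bal H.base M.carrier :=
  actLin K G.carrier (Bal H.base M.carrier) ∘ₗ
    ((H.augSpan M).liftQ (M.conv G.antipode (H.balOne M))
      (H.eq_zero_of_mem_augSpan M _ fun r m hr => by
        rw [conv_antipode_smul, hr, zero_smul])).lTensor G.carrier

theorem reduceUnfold_tmul (a : G) (m : M.carrier) : H.reduceUnfold M (a ⊗ₜ (H.augSpan M).mkQ m) =
    a • M.conv G.antipode (H.balOne M) m := rfl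

theorem reduceFold_smul (a : G) (y : Bal H.base M.carrier) :
    H.reduceFold M (a • y) = a • H.reduceFold M y := by
  induction y using Bal.induction with
  | h0 => simp
  | hadd x y hx hy => simp only [smul_add, map_add, hx, hy]
  | h b m => rw [Bal.smul_tmul, reduceFold_tmul, reduceFold_tmul, ← mul_smul]

theorem reduceUnfold_smul (a : G) (y : G.carrier ⊗[K] (M.carrier ⧸ H.augSpan M)) :
    H.reduceUnfold M (a • y) = a • H.reduceUnfold M y := by
  induction y with
  | zero => simp
  | add x y hx hy => simp only [smul_add, map_add, hx, hy]
  | tmul b v => exact mul_smul a b _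

theorem unitLin_eq_conv : H.unitLin M = M.conv (LinearMap.id : G.carrier →ₗ[K] G.carrier)
    (TensorProduct.mk K G.carrier _ 1 ∘ₗ (H.augSpan M).mkQ) := by
  refine LinearMap.ext fun m => ?_
  change (H.augSpan M).mkQ.lTensor G.carrier (M.coact m) = actLin K _ _ (TensorProduct.map _ _
    (M.coact m))
  induction M.coact m with
  | zero => simp
  | add x y hx hy => simp only [map_add, hx, hy]
  | tmul a v => simp [TensorProduct.smul_tmul']

/-- The fold is convolution with the identity of K[G] and the unfold is convolution with S, so id *
S = 1 and S * id = 1 make them mutually inverse. This holds for every Hopf supermodule, without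
flatness. -/
theorem reduceUnfold_reduceFold (y : Bal H.base M.carrier) :
    H.reduceUnfold M (H.reduceFold M y) = y := by
  induction y using Bal.induction with
  | h0 => simp
  | hadd x y hx hy => simp only [map_add, hx, hy]
  | h a m =>
    rw [reduceFold_tmul, reduceUnfold_smul]
    have h1 : H.reduceUnfold M ∘ₗ H.unitLin M = H.balOne M := by
      rw [unitLin_eq_conv]
      refine (M.comp_conv (H.reduceUnfold M) (H.reduceUnfold_smul M) _ _).trans ?_
      have h2 : H.reduceUnfold M ∘ₗ TensorProduct.mk K G.carrier _ 1 ∘ₗ (H.augSpan M).mkQ =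
          M.conv G.antipode (H.balOne M) := LinearMap.ext fun m =>
        (H.reduceUnfold_tmul M 1 m).trans (one_smul G.carrier _)
      refine (congrArg (M.conv _) h2).trans ?_
      rw [conv_conv, G.cv_id_antipode, cvOne_conv]
    refine (congrArg (a • ·) (LinearMap.congr_fun h1 m)).trans ?_
    exact Bal.smul_one_tmul H.base a m

theorem reduceFold_reduceUnfold (x : G.carrier ⊗[K] (M.carrier ⧸ H.augSpan M)) :
    H.reduceFold M (H.reduceUnfold M x) = x := by
  induction x with
  | zero => simp
  | add x y hx hy => simp only [map_add, hx, hy]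
  | tmul a v =>
    obtain ⟨m, rfl⟩ := (H.augSpan M).mkQ_surjective v
    refine (congrArg _ (H.reduceUnfold_tmul M a m)).trans ?_
    rw [reduceFold_smul]
    have h1 : H.reduceFold M ∘ₗ M.conv G.antipode (H.balOne M) =
        TensorProduct.mk K G.carrier _ 1 ∘ₗ (H.augSpan M).mkQ := by
      refine (M.comp_conv (H.reduceFold M) (H.reduceFold_smul M) _ _).trans ?_
      have h2 : H.reduceFold M ∘ₗ H.balOne M = H.unitLin M := LinearMap.ext fun m =>
        (H.reduceFold_tmul M 1 m).trans (one_smul G.carrier _)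
      refine (congrArg (M.conv _) h2).trans ?_
      rw [unitLin_eq_conv, conv_conv, G.cv_antipode_id, cvOne_conv]
    refine (congrArg (a • ·) (LinearMap.congr_fun h1 m)).trans ?_
    change (a * 1) ⊗ₜ[K] _ = _
    rw [mul_one]

end Reduction

end ClosedSupersubgroup

end
end Super

/-! ### Unit and counit of the equivalence. -/

namespace Super
noncomputable section
set_option linter.unusedSectionVars false
open Coalgebra

variable {K : Type u} [Field K]

namespace ClosedSupersubgroup

open CommSuperalg LeftSComod HopfSMod

variable {G : AffineSupergroup K} (H : ClosedSupersubgroup G)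

section Unit

variable (M : HopfSMod H.invariants)

theorem assoc_rightCoact (t : G.carrier ⊗[K] M.carrier) :
    TensorProduct.assoc K G.carrier H.carrier _
      (H.rightCoact.rTensor _ ((H.augSpan M).mkQ.lTensor G.carrier t)) =
    ((H.augSpan M).mkQ.lTensor H.carrier ∘ₗ H.p.rTensor M.carrier).lTensor G.carrier
      (TensorProduct.assoc K G.carrier G.carrier _ (comul.rTensor _ t)) := by
  induction t with
  | zero => simp
  | add x y hx hy => simp only [map_add, hx, hy]
  | tmul c m =>
    change TensorProduct.assoc K G.carrier H.carrier _ (H.p.lTensor G.carrier (comul c) ⊗ₜ _) = _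
    rw [LinearMap.rTensor_tmul]
    induction (comul (R := K) c) with
    | zero => simp
    | add x y hx hy => simp only [map_add, TensorProduct.add_tmul, hx, hy]
    | tmul x y => rfl

/-- The cotensor equation for ∑ m_{-1} ⊗ [m_0] is coassociativity of M with p applied to the middle
leg. -/
theorem unitLin_mem (m : M.carrier) : H.unitLin M m ∈ cotensor H.rightCoact (H.reduce M) := by
  refine sub_eq_zero.2 ((H.assoc_rightCoact M (M.coact m)).trans ?_)
  rw [M.coassoc, ← LinearMap.comp_apply, ← LinearMap.lTensor_comp]
  exact LinearMap.congr_fun (LinearMap.lTensor_comp G.carrier (H.reduce M).coact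
    (H.augSpan M).mkQ) (M.coact m)

/-- The map `M → K[G] □ M/R⁺M`. -/
def unitMap : M.carrier →ₗ[K] (H.indComod (H.reduce M)).carrier :=
  (H.unitLin M).codRestrict (cotensor H.rightCoact (H.reduce M)) (H.unitLin_mem M)

theorem assoc_comul_lTensor {C : AffineSupergroup K} {V W : Type*} [AddCommGroup V] [Module K V]
    [AddCommGroup W] [Module K W] (f : V →ₗ[K] W) (t : C.carrier ⊗[K] V) :
    TensorProduct.assoc K C.carrier C.carrier W (comul.rTensor W (f.lTensor C.carrier t)) =
      (f.lTensor C.carrier).lTensor C.carrier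
        (TensorProduct.assoc K C.carrier C.carrier V (comul.rTensor V t)) := by
  induction t with
  | zero => simp
  | add x y hx hy => simp only [map_add, hx, hy]
  | tmul c v =>
    simp only [LinearMap.lTensor_tmul, LinearMap.rTensor_tmul]
    induction (comul (R := K) c) with
    | zero => simp
    | add x y hx hy => simp only [map_add, TensorProduct.add_tmul, hx, hy]
    | tmul x y => rfl

/-- The morphism of Hopf supermodules `M → K[G] □ M/R⁺M`. -/
def unitInd : M ⟶ H.ind.obj (H.reduce M) :=
  homMk (Hom.mk (H.unitMap M)
    (fun i m hm => map_mem_tensorGr (f := LinearMap.id) (g := (H.augSpan M).mkQ)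
      (𝒲' := (H.reduce M).gr) (fun _ _ h => h) (fun i x hx => ⟨x, hx, rfl⟩) i _
      (M.coact_mem i m hm))
    fun m => by
      apply lTensor_inj (A := G.carrier) (cotensor H.rightCoact (H.reduce M)).subtype_injective
      refine (H.indComod_coact (H.reduce M) (H.unitMap M m)).trans ?_
      refine (assoc_comul_lTensor (H.augSpan M).mkQ (M.coact m)).trans ?_
      rw [M.coassoc, ← LinearMap.comp_apply, ← LinearMap.lTensor_comp]
      exact LinearMap.congr_fun (LinearMap.lTensor_comp G.carrier
        (cotensor H.rightCoact (H.reduce M)).subtype (H.unitMap M)) (M.coact m))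
    fun r m => Subtype.ext (H.unitLin_smul M r m)

variable {M} in
theorem lTensor_unitLin {M' : HopfSMod H.invariants} (f : M ⟶ M')
    (g : (M.carrier ⧸ H.augSpan M) →ₗ[K] (M'.carrier ⧸ H.augSpan M'))
    (hg : ∀ m, g ((H.augSpan M).mkQ m) = (H.augSpan M').mkQ (lin (comodHom f) m)) (m : M.carrier) :
    g.lTensor G.carrier (H.unitLin M m) = H.unitLin M' (lin (comodHom f) m) := by
  have h1 := coact_lin (comodHom f) m
  refine Eq.trans ?_ (congrArg ((H.augSpan M').mkQ.lTensor G.carrier) h1.symm)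
  change g.lTensor G.carrier ((H.augSpan M).mkQ.lTensor G.carrier (M.coact m)) = _
  have h2 : g ∘ₗ (H.augSpan M).mkQ = (H.augSpan M').mkQ ∘ₗ lin (comodHom f) := LinearMap.ext hg
  refine (LinearMap.congr_fun (LinearMap.lTensor_comp G.carrier g (H.augSpan M).mkQ) _).symm.trans
    ?_
  rw [h2, LinearMap.lTensor_comp]
  rfl

end Unit

/-- The reduction functor `M ↦ M/R⁺M`. -/
def reduction : HopfSMod H.invariants ⥤ LeftSComod H.toAffineSupergroup where
  obj M := H.reduce M
  map {M M'} f := quotDesc (H.restrict M.toLeftSComod) (H.augSpan M) (H.augSpan_homog M)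
    (H.mkQ_restrict_coact M) (H.restrictMap (comodHom f) ≫ H.reduceπ M')
    (H.eq_zero_of_mem_augSpan M ((H.augSpan M').mkQ ∘ₗ lin (comodHom f)) fun r m hr => by
      rw [LinearMap.comp_apply, lin_smul, mkQ_smul, hr, zero_smul])
  map_id M := lin_ext fun v => by
    obtain ⟨v, rfl⟩ := (H.augSpan M).mkQ_surjective v
    rfl
  map_comp f g := lin_ext fun v => by
    obtain ⟨v, rfl⟩ := (H.augSpan _).mkQ_surjective v
    rfl

/-- The unit transformation `M → K[G] □ M/R⁺M`. -/
def unitNat : 𝟭 (HopfSMod H.invariants) ⟶ H.reduction ⋙ H.ind where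
  app M := H.unitInd M
  naturality M M' f := comodHom_ext fun m => Subtype.ext
    (H.lTensor_unitLin f (lin (H.reduction.map f)) (fun _ => rfl) m).symm

section Counit

variable (N : LeftSComod H.toAffineSupergroup)

/-- `a ⊗ n ↦ ε(a) n`. -/
def counitTensor (G : AffineSupergroup K) (V : Type*) [AddCommGroup V] [Module K V] :
    G.carrier ⊗[K] V →ₗ[K] V :=
  (TensorProduct.lid K V).toLinearMap ∘ₗ counit.rTensor V

@[simp] theorem counitTensor_tmul (V : Type*) [AddCommGroup V] [Module K V] (a : G) (v : V) :
    counitTensor G V (a ⊗ₜ v) = counit (R := K) a • v := rfl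

theorem counitTensor_even {V : Type*} [AddCommGroup V] [Module K V] {𝒱 : ZMod 2 → Submodule K V} :
    IsEven (tensorGr G.gr 𝒱) 𝒱 (counitTensor G V) := fun i t ht => by
  induction ht using Submodule.span_induction with
  | mem x hx =>
    obtain ⟨j, k, rfl, a, ha, v, hv, rfl⟩ := hx
    rw [counitTensor_tmul]
    rcases zmod2_cases j with rfl | rfl
    · rw [zero_add]; exact Submodule.smul_mem _ _ hv
    · rw [G.counit_mem a ha, zero_smul]; exact zero_mem _
  | zero => rw [map_zero]; exact zero_mem _
  | add x y _ _ hx hy => rw [map_add]; exact add_mem hx hy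
  | smul c x _ hx => rw [map_smul]; exact Submodule.smul_mem _ c hx

theorem counitTensor_smul {V : Type u} [AddCommGroup V] [Module K V] (a : G)
    (t : G.carrier ⊗[K] V) :
    counitTensor G V (a • t) = counit (R := K) a • counitTensor G V t := by
  induction t with
  | zero => simp
  | add x y hx hy => simp only [map_add, smul_add, hx, hy]
  | tmul b v =>
    rw [TensorProduct.smul_tmul', smul_eq_mul, counitTensor_tmul, counitTensor_tmul, G.counit_mul,
      mul_smul]

theorem counitTensor_cofreeCoact {V : Type u} [AddCommGroup V] [Module K V]
    (t : G.carrier ⊗[K] V) :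
    (counitTensor G V).lTensor G.carrier (cofreeCoact G V t) = t := by
  induction t with
  | zero => simp
  | add x y hx hy => simp only [map_add, hx, hy]
  | tmul a v =>
    have e : ∀ s : G.carrier ⊗[K] G.carrier, (counitTensor G V).lTensor G.carrier
        (TensorProduct.assoc K G.carrier G.carrier V (s ⊗ₜ v)) =
        TensorProduct.rid K G.carrier (counit.lTensor G.carrier s) ⊗ₜ v := fun s => by
      induction s with
      | zero => simp
      | add x y hx hy => simp only [map_add, TensorProduct.add_tmul, hx, hy]
      | tmul x y => simp [TensorProduct.tmul_smul, TensorProduct.smul_tmul']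
    refine (e (comul a)).trans ?_
    rw [Coalgebra.lTensor_counit_comul, TensorProduct.rid_tmul, one_smul]

/-- `∑ a ⊗ n ↦ ∑ ε(a) n` on `K[G] □ N`. -/
def counitInd : (H.indComod N).carrier →ₗ[K] N.carrier :=
  counitTensor G N.carrier ∘ₗ H.indIncl N

theorem lTensor_counitInd_coact (x : (H.indComod N).carrier) :
    (H.counitInd N).lTensor G.carrier ((H.indComod N).coact x) = H.indIncl N x := by
  rw [counitInd, LinearMap.lTensor_comp]
  exact (congrArg _ (H.indComod_coact N x)).trans (counitTensor_cofreeCoact x.1)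

/-- Apply ε to the first factor of the two sides of the cotensor equation; one gives τ_N of the
value, the other p of the remaining leg. -/
theorem coact_counitInd (x : (H.indComod N).carrier) :
    N.coact (H.counitInd N x) = H.p.rTensor N.carrier (H.indIncl N x) := by
  have e1 : ∀ t : G.carrier ⊗[K] N.carrier, N.coact (counitTensor G N.carrier t) =
      counitTensor G _ (N.coact.lTensor G.carrier t) := fun t => by
    induction t with
    | zero => simp
    | add x y hx hy => simp only [map_add, hx, hy]
    | tmul a v => simp
  have e2 : ∀ t : G.carrier ⊗[K] N.carrier, counitTensor G _
      (TensorProduct.assoc K G.carrier H.carrier N.carrier (H.rightCoact.rTensor N.carrier t)) =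
      H.p.rTensor N.carrier t := fun t => by
    induction t with
    | zero => simp
    | add x y hx hy => simp only [map_add, hx, hy]
    | tmul a v =>
      have e : ∀ s : G.carrier ⊗[K] G.carrier, counitTensor G _
          (TensorProduct.assoc K G.carrier H.carrier N.carrier (H.p.lTensor G.carrier s ⊗ₜ v)) =
          H.p (TensorProduct.lid K G.carrier (counit.rTensor G.carrier s)) ⊗ₜ v := fun s => by
        induction s with
        | zero => simp
        | add x y hx hy => simp only [map_add, TensorProduct.add_tmul, hx, hy]
        | tmul x y => simp [TensorProduct.smul_tmul']
      refine (e (comul a)).trans ?_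
      rw [Coalgebra.rTensor_counit_comul, TensorProduct.lid_tmul, one_smul]
      rfl
  refine (e1 _).trans (Eq.trans ?_ (e2 _))
  exact congrArg _ (sub_eq_zero.1 (show cotensorDiff H.rightCoact N x.1 = 0 from x.2)).symm

/-- The morphism of supercomodules `(K[G] □ N)/R⁺(K[G] □ N) → N`. -/
def counitHom : H.reduce (H.indObj N) ⟶ N :=
  quotDesc (H.restrict (H.indComod N)) (H.augSpan (H.indObj N)) (H.augSpan_homog (H.indObj N))
    (H.mkQ_restrict_coact (H.indObj N))
    (Hom.mk (H.counitInd N) (fun i x hx => counitTensor_even i _ hx) fun x => by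
      refine (H.coact_counitInd N x).trans ?_
      change _ = (H.counitInd N).lTensor H.carrier (H.p.rTensor _ ((H.indComod N).coact x))
      rw [← rTensor_lTensor_comm]
      exact (congrArg _ (H.lTensor_counitInd_coact N x)).symm)
    (H.eq_zero_of_mem_augSpan (H.indObj N) (H.counitInd N) fun r m hr =>
      (counitTensor_smul (r : G.carrier) (H.indIncl N m)).trans (by rw [hr, zero_smul]))

/-- The counit transformation `(K[G] □ N)/R⁺(K[G] □ N) → N`. -/
def counitNat : H.ind ⋙ H.reduction ⟶ 𝟭 (LeftSComod H.toAffineSupergroup) where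
  app N := H.counitHom N
  naturality N N' f := lin_ext fun v => by
    obtain ⟨(x : (H.indComod N).carrier), rfl⟩ := (H.augSpan (H.indObj N)).mkQ_surjective v
    change counitTensor G N'.carrier ((lin f).lTensor G.carrier (H.indIncl N x)) =
      lin f (counitTensor G N.carrier (H.indIncl N x))
    induction H.indIncl N x with
    | zero => simp
    | add x y hx hy => simp only [map_add, hx, hy]
    | tmul a n => simp

/-- Both sides send a ⊗ x to a·x in K[G] ⊗ N. So id ⊗ counit is the comparison between the two
descriptions of K[G] ⊗_R (K[G] □ N). -/
theorem lTensor_counitHom (y : Bal H.base (H.indComod N).carrier) :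
    (lin (H.counitHom N)).lTensor G.carrier (H.reduceFold (H.indObj N) y) = H.indFold N y := by
  let e : ((H.indComod N).carrier ⧸ H.augSpan (H.indObj N)) →ₗ[K] N.carrier := lin (H.counitHom N)
  have he : e ∘ₗ (H.augSpan (H.indObj N)).mkQ = H.counitInd N := rfl
  refine LinearMap.congr_fun (f := e.lTensor G.carrier ∘ₗ H.reduceFold (H.indObj N))
    (Bal.hom_ext fun a x => ?_) y
  refine Eq.trans ?_ (H.indFold_tmul N a x).symm
  refine Eq.trans ?_ (congrArg (a • ·) (H.lTensor_counitInd_coact N x))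
  rw [← he]
  refine Eq.trans ?_ (congrArg (a • ·) (LinearMap.congr_fun (LinearMap.lTensor_comp G.carrier e
    (H.augSpan (H.indObj N)).mkQ) ((H.indComod N).coact x)).symm)
  change e.lTensor G.carrier (a • H.unitLin (H.indObj N) x) =
    a • e.lTensor G.carrier (H.unitLin (H.indObj N) x)
  induction H.unitLin (H.indObj N) x with
  | zero => simp
  | add x y hx hy => simp only [map_add, smul_add, hx, hy]
  | tmul b v => rfl

end Counit

variable {H} in
-- Tensored with K[G] the counit becomes `indFold` composed with the inverse of `reduceFold`, which
-- is bijective. Elements are moved in by 1 ⊗ v and out again by ε on the first factor.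
theorem IsFFGalois.counitHom_bijective (h : H.IsFFGalois) (N : LeftSComod H.toAffineSupergroup) :
    Function.Bijective (lin (H.counitHom N)) := by
  let e : ((H.indComod N).carrier ⧸ H.augSpan (H.indObj N)) →ₗ[K] N.carrier := lin (H.counitHom N)
  have hκ := h.indFold_bijective N
  have he : ∀ y, e.lTensor G.carrier (H.reduceFold (H.indObj N) y) = H.indFold N y :=
    H.lTensor_counitHom N
  constructor
  · refine (injective_iff_map_eq_zero e).2 fun v hv => ?_
    have h1 := H.reduceFold_reduceUnfold (H.indObj N) ((1 : G.carrier) ⊗ₜ v)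
    have h2 : H.indFold N (H.reduceUnfold (H.indObj N) ((1 : G.carrier) ⊗ₜ v)) = 0 := by
      rw [← he, h1, LinearMap.lTensor_tmul, hv, TensorProduct.tmul_zero]
    have h4 := h1.symm.trans ((congrArg (H.reduceFold (H.indObj N))
      (hκ.1 (h2.trans (map_zero _).symm))).trans (map_zero (H.reduceFold (H.indObj N))))
    -- 1 ⊗ v = 0 gives v = 0 by applying ε to the first factor.
    have h3 := congrArg (counitTensor G _) h4
    rwa [map_zero, counitTensor_tmul, G.counit_one, one_smul] at h3
  · intro n
    obtain ⟨y, hy⟩ := hκ.2 ((1 : G.carrier) ⊗ₜ n)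
    refine ⟨counitTensor G _ (H.reduceFold (H.indObj N) y), ?_⟩
    have h1 : ∀ t, counitTensor G N.carrier (e.lTensor G.carrier t) = e (counitTensor G _ t) :=
      fun t => by
        induction t with
        | zero => simp
        | add x y hx hy => simp only [map_add, hx, hy]
        | tmul a v => simp
    refine (h1 _).symm.trans ((congrArg _ ((he y).trans hy)).trans ?_)
    rw [counitTensor_tmul, G.counit_one, one_smul]

variable {H} in
-- After base change to K[G] the unit, followed by the bijection `indFold`, is the bijection
-- `reduceFold`. Faithful flatness then descends injectivity and surjectivity to M.
theorem IsFFGalois.unitInd_bijective (h : H.IsFFGalois) (M : HopfSMod H.invariants) :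
    Function.Bijective (lin (comodHom (H.unitInd M))) := by
  have hff : LeftFF H.base := h.leftFF
  let u : M.carrier →ₗ[H.invariants.toSuper.carrier] (H.indComod (H.reduce M)).carrier :=
    { H.unitMap M with map_smul' := fun r m => Subtype.ext (H.unitLin_smul M r m) }
  have hu : ∀ y, H.indFold (H.reduce M) (Bal.map H.base u y) = H.reduceFold M y :=
    LinearMap.congr_fun (f := H.indFold (H.reduce M) ∘ₗ (Bal.map H.base u).restrictScalars K)
      (g := H.reduceFold M) (Bal.hom_ext fun a m => H.indFold_tmul (H.reduce M) a (u m))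
  have hsurj : Function.Surjective (Bal.map H.base u) := fun y =>
    ⟨H.reduceUnfold M (H.indFold (H.reduce M) y), (h.indFold_bijective (H.reduce M)).1
      ((hu _).trans (H.reduceFold_reduceUnfold M _))⟩
  constructor
  · refine (injective_iff_map_eq_zero (H.unitMap M)).2 fun m hm => hff.tmul_one_injective ?_
    have h1 : H.reduceFold M (Bal.tmul H.base 1 m) = 0 :=
      (one_smul G.carrier (H.unitLin M m)).trans (congrArg Subtype.val hm)
    rw [← H.reduceUnfold_reduceFold M (Bal.tmul H.base 1 m), h1, map_zero]
  -- Surjectivity as exactness of u followed by the zero endomorphism, which can be tested after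
  -- base change.
  · have h1 : Function.Exact u (0 : (H.indComod (H.reduce M)).carrier
        →ₗ[H.invariants.toSuper.carrier] (H.indComod (H.reduce M)).carrier) := by
      rw [hff]
      intro y
      rw [Bal.map_zero_hom]
      exact ⟨fun _ => hsurj y, fun _ => rfl⟩
    exact fun x => (h1 x).1 rfl

variable {H} in
theorem IsFFGalois.isEquivalence_ind (h : H.IsFFGalois) : H.ind.IsEquivalence := by
  have h1 : ∀ M, IsIso (H.unitNat.app M) := fun M =>
    HopfSMod.isIso_of_bijective _ (h.unitInd_bijective M)
  have h2 : ∀ N, IsIso (H.counitNat.app N) := fun N =>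
    LeftSComod.isIso_of_bijective _ (h.counitHom_bijective N)
  have := NatIso.isIso_of_isIso_app H.unitNat
  have := NatIso.isIso_of_isIso_app H.counitNat
  exact (CategoryTheory.Equivalence.mk H.ind H.reduction (asIso H.counitNat).symm
    (asIso H.unitNat).symm).isEquivalence_functor

end ClosedSupersubgroup

end
end Super

/-! ### The four conditions are tied together. -/

theorem theorem5p2 {K : Type u} [Field K] (hK : ringChar K ≠ 2)
    (G : Super.AffineSupergroup K) (H : Super.ClosedSupersubgroup G) :
    List.TFAE [H.IsQuotientAffine,
      Super.IsFaithfullyCoflat H.rightCoact,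
      H.ind.IsEquivalence,
      H.IsInjectiveCogenerator] := by
  have h2 : (2 : K) ≠ 0 := Ring.two_ne_zero hK
  -- Right colinear section from surjectivity, turned into a left one by antipodes, hence an
  -- injective cogenerator; this serves the implications from (i), (ii) and (iii).
  have e4 : H.PreservesSurjections → H.IsInjectiveCogenerator := fun h => by
    obtain ⟨l, hl⟩ := h.exists_isSection h2
    exact hl.isLeftSection.isInjectiveCogenerator
  -- A left section composed with S is a splitting, and a splitting yields the faithfully flat
  -- Galois extension from which (i), (ii) and (iii) follow.
  have gal : H.IsInjectiveCogenerator → H.IsFFGalois := fun h => by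
    obtain ⟨l, hl⟩ := h.exists_isLeftSection
    exact hl.isSplitting.isFFGalois h2
  tfae_have 1 → 4 := fun h =>
    e4 (Super.ClosedSupersubgroup.preservesSurjections_of_isQuotientAffine h2 h)
  tfae_have 2 → 4 := fun h =>
    e4 (Super.ClosedSupersubgroup.preservesSurjections_of_isFaithfullyCoflat h)
  tfae_have 3 → 4 := fun h =>
    e4 (Super.ClosedSupersubgroup.preservesSurjections_of_isEquivalence h)
  tfae_have 4 → 1 := fun h => (gal h).isQuotientAffine h2
  tfae_have 4 → 2 := fun h => (gal h).isFaithfullyCoflat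
  tfae_have 4 → 3 := fun h => (gal h).isEquivalence_ind
  tfae_finish
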